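/- Let $\mathbb T=\mathbb R/\mathbb Z$, let $\mathcal H$ be the space of $f\in L^2_{\mathbb R}(\mathbb T)$ with $\int_0^1 f\,dx=0$, and let $\mathfrak H$ be the real Hilbert space of pairs $\psi=(p,q)$ with $p,p',q\in\mathcal H$, with norm $\|\psi\|_1^2=\int_0^1(|p'|^2+|q|^2)\,dx$. Let $\mathfrak H_{\mathbb C}$ be its complexification and let $\mathcal B_\varepsilon\subset\mathfrak H$, $\mathcal B_{\mathbb C,\varepsilon}\subset\mathfrak H_{\mathbb C}$ be the open balls of radius $\varepsilon$ about $0$. Put $\mathbb Z_0=\mathbb Z\setminus\{0\}$, $z_n^o=2\pi n/\sqrt3$ and, for $n\ge1$, $\mathcal D_n=\{\lambda\in\mathbb C:|\lambda^{1/3}-z_n^o|<1\}$, where $\arg\lambda^{1/3}\in(-\pi/3,\pi/3]$. For $\lambda\in\mathbb C$ let $\varphi_1,\varphi_2,\varphi_3$ be the solutions of $(y''+py)'+py'+qy=\lambda y$ with $\varphi_j^{[k-1]}(0)=\delta_{jk}$, where $y^{[0]}=y$, $y^{[1]}=y'$, $y^{[2]}=y''+py$, let $M(\lambda)=(\varphi_j^{[k-1]}(1,\lambda))_{j,k=1}^3$,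 and let $\tau_3(\lambda)$ be the simple eigenvalue of $M(\lambda)$ that is larger in absolute value than the other eigenvalues (for $\psi=0$ it equals $e^{\lambda^{1/3}}$, $\lambda\notin(-\infty,0]$). Consider the transposed three-point problem $$-(y''+py)'-py'+qy=\lambda y,\qquad y(0)=y(1)=y(2)=0.$$ There is $\varepsilon_0>0$ such that the following holds for every $0<\varepsilon\le\varepsilon_0$. (0) For all $\psi\in\mathcal B_\varepsilon$ and $n\ge1$ the transposed problem has exactly one eigenvalue $\tilde\mu_n$ in $\mathcal D_n$, it is real, it has exactly one eigenfunction $\tilde y_n$ with $\tilde y_n'(0)=1$, one has $\tilde y_n'(1)\ne0$, and $\tau_3(\tilde\mu_n)$ exists, is unique and is positive. Define the norming constants by $$h_{sn}(\psi)=8(\pi n)^2\log\bigl|\tilde y_n'(1)\,\tau_3^{-1/2}(\tilde\mu_n)\bigr|,\qquad h_{s,-n}(\psi)=-h_{sn}(\psi_*^-),\qquad n\ge1,$$ where $\psi_*^-(x)=(p(1-x),-q(1-x))$. (1) For every $n\in\mathbb Z_0$ the function $h_{sn}$ extends from $\mathcal B_\varepsilon$ to an analytic function on $\mathcal B_{\mathbb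 C,\varepsilon}$. (2) There is a constant $C>0$ such that for all $\psi\in\mathcal B_\varepsilon$ and $n\in\mathbb Z_0$ $$\Bigl|h_{sn}(\psi)-\Bigl(\frac{\hat p'_{sn}}{\sqrt3}+\hat q_{cn}-\hat p'_{cn}+\sqrt3\,\hat q_{sn}\Bigr)\Bigr|\le\frac{C\|\psi\|_1^2}{|n|},$$ where $\hat f_{cn}=\int_0^1f(x)\cos(2\pi nx)\,dx$ and $\hat f_{sn}=\int_0^1f(x)\sin(2\pi nx)\,dx$, and the $L^2$-gradient of $h_{sn}$ at $\psi$ (continuous mean-zero functions of $t\in[0,1]$) satisfies $$\sup_{t\in[0,1]}\Bigl|\frac{\partial h_{sn}(\psi)}{\partial p(t)}+z_n^o\,b_n(t)\Bigr|\le C\|\psi\|_1,\qquad \sup_{t\in[0,1]}\Bigl|\frac{\partial h_{sn}(\psi)}{\partial q(t)}-b_n(t)\Bigr|\le\frac{C\|\psi\|_1}{|n|},$$ where $b_n(t)=\cos(2\pi nt)+\sqrt3\sin(2\pi nt)$. -/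

import Mathlib

open MeasureTheory Set
open scoped Real

noncomputable section

namespace ThreePoint

/-! ### The space of coefficients -/

/-- `L²(𝕋)`, `𝕋 = ℝ/ℤ`, mean-zero functions with values in `𝕜 = ℝ` or `ℂ`. -/
def MeanZero (𝕜 : Type) [RCLike 𝕜] :
    Submodule 𝕜 (Lp 𝕜 2 (volume : Measure UnitAddCircle)) where
  carrier := {f | ∫ x, f x = 0}
  zero_mem' := by
    change ∫ x, (0 : Lp 𝕜 2 (volume : Measure UnitAddCircle)) x = 0
    rw [integral_congr_ae (Lp.coeFn_zero 𝕜 2 volume)]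
    simp
  add_mem' := by
    intro f g hf hg
    change ∫ x, f x = 0 at hf
    change ∫ x, g x = 0 at hg
    change ∫ x, (f + g) x = 0
    have h1 := (Lp.memLp f).integrable one_le_two
    have h2 := (Lp.memLp g).integrable one_le_two
    rw [integral_congr_ae (Lp.coeFn_add f g)]
    simp only [Pi.add_apply]
    rw [integral_add h1 h2, hf, hg, add_zero]
  smul_mem' := by
    intro c f hf
    change ∫ x, f x = 0 at hf
    change ∫ x, (c • f) x = 0
    rw [integral_congr_ae (Lp.coeFn_smul c f)]
    simp only [Pi.smul_apply]
    rw [integral_smul, hf, smul_zero]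

/-- The Hilbert space of coefficients `ψ = (p, q)`, where `p, p', q` are 1-periodic, mean-zero and
square integrable on a period, with the norm `‖ψ‖² = ‖p'‖² + ‖q‖²` (and the corresponding inner
product). Since `p ↦ p'` is a bijection from the first factor onto the mean-zero functions, the
element `ψ` is stored as the pair `(p', q)`; the function `p` itself is `coefP ψ`.
For `𝕜 = ℂ` it is the complexification of the space for `𝕜 = ℝ`. -/
abbrev Coef (𝕜 : Type) [RCLike 𝕜] : Type := WithLp 2 (MeanZero 𝕜 × MeanZero 𝕜)

/-- The derivative `p'` of the first coefficient, as a 1-periodic function on `ℝ`. -/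
def coefDP {𝕜 : Type} [RCLike 𝕜] (ψ : Coef 𝕜) (x : ℝ) : 𝕜 :=
  (ψ.fst : Lp 𝕜 2 (volume : Measure UnitAddCircle)) (x : UnitAddCircle)

/-- The first coefficient `p`: the antiderivative of `p'` with mean value zero. -/
def coefP {𝕜 : Type} [RCLike 𝕜] (ψ : Coef 𝕜) (x : ℝ) : 𝕜 :=
  (∫ s in (0 : ℝ)..x, coefDP ψ s) - ∫ r in (0 : ℝ)..1, ∫ s in (0 : ℝ)..r, coefDP ψ s

/-- The second coefficient `q`, as a 1-periodic function on `ℝ`. -/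
def coefQ {𝕜 : Type} [RCLike 𝕜] (ψ : Coef 𝕜) (x : ℝ) : 𝕜 :=
  (ψ.snd : Lp 𝕜 2 (volume : Measure UnitAddCircle)) (x : UnitAddCircle)

/-- A real mean-zero function regarded as a complex one. -/
def MeanZero.toComplex (f : MeanZero ℝ) : MeanZero ℂ :=
  ⟨Complex.ofRealCLM.compLp (f : Lp ℝ 2 (volume : Measure UnitAddCircle)), by
    have hf : ∫ x, (f : Lp ℝ 2 (volume : Measure UnitAddCircle)) x = 0 := f.2
    change ∫ x, (Complex.ofRealCLM.compLp
      (f : Lp ℝ 2 (volume : Measure UnitAddCircle))) x = 0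
    rw [integral_congr_ae (Complex.ofRealCLM.coeFn_compLp f.1)]
    simp only [Complex.ofRealCLM_apply]
    rw [integral_complex_ofReal, hf, Complex.ofReal_zero]⟩

/-- The embedding of the real space of coefficients into its complexification. -/
def Coef.toComplex (ψ : Coef ℝ) : Coef ℂ :=
  WithLp.toLp 2 (MeanZero.toComplex ψ.fst, MeanZero.toComplex ψ.snd)

/-! ### The differential equations -/

/-- `Y = (y, y', y'' + p y)` where `y` is a (Carathéodory) solution on `ℝ` of
`(y'' + p y)' + p y' = r y`: the components of `Y` are absolutely continuous and
`Y₀' = Y₁`, `Y₁' = Y₂ - p Y₀`, `Y₂' = r Y₀ - p Y₁` almost everywhere. -/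
def IsQuasiSolution (p r : ℝ → ℂ) (Y : ℝ → Fin 3 → ℂ) : Prop :=
  Continuous Y ∧
    (∀ x, Y x 0 = Y 0 0 + ∫ t in (0 : ℝ)..x, Y t 1) ∧
    (∀ x, Y x 1 = Y 0 1 + ∫ t in (0 : ℝ)..x, (Y t 2 - p t * Y t 0)) ∧
    (∀ x, Y x 2 = Y 0 2 + ∫ t in (0 : ℝ)..x, (r t * Y t 0 - p t * Y t 1))

/-- Solutions of `(y'' + p y)' + p y' + q y = l y`. -/
def IsSolution (p q : ℝ → ℂ) (l : ℂ) (Y : ℝ → Fin 3 → ℂ) : Prop :=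
  IsQuasiSolution p (fun t => l - q t) Y

/-- Solutions of the transposed equation `-(y'' + p y)' - p y' + q y = l y`. -/
def IsTransposeSolution (p q : ℝ → ℂ) (l : ℂ) (Y : ℝ → Fin 3 → ℂ) : Prop :=
  IsQuasiSolution p (fun t => q t - l) Y

/-! ### Monodromy matrix and the multiplier `τ₃` -/

/-- The fundamental solution `φ_{j+1}` together with its quasi-derivatives, normalized by
`φ_{j+1}^{[k]}(0) = δ_{jk}`, `j, k = 0, 1, 2`. -/
def fundSol (p q : ℝ → ℂ) (l : ℂ) (j : Fin 3) : ℝ → Fin 3 → ℂ :=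
  Classical.epsilon fun Y => IsSolution p q l Y ∧ ∀ k, Y 0 k = if j = k then 1 else 0

/-- The monodromy matrix `M(l) = (φ_j^{[k-1]}(1, l))_{j,k}`. -/
def monodromy (p q : ℝ → ℂ) (l : ℂ) : Matrix (Fin 3) (Fin 3) ℂ :=
  Matrix.of fun j k => fundSol p q l j 1 k

/-- `τ` is the multiplier `τ₃(l)`: a simple eigenvalue of the monodromy matrix that exceeds the
other multipliers in absolute value. For zero coefficients the multipliers are `exp (ω z)` with
`z = l^{1/3}`, `ω³ = 1`, and the dominant one is `τ₃ = exp z` for every `l` outside `(-∞, 0]`. -/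
def IsTau3 (p q : ℝ → ℂ) (l τ : ℂ) : Prop :=
  (monodromy p q l).charpoly.rootMultiplicity τ = 1 ∧
    ∀ σ : ℂ, (monodromy p q l).charpoly.IsRoot σ → σ ≠ τ → ‖σ‖ < ‖τ‖

/-- The multiplier `τ₃(l)`. -/
def tau3 (p q : ℝ → ℂ) (l : ℂ) : ℂ := Classical.epsilon (IsTau3 p q l)

/-! ### The transposed three-point problem -/

/-- `z_n^o = 2πn/√3`. -/
def zo (n : ℤ) : ℝ := 2 * π * n / √3

/-- The domain `D_n = {l : |l^{1/3} - z_n^o| < 1}` for `n ≥ 1`, with `arg l^{1/3} ∈ (-π/3, π/3]`. -/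
def dom (n : ℤ) : Set ℂ := {l | ‖l ^ (1 / 3 : ℂ) - (zo n : ℂ)‖ < 1}

/-- The three-point conditions `y(0) = y(1) = y(2) = 0` for a solution of the transposed
equation. -/
def IsTransposeBVP (p q : ℝ → ℂ) (l : ℂ) (Y : ℝ → Fin 3 → ℂ) : Prop :=
  IsTransposeSolution p q l Y ∧ Y 0 0 = 0 ∧ Y 1 0 = 0 ∧ Y 2 0 = 0

/-- `l` is an eigenvalue of the transposed operator with three-point conditions. -/
def IsTransposeEigenvalue (p q : ℝ → ℂ) (l : ℂ) : Prop :=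
  ∃ Y, IsTransposeBVP p q l Y ∧ Y ≠ 0

/-- The eigenvalue of the transposed operator in the domain `D_n`, `n ≥ 1`. -/
def muT (p q : ℝ → ℂ) (n : ℤ) : ℂ :=
  Classical.epsilon fun l => l ∈ dom n ∧ IsTransposeEigenvalue p q l

/-- `Y` is an eigenfunction for the eigenvalue in `D_n`, normalized by `y'(0) = 1`. -/
def IsNormalizedEigenfunction (p q : ℝ → ℂ) (n : ℤ) (Y : ℝ → Fin 3 → ℂ) : Prop :=
  IsTransposeBVP p q (muT p q n) Y ∧ Y 0 1 = 1

/-- The normalized eigenfunction with its quasi-derivatives. -/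
def yT (p q : ℝ → ℂ) (n : ℤ) : ℝ → Fin 3 → ℂ :=
  Classical.epsilon (IsNormalizedEigenfunction p q n)

/-! ### Norming constants -/

/-- The norming constant with positive index,
`8 (πn)² log |y_n'(1) τ₃^{-1/2}(μ_n)|` for the transposed problem. -/
def normingPos (p q : ℝ → ℂ) (n : ℤ) : ℝ :=
  8 * (π * n) ^ 2 * Real.log ‖yT p q n 1 1 * tau3 p q (muT p q n) ^ (-(1 / 2) : ℂ)‖

/-- The norming constant `h_{sn}` of a pair of coefficients; for `n < 0` it is minus the
constant with index `-n` of the coefficients `p(1 - x)`, `-q(1 - x)`. -/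
def normingFun (p q : ℝ → ℂ) (n : ℤ) : ℝ :=
  if 0 < n then normingPos p q n
  else -normingPos (fun x => p (1 - x)) (fun x => -q (1 - x)) (-n)

/-- The first coefficient as a complex-valued function. -/
def cP (ψ : Coef ℝ) (x : ℝ) : ℂ := ((coefP ψ x : ℝ) : ℂ)

/-- The second coefficient as a complex-valued function. -/
def cQ (ψ : Coef ℝ) (x : ℝ) : ℂ := ((coefQ ψ x : ℝ) : ℂ)

/-- The norming constant `h_{sn}(ψ)`. -/
def hs (n : ℤ) (ψ : Coef ℝ) : ℝ := normingFun (cP ψ) (cQ ψ) n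

/-- For `n ≥ 1` all the objects in the definition of `h_{sn}(ψ)` exist, are uniquely determined,
and the expression under the logarithm is meaningful and nonzero. -/
def NormingWellDefined (ψ : Coef ℝ) (n : ℤ) : Prop :=
  (∃! l, l ∈ dom n ∧ IsTransposeEigenvalue (cP ψ) (cQ ψ) l) ∧
    (muT (cP ψ) (cQ ψ) n).im = 0 ∧
    (∃! Y, IsNormalizedEigenfunction (cP ψ) (cQ ψ) n Y) ∧
    yT (cP ψ) (cQ ψ) n 1 1 ≠ 0 ∧
    (∃! τ, IsTau3 (cP ψ) (cQ ψ) (muT (cP ψ) (cQ ψ) n) τ) ∧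
    (tau3 (cP ψ) (cQ ψ) (muT (cP ψ) (cQ ψ) n)).im = 0 ∧
    0 < (tau3 (cP ψ) (cQ ψ) (muT (cP ψ) (cQ ψ) n)).re

/-! ### Fourier coefficients and gradients -/

/-- `∫₀¹ f(x) cos(2πnx) dx`. -/
def fc (n : ℤ) (f : ℝ → ℝ) : ℝ := ∫ x in (0 : ℝ)..1, f x * Real.cos (2 * π * n * x)

/-- `∫₀¹ f(x) sin(2πnx) dx`. -/
def fs (n : ℤ) (f : ℝ → ℝ) : ℝ := ∫ x in (0 : ℝ)..1, f x * Real.sin (2 * π * n * x)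

/-- `b_n(t) = cos(2πnt) + √3 sin(2πnt)`. -/
def bn (n : ℤ) (t : ℝ) : ℝ := Real.cos (2 * π * n * t) + √3 * Real.sin (2 * π * n * t)

/-- `(gp, gq) = (∂F/∂p(t), ∂F/∂q(t))` is the gradient of `F` at `ψ`: the continuous mean-zero
functions on `[0, 1]` that represent the Fréchet derivative of `F` at `ψ` through the `L²`
pairing. -/
def IsGradient (F : Coef ℝ → ℝ) (ψ : Coef ℝ) (gp gq : ℝ → ℝ) : Prop :=
  ContinuousOn gp (Icc 0 1) ∧ ContinuousOn gq (Icc 0 1) ∧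
    (∫ t in (0 : ℝ)..1, gp t) = 0 ∧ (∫ t in (0 : ℝ)..1, gq t) = 0 ∧
    ∃ L : Coef ℝ →L[ℝ] ℝ, HasFDerivAt F L ψ ∧
      ∀ v, L v = ∫ t in (0 : ℝ)..1, (gp t * coefP v t + gq t * coefQ v t)

end ThreePoint

end

open MeasureTheory Set
open scoped Real

noncomputable section

namespace ThreePoint

/-! ### Primitives of integrable functions on `[0, 1]` -/

/-! Write λ = z³. In the eigenbasis of the unperturbed transposed equation, and after division by
exp(zx/2), the first order system has the exponents ±i√3z/2 and −3z/2 and a perturbation that is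
linear in E = (p/z, q/z²) ∈ L¹ × L¹. Its monodromy matrix is analytic in E on a ball whose radius
does not depend on z, with bounds that do not depend on z. At the base point z = 2πn/√3 and E = 0 it
equals (−1)ⁿ diag(1, 1, c) with c exponentially small. Since only q − λ enters, the value λ = z³ − m
z² at the fixed base point amounts to adding the constant m to q/z² (`shiftE`): the spectral
parameter is just one more direction in the space of coefficients.

Let N be the monodromy matrix of the transposed equation. The three-point conditions say that Y(0),
N Y(0) and N² Y(0) have vanishing first component. Near diag(1, 1, c) this forces Y(0) to be an
eigenvector of N (`exists_eq_Xs_of_csum_eq_zero`), so that for the normalized eigenfunction y'(1) is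
an eigenvalue a of N. The left eigenvector that annihilates Y(0) supplies a second eigenvalue b, and
det N = 1 gives the third, 1/(ab). Lagrange's bracket makes M(λ) similar to N⁻¹
(`PerCoef.monodromy_mul`), whence τ₃ = ab and |y'(1) τ₃^(-1/2)| = |a/b|^(1/2). With a = (−1)ⁿ
exp(z/2)(1 + k) and b = (−1)ⁿ exp(z/2)(1 + k') the norming constant becomes 4(πn)²(log(1 + k) −
log(1 + k')) (`Setting.normingPos_eq`).

The unknowns (m, s, k) of the right eigenvector (1, −1 − s, s) and then (u, k') of the left
eigenvector (1 + s + u, 1 + u, u) are fixed points of analytic maps with domains and bounds uniform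
in n. The quantitative implicit function theorem `analytic_fixedPoint` yields them as analytic
functions of E on a common ball. The unperturbed eigenvalue 1 is double, but there is no branching:
the three-point conditions single out a line, and b is the eigenvalue near 1 on the quotient by that
line. A nontrivial solution with λ in the domain D_n is first localized near the base point and is
then caught by the uniqueness of the fixed point (`Setting.eq_lam_of_isTransposeBVP`). Reality
follows from uniqueness and conjugation.

Since E is linear in ψ, analyticity in ψ is immediate. For the gradient, Cauchy's estimates bound
the change of the derivative as a functional on L¹ × L¹, which is a sup norm bound on its kernels.
The kernels are continuous because those of the monodromy matrix are explicit and implicit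
differentiation preserves this property (`Rep`, `RepAt`). The rates come from ‖E‖ ≤ 2‖ψ‖/z and the
weights 1/z and 1/z².

The asymptotics need one power of n more than this: the prefactor is 3z², so a remainder ‖E‖² gives
only O(‖ψ‖²). Here p' ∈ L² and the mean value zero of p enter. Integration by parts makes the first
order entries O(z⁻²) and the off-diagonal second order entries O(z⁻³) (`SmoothPair.norm_T1_le`,
`SmoothPair.norm_T2_le`), and the spectral shift does not act to first order on the two off-diagonal
entries of the dominant block. Hence the remainder is O(z⁻³) (`Setting.norm_logRatio_add_le`), and
the main term is an integral against b_n. Negative indices are covered by a sign e = ±1 and the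
coefficients p(ex), e q(ex). -/

/-- `f` is on `[0, 1]` a primitive of the integrable function `f'`. -/
def HasPrim (f f' : ℝ → ℂ) : Prop :=
  IntervalIntegrable f' volume 0 1 ∧ ∀ x ∈ Icc (0 : ℝ) 1, f x = f 0 + ∫ t in (0 : ℝ)..x, f' t

/-- The real and imaginary parts are real primitives, hence absolutely continuous, and the complex
primitive is recombined from them. -/
lemma absolutelyContinuous_primitive {f : ℝ → ℂ} (hf : IntervalIntegrable f volume 0 1) (c : ℂ) :
    AbsolutelyContinuousOnInterval (fun x => c + ∫ t in (0 : ℝ)..x, f t) 0 1 := by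
  have hre : IntervalIntegrable (fun t => (f t).re) volume 0 1 :=
    ⟨hf.1.re, hf.2.re⟩
  have him : IntervalIntegrable (fun t => (f t).im) volume 0 1 :=
    ⟨hf.1.im, hf.2.im⟩
  have h1 := hre.absolutelyContinuousOnInterval_intervalIntegral (c := 0) (by simp)
  have h2 := him.absolutelyContinuousOnInterval_intervalIntegral (c := 0) (by simp)
  have hc : ∀ c : ℂ, AbsolutelyContinuousOnInterval (fun _ : ℝ => c) 0 1 := fun c =>
    ((LipschitzWith.const c).lipschitzOnWith (s := uIcc 0 1)).absolutelyContinuousOnInterval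
  have h := (hc c).add ((h1.smul (hc 1)).add (h2.smul (hc Complex.I)))
  rw [absolutelyContinuousOnInterval_iff] at h ⊢
  have key : ∀ x ∈ uIcc (0 : ℝ) 1, c + ∫ t in (0 : ℝ)..x, f t =
      ((fun _ : ℝ => c) + ((fun x => ∫ v in (0 : ℝ)..x, (f v).re) • (fun _ : ℝ => (1 : ℂ)) +
        (fun x => ∫ v in (0 : ℝ)..x, (f v).im) • (fun _ : ℝ => Complex.I)) : ℝ → ℂ) x := by
    intro x hx
    have hfx : IntervalIntegrable f volume 0 x :=
      hf.mono_set (uIcc_subset_uIcc_left hx)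
    simp only [Pi.add_apply, Pi.smul_apply', Complex.real_smul, mul_one]
    congr 1
    have e1 := Complex.reCLM.intervalIntegral_comp_comm hfx
    have e2 := Complex.imCLM.intervalIntegral_comp_comm hfx
    simp only [Complex.reCLM_apply, Complex.imCLM_apply] at e1 e2
    rw [e1, e2, Complex.re_add_im]
  intro ε hε
  obtain ⟨δ, hδ, H⟩ := h ε hε
  refine ⟨δ, hδ, fun E hE hlt => ?_⟩
  refine lt_of_eq_of_lt ?_ (H E hE hlt)
  refine Finset.sum_congr rfl fun i hi => ?_
  have := hE.1 i hi
  rw [key _ this.1, key _ this.2]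

namespace HasPrim

variable {f f' g g' : ℝ → ℂ}

lemma continuousOn (h : HasPrim f f') : ContinuousOn f (Icc 0 1) := by
  have h1 := (absolutelyContinuous_primitive h.1 (f 0)).continuousOn
  rw [uIcc_of_le zero_le_one] at h1
  exact h1.congr fun x hx => h.2 x hx

lemma intervalIntegrable (h : HasPrim f f') : IntervalIntegrable f volume 0 1 :=
  ContinuousOn.intervalIntegrable (by rw [uIcc_of_le zero_le_one]; exact h.continuousOn)

lemma mono_right (h : HasPrim f f') (h' : ∀ t ∈ Ioc (0 : ℝ) 1, f' t = g' t) : HasPrim f g' := by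
  refine ⟨h.1.congr (fun t ht => h' t (by rwa [uIoc_of_le zero_le_one] at ht)), fun x hx => ?_⟩
  rw [h.2 x hx]
  congr 1
  refine intervalIntegral.integral_congr_ae (.of_forall fun t ht => h' t ?_)
  rw [uIoc_of_le hx.1] at ht
  exact ⟨ht.1, ht.2.trans hx.2⟩

lemma mono_left (h : HasPrim f f') (h' : ∀ t ∈ Icc (0 : ℝ) 1, f t = g t) : HasPrim g f' :=
  ⟨h.1, fun x hx => by rw [← h' x hx, ← h' 0 (by simp)]; exact h.2 x hx⟩

lemma const (c : ℂ) : HasPrim (fun _ => c) (fun _ => 0) :=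
  ⟨by simp, by simp⟩

lemma add (hf : HasPrim f f') (hg : HasPrim g g') :
    HasPrim (fun x => f x + g x) (fun x => f' x + g' x) := by
  refine ⟨hf.1.add hg.1, fun x hx => ?_⟩
  have hx' : x ∈ uIcc (0 : ℝ) 1 := by rwa [uIcc_of_le zero_le_one]
  simp only
  rw [intervalIntegral.integral_add (hf.1.mono_set (uIcc_subset_uIcc_left hx'))
    (hg.1.mono_set (uIcc_subset_uIcc_left hx')), hf.2 x hx, hg.2 x hx]
  ring

/-- Integration by parts: the difference of the two sides is absolutely continuous with derivative
zero almost everywhere, hence constant. -/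
lemma mul (hf : HasPrim f f') (hg : HasPrim g g') :
    HasPrim (fun x => f x * g x) (fun x => f' x * g x + f x * g' x) := by
  have hfc := hf.continuousOn
  have hgc := hg.continuousOn
  have hint : IntervalIntegrable (fun x => f' x * g x + f x * g' x) volume 0 1 :=
    (hf.1.mul_continuousOn (by rwa [uIcc_of_le zero_le_one])).add
      (hg.1.continuousOn_mul (by rwa [uIcc_of_le zero_le_one]))
  refine ⟨hint, ?_⟩
  have hac := ((absolutelyContinuous_primitive hf.1 (f 0)).smul
    (absolutelyContinuous_primitive hg.1 (g 0))).sub (absolutelyContinuous_primitive hint 0)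
  have hder : ∀ᵐ x, x ∈ uIcc (0 : ℝ) 1 → HasDerivAt
      (((fun x => f 0 + ∫ t in (0 : ℝ)..x, f' t) • fun x => g 0 + ∫ t in (0 : ℝ)..x, g' t) -
        fun x => 0 + ∫ t in (0 : ℝ)..x, (f' t * g t + f t * g' t)) 0 x := by
    filter_upwards [hf.1.ae_hasDerivAt_integral, hg.1.ae_hasDerivAt_integral,
      hint.ae_hasDerivAt_integral] with x h1 h2 h3 hx
    have hx' : x ∈ Icc (0 : ℝ) 1 := by rwa [uIcc_of_le zero_le_one] at hx
    have k1 := (h1 hx 0 (by simp)).const_add (f 0)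
    have k2 := (h2 hx 0 (by simp)).const_add (g 0)
    have k3 := (h3 hx 0 (by simp)).const_add 0
    have k := (k1.mul k2).sub k3
    refine k.congr_deriv ?_
    rw [← hf.2 x hx', ← hg.2 x hx']
    ring
  obtain ⟨C, hC⟩ := hac.const_of_ae_hasDerivAt_zero hder
  intro x hx
  have c0 := hC 0 (by simp)
  have cx := hC x (by rwa [uIcc_of_le zero_le_one])
  simp only [Pi.sub_apply, smul_eq_mul, Pi.mul_apply, zero_add,
    intervalIntegral.integral_same, add_zero, sub_zero] at c0 cx
  rw [← hf.2 x hx, ← hg.2 x hx, ← c0] at cx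
  simp only
  linear_combination cx

lemma const_mul (hf : HasPrim f f') (c : ℂ) :
    HasPrim (fun x => c * f x) (fun x => c * f' x) :=
  ((const c).mul hf).mono_right (by intro t _; simp)

lemma neg (hf : HasPrim f f') : HasPrim (fun x => -f x) (fun x => -f' x) :=
  ((hf.const_mul (-1)).mono_right (g' := fun x => -f' x) (by intro t _; ring)).mono_left
    (by intro t _; ring)

lemma sub (hf : HasPrim f f') (hg : HasPrim g g') :
    HasPrim (fun x => f x - g x) (fun x => f' x - g' x) :=
  ((hf.add hg.neg).mono_right (g' := fun x => f' x - g' x) (by intro t _; ring)).mono_left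
    (by intro t _; ring)

lemma sum {ι : Type*} (s : Finset ι) {F F' : ι → ℝ → ℂ} (h : ∀ i ∈ s, HasPrim (F i) (F' i)) :
    HasPrim (fun x => ∑ i ∈ s, F i x) (fun x => ∑ i ∈ s, F' i x) := by
  classical
  induction s using Finset.induction_on with
  | empty => simpa using const 0
  | insert a s ha ih =>
    simp only [Finset.sum_insert ha]
    exact (h a (by simp)).add (ih fun i hi => h i (by simp [hi]))

lemma of_hasDerivAt {F F' : ℝ → ℂ} (h : ∀ x, HasDerivAt F (F' x) x) (hc : Continuous F') :
    HasPrim F F' := by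
  refine ⟨hc.intervalIntegrable _ _, fun x _ => ?_⟩
  rw [intervalIntegral.integral_eq_sub_of_hasDerivAt (fun t _ => h t) (hc.intervalIntegrable _ _)]
  ring

lemma cexp (d : ℂ) : HasPrim (fun x => Complex.exp (d * x)) (fun x => d * Complex.exp (d * x)) := by
  refine of_hasDerivAt (fun x => ?_) (by fun_prop)
  have h1 : HasDerivAt (fun x : ℝ => d * (x : ℂ)) d x := by
    simpa using (Complex.ofRealCLM.hasDerivAt (x := x)).const_mul d
  simpa [mul_comm] using h1.cexp

lemma integral_eq (h : HasPrim f f') : ∫ t in (0 : ℝ)..1, f' t = f 1 - f 0 := by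
  rw [h.2 1 (by simp)]; ring

/-- Variation of constants for a scalar linear equation. -/
lemma duhamel {d : ℂ} {u r : ℝ → ℂ} (h : HasPrim u fun t => d * u t + r t) {x : ℝ}
    (hx : x ∈ Icc (0 : ℝ) 1) :
    u x = Complex.exp (d * x) * u 0 + ∫ t in (0 : ℝ)..x, Complex.exp (d * (x - t)) * r t := by
  have h1 := ((cexp (-d)).mul h).mono_right (g' := fun t => Complex.exp (-d * t) * r t)
    (by intro t _; ring)
  have h2 := h1.2 x hx
  have h3 : ∫ t in (0 : ℝ)..x, Complex.exp (d * (x - t)) * r t =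
      Complex.exp (d * x) * ∫ t in (0 : ℝ)..x, Complex.exp (-d * t) * r t := by
    rw [← intervalIntegral.integral_const_mul]
    congr 1
    funext t
    rw [← mul_assoc, ← Complex.exp_add]
    ring_nf
  rw [h3, ← mul_add]
  simp only [Complex.ofReal_zero, mul_zero, Complex.exp_zero, one_mul] at h2
  rw [← h2, ← mul_assoc, ← Complex.exp_add]
  simp

/-- Converse of `HasPrim.duhamel`. In particular the integral formula alone gives continuity, which
is why the Volterra operators below take values in continuous functions. -/
lemma of_duhamel {d v : ℂ} {u r : ℝ → ℂ} (hr : IntervalIntegrable r volume 0 1)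
    (h : ∀ x ∈ Icc (0 : ℝ) 1,
      u x = Complex.exp (d * x) * v + ∫ t in (0 : ℝ)..x, Complex.exp (d * (x - t)) * r t) :
    HasPrim u fun t => d * u t + r t := by
  have hr' : IntervalIntegrable (fun t : ℝ => Complex.exp (-d * t) * r t) volume 0 1 :=
    hr.continuousOn_mul (by fun_prop)
  have h0 : HasPrim (fun x : ℝ => v + ∫ t in (0 : ℝ)..x, Complex.exp (-d * t) * r t)
      (fun t : ℝ => Complex.exp (-d * t) * r t) :=
    ⟨hr', fun x _ => by simp⟩
  have h1 := (cexp d).mul h0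
  have h2 : ∀ x ∈ Icc (0 : ℝ) 1, Complex.exp (d * x) *
      (v + ∫ t in (0 : ℝ)..x, Complex.exp (-d * t) * r t) = u x := by
    intro x hx
    rw [h x hx, mul_add, ← intervalIntegral.integral_const_mul]
    congr 2
    funext t
    rw [← mul_assoc, ← Complex.exp_add]
    ring_nf
  refine (h1.mono_left h2).mono_right fun t ht => ?_
  have h3 : Complex.exp (d * t) * (Complex.exp (-d * t) * r t) = r t := by
    rw [← mul_assoc, ← Complex.exp_add]; simp
  rw [h3, mul_assoc, h2 t ⟨ht.1.le, ht.2⟩]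

end HasPrim

/-! ### Bounded analytic maps and a quantitative analytic implicit function theorem -/

section Analytic

open Metric
open scoped Topology

variable {X Y : Type*} [NormedAddCommGroup X] [NormedSpace ℂ X]
  [NormedAddCommGroup Y] [NormedSpace ℂ Y] [CompleteSpace Y]

/-- Cauchy's estimate on the ball of radius r/2 about x, where f differs from f x by at most 2K. -/
lemma norm_fderiv_le_of_bounded {f : X → Y} {r K : ℝ}
    (hf : AnalyticOnNhd ℂ f (ball 0 r)) (hK : ∀ x ∈ ball (0 : X) r, ‖f x‖ ≤ K) {x : X}
    (hx : ‖x‖ < r / 2) : ‖fderiv ℂ f x‖ ≤ 4 * K / r := by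
  have hr : 0 < r := by have := norm_nonneg x; linarith
  have hsub : ball x (r / 2) ⊆ ball 0 r := by
    intro y hy
    rw [mem_ball_zero_iff]
    rw [mem_ball, dist_eq_norm] at hy
    calc ‖y‖ = ‖(y - x) + x‖ := by simp
      _ ≤ ‖y - x‖ + ‖x‖ := norm_add_le _ _
      _ < r := by linarith
  have hxr : x ∈ ball (0 : X) r := hsub (mem_ball_self (by linarith))
  have h := Complex.norm_fderiv_le_div_of_mapsTo_ball (f := f) (c := x) (R₁ := r / 2)
    (R₂ := 2 * K) (hf.differentiableOn.mono hsub) ?_ (by linarith)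
  · refine h.trans_eq ?_
    field_simp
    ring
  · intro y hy
    rw [mem_closedBall, dist_eq_norm]
    exact (norm_sub_le _ _).trans (by linarith [hK y (hsub hy), hK x hxr])

/-- Schwarz's lemma for the derivative, which on the ball of radius r/2 differs from its value at 0
by at most 8K/r. -/
lemma norm_fderiv_sub_le_of_bounded {f : X → Y} {r K : ℝ}
    (hf : AnalyticOnNhd ℂ f (ball 0 r)) (hK : ∀ x ∈ ball (0 : X) r, ‖f x‖ ≤ K) {x : X}
    (hx : ‖x‖ < r / 2) : ‖fderiv ℂ f x - fderiv ℂ f 0‖ ≤ 16 * K / r ^ 2 * ‖x‖ := by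
  have hr : 0 < r := by have := norm_nonneg x; linarith
  have h := Complex.dist_le_div_mul_dist_of_mapsTo_ball (f := fderiv ℂ f) (c := 0) (z := x)
    (R₁ := r / 2) (R₂ := 8 * K / r)
    (hf.fderiv.differentiableOn.mono (ball_subset_ball (by linarith))) ?_ (by simpa using hx)
  · rw [dist_eq_norm, dist_zero_right] at h
    refine h.trans_eq ?_
    field_simp
    ring
  · intro y hy
    rw [mem_closedBall, dist_eq_norm]
    refine (norm_sub_le _ _).trans ?_
    have h1 := norm_fderiv_le_of_bounded hf hK (x := y) (by simpa using hy)
    have h2 := norm_fderiv_le_of_bounded hf hK (x := 0) (by simpa using hr)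
    calc _ ≤ 4 * K / r + 4 * K / r := add_le_add h1 h2
      _ = _ := by ring

lemma norm_le_of_bounded {f : X → Y} {r K : ℝ} (hf : AnalyticOnNhd ℂ f (ball 0 r))
    (hK : ∀ x ∈ ball (0 : X) r, ‖f x‖ ≤ K) (h0 : f 0 = 0) {x : X} (hx : ‖x‖ < r) :
    ‖f x‖ ≤ K / r * ‖x‖ := by
  have h := Complex.dist_le_div_mul_dist_of_mapsTo_ball (f := f) (c := 0) (z := x)
    (R₁ := r) (R₂ := K) hf.differentiableOn ?_ (by simpa using hx)
  · simpa [h0] using h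
  · intro y hy
    simpa [h0] using hK y hy

end Analytic

section FixedPoint

open Metric Filter
open scoped Topology ContDiff

variable {E W : Type*} [NormedAddCommGroup E] [NormedSpace ℂ E] [CompleteSpace E]
  [NormedAddCommGroup W] [NormedSpace ℂ W] [CompleteSpace W]

/-- The fixed point `g x` of `Γ (x, ·)` depends analytically on `x`, on a ball whose radius depends
only on the size of the domain of `Γ` and on a bound for `Γ`. -/
theorem analytic_fixedPoint {K r : ℝ} (hK : 0 ≤ K) (hr : 0 < r) :
    ∃ ρ > 0, ∃ σ > 0, ρ ≤ r ∧ σ ≤ r ∧ ∃ L ≥ 0, ∀ Γ : E × W → W,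
      AnalyticOnNhd ℂ Γ (ball 0 r) → (∀ x ∈ ball (0 : E × W) r, ‖Γ x‖ ≤ K) → Γ 0 = 0 →
      (∀ w, ‖fderiv ℂ Γ 0 (0, w)‖ ≤ ‖w‖ / 4) →
      ∃ g : E → W, AnalyticOnNhd ℂ g (ball 0 ρ) ∧ ∀ x ∈ ball (0 : E) ρ,
        ‖g x‖ ≤ L * ‖x‖ ∧ ‖g x‖ < σ ∧ Γ (x, g x) = g x ∧
        (∀ w, ‖w‖ < σ → Γ (x, w) = w → w = g x) ∧
        ∃ A : W →L[ℂ] W, fderiv ℂ g x = A ∘L (fderiv ℂ Γ (x, g x) ∘L .inl ℂ E W) := by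
  -- On the ball of radius σ the partial derivative in w changes by at most 1/4; together with the
  -- bound 1/4 at the origin this gives the contraction factor 1/2.
  obtain ⟨σ, hσ, hσr, hσK⟩ : ∃ σ > 0, σ ≤ r / 2 ∧ 16 * K / r ^ 2 * σ ≤ 1 / 4 := by
    refine ⟨min (r / 2) (1 / (4 * (16 * K / r ^ 2 + 1))), by positivity, min_le_left _ _, ?_⟩
    calc _ ≤ 16 * K / r ^ 2 * (1 / (4 * (16 * K / r ^ 2 + 1))) := by
          gcongr; exact min_le_right _ _
      _ ≤ _ := by
          rw [mul_one_div, div_le_iff₀ (by positivity)]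
          linarith
  -- With this ρ the map Γ (x, ·) preserves the closed ball of radius σ/2: at most σ/4 comes from
  -- the contraction and less than σ/4 from Γ (x, 0).
  obtain ⟨ρ, hρ, hρσ, hρK⟩ : ∃ ρ > 0, ρ ≤ σ ∧ K / r * ρ < σ / 4 := by
    refine ⟨min σ (σ / (8 * (K / r + 1))), by positivity, min_le_left _ _, ?_⟩
    calc K / r * min σ (σ / (8 * (K / r + 1))) ≤ K / r * (σ / (8 * (K / r + 1))) := by
          gcongr; exact min_le_right _ _
      _ < _ := by
          rw [mul_div_assoc', div_lt_iff₀ (by positivity)]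
          have : 0 ≤ K / r := by positivity
          nlinarith
  refine ⟨ρ, hρ, σ, hσ, by linarith, by linarith, 2 * (K / r), by positivity, ?_⟩
  intro Γ hΓ hΓK hΓ0 hΓw
  -- the partial derivative in the second variable
  have hDw : ∀ x : E × W, ‖x‖ < σ → ‖fderiv ℂ Γ x ∘L .inr ℂ E W‖ ≤ 1 / 2 := by
    intro x hx
    refine ContinuousLinearMap.opNorm_le_bound _ (by norm_num) fun w => ?_
    have h1 := norm_fderiv_sub_le_of_bounded hΓ hΓK (x := x) (by linarith)
    have h2 : ‖fderiv ℂ Γ x - fderiv ℂ Γ 0‖ ≤ 1 / 4 := by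
      refine h1.trans (le_trans ?_ hσK)
      gcongr
    have h3 : fderiv ℂ Γ x (0, w) = (fderiv ℂ Γ x - fderiv ℂ Γ 0) (0, w) + fderiv ℂ Γ 0 (0, w) := by
      simp
    have h4 : ‖((0, w) : E × W)‖ = ‖w‖ := by simp [Prod.norm_def]
    calc ‖(fderiv ℂ Γ x ∘L .inr ℂ E W) w‖ = ‖fderiv ℂ Γ x (0, w)‖ := by simp
      _ ≤ ‖(fderiv ℂ Γ x - fderiv ℂ Γ 0) (0, w)‖ + ‖fderiv ℂ Γ 0 (0, w)‖ := by
          rw [h3]; exact norm_add_le _ _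
      _ ≤ 1 / 4 * ‖w‖ + ‖w‖ / 4 := by
          gcongr
          · exact ((fderiv ℂ Γ x - fderiv ℂ Γ 0).le_opNorm _).trans (by rw [h4]; gcongr)
          · exact hΓw w
      _ = _ := by ring
  have hlip : ∀ x : E, ‖x‖ < σ → ∀ w ∈ ball (0 : W) σ, ∀ w' ∈ ball (0 : W) σ,
      ‖Γ (x, w') - Γ (x, w)‖ ≤ 1 / 2 * ‖w' - w‖ := by
    intro x hx w hw w' hw'
    refine Convex.norm_image_sub_le_of_norm_hasFDerivWithin_le (𝕜 := ℂ)
      (f := fun w => Γ (x, w)) (f' := fun w => fderiv ℂ Γ (x, w) ∘L .inr ℂ E W)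
      (s := ball (0 : W) σ) (fun v hv => ?_) (fun v hv => ?_) (convex_ball _ _) hw hw'
    · have hv' : ‖(x, v)‖ < r := by
        rw [mem_ball_zero_iff] at hv
        rw [Prod.norm_def]
        exact max_lt (by simp only; linarith) (by simp only; linarith)
      have h1 := (hΓ (x, v) (by rwa [mem_ball_zero_iff])).differentiableAt.hasFDerivAt
      exact (h1.comp v (hasFDerivAt_prodMk_right x v)).hasFDerivWithinAt
    · rw [mem_ball_zero_iff] at hv
      exact hDw _ (by rw [Prod.norm_def]; exact max_lt hx hv)
  have h0 : ∀ x : E, ‖x‖ < σ → ‖Γ (x, 0)‖ ≤ K / r * ‖x‖ := by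
    intro x hx
    have h4 : ‖((x, 0) : E × W)‖ = ‖x‖ := by simp [Prod.norm_def]
    have := norm_le_of_bounded hΓ hΓK hΓ0 (x := (x, 0)) (by rw [h4]; linarith)
    rwa [h4] at this
  have huniq : ∀ x : E, ‖x‖ < σ → ∀ w ∈ ball (0 : W) σ, ∀ w' ∈ ball (0 : W) σ,
      Γ (x, w) = w → Γ (x, w') = w' → w' = w := by
    intro x hx w hw w' hw' e e'
    have := hlip x hx w hw w' hw'
    rw [e, e'] at this
    have h1 : ‖w' - w‖ = 0 := by linarith [norm_nonneg (w' - w)]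
    rwa [norm_eq_zero, sub_eq_zero] at h1
  have hex : ∀ x : E, ‖x‖ < ρ → ∃ w ∈ ball (0 : W) σ, Γ (x, w) = w := by
    intro x hx
    have hxσ : ‖x‖ < σ := by linarith
    have hsub : closedBall (0 : W) (σ / 2) ⊆ ball 0 σ := closedBall_subset_ball (by linarith)
    have hmaps : MapsTo (fun w => Γ (x, w)) (closedBall (0 : W) (σ / 2))
        (closedBall (0 : W) (σ / 2)) := by
      intro w hw
      have h1 := hlip x hxσ 0 (by simpa using hσ) w (hsub hw)
      rw [sub_zero] at h1
      rw [mem_closedBall_zero_iff] at hw ⊢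
      have h2 : ‖Γ (x, w)‖ ≤ ‖Γ (x, w) - Γ (x, 0)‖ + ‖Γ (x, 0)‖ := by
        simpa using norm_add_le (Γ (x, w) - Γ (x, 0)) (Γ (x, 0))
      have h3 : K / r * ‖x‖ ≤ K / r * ρ := by gcongr
      simp only
      linarith [h0 x hxσ]
    have hcontr : ContractingWith (1 / 2) (hmaps.restrict (fun w => Γ (x, w))
        (closedBall (0 : W) (σ / 2)) (closedBall (0 : W) (σ / 2))) := by
      refine ⟨by norm_num, LipschitzWith.of_dist_le_mul fun w w' => ?_⟩
      have := hlip x hxσ w' (hsub w'.2) w (hsub w.2)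
      simpa [Subtype.dist_eq, dist_eq_norm] using this
    obtain ⟨w, hw, hfix, -⟩ := hcontr.exists_fixedPoint' (isClosed_closedBall.isComplete) hmaps
      (x := (0 : W)) (by simp; linarith) (edist_ne_top _ _)
    exact ⟨w, hsub hw, hfix⟩
  choose! g hgball hgfix using hex
  have hgan : AnalyticOnNhd ℂ g (ball 0 ρ) := by
    intro x hx
    have hx' : ‖x‖ < ρ := by simpa using hx
    have hgx : ‖g x‖ < σ := by simpa using hgball x hx'
    have hxw : ‖(x, g x)‖ < σ := by
      rw [Prod.norm_def]; exact max_lt (by simp only; linarith) hgx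
    have hΓx : AnalyticAt ℂ Γ (x, g x) := hΓ _ (by rw [mem_ball_zero_iff]; linarith)
    set f : E × W → W := fun y => y.2 - Γ y with hf
    have hfa : AnalyticAt ℂ f (x, g x) := analyticAt_snd.sub hΓx
    have cdf : ContDiffAt ℂ ω f (x, g x) := hfa.contDiffAt
    have hfd : fderiv ℂ f (x, g x) ∘L .inr ℂ E W = 1 - fderiv ℂ Γ (x, g x) ∘L .inr ℂ E W := by
      rw [hf, fderiv_fun_sub differentiableAt_snd hΓx.differentiableAt, fderiv_snd]
      ext w
      simp
    have hinv : (fderiv ℂ f (x, g x) ∘L .inr ℂ E W).IsInvertible := by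
      rw [hfd]
      have hu : IsUnit (1 - fderiv ℂ Γ (x, g x) ∘L .inr ℂ E W) :=
        isUnit_one_sub_of_norm_lt_one ((hDw _ hxw).trans_lt (by norm_num))
      obtain ⟨u, hu⟩ := hu
      rw [← hu]
      exact ⟨ContinuousLinearEquiv.unitsEquiv ℂ W u, rfl⟩
    have ha : AnalyticAt ℂ (cdf.implicitFunction (by simp) hinv) x :=
      (cdf.contDiffAt_implicitFunction (by simp) hinv).analyticAt
    -- Near x the local implicit function stays in the ball of radius σ, where fixed points are
    -- unique; so it coincides with g and passes its analyticity on.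
    refine ha.congr ?_
    have hself : cdf.implicitFunction (by simp) hinv x = g x :=
      cdf.implicitFunction_apply_self (by simp) hinv
    have e1 := cdf.eventually_apply_implicitFunction (by simp) hinv
    have e2 : ∀ᶠ y in 𝓝 x, cdf.implicitFunction (by simp) hinv y ∈ ball (0 : W) σ :=
      ha.continuousAt.eventually_mem (isOpen_ball.mem_nhds (by rw [hself]; exact hgball x hx'))
    have e3 : ∀ᶠ y in 𝓝 x, y ∈ ball (0 : E) ρ := isOpen_ball.mem_nhds hx
    filter_upwards [e1, e2, e3] with y h1 h2 h3
    have h3' : ‖y‖ < ρ := by simpa using h3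
    have hfx : f (x, g x) = 0 := by simp [hf, hgfix x hx']
    rw [hfx] at h1
    refine huniq y (by linarith) (g y) (hgball y h3') _ h2 (hgfix y h3') ?_
    simp only [hf] at h1
    exact (sub_eq_zero.mp h1).symm
  refine ⟨g, hgan, fun x hx => ?_⟩
  have hx' : ‖x‖ < ρ := by simpa using hx
  have hgx : ‖g x‖ < σ := by simpa using hgball x hx'
  refine ⟨?_, hgx, hgfix x hx', fun w hw hfix =>
    huniq x (by linarith) (g x) (hgball x hx') w (by simpa using hw) (hgfix x hx') hfix, ?_⟩
  · have h1 := hlip x (by linarith) 0 (by simpa using hσ) (g x) (hgball x hx')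
    rw [hgfix x hx', sub_zero] at h1
    have h2 : ‖g x‖ ≤ ‖g x - Γ (x, 0)‖ + ‖Γ (x, 0)‖ := by
      simpa using norm_add_le (g x - Γ (x, 0)) (Γ (x, 0))
    linarith [h0 x (by linarith)]
  · have hxw : ‖(x, g x)‖ < σ := by
      rw [Prod.norm_def]; exact max_lt (by simp only; linarith) hgx
    have hΓx : AnalyticAt ℂ Γ (x, g x) := hΓ _ (by rw [mem_ball_zero_iff]; linarith)
    have hu : IsUnit (1 - fderiv ℂ Γ (x, g x) ∘L .inr ℂ E W) :=
      isUnit_one_sub_of_norm_lt_one ((hDw _ hxw).trans_lt (by norm_num))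
    obtain ⟨u, hu⟩ := hu
    have hg : HasFDerivAt g (fderiv ℂ g x) x := (hgan x hx).differentiableAt.hasFDerivAt
    have hc := hΓx.differentiableAt.hasFDerivAt.comp x ((hasFDerivAt_id x).prodMk hg)
    -- Differentiating g x = Γ (x, g x) gives (1 − ∂_w Γ) g' = ∂_x Γ, and the operator A is the
    -- inverse of the first factor.
    have hc' : HasFDerivAt g (fderiv ℂ Γ (x, g x) ∘L
        (ContinuousLinearMap.id ℂ E).prod (fderiv ℂ g x)) x := by
      refine hc.congr_of_eventuallyEq ?_
      filter_upwards [isOpen_ball.mem_nhds hx] with y hy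
      exact (hgfix y (by simpa using hy)).symm
    have heq := hg.unique hc'
    refine ⟨((u⁻¹ : (W →L[ℂ] W)ˣ) : W →L[ℂ] W), ?_⟩
    have h1 : (u : W →L[ℂ] W) ∘L fderiv ℂ g x = fderiv ℂ Γ (x, g x) ∘L .inl ℂ E W := by
      rw [hu]
      ext v
      have := congrArg (fun T : E →L[ℂ] W => T v) heq
      simp only [ContinuousLinearMap.comp_apply, ContinuousLinearMap.prod_apply,
        ContinuousLinearMap.id_apply] at this
      have h2 : ((v, fderiv ℂ g x v) : E × W) = (v, 0) + (0, fderiv ℂ g x v) := by simp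
      rw [h2, map_add] at this
      simp only [ContinuousLinearMap.comp_apply, ContinuousLinearMap.sub_apply,
        ContinuousLinearMap.one_apply, ContinuousLinearMap.inl_apply,
        ContinuousLinearMap.inr_apply]
      rw [sub_eq_iff_eq_add]
      exact this
    rw [← h1, ← ContinuousLinearMap.comp_assoc]
    have h2 : ((u⁻¹ : (W →L[ℂ] W)ˣ) : W →L[ℂ] W) ∘L (u : W →L[ℂ] W) = .id ℂ W :=
      u.inv_mul
    rw [h2, ContinuousLinearMap.id_comp]

end FixedPoint

/-! ### Volterra operators -/

/-- Integrable functions on `(0, 1]`. -/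
abbrev L1 : Type := Lp ℂ 1 (volume.restrict (Ioc (0 : ℝ) 1))

/-- Continuous functions on `[0, 1]`. -/
abbrev CI : Type := C(Icc (0 : ℝ) 1, ℂ)

/-- The constant extension of a continuous function on `[0, 1]` to the line. -/
def ext (φ : CI) (t : ℝ) : ℂ := φ (projIcc 0 1 zero_le_one t)

lemma continuous_ext (φ : CI) : Continuous (ext φ) := φ.continuous.comp continuous_projIcc

lemma norm_ext_le (φ : CI) (t : ℝ) : ‖ext φ t‖ ≤ ‖φ‖ := φ.norm_coe_le_norm _

lemma ext_apply (φ : CI) {t : ℝ} (ht : t ∈ Icc (0 : ℝ) 1) : ext φ t = φ ⟨t, ht⟩ := by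
  rw [ext, projIcc_of_mem _ ht]

lemma L1.intervalIntegrable (f : L1) : IntervalIntegrable f volume 0 1 := by
  rw [intervalIntegrable_iff_integrableOn_Ioc_of_le zero_le_one]
  exact L1.integrable_coeFn f

lemma L1.norm_eq (f : L1) : ‖f‖ = ∫ t in (0 : ℝ)..1, ‖f t‖ := by
  rw [L1.norm_eq_integral_norm, intervalIntegral.integral_of_le zero_le_one]

lemma ae_Ioc_of_ae_restrict {p : ℝ → Prop} (h : ∀ᵐ t ∂(volume.restrict (Ioc (0 : ℝ) 1)), p t)
    {x : ℝ} (hx : x ∈ Icc (0 : ℝ) 1) : ∀ᵐ t, t ∈ uIoc 0 x → p t := by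
  rw [ae_restrict_iff' measurableSet_Ioc] at h
  filter_upwards [h] with t ht htx
  rw [uIoc_of_le hx.1] at htx
  exact ht ⟨htx.1, htx.2.trans hx.2⟩

lemma IntervalIntegrable.mono_Icc {f : ℝ → ℂ} (hf : IntervalIntegrable f volume 0 1) {x : ℝ}
    (hx : x ∈ Icc (0 : ℝ) 1) : IntervalIntegrable f volume 0 x :=
  hf.mono_set (uIcc_subset_uIcc_left (by rwa [uIcc_of_le zero_le_one]))

lemma intervalIntegrable_kernel (d : ℂ) (f : L1) (φ : CI) (x : ℝ) :
    IntervalIntegrable (fun t : ℝ => Complex.exp (d * (x - t)) * (f t * ext φ t)) volume 0 1 :=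
  ((L1.intervalIntegrable f).mul_continuousOn (continuous_ext φ).continuousOn).continuousOn_mul
    (by fun_prop)

lemma norm_exp_mul_le (d : ℂ) {s : ℝ} (hs : s ∈ Icc (0 : ℝ) 1) :
    ‖Complex.exp (d * s)‖ ≤ Real.exp |d.re| := by
  rw [Complex.norm_exp]
  refine Real.exp_le_exp.mpr ?_
  simp only [Complex.mul_re, Complex.ofReal_re, Complex.ofReal_im, mul_zero, sub_zero]
  calc d.re * s ≤ |d.re| * s := mul_le_mul_of_nonneg_right (le_abs_self _) hs.1
    _ ≤ |d.re| * 1 := mul_le_mul_of_nonneg_left hs.2 (abs_nonneg _)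
    _ = _ := mul_one _

lemma norm_kernel_integral_le {d : ℂ} {A : ℝ}
    (hA : ∀ s ∈ Icc (0 : ℝ) 1, ‖Complex.exp (d * (s : ℝ))‖ ≤ A) (f : L1) {h : ℝ → ℂ} {H : ℝ}
    (hH0 : 0 ≤ H) (hH : ∀ t ∈ Icc (0 : ℝ) 1, ‖h t‖ ≤ H) {x : ℝ} (hx : x ∈ Icc (0 : ℝ) 1) :
    ‖∫ t in (0 : ℝ)..x, Complex.exp (d * (x - t)) * (f t * h t)‖ ≤ A * ‖f‖ * H := by
  have hA0 : 0 ≤ A := (norm_nonneg _).trans (hA 0 (by simp))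
  have hfi := L1.intervalIntegrable f
  calc _ ≤ ∫ t in (0 : ℝ)..x, A * H * ‖f t‖ := by
        refine intervalIntegral.norm_integral_le_of_norm_le hx.1 (.of_forall fun t ht => ?_)
          ((IntervalIntegrable.mono_Icc hfi hx).norm.const_mul _)
        have hs : x - t ∈ Icc (0 : ℝ) 1 := ⟨by linarith [ht.2], by linarith [ht.1, hx.2]⟩
        have h1 := hA _ hs
        push_cast at h1
        rw [norm_mul, norm_mul]
        calc _ ≤ A * (‖f t‖ * H) := by
              gcongr
              exact hH t ⟨ht.1.le, ht.2.trans hx.2⟩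
          _ = _ := by ring
    _ ≤ ∫ t in (0 : ℝ)..1, A * H * ‖f t‖ := by
        refine intervalIntegral.integral_mono_interval le_rfl hx.1 hx.2
          (.of_forall fun t => by positivity) (hfi.norm.const_mul _)
    _ = A * ‖f‖ * H := by
        rw [intervalIntegral.integral_const_mul, ← L1.norm_eq]; ring

/-- The Volterra operator `φ ↦ ∫₀ˣ exp (d (x - t)) f(t) φ(t) dt`. -/
def voltFun (d : ℂ) (f : L1) (φ : CI) : CI where
  toFun x := ∫ t in (0 : ℝ)..x, Complex.exp (d * (x - t)) * (f t * ext φ t)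
  continuous_toFun := by
    have hr : IntervalIntegrable (fun t => f t * ext φ t) volume 0 1 :=
      (L1.intervalIntegrable f).mul_continuousOn (continuous_ext φ).continuousOn
    have h : HasPrim (fun x : ℝ => ∫ t in (0 : ℝ)..x, Complex.exp (d * (x - t)) *
        (f t * ext φ t)) _ := HasPrim.of_duhamel (d := d) (v := 0) hr (fun x _ => by simp)
    exact continuousOn_iff_continuous_domRestrict.mp h.continuousOn

lemma voltFun_apply (d : ℂ) (f : L1) (φ : CI) (x : Icc (0 : ℝ) 1) :
    voltFun d f φ x = ∫ t in (0 : ℝ)..x, Complex.exp (d * (x - t)) * (f t * ext φ t) := rfl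

lemma norm_voltFun_le {d : ℂ} {A : ℝ}
    (hA : ∀ s ∈ Icc (0 : ℝ) 1, ‖Complex.exp (d * (s : ℝ))‖ ≤ A) (f : L1) (φ : CI) :
    ‖voltFun d f φ‖ ≤ A * ‖f‖ * ‖φ‖ := by
  have hA0 : 0 ≤ A := (norm_nonneg _).trans (hA 0 (by simp))
  exact (ContinuousMap.norm_le _ (by positivity)).mpr fun x =>
    norm_kernel_integral_le hA f (norm_nonneg _) (fun t _ => norm_ext_le φ t) x.2

/-- The Volterra operator as a bounded bilinear map. -/
def volt (d : ℂ) : L1 →L[ℂ] CI →L[ℂ] CI :=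
  LinearMap.mkContinuous₂ (LinearMap.mk₂ ℂ (voltFun d)
    (by
      intro f g φ
      ext x
      simp only [voltFun_apply, ContinuousMap.add_apply]
      rw [← intervalIntegral.integral_add
        (IntervalIntegrable.mono_Icc (intervalIntegrable_kernel d f φ x) x.2)
        (IntervalIntegrable.mono_Icc (intervalIntegrable_kernel d g φ x) x.2)]
      refine intervalIntegral.integral_congr_ae ?_
      filter_upwards [ae_Ioc_of_ae_restrict (Lp.coeFn_add f g) x.2] with t ht htx
      rw [ht htx, Pi.add_apply]
      ring)
    (by
      intro c f φ
      ext x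
      simp only [voltFun_apply, ContinuousMap.smul_apply, smul_eq_mul]
      rw [← intervalIntegral.integral_const_mul]
      refine intervalIntegral.integral_congr_ae ?_
      filter_upwards [ae_Ioc_of_ae_restrict (Lp.coeFn_smul c f) x.2] with t ht htx
      rw [ht htx, Pi.smul_apply, smul_eq_mul]
      ring)
    (by
      intro f φ χ
      ext x
      simp only [voltFun_apply, ContinuousMap.add_apply]
      rw [← intervalIntegral.integral_add
        (IntervalIntegrable.mono_Icc (intervalIntegrable_kernel d f φ x) x.2)
        (IntervalIntegrable.mono_Icc (intervalIntegrable_kernel d f χ x) x.2)]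
      congr 1
      funext t
      simp only [ext, ContinuousMap.add_apply]
      ring)
    (by
      intro c f φ
      ext x
      simp only [voltFun_apply, ContinuousMap.smul_apply, smul_eq_mul]
      rw [← intervalIntegral.integral_const_mul]
      congr 1
      funext t
      simp only [ext, ContinuousMap.smul_apply, smul_eq_mul]
      ring))
    (Real.exp |d.re|)
    (fun f φ => norm_voltFun_le (fun _ hs => norm_exp_mul_le d hs) f φ)

lemma volt_apply (d : ℂ) (f : L1) (φ : CI) (x : Icc (0 : ℝ) 1) :
    volt d f φ x = ∫ t in (0 : ℝ)..x, Complex.exp (d * (x - t)) * (f t * ext φ t) := rfl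

lemma norm_volt_le {d : ℂ} {A : ℝ}
    (hA : ∀ s ∈ Icc (0 : ℝ) 1, ‖Complex.exp (d * (s : ℝ))‖ ≤ A) (f : L1) (φ : CI) :
    ‖volt d f φ‖ ≤ A * ‖f‖ * ‖φ‖ := norm_voltFun_le hA f φ

/-! ### The scaled first order system -/

/-- The cube roots of `-1`. -/
def al : Fin 3 → ℂ := ![1 / 2 + √3 / 2 * Complex.I, 1 / 2 - √3 / 2 * Complex.I, -1]

/-- The inverses of the cube roots of `-1`. -/
def be : Fin 3 → ℂ := ![1 / 2 - √3 / 2 * Complex.I, 1 / 2 + √3 / 2 * Complex.I, -1]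

lemma sqrt_three_sq : ((√3 : ℝ) : ℂ) ^ 2 = 3 := by
  rw [← Complex.ofReal_pow, Real.sq_sqrt (by norm_num)]; norm_num

lemma be_sq (k : Fin 3) : be k ^ 2 = -al k := by
  fin_cases k <;> simp [be, al] <;> ring_nf <;> simp [sqrt_three_sq] <;> ring

lemma al_sq (k : Fin 3) : al k ^ 2 = -be k := by
  fin_cases k <;> simp [be, al] <;> ring_nf <;> simp [sqrt_three_sq] <;> ring

lemma be_mul_al (k : Fin 3) : be k * al k = 1 := by
  fin_cases k <;> simp [be, al] <;> ring_nf <;> simp [sqrt_three_sq] <;> ring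

lemma norm_al (k : Fin 3) : ‖al k‖ = 1 := by
  have h3 : al k ^ 3 = -1 := by rw [pow_succ, al_sq, neg_mul, be_mul_al]
  have : ‖al k‖ ^ 3 = 1 := by rw [← norm_pow, h3]; simp
  exact (pow_eq_one_iff_of_nonneg (norm_nonneg _) (by norm_num)).mp this

lemma norm_be (k : Fin 3) : ‖be k‖ = 1 := by
  have : ‖be k * al k‖ = 1 := by rw [be_mul_al]; simp
  rwa [norm_mul, norm_al, mul_one] at this

/-- Coefficients of `P` in the scaled system. -/
def aa (k l : Fin 3) : ℂ := -(be k + be k ^ 2 * al l) / 3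

/-- Coefficients of `Q` in the scaled system. -/
def cc (k : Fin 3) : ℂ := be k ^ 2 / 3

lemma norm_aa_le (k l : Fin 3) : ‖aa k l‖ ≤ 1 := by
  rw [aa, norm_div, norm_neg]
  have := norm_add_le (be k) (be k ^ 2 * al l)
  rw [norm_mul, norm_pow, norm_be, norm_al] at this
  norm_num at this ⊢
  linarith

lemma norm_cc_le (k : Fin 3) : ‖cc k‖ ≤ 1 := by
  rw [cc, norm_div, norm_pow, norm_be]; norm_num

/-- The space of scaled coefficients `(P, Q)`. -/
abbrev Ecal : Type := L1 × L1

/-- Continuous vector functions on `[0, 1]`. -/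
def Curves : Type := Fin 3 → CI

instance : NormedAddCommGroup Curves := inferInstanceAs (NormedAddCommGroup (Fin 3 → CI))

instance : NormedSpace ℂ Curves := inferInstanceAs (NormedSpace ℂ (Fin 3 → CI))

instance : CompleteSpace Curves := inferInstanceAs (CompleteSpace (Fin 3 → CI))

namespace Curves

/-- The components of a continuous vector function. -/
def c (X : Curves) (k : Fin 3) : CI := (show Fin 3 → CI from X) k

/-- The continuous vector function with given components. -/
def of (f : Fin 3 → CI) : Curves := f

lemma of_c (f : Fin 3 → CI) (k : Fin 3) : (of f).c k = f k := rfl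

lemma ext {X Z : Curves} (h : ∀ k x, X.c k x = Z.c k x) : X = Z :=
  funext fun k => ContinuousMap.ext (h k)

lemma add_c (X Z : Curves) (k : Fin 3) : (X + Z).c k = X.c k + Z.c k := rfl

lemma smul_c (a : ℂ) (X : Curves) (k : Fin 3) : (a • X).c k = a • X.c k := rfl

lemma norm_le {X : Curves} {C : ℝ} (hC : 0 ≤ C) (h : ∀ k x, ‖X.c k x‖ ≤ C) : ‖X‖ ≤ C :=
  (pi_norm_le_iff_of_nonneg (G := fun _ : Fin 3 => CI) hC).mpr fun k =>
    (ContinuousMap.norm_le _ hC).mpr (h k)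

lemma norm_c_le (X : Curves) (k : Fin 3) : ‖X.c k‖ ≤ ‖X‖ :=
  norm_le_pi_norm (G := fun _ : Fin 3 => CI) X k

end Curves

/-- The entries of the perturbation matrix. -/
def RR (E : Ecal) (k l : Fin 3) (t : ℝ) : ℂ := aa k l * E.1 t + cc k * E.2 t

/-- The integral operator of the scaled system, for given coefficients. -/
def KEfun (d : Fin 3 → ℂ) (E : Ecal) (X : Curves) : Curves :=
  Curves.of fun k => ∑ l, volt (d k) (aa k l • E.1 + cc k • E.2) (X.c l)

lemma norm_KEfun_le {d : Fin 3 → ℂ} {A : ℝ}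
    (hA : ∀ k, ∀ s ∈ Icc (0 : ℝ) 1, ‖Complex.exp (d k * (s : ℝ))‖ ≤ A) (E : Ecal) (X : Curves) :
    ‖KEfun d E X‖ ≤ 6 * A * ‖E‖ * ‖X‖ := by
  have hA0 : 0 ≤ A := (norm_nonneg _).trans (hA 0 0 (by simp))
  refine (pi_norm_le_iff_of_nonneg (G := fun _ : Fin 3 => CI) (by positivity)).mpr fun k => ?_
  change ‖∑ l, volt (d k) (aa k l • E.1 + cc k • E.2) (X.c l)‖ ≤ _
  calc _ ≤ ∑ _l : Fin 3, A * (2 * ‖E‖) * ‖X‖ := by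
        refine norm_sum_le_of_le _ fun l _ => ?_
        refine (norm_volt_le (hA k) _ _).trans ?_
        gcongr
        · calc ‖aa k l • E.1 + cc k • E.2‖ ≤ ‖aa k l‖ * ‖E.1‖ + ‖cc k‖ * ‖E.2‖ := by
                refine (norm_add_le _ _).trans ?_
                rw [norm_smul, norm_smul]
            _ ≤ 1 * ‖E‖ + 1 * ‖E‖ := by
                gcongr
                · exact norm_aa_le k l
                · exact norm_fst_le E
                · exact norm_cc_le k
                · exact norm_snd_le E
            _ = _ := by ring
        · exact X.norm_c_le l
    _ = _ := by simp; ring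

lemma norm_exp_mul_le_of_sum (d : Fin 3 → ℂ) (k : Fin 3) {s : ℝ} (hs : s ∈ Icc (0 : ℝ) 1) :
    ‖Complex.exp (d k * s)‖ ≤ Real.exp (|(d 0).re| + |(d 1).re| + |(d 2).re|) :=
  (norm_exp_mul_le (d k) hs).trans (Real.exp_le_exp.mpr (by
    have h0 := abs_nonneg (d 0).re
    have h1 := abs_nonneg (d 1).re
    have h2 := abs_nonneg (d 2).re
    fin_cases k <;> simp <;> linarith))

/-- The integral operator of the scaled system, as a function of the coefficients. -/
def KE (d : Fin 3 → ℂ) : Ecal →L[ℂ] Curves →L[ℂ] Curves :=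
  LinearMap.mkContinuous₂ (LinearMap.mk₂ ℂ (KEfun d)
    (by
      intro E F X
      refine Curves.ext fun k x => congrArg (fun φ : CI => φ x) ?_
      simp only [KEfun, Curves.of_c, Curves.add_c, ← Finset.sum_add_distrib]
      refine Finset.sum_congr rfl fun l _ => ?_
      have h : aa k l • (E + F).1 + cc k • (E + F).2 =
          (aa k l • E.1 + cc k • E.2) + (aa k l • F.1 + cc k • F.2) := by
        rw [Prod.fst_add, Prod.snd_add, smul_add, smul_add]; abel
      rw [h, map_add]
      rfl)
    (by
      intro c E X
      refine Curves.ext fun k x => congrArg (fun φ : CI => φ x) ?_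
      simp only [KEfun, Curves.of_c, Curves.smul_c, Finset.smul_sum]
      refine Finset.sum_congr rfl fun l _ => ?_
      have h : aa k l • (c • E).1 + cc k • (c • E).2 = c • (aa k l • E.1 + cc k • E.2) := by
        rw [Prod.smul_fst, Prod.smul_snd, smul_add, smul_comm c, smul_comm c]
      rw [h, map_smul]
      rfl)
    (by
      intro E X Z
      refine Curves.ext fun k x => congrArg (fun φ : CI => φ x) ?_
      simp only [KEfun, Curves.of_c, Curves.add_c, map_add, Finset.sum_add_distrib])
    (by
      intro c E X
      refine Curves.ext fun k x => congrArg (fun φ : CI => φ x) ?_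
      simp only [KEfun, Curves.of_c, Curves.smul_c, map_smul, Finset.smul_sum]))
    (6 * Real.exp (|(d 0).re| + |(d 1).re| + |(d 2).re|))
    (norm_KEfun_le fun k _ hs => norm_exp_mul_le_of_sum d k hs)

lemma KE_apply (d : Fin 3 → ℂ) (E : Ecal) (X : Curves) (k : Fin 3) {x : ℝ} (hx : x ∈ Icc (0 : ℝ) 1) :
    (KE d E X).c k ⟨x, hx⟩ =
      ∫ t in (0 : ℝ)..x, Complex.exp (d k * (x - t)) * ∑ l, RR E k l t * ext (X.c l) t := by
  have h : (KE d E X).c k ⟨x, hx⟩ =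
      ∑ l, volt (d k) (aa k l • E.1 + cc k • E.2) (X.c l) ⟨x, hx⟩ := by
    change (KEfun d E X).c k ⟨x, hx⟩ = _
    simp [KEfun, Curves.of_c, ContinuousMap.sum_apply]
  rw [h]
  simp only [volt_apply]
  rw [← intervalIntegral.integral_finsetSum fun l _ =>
    IntervalIntegrable.mono_Icc (intervalIntegrable_kernel _ _ _ x) hx]
  refine intervalIntegral.integral_congr_ae ?_
  have hc : ∀ l, ∀ᵐ t, t ∈ uIoc 0 x →
      (aa k l • E.1 + cc k • E.2 : L1) t = aa k l * E.1 t + cc k * E.2 t := by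
    intro l
    filter_upwards [ae_Ioc_of_ae_restrict (Lp.coeFn_add (aa k l • E.1) (cc k • E.2)) hx,
      ae_Ioc_of_ae_restrict (Lp.coeFn_smul (aa k l) E.1) hx,
      ae_Ioc_of_ae_restrict (Lp.coeFn_smul (cc k) E.2) hx] with t h1 h2 h3 ht
    rw [h1 ht, Pi.add_apply, h2 ht, h3 ht]
    rfl
  filter_upwards [hc 0, hc 1, hc 2] with t h0 h1 h2 ht
  simp only [Fin.sum_univ_three, h0 ht, h1 ht, h2 ht, RR]
  ring

lemma RR_intervalIntegrable (E : Ecal) (k l : Fin 3) : IntervalIntegrable (RR E k l) volume 0 1 :=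
  ((L1.intervalIntegrable E.1).const_mul _).add ((L1.intervalIntegrable E.2).const_mul _)

lemma RR_mul_intervalIntegrable (E : Ecal) (X : Curves) (k : Fin 3) :
    IntervalIntegrable (fun t => ∑ l, RR E k l t * ext (X.c l) t) volume 0 1 := by
  have : (fun t => ∑ l, RR E k l t * ext (X.c l) t) = ∑ l, fun t => RR E k l t * ext (X.c l) t := by
    ext t; simp
  rw [this]
  exact IntervalIntegrable.sum _ fun l _ =>
    (RR_intervalIntegrable E k l).mul_continuousOn (continuous_ext _).continuousOn

/-- Solutions of the unperturbed scaled system. -/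
def X0 (d : Fin 3 → ℂ) (v : Fin 3 → ℂ) : Curves :=
  Curves.of fun k => ⟨fun x => Complex.exp (d k * (x : ℝ)) * v k, by fun_prop⟩

lemma X0_apply (d v : Fin 3 → ℂ) (k : Fin 3) (x : Icc (0 : ℝ) 1) :
    (X0 d v).c k x = Complex.exp (d k * (x : ℝ)) * v k := rfl

/-! ### Neumann series for the scaled system, uniform in the spectral parameter -/

/-- Exponents that are not large. -/
def Tame (d : Fin 3 → ℂ) : Prop := ∀ k, (d k).re ≤ 1

/-- The bound is e < 3. Only an upper bound on the real parts is needed, so it is uniform in the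
large imaginary and the large negative exponents. -/
lemma Tame.norm_exp_le {d : Fin 3 → ℂ} (h : Tame d) (k : Fin 3) {s : ℝ} (hs : s ∈ Icc (0 : ℝ) 1) :
    ‖Complex.exp (d k * s)‖ ≤ 3 := by
  rw [Complex.norm_exp]
  simp only [Complex.mul_re, Complex.ofReal_re, Complex.ofReal_im, mul_zero, sub_zero]
  have : (d k).re * s ≤ 1 := by
    calc (d k).re * s ≤ 1 * s := mul_le_mul_of_nonneg_right (h k) hs.1
      _ ≤ 1 := by linarith [hs.2]
  exact (Real.exp_le_exp.mpr this).trans (Real.exp_one_lt_d9.le.trans (by norm_num))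

lemma Tame.norm_KE_le {d : Fin 3 → ℂ} (h : Tame d) (E : Ecal) : ‖KE d E‖ ≤ 18 * ‖E‖ := by
  refine ContinuousLinearMap.opNorm_le_bound _ (by positivity) fun X => ?_
  refine (norm_KEfun_le (fun k s hs => h.norm_exp_le k hs) E X).trans_eq ?_
  ring

lemma Tame.norm_X0_le {d : Fin 3 → ℂ} (h : Tame d) (v : Fin 3 → ℂ) : ‖X0 d v‖ ≤ 3 * ‖v‖ := by
  refine Curves.norm_le (by positivity) fun k x => ?_
  rw [X0_apply, norm_mul]
  gcongr
  · exact h.norm_exp_le k x.2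
  · exact norm_le_pi_norm v k

/-- The solution of the scaled system with given initial vector. -/
def sol (d : Fin 3 → ℂ) (E : Ecal) (v : Fin 3 → ℂ) : Curves :=
  Ring.inverse (1 - KE d E) (X0 d v)

/-- The threshold 1/36 gives the Neumann series the ratio 1/2. It involves neither z nor n, which
makes all later radii uniform. -/
lemma Tame.norm_KE_lt {d : Fin 3 → ℂ} (h : Tame d) {E : Ecal} (hE : ‖E‖ < 1 / 36) :
    ‖KE d E‖ ≤ 1 / 2 := (h.norm_KE_le E).trans (by linarith)

lemma Tame.isUnit {d : Fin 3 → ℂ} (h : Tame d) {E : Ecal} (hE : ‖E‖ < 1 / 36) :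
    IsUnit (1 - KE d E) :=
  isUnit_one_sub_of_norm_lt_one ((h.norm_KE_lt hE).trans_lt (by norm_num))

lemma Tame.inverse_eq {d : Fin 3 → ℂ} (h : Tame d) {E : Ecal} (hE : ‖E‖ < 1 / 36) (X : Curves) :
    Ring.inverse (1 - KE d E) X = X + KE d E (Ring.inverse (1 - KE d E) X) := by
  have h1 := Ring.mul_inverse_cancel _ (h.isUnit hE)
  have h2 := congrArg (fun S : Curves →L[ℂ] Curves => S X) h1
  have h3 : Ring.inverse (1 - KE d E) X - KE d E (Ring.inverse (1 - KE d E) X) = X := h2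
  exact sub_eq_iff_eq_add.mp h3

lemma Tame.eq_inverse {d : Fin 3 → ℂ} (h : Tame d) {E : Ecal} (hE : ‖E‖ < 1 / 36) {X Z : Curves}
    (hZ : Z = X + KE d E Z) : Z = Ring.inverse (1 - KE d E) X := by
  have h1 := Ring.inverse_mul_cancel _ (h.isUnit hE)
  have h2 : Ring.inverse (1 - KE d E) (Z - KE d E Z) = Z :=
    congrArg (fun S : Curves →L[ℂ] Curves => S Z) h1
  rw [← h2, show Z - KE d E Z = X by nth_rewrite 1 [hZ]; abel]

lemma Tame.norm_inverse_le {d : Fin 3 → ℂ} (h : Tame d) {E : Ecal} (hE : ‖E‖ < 1 / 36) (X : Curves) :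
    ‖Ring.inverse (1 - KE d E) X‖ ≤ 2 * ‖X‖ := by
  have h1 := h.inverse_eq hE X
  have h2 := (KE d E).le_opNorm (Ring.inverse (1 - KE d E) X)
  have h3 : ‖KE d E‖ * ‖Ring.inverse (1 - KE d E) X‖ ≤ 1 / 2 * ‖Ring.inverse (1 - KE d E) X‖ := by
    gcongr
    exact h.norm_KE_lt hE
  have h4 := norm_add_le X (KE d E (Ring.inverse (1 - KE d E) X))
  rw [← h1] at h4
  linarith

lemma Tame.sol_eq {d : Fin 3 → ℂ} (h : Tame d) {E : Ecal} (hE : ‖E‖ < 1 / 36) (v : Fin 3 → ℂ) :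
    sol d E v = X0 d v + KE d E (sol d E v) := h.inverse_eq hE _

lemma Tame.norm_sol_le {d : Fin 3 → ℂ} (h : Tame d) {E : Ecal} (hE : ‖E‖ < 1 / 36)
    (v : Fin 3 → ℂ) : ‖sol d E v‖ ≤ 6 * ‖v‖ :=
  (h.norm_inverse_le hE _).trans (by linarith [h.norm_X0_le v])

lemma X0_sum (d v : Fin 3 → ℂ) : X0 d v = ∑ l, v l • X0 d (Pi.single l 1) := by
  rw [Fin.sum_univ_three]
  refine Curves.ext fun k x => ?_
  simp only [Curves.add_c, Curves.smul_c, ContinuousMap.add_apply, ContinuousMap.smul_apply,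
    X0_apply, smul_eq_mul]
  fin_cases k <;> simp <;> ring

lemma sol_sum (d v : Fin 3 → ℂ) (E : Ecal) :
    sol d E v = ∑ l, v l • sol d E (Pi.single l 1) := by
  rw [sol, X0_sum, map_sum]
  simp [sol]

/-- Evaluation at the right end point. -/
def ev1 (j : Fin 3) : Curves →L[ℂ] ℂ :=
  LinearMap.mkContinuous
    { toFun := fun X => X.c j ⟨1, by simp⟩
      map_add' := fun _ _ => rfl
      map_smul' := fun _ _ => rfl } 1
    (fun X => by
      rw [one_mul]
      exact ((X.c j).norm_coe_le_norm _).trans (X.norm_c_le j))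

lemma ev1_apply (j : Fin 3) (X : Curves) : ev1 j X = X.c j ⟨1, by simp⟩ := rfl

lemma norm_ev1_apply_le (j : Fin 3) (X : Curves) : ‖ev1 j X‖ ≤ ‖X‖ :=
  ((X.c j).norm_coe_le_norm _).trans (X.norm_c_le j)

/-- The monodromy matrix of the scaled system. -/
def TT (d : Fin 3 → ℂ) (E : Ecal) : Fin 3 → Fin 3 → ℂ :=
  fun j l => ev1 j (sol d E (Pi.single l 1))

lemma Tame.norm_TT_le {d : Fin 3 → ℂ} (h : Tame d) {E : Ecal} (hE : ‖E‖ < 1 / 36) :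
    ‖TT d E‖ ≤ 6 := by
  refine (pi_norm_le_iff_of_nonneg (by norm_num)).mpr fun j =>
    (pi_norm_le_iff_of_nonneg (by norm_num)).mpr fun l => ?_
  refine (norm_ev1_apply_le j _).trans ((h.norm_sol_le hE _).trans ?_)
  rw [Pi.norm_single]
  simp

lemma TT_zero (d : Fin 3 → ℂ) (j l : Fin 3) :
    TT d 0 j l = if j = l then Complex.exp (d j) else 0 := by
  simp only [TT, sol, map_zero, sub_zero, Ring.inverse_one]
  change (X0 d (Pi.single l 1)).c j ⟨1, _⟩ = _
  rw [X0_apply]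
  simp [Pi.single_apply]

lemma Tame.analyticAt_inverse {d : Fin 3 → ℂ} (h : Tame d) {E : Ecal} (hE : ‖E‖ < 1 / 36) :
    AnalyticAt ℂ (fun E => Ring.inverse (1 - KE d E)) E := by
  obtain ⟨u, hu⟩ := h.isUnit hE
  have h1 : AnalyticAt ℂ (fun E => 1 - KE d E) E :=
    analyticAt_const.sub ((KE d).analyticAt E)
  have h2 : AnalyticAt ℂ Ring.inverse (1 - KE d E) := hu ▸ _root_.analyticAt_inverse (𝕜 := ℂ) u
  exact AnalyticAt.comp (f := fun E => 1 - KE d E) h2 h1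

lemma Tame.analyticOnNhd_TT {d : Fin 3 → ℂ} (h : Tame d) :
    AnalyticOnNhd ℂ (TT d) (Metric.ball 0 (1 / 36)) := by
  intro E hE
  rw [mem_ball_zero_iff] at hE
  rw [analyticAt_pi_iff]
  intro j
  rw [analyticAt_pi_iff]
  intro l
  have h1 := h.analyticAt_inverse hE
  exact AnalyticAt.comp (f := fun E => Ring.inverse (1 - KE d E))
    (g := ev1 j ∘L (ContinuousLinearMap.apply ℂ Curves (X0 d (Pi.single l 1))))
    (ContinuousLinearMap.analyticAt _ _) h1

/-- Expansion of the monodromy matrix up to terms of third order. -/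
lemma Tame.norm_TT_sub_le {d : Fin 3 → ℂ} (h : Tame d) {E : Ecal} (hE : ‖E‖ < 1 / 36)
    (j l : Fin 3) :
    ‖TT d E j l - (if j = l then Complex.exp (d j) else 0)
      - ev1 j (KE d E (X0 d (Pi.single l 1)))
      - ev1 j (KE d E (KE d E (X0 d (Pi.single l 1))))‖ ≤ 6 * (18 * ‖E‖) ^ 3 := by
  set v : Fin 3 → ℂ := Pi.single l 1 with hv
  have hv1 : ‖v‖ = 1 := by rw [hv, Pi.norm_single]; simp
  have e1 := h.sol_eq hE v
  have e0 : ev1 j (X0 d v) = if j = l then Complex.exp (d j) else 0 := by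
    rw [ev1_apply, X0_apply, hv]; simp [Pi.single_apply]
  have e2 : TT d E j l - (if j = l then Complex.exp (d j) else 0) - ev1 j (KE d E (X0 d v))
      - ev1 j (KE d E (KE d E (X0 d v))) = ev1 j (KE d E (KE d E (KE d E (sol d E v)))) := by
    rw [← e0, TT, ← hv, ← map_sub, ← map_sub, ← map_sub]
    congr 1
    -- The integral equation is inserted into itself twice; what remains after the first and second
    -- order terms contains three factors `KE d E`.
    have e3 : sol d E v = X0 d v + KE d E (X0 d v + KE d E (X0 d v + KE d E (sol d E v))) := by
      rw [← e1, ← e1, ← e1]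
    nth_rewrite 1 [e3]
    simp only [map_add]
    abel
  rw [e2]
  refine (norm_ev1_apply_le j _).trans ?_
  have hk : ∀ Z : Curves, ‖KE d E Z‖ ≤ 18 * ‖E‖ * ‖Z‖ := fun Z =>
    ((KE d E).le_opNorm Z).trans (by gcongr; exact h.norm_KE_le E)
  calc _ ≤ 18 * ‖E‖ * (18 * ‖E‖ * (18 * ‖E‖ * (6 * ‖v‖))) := by
        refine (hk _).trans ?_
        gcongr
        refine (hk _).trans ?_
        gcongr
        refine (hk _).trans ?_
        gcongr
        exact h.norm_sol_le hE v
    _ = _ := by rw [hv1]; ring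

/-! ### Differential form of the scaled system and Liouville's formula -/

/-- The determinant of three columns. -/
def det3 (a b c : Fin 3 → ℂ) : ℂ :=
  a 0 * (b 1 * c 2 - b 2 * c 1) - b 0 * (a 1 * c 2 - a 2 * c 1) + c 0 * (a 1 * b 2 - a 2 * b 1)

lemma HasPrim.det3 {a b c a' b' c' : ℝ → Fin 3 → ℂ}
    (ha : ∀ k, HasPrim (fun t => a t k) fun t => a' t k)
    (hb : ∀ k, HasPrim (fun t => b t k) fun t => b' t k)
    (hc : ∀ k, HasPrim (fun t => c t k) fun t => c' t k) :
    HasPrim (fun t => det3 (a t) (b t) (c t))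
      fun t => det3 (a' t) (b t) (c t) + det3 (a t) (b' t) (c t) + det3 (a t) (b t) (c' t) := by
  refine HasPrim.mono_right ((((ha 0).mul (((hb 1).mul (hc 2)).sub ((hb 2).mul (hc 1)))).sub
    ((hb 0).mul (((ha 1).mul (hc 2)).sub ((ha 2).mul (hc 1))))).add
    ((hc 0).mul (((ha 1).mul (hb 2)).sub ((ha 2).mul (hb 1))))) fun t _ => ?_
  simp only [ThreePoint.det3]
  ring

/-- Liouville's formula for inhomogeneous linear systems. -/
lemma HasPrim.det3_linear {A : ℝ → Fin 3 → Fin 3 → ℂ} {τ : ℂ}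
    (hA : ∀ t, A t 0 0 + A t 1 1 + A t 2 2 = τ) {a b c f g h : ℝ → Fin 3 → ℂ}
    (ha : ∀ k, HasPrim (fun t => a t k) fun t => (∑ l, A t k l * a t l) + f t k)
    (hb : ∀ k, HasPrim (fun t => b t k) fun t => (∑ l, A t k l * b t l) + g t k)
    (hc : ∀ k, HasPrim (fun t => c t k) fun t => (∑ l, A t k l * c t l) + h t k) :
    HasPrim (fun t : ℝ => Complex.exp (-τ * t) * ThreePoint.det3 (a t) (b t) (c t))
      fun t : ℝ => Complex.exp (-τ * t) * (ThreePoint.det3 (f t) (b t) (c t) +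
        ThreePoint.det3 (a t) (g t) (c t) + ThreePoint.det3 (a t) (b t) (h t)) := by
  refine ((HasPrim.cexp (-τ)).mul (HasPrim.det3 ha hb hc)).mono_right fun t _ => ?_
  simp only [ThreePoint.det3, Fin.sum_univ_three, ← hA t]
  ring

/-- Cramer's rule without division, hence without an assumption on the determinant. -/
lemma cramer3 (x a b c : Fin 3 → ℂ) (j : Fin 3) :
    x j * det3 a b c = a j * det3 x b c + b j * det3 a x c + c j * det3 a b x := by
  fin_cases j <;> simp [det3] <;> ring

/-- The term `KE d V Z` is a source. It is zero for solutions of the system and carries the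
variation V of the coefficients for derivatives of solutions. -/
lemma Curves.hasPrim_of_eq {d v : Fin 3 → ℂ} {E V : Ecal} {X Z : Curves}
    (h : X = X0 d v + KE d E X + KE d V Z) (k : Fin 3) :
    HasPrim (ThreePoint.ext (X.c k)) fun t => d k * ThreePoint.ext (X.c k) t +
      ((∑ l, RR E k l t * ThreePoint.ext (X.c l) t) +
        ∑ l, RR V k l t * ThreePoint.ext (Z.c l) t) := by
  have i1 := RR_mul_intervalIntegrable E X k
  have i2 := RR_mul_intervalIntegrable V Z k
  refine HasPrim.of_duhamel (v := v k) (i1.add i2) fun x hx => ?_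
  have h1 : X.c k ⟨x, hx⟩ = (X0 d v + KE d E X + KE d V Z).c k ⟨x, hx⟩ := by rw [← h]
  rw [ext_apply _ hx, h1]
  simp only [Curves.add_c, ContinuousMap.add_apply, KE_apply, X0_apply]
  rw [add_assoc, ← intervalIntegral.integral_add]
  · congr 2
    funext t
    ring
  · exact (IntervalIntegrable.mono_Icc i1 hx).continuousOn_mul (by fun_prop)
  · exact (IntervalIntegrable.mono_Icc i2 hx).continuousOn_mul (by fun_prop)

/-- The coefficient matrix of the scaled system. -/
def AA (d : Fin 3 → ℂ) (E : Ecal) (t : ℝ) (k l : Fin 3) : ℂ :=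
  (if k = l then d k else 0) + RR E k l t

lemma AA_sum (d : Fin 3 → ℂ) (E : Ecal) (t : ℝ) (k : Fin 3) (x : Fin 3 → ℂ) :
    ∑ l, AA d E t k l * x l = d k * x k + ∑ l, RR E k l t * x l := by
  simp [AA, add_mul, Finset.sum_add_distrib]

/-- The perturbation is traceless because the `be k` and the `al k` sum to zero; so the Wronskian is
the unperturbed one. -/
lemma AA_trace (d : Fin 3 → ℂ) (E : Ecal) (t : ℝ) :
    AA d E t 0 0 + AA d E t 1 1 + AA d E t 2 2 = d 0 + d 1 + d 2 := by
  have h1 : aa 0 0 + aa 1 1 + aa 2 2 = 0 := by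
    simp only [aa, be_sq, neg_mul, ← sq, al_sq]
    simp [be]
    ring
  have h2 : cc 0 + cc 1 + cc 2 = 0 := by
    simp only [cc, be_sq]
    simp [al]
    ring
  simp only [AA, RR, if_true]
  linear_combination E.1 t * h1 + E.2 t * h2

/-- The columns of the fundamental matrix of the scaled system. -/
def col (d : Fin 3 → ℂ) (E : Ecal) (l : Fin 3) (t : ℝ) (k : Fin 3) : ℂ :=
  ext ((sol d E (Pi.single l 1)).c k) t

lemma continuous_col (d : Fin 3 → ℂ) (E : Ecal) (l k : Fin 3) :
    Continuous fun t => col d E l t k := continuous_ext _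

lemma col_one (d : Fin 3 → ℂ) (E : Ecal) (l k : Fin 3) : col d E l 1 k = TT d E k l := by
  rw [col, ext_apply _ (by simp)]; rfl

section Sol

variable {d : Fin 3 → ℂ} (h : Tame d) {E : Ecal} (hE : ‖E‖ < 1 / 36)

include h hE

lemma Tame.col_hasPrim (l k : Fin 3) :
    HasPrim (fun t => col d E l t k) fun t => (∑ i, AA d E t k i * col d E l t i) + 0 := by
  have h1 : sol d E (Pi.single l 1) = X0 d (Pi.single l 1) + KE d E (sol d E (Pi.single l 1)) +
      KE d 0 0 := by
    rw [map_zero (KE d 0), add_zero]; exact h.sol_eq hE _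
  refine (Curves.hasPrim_of_eq h1 k).mono_right fun t _ => ?_
  rw [AA_sum]
  have : ∑ i, RR 0 k i t * ext ((0 : Curves).c i) t = 0 :=
    Finset.sum_eq_zero fun i _ => by
      have : ext ((0 : Curves).c i) t = 0 := rfl
      rw [this, mul_zero]
  rw [this]
  simp only [col, add_zero]

lemma Tame.col_zero (l k : Fin 3) : col d E l 0 k = if k = l then 1 else 0 := by
  rw [col, ext_apply _ (by simp), h.sol_eq hE, Curves.add_c, ContinuousMap.add_apply, KE_apply,
    X0_apply]
  simp [Pi.single_apply]

lemma Tame.det3_col_zero : det3 (col d E 0 0) (col d E 1 0) (col d E 2 0) = 1 := by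
  simp [det3, h.col_zero hE]

lemma Tame.det3_col_one :
    det3 (col d E 0 1) (col d E 1 1) (col d E 2 1) = Complex.exp (d 0 + d 1 + d 2) := by
  have h1 := HasPrim.det3_linear (AA_trace d E) (h.col_hasPrim hE 0) (h.col_hasPrim hE 1)
    (h.col_hasPrim hE 2) (f := fun _ _ => 0) (g := fun _ _ => 0) (h := fun _ _ => 0)
  have h2 := h1.2 1 (by simp)
  have h3 : ∀ a b c : Fin 3 → ℂ, det3 (fun _ => 0) b c + det3 a (fun _ => 0) c +
      det3 a b (fun _ => 0) = 0 := by
    intro a b c; simp [det3]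
  simp only [h3, mul_zero, intervalIntegral.integral_zero, add_zero, h.det3_col_zero hE,
    Complex.ofReal_zero, Complex.ofReal_one, Complex.exp_zero, mul_one] at h2
  have h4 : Complex.exp (d 0 + d 1 + d 2) * Complex.exp (-(d 0 + d 1 + d 2)) = 1 := by
    rw [← Complex.exp_add]; simp
  linear_combination Complex.exp (d 0 + d 1 + d 2) * h2 -
    det3 (col d E 0 1) (col d E 1 1) (col d E 2 1) * h4

/-- The derivative of (1 − KE)⁻¹ in the direction V is (1 − KE)⁻¹ (KE V) (1 − KE)⁻¹, and the right
factor applied to `X0` is the solution itself. -/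
lemma Tame.hasFDerivAt_TT_apply (j l : Fin 3) :
    ∃ L : Ecal →L[ℂ] ℂ, HasFDerivAt (fun E => TT d E j l) L E ∧
      ∀ V, L V = ev1 j (Ring.inverse (1 - KE d E) (KE d V (sol d E (Pi.single l 1)))) := by
  obtain ⟨u, hu⟩ := h.isUnit hE
  have h1 : HasFDerivAt (fun E => 1 - KE d E) (-(KE d)) E := (KE d).hasFDerivAt.const_sub 1
  have h2 : HasFDerivAt Ring.inverse _ (1 - KE d E) := hu ▸ hasFDerivAt_ringInverse (𝕜 := ℂ) u
  have h3 := HasFDerivAt.comp (f := fun E => 1 - KE d E) E h2 h1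
  set ψ : (Curves →L[ℂ] Curves) →L[ℂ] ℂ := ev1 j ∘L (ContinuousLinearMap.apply ℂ Curves (X0 d (Pi.single l 1)))
  have h4 := ψ.hasFDerivAt.comp E h3
  refine ⟨_, h4, fun V => ?_⟩
  have hui : Ring.inverse (1 - KE d E) = ((u⁻¹ : (Curves →L[ℂ] Curves)ˣ) : Curves →L[ℂ] Curves) := by
    rw [← hu, Ring.inverse_unit]
  rw [sol, hui]
  simp [ψ]

/-- Variation of constants without inverting the fundamental matrix. The derivative δ of a column
solves the inhomogeneous system with zero initial value. Cramer's rule expresses δ(1) by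
determinants in which δ replaces one column, and by Liouville's formula each of them is the integral
of its source term alone. The result displays the kernels as continuous functions of t. -/
lemma Tame.fderiv_TT_eq_integral (j l : Fin 3) (V : Ecal) :
    ev1 j (Ring.inverse (1 - KE d E) (KE d V (sol d E (Pi.single l 1)))) =
      ∫ t in (0 : ℝ)..1, Complex.exp (-(d 0 + d 1 + d 2) * t) *
        (TT d E j 0 * det3 (fun k => ∑ i, RR V k i t * col d E l t i) (col d E 1 t) (col d E 2 t) +
         TT d E j 1 * det3 (col d E 0 t) (fun k => ∑ i, RR V k i t * col d E l t i) (col d E 2 t) +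
         TT d E j 2 * det3 (col d E 0 t) (col d E 1 t)
          (fun k => ∑ i, RR V k i t * col d E l t i)) := by
  set δ := Ring.inverse (1 - KE d E) (KE d V (sol d E (Pi.single l 1))) with hδ
  have e1 : δ = X0 d 0 + KE d E δ + KE d V (sol d E (Pi.single l 1)) := by
    have h0 : X0 d 0 = 0 := by
      refine Curves.ext fun k x => ?_
      rw [X0_apply, Pi.zero_apply, mul_zero]
      rfl
    rw [h0, zero_add, add_comm]
    exact h.inverse_eq hE _
  set f : ℝ → Fin 3 → ℂ := fun t k => ∑ i, RR V k i t * col d E l t i with hf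
  set D : ℝ → Fin 3 → ℂ := fun t k => ext (δ.c k) t with hD
  have hprim : ∀ k, HasPrim (fun t => D t k) fun t => (∑ i, AA d E t k i * D t i) + f t k := by
    intro k
    refine (Curves.hasPrim_of_eq e1 k).mono_right fun t _ => ?_
    rw [AA_sum, add_assoc]
    rfl
  have hD0 : ∀ k, D 0 k = 0 := by
    intro k
    simp only [hD]
    rw [ext_apply _ (by simp), e1, Curves.add_c, Curves.add_c, ContinuousMap.add_apply,
      ContinuousMap.add_apply, KE_apply, KE_apply, X0_apply]
    simp
  have hz : ∀ b c : Fin 3 → ℂ, det3 (fun _ => 0) b c = 0 ∧ det3 b (fun _ => 0) c = 0 ∧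
      det3 b c (fun _ => 0) = 0 := by
    intro b c; simp [det3]
  have hD0' : D 0 = fun _ => 0 := funext hD0
  have k0 := HasPrim.det3_linear (AA_trace d E) hprim (h.col_hasPrim hE 1)
    (h.col_hasPrim hE 2) (g := fun _ _ => 0) (h := fun _ _ => 0)
  have k1 := HasPrim.det3_linear (AA_trace d E) (h.col_hasPrim hE 0) hprim
    (h.col_hasPrim hE 2) (f := fun _ _ => 0) (h := fun _ _ => 0)
  have k2 := HasPrim.det3_linear (AA_trace d E) (h.col_hasPrim hE 0) (h.col_hasPrim hE 1)
    hprim (f := fun _ _ => 0) (g := fun _ _ => 0)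
  have k := (((k0.const_mul (TT d E j 0)).add (k1.const_mul (TT d E j 1))).add
    (k2.const_mul (TT d E j 2))).integral_eq
  simp only [hD0', (hz _ _).1, (hz _ _).2.1, (hz _ _).2.2, add_zero, zero_add, mul_zero,
    sub_zero] at k
  have hcr := cramer3 (D 1) (col d E 0 1) (col d E 1 1) (col d E 2 1) j
  rw [h.det3_col_one hE, col_one, col_one, col_one] at hcr
  have hev : ev1 j δ = D 1 j := by
    simp only [hD]; rw [ext_apply _ (by simp)]; rfl
  have h4 : Complex.exp (-(d 0 + d 1 + d 2)) * Complex.exp (d 0 + d 1 + d 2) = 1 := by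
    rw [← Complex.exp_add, neg_add_cancel, Complex.exp_zero]
  rw [hev]
  calc D 1 j = Complex.exp (-(d 0 + d 1 + d 2)) * (D 1 j * Complex.exp (d 0 + d 1 + d 2)) := by
        generalize Complex.exp (-(d 0 + d 1 + d 2)) = e1 at h4 ⊢
        generalize Complex.exp (d 0 + d 1 + d 2) = e2 at h4 ⊢
        linear_combination -D 1 j * h4
    _ = _ := by
        rw [hcr]
        convert k.symm using 1
        · simp only [Complex.ofReal_one, mul_one]; ring
        · congr 1
          funext t
          ring

end Sol

/-! ### Functionals with continuous kernels -/

section Rep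

variable {F G : Type*} [NormedAddCommGroup F] [NormedSpace ℂ F] [NormedAddCommGroup G]
  [NormedSpace ℂ G]

/-- Functionals of `(P, Q)` that are given by continuous kernels. -/
def Rep (L : Ecal →L[ℂ] F) : Prop :=
  ∃ gP gQ : ℝ → F, ContinuousOn gP (Icc 0 1) ∧ ContinuousOn gQ (Icc 0 1) ∧
    ∀ V : Ecal, L V = ∫ t in (0 : ℝ)..1, (V.1 t • gP t + V.2 t • gQ t)

lemma intervalIntegrable_smul (f : L1) {g : ℝ → F} (hg : ContinuousOn g (Icc 0 1)) :
    IntervalIntegrable (fun t => f t • g t) volume 0 1 := by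
  have h := L1.intervalIntegrable f
  rw [intervalIntegrable_iff_integrableOn_Icc_of_le zero_le_one] at h ⊢
  exact h.smul_continuousOn hg isCompact_Icc

lemma Rep.comp [CompleteSpace F] [CompleteSpace G] {L : Ecal →L[ℂ] F} (h : Rep L) (A : F →L[ℂ] G) :
    Rep (A ∘L L) := by
  obtain ⟨gP, gQ, hP, hQ, hL⟩ := h
  refine ⟨fun t => A (gP t), fun t => A (gQ t), A.continuous.comp_continuousOn hP,
    A.continuous.comp_continuousOn hQ, fun V => ?_⟩
  rw [ContinuousLinearMap.comp_apply, hL, ← A.intervalIntegral_comp_comm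
    ((intervalIntegrable_smul V.1 hP).add (intervalIntegrable_smul V.2 hQ))]
  simp

lemma Rep.add {L M : Ecal →L[ℂ] F} (hL : Rep L) (hM : Rep M) : Rep (L + M) := by
  obtain ⟨gP, gQ, hP, hQ, hL⟩ := hL
  obtain ⟨gP', gQ', hP', hQ', hM⟩ := hM
  refine ⟨fun t => gP t + gP' t, fun t => gQ t + gQ' t, hP.add hP', hQ.add hQ', fun V => ?_⟩
  change L V + M V = _
  rw [hL, hM, ← intervalIntegral.integral_add
    ((intervalIntegrable_smul V.1 hP).add (intervalIntegrable_smul V.2 hQ))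
    ((intervalIntegrable_smul V.1 hP').add (intervalIntegrable_smul V.2 hQ'))]
  congr 1
  funext t
  simp only [smul_add]
  abel

lemma Rep.zero : Rep (0 : Ecal →L[ℂ] F) :=
  ⟨0, 0, continuousOn_const, continuousOn_const, fun V => by simp⟩

lemma Rep.sum {ι : Type*} (s : Finset ι) {L : ι → Ecal →L[ℂ] F} (h : ∀ i ∈ s, Rep (L i)) :
    Rep (∑ i ∈ s, L i) := by
  classical
  induction s using Finset.induction_on with
  | empty => simpa using Rep.zero
  | insert a s ha ih =>
    rw [Finset.sum_insert ha]
    exact (h a (by simp)).add (ih fun i hi => h i (by simp [hi]))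

lemma Rep.pi {ι : Type*} [Fintype ι] [CompleteSpace F] {L : Ecal →L[ℂ] (ι → F)}
    (h : ∀ i, Rep (ContinuousLinearMap.proj i ∘L L)) : Rep L := by
  classical
  have : L = ∑ i, ContinuousLinearMap.single ℂ (fun _ : ι => F) i ∘L
      (ContinuousLinearMap.proj i ∘L L) := by
    refine ContinuousLinearMap.ext fun V => funext fun j => ?_
    simp [Finset.sum_apply, Pi.single_apply]
  rw [this]
  exact Rep.sum _ fun i _ => (h i).comp _

/-- The integrand of `Tame.fderiv_TT_eq_integral` is pointwise linear in V.1 t and V.2 t, so the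
kernels are its coefficients. -/
lemma Tame.rep_fderiv_TT {d : Fin 3 → ℂ} (h : Tame d) {E : Ecal} (hE : ‖E‖ < 1 / 36) :
    Rep (fderiv ℂ (TT d) E) := by
  have hd : DifferentiableAt ℂ (TT d) E :=
    (h.analyticOnNhd_TT E (by simpa using hE)).differentiableAt
  refine Rep.pi fun j => Rep.pi fun l => ?_
  obtain ⟨L, hL, hLV⟩ := h.hasFDerivAt_TT_apply hE j l
  have h1 := (hasFDerivAt_pi'.mp (hasFDerivAt_pi'.mp hd.hasFDerivAt j) l).unique hL
  rw [h1]
  have hc := fun i k => continuous_col d E i k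
  refine ⟨fun t => Complex.exp (-(d 0 + d 1 + d 2) * t) *
        (TT d E j 0 * det3 (fun k => ∑ i, aa k i * col d E l t i) (col d E 1 t) (col d E 2 t) +
         TT d E j 1 * det3 (col d E 0 t) (fun k => ∑ i, aa k i * col d E l t i) (col d E 2 t) +
         TT d E j 2 * det3 (col d E 0 t) (col d E 1 t) (fun k => ∑ i, aa k i * col d E l t i)),
    fun t => Complex.exp (-(d 0 + d 1 + d 2) * t) *
        (TT d E j 0 * det3 (fun k => ∑ i, cc k * col d E l t i) (col d E 1 t) (col d E 2 t) +
         TT d E j 1 * det3 (col d E 0 t) (fun k => ∑ i, cc k * col d E l t i) (col d E 2 t) +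
         TT d E j 2 * det3 (col d E 0 t) (col d E 1 t) (fun k => ∑ i, cc k * col d E l t i)),
    ?_, ?_, fun V => ?_⟩
  · simp only [det3, Fin.sum_univ_three]
    exact Continuous.continuousOn (by fun_prop)
  · simp only [det3, Fin.sum_univ_three]
    exact Continuous.continuousOn (by fun_prop)
  · rw [hLV, h.fderiv_TT_eq_integral hE]
    congr 1
    funext t
    simp only [det3, RR, Fin.sum_univ_three, smul_eq_mul]
    ring

end Rep

/-! ### Quasi-solutions on `[0, 1]` -/

/-- The right-hand side of the first order system for quasi-solutions. -/
def qsRhs (p r : ℝ → ℂ) (Y : ℝ → Fin 3 → ℂ) (t : ℝ) : Fin 3 → ℂ :=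
  ![Y t 1, Y t 2 - p t * Y t 0, r t * Y t 0 - p t * Y t 1]

lemma isQuasiSolution_iff {p r : ℝ → ℂ} {Y : ℝ → Fin 3 → ℂ} :
    IsQuasiSolution p r Y ↔
      Continuous Y ∧ ∀ i x, Y x i = Y 0 i + ∫ t in (0 : ℝ)..x, qsRhs p r Y t i := by
  rw [IsQuasiSolution, Fin.forall_fin_succ, Fin.forall_fin_two]
  rfl

/-- Quasi-solutions on `[0, 1]`. -/
def OnUnit (p r : ℝ → ℂ) (Y : ℝ → Fin 3 → ℂ) : Prop :=
  ∀ i, HasPrim (fun t => Y t i) fun t => qsRhs p r Y t i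

lemma HasPrim.congr_ae {f f' g' : ℝ → ℂ} (h : HasPrim f f')
    (h' : f' =ᵐ[volume.restrict (Ioc (0 : ℝ) 1)] g') : HasPrim f g' := by
  refine ⟨?_, fun x hx => ?_⟩
  · have := h.1
    rw [intervalIntegrable_iff_integrableOn_Ioc_of_le zero_le_one] at this ⊢
    exact this.congr h'
  · rw [h.2 x hx]
    congr 1
    exact intervalIntegral.integral_congr_ae (ae_Ioc_of_ae_restrict h' hx)

/-- `E` consists of the classes of the functions `P` and `Q`. -/
def Represents (E : Ecal) (P Q : ℝ → ℂ) : Prop :=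
  E.1 =ᵐ[volume.restrict (Ioc (0 : ℝ) 1)] P ∧ E.2 =ᵐ[volume.restrict (Ioc (0 : ℝ) 1)] Q

/-- Components of a vector in the scaled eigenbasis. -/
def scaled (z : ℂ) (y : Fin 3 → ℂ) (k : Fin 3) : ℂ :=
  (∑ i : Fin 3, be k ^ (i : ℕ) * (y i / z ^ (i : ℕ))) / 3

/-- The vector with given components in the scaled eigenbasis. -/
def unscaled (z : ℂ) (x : Fin 3 → ℂ) (i : Fin 3) : ℂ := z ^ (i : ℕ) * ∑ k, al k ^ (i : ℕ) * x k

/-- The exponents of the unperturbed scaled system. -/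
def dz (z : ℂ) (k : Fin 3) : ℂ := z * al k - z / 2

lemma scaled_eq (z : ℂ) (y : Fin 3 → ℂ) (k : Fin 3) :
    scaled z y k = (y 0 + be k * (y 1 / z) + -al k * (y 2 / z ^ 2)) / 3 := by
  rw [← be_sq]
  simp [scaled, Fin.sum_univ_three]

lemma unscaled_scaled {z : ℂ} (hz : z ≠ 0) (y : Fin 3 → ℂ) : unscaled z (scaled z y) = y := by
  funext i
  simp only [unscaled, scaled_eq, Fin.sum_univ_three]
  have h2 := sqrt_three_sq
  have h3 : ((√3 : ℝ) : ℂ) ^ 3 = 3 * ((√3 : ℝ) : ℂ) := by rw [pow_succ, h2]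
  have h4 : ((√3 : ℝ) : ℂ) ^ 4 = 9 := by rw [pow_succ, h3, mul_assoc, ← sq, h2]; norm_num
  fin_cases i <;> simp [al, be] <;> field_simp <;> ring_nf <;> simp [h2, h3, h4] <;> ring_nf

lemma scaled_unscaled {z : ℂ} (hz : z ≠ 0) (x : Fin 3 → ℂ) : scaled z (unscaled z x) = x := by
  funext k
  have h2 := sqrt_three_sq
  have h3 : ((√3 : ℝ) : ℂ) ^ 3 = 3 * ((√3 : ℝ) : ℂ) := by rw [pow_succ, h2]
  have h4 : ((√3 : ℝ) : ℂ) ^ 4 = 9 := by rw [pow_succ, h3, mul_assoc, ← sq, h2]; norm_num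
  simp only [unscaled, scaled_eq, Fin.sum_univ_three]
  fin_cases k <;> simp [al, be] <;> field_simp <;> ring_nf <;> simp [h2, h3, h4] <;> ring_nf

/-- In the scaled eigenbasis the constant part of the system is diagonal with entries z · al k,
while p acquires the weight 1/z and q the weight 1/z². This is why the coefficients are measured by
the pair (p/z, q/z²). -/
lemma scaled_rhs {z : ℂ} (hz : z ≠ 0) (y : Fin 3 → ℂ) (p q : ℂ) (k : Fin 3) :
    scaled z ![y 1, y 2 - p * y 0, (q - z ^ 3) * y 0 - p * y 1] k =
      z * al k * scaled z y k +
        ∑ l, (aa k l * (p / z) + cc k * (q / z ^ 2)) * scaled z y l := by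
  have h0 : y 0 = ∑ l, scaled z y l := by
    conv_lhs => rw [← unscaled_scaled hz y]
    simp [unscaled]
  have h1 : y 1 = z * ∑ l, al l * scaled z y l := by
    conv_lhs => rw [← unscaled_scaled hz y]
    simp [unscaled]
  have h2 : ∑ l, (aa k l * (p / z) + cc k * (q / z ^ 2)) * scaled z y l =
      -(be k * (p / z) * y 0 + be k ^ 2 * (p / z) * (y 1 / z) - be k ^ 2 * (q / z ^ 2) * y 0) /
        3 := by
    have h1' : y 1 / z = ∑ l, al l * scaled z y l := by rw [h1]; field_simp
    rw [h1', h0]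
    simp only [Fin.sum_univ_three, aa, cc]
    ring
  rw [h2, scaled_eq, scaled_eq, be_sq]
  simp only [Matrix.cons_val_zero, Matrix.cons_val_one, Matrix.cons_val]
  have hb := be_mul_al k
  have ha := al_sq k
  field_simp
  linear_combination (-z ^ 2 * y 1) * hb + z * y 2 * ha

/-! ### Propagation of quasi-solutions -/

/-- The propagator of the quasi-solutions on `[0, 1]`. -/
def prop (z : ℂ) (E : Ecal) (x : ℝ) (y : Fin 3 → ℂ) (i : Fin 3) : ℂ :=
  Complex.exp (z / 2 * x) *
    unscaled z (fun k => ext ((sol (dz z) E (scaled z y)).c k) x) i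

lemma prop_zero {z : ℂ} (hz : z ≠ 0) (hd : Tame (dz z)) {E : Ecal} (hE : ‖E‖ < 1 / 36)
    (y : Fin 3 → ℂ) : prop z E 0 y = y := by
  funext i
  have h1 : (fun k => ext ((sol (dz z) E (scaled z y)).c k) 0) = scaled z y := by
    funext k
    rw [ext_apply _ (by simp), hd.sol_eq hE, Curves.add_c, ContinuousMap.add_apply, KE_apply, X0_apply]
    simp
  rw [prop, h1, unscaled_scaled hz]
  simp

section OnUnit

variable {z : ℂ} (hz : z ≠ 0) (hd : Tame (dz z)) {E : Ecal} (hE : ‖E‖ < 1 / 36) {p q : ℝ → ℂ}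
  (hEpq : Represents E (fun t => p t / z) (fun t => q t / z ^ 2))

include hz hd hE hEpq

/-- Multiplied by exp(−zx/2), the scaled components solve the Volterra equation `X = X0 + KE X`,
which has only one solution. -/
lemma OnUnit.eq_prop {Y : ℝ → Fin 3 → ℂ} (hY : OnUnit p (fun t => q t - z ^ 3) Y) {x : ℝ}
    (hx : x ∈ Icc (0 : ℝ) 1) : Y x = prop z E x (Y 0) := by
  have hS : ∀ k, HasPrim (fun t => scaled z (Y t) k)
      fun t => z * al k * scaled z (Y t) k + ∑ l, RR E k l t * scaled z (Y t) l := by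
    intro k
    have h1 : HasPrim (fun t => scaled z (Y t) k)
        (fun t => scaled z (qsRhs p (fun t => q t - z ^ 3) Y t) k) := by
      refine HasPrim.mono_right (HasPrim.mono_left (((hY 0).const_mul (1 / 3)).add
        (((hY 1).const_mul (be k / z / 3)).add ((hY 2).const_mul (-al k / z ^ 2 / 3))))
        (fun t _ => ?_)) fun t _ => ?_
      · rw [scaled_eq]; field_simp; ring
      · rw [scaled_eq]; field_simp; ring
    refine h1.congr_ae ?_
    filter_upwards [hEpq.1, hEpq.2] with t h1 h2
    simp only [RR, h1, h2]
    exact scaled_rhs hz (Y t) (p t) (q t) k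
  have hX : ∀ k, HasPrim (fun t : ℝ => Complex.exp (-(z / 2) * t) * scaled z (Y t) k)
      fun t : ℝ => dz z k * (Complex.exp (-(z / 2) * t) * scaled z (Y t) k) +
        ∑ l, RR E k l t * (Complex.exp (-(z / 2) * t) * scaled z (Y t) l) := by
    intro k
    refine ((HasPrim.cexp (-(z / 2))).mul (hS k)).mono_right fun t _ => ?_
    simp only [Fin.sum_univ_three, dz]
    ring
  set X : Curves := Curves.of fun k => ⟨fun t : Icc (0 : ℝ) 1 =>
    Complex.exp (-(z / 2) * (t : ℝ)) * scaled z (Y t) k,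
    continuousOn_iff_continuous_domRestrict.mp (hX k).continuousOn⟩ with hXdef
  have hext : ∀ k, ∀ t ∈ Icc (0 : ℝ) 1,
      ext (X.c k) t = Complex.exp (-(z / 2) * t) * scaled z (Y t) k := by
    intro k t ht
    rw [ext_apply _ ht]; rfl
  have hfix : X = X0 (dz z) (scaled z (Y 0)) + KE (dz z) E X := by
    refine Curves.ext fun k t => ?_
    obtain ⟨t, ht⟩ := t
    rw [Curves.add_c, ContinuousMap.add_apply, KE_apply, X0_apply]
    have h1 := (hX k).duhamel ht
    have h2 : X.c k ⟨t, ht⟩ = Complex.exp (-(z / 2) * t) * scaled z (Y t) k := rfl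
    rw [h2, h1]
    simp only [Complex.ofReal_zero, mul_zero, Complex.exp_zero, one_mul]
    congr 1
    refine intervalIntegral.integral_congr_ae (.of_forall fun s hs => ?_)
    rw [uIoc_of_le ht.1] at hs
    simp only [hext _ s ⟨hs.1.le, hs.2.trans ht.2⟩]
  have hsol : X = sol (dz z) E (scaled z (Y 0)) := hd.eq_inverse hE hfix
  funext i
  rw [prop, ← hsol]
  simp only [hext _ x hx]
  have h1 : unscaled z (fun k => Complex.exp (-(z / 2) * x) * scaled z (Y x) k) i =
      Complex.exp (-(z / 2) * x) * unscaled z (scaled z (Y x)) i := by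
    simp only [unscaled, Fin.sum_univ_three]; ring
  rw [h1, unscaled_scaled hz, ← mul_assoc, ← Complex.exp_add]
  simp

lemma onUnit_prop (y : Fin 3 → ℂ) :
    OnUnit p (fun t => q t - z ^ 3) (fun x => prop z E x y) := by
  set S := sol (dz z) E (scaled z y) with hSdef
  have h0 : S = X0 (dz z) (scaled z y) + KE (dz z) E S + KE (dz z) 0 0 := by
    rw [map_zero (KE (dz z) 0), add_zero]; exact hd.sol_eq hE _
  have hX : ∀ k, HasPrim (ext (S.c k)) fun t => dz z k * ext (S.c k) t +
      ∑ l, RR E k l t * ext (S.c l) t := by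
    intro k
    refine (Curves.hasPrim_of_eq h0 k).mono_right fun t _ => ?_
    have : ∑ i, RR 0 k i t * ext ((0 : Curves).c i) t = 0 :=
      Finset.sum_eq_zero fun i _ => by
        have : ext ((0 : Curves).c i) t = 0 := rfl
        rw [this, mul_zero]
    rw [this, add_zero]
  have hZ : ∀ k, HasPrim (fun t : ℝ => Complex.exp (z / 2 * t) * ext (S.c k) t)
      fun t : ℝ => z * al k * (Complex.exp (z / 2 * t) * ext (S.c k) t) +
        ∑ l, RR E k l t * (Complex.exp (z / 2 * t) * ext (S.c l) t) := by
    intro k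
    refine ((HasPrim.cexp (z / 2)).mul (hX k)).mono_right fun t _ => ?_
    simp only [Fin.sum_univ_three, dz]
    ring
  have hprop : ∀ t, prop z E t y = unscaled z fun k => Complex.exp (z / 2 * t) * ext (S.c k) t := by
    intro t
    funext i
    simp only [prop, unscaled, Fin.sum_univ_three]
    ring
  intro i
  have h1 : HasPrim (fun t => prop z E t y i) (fun t : ℝ => unscaled z (fun k =>
      z * al k * (Complex.exp (z / 2 * t) * ext (S.c k) t) +
        ∑ l, RR E k l t * (Complex.exp (z / 2 * t) * ext (S.c l) t)) i) := by
    refine HasPrim.mono_right (HasPrim.mono_left ((HasPrim.sum Finset.univ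
      (fun k _ => (hZ k).const_mul (al k ^ (i : ℕ)))).const_mul (z ^ (i : ℕ)))
        (fun t _ => ?_)) fun t _ => ?_
    · rw [hprop t]; rfl
    · rfl
  refine h1.congr_ae ?_
  filter_upwards [hEpq.1, hEpq.2] with t h2 h3
  have h4 := fun k => scaled_rhs hz (prop z E t y) (p t) (q t) k
  have h5 : scaled z (prop z E t y) = fun k => Complex.exp (z / 2 * t) * ext (S.c k) t := by
    rw [hprop t, scaled_unscaled hz]
  rw [h5] at h4
  have h6 : (fun k => z * al k * (Complex.exp (z / 2 * t) * ext (S.c k) t) +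
        ∑ l, RR E k l t * (Complex.exp (z / 2 * t) * ext (S.c l) t)) =
      scaled z (qsRhs p (fun t => q t - z ^ 3) (fun x => prop z E x y) t) := by
    funext k
    refine Eq.trans ?_ (h4 k).symm
    simp only [RR, h2, h3]
  rw [h6, unscaled_scaled hz]

end OnUnit

/-! ### Quasi-solutions on the line -/

lemma intervalIntegrable_qsRhs {p r : ℝ → ℂ} {Y : ℝ → Fin 3 → ℂ} {a b : ℝ}
    (hp : IntervalIntegrable p volume a b) (hr : IntervalIntegrable r volume a b)
    (hY : Continuous Y) (i : Fin 3) :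
    IntervalIntegrable (fun t => qsRhs p r Y t i) volume a b := by
  have h := fun k => (continuous_apply k).comp hY
  fin_cases i
  · exact (h 1).intervalIntegrable _ _
  · exact ((h 2).intervalIntegrable _ _).sub (hp.mul_continuousOn (h 0).continuousOn)
  · exact (hr.mul_continuousOn (h 0).continuousOn).sub (hp.mul_continuousOn (h 1).continuousOn)

lemma qsRhs_shift {p r : ℝ → ℂ} {c : ℝ} (hp : Function.Periodic p c) (hr : Function.Periodic r c)
    (Y : ℝ → Fin 3 → ℂ) (t : ℝ) :
    qsRhs p r (fun x => Y (x + c)) t = qsRhs p r Y (t + c) := by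
  simp only [qsRhs, hp t, hr t]

/-- A family of vectors over the integers that is multiplied by `N` in each step. -/
lemma eq_zpow_of_step {N : Matrix (Fin 3) (Fin 3) ℂ} (hN : IsUnit N.det) {w : ℤ → Fin 3 → ℂ}
    (hw : ∀ k, w (k + 1) = N.mulVec (w k)) (k : ℤ) : w k = (N ^ k).mulVec (w 0) := by
  induction k using Int.induction_on with
  | zero => simp
  | succ k ih => rw [hw, ih, Matrix.mulVec_mulVec, add_comm, Matrix.zpow_one_add hN]
  | pred k ih =>
    have h := hw (-k - 1)
    rw [sub_add_cancel, ih] at h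
    have h2 : (N ^ (-1 : ℤ)).mulVec ((N ^ (-(k : ℤ))).mulVec (w 0)) = w (-k - 1) := by
      rw [h, Matrix.mulVec_mulVec]
      simp [Matrix.nonsing_inv_mul _ hN]
    rw [← h2, Matrix.mulVec_mulVec, ← Matrix.zpow_add hN]
    congr 2
    ring

/-- Quasi-solutions on the line are obtained from those on a period by the monodromy matrix. -/
lemma isQuasiSolution_iff_of_unit {p r : ℝ → ℂ} (hpp : Function.Periodic p 1)
    (hrp : Function.Periodic r 1) (hp : ∀ a b, IntervalIntegrable p volume a b)
    (hr : ∀ a b, IntervalIntegrable r volume a b)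
    {Φ : ℝ → Matrix (Fin 3) (Fin 3) ℂ} (hΦ1 : IsUnit (Φ 1).det)
    (h1 : ∀ Y, OnUnit p r Y → ∀ x ∈ Icc (0 : ℝ) 1, Y x = (Φ x).mulVec (Y 0))
    (h2 : ∀ y, OnUnit p r fun x => (Φ x).mulVec y) (Y : ℝ → Fin 3 → ℂ) :
    IsQuasiSolution p r Y ↔
      ∀ k : ℤ, ∀ x ∈ Icc (0 : ℝ) 1, Y (x + k) = (Φ x).mulVec ((Φ 1 ^ k).mulVec (Y 0)) := by
  have hppk : ∀ k : ℤ, Function.Periodic p (k : ℝ) := fun k => by simpa using hpp.int_mul k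
  have hrpk : ∀ k : ℤ, Function.Periodic r (k : ℝ) := fun k => by simpa using hrp.int_mul k
  rw [isQuasiSolution_iff]
  constructor
  · rintro ⟨hc, hY⟩
    have hint : ∀ i a b, IntervalIntegrable (fun t => qsRhs p r Y t i) volume a b :=
      fun i a b => intervalIntegrable_qsRhs (hp a b) (hr a b) hc i
    have hshift : ∀ k : ℤ, OnUnit p r fun x => Y (x + k) := by
      intro k i
      have hc' : Continuous fun x : ℝ => Y (x + k) := by fun_prop
      refine ⟨intervalIntegrable_qsRhs (hp 0 1) (hr 0 1) hc' i, fun x _ => ?_⟩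
      simp only [qsRhs_shift (hppk k) (hrpk k)]
      rw [intervalIntegral.integral_comp_add_right (fun t => qsRhs p r Y t i), hY i (x + k),
        hY i (0 + k), add_assoc, intervalIntegral.integral_add_adjacent_intervals
        (hint i _ _) (hint i _ _)]
    have hstep : ∀ k : ℤ, ∀ x ∈ Icc (0 : ℝ) 1, Y (x + k) = (Φ x).mulVec (Y k) := by
      intro k x hx
      simpa using h1 _ (hshift k) x hx
    have hz := eq_zpow_of_step hΦ1 (w := fun k : ℤ => Y k) fun k => by
      have := hstep k 1 (by simp)
      rw [← this]
      push_cast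
      rw [add_comm]
    intro k x hx
    have hk := hz k
    simp only [Int.cast_zero] at hk
    rw [hstep k x hx, hk]
  · intro hY
    have hloc : ∀ k : ℤ, OnUnit p r fun x => Y (x + k) := by
      intro k i
      refine HasPrim.mono_right (HasPrim.mono_left (h2 ((Φ 1 ^ k).mulVec (Y 0)) i)
        fun t ht => ?_) fun t ht => ?_
      · simp only [hY k t ht]
      · have h := hY k t ⟨ht.1.le, ht.2⟩
        simp only [qsRhs, h]
    have hc : Continuous Y := by
      -- Continuity is glued from the closed unit intervals, which form a locally finite cover of
      -- the line.
      have hlf : LocallyFinite fun k : ℤ => Icc (k : ℝ) (k + 1) := by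
        intro x
        refine ⟨Ioo (x - 1) (x + 1), Ioo_mem_nhds (by linarith) (by linarith), ?_⟩
        refine (Set.finite_Icc (⌊x⌋ - 2) (⌊x⌋ + 2)).subset ?_
        rintro k ⟨y, ⟨h3, h4⟩, h5, h6⟩
        have h7 := Int.floor_le x
        have h8 := Int.lt_floor_add_one x
        rw [mem_Icc]
        constructor
        · have : (⌊x⌋ : ℝ) - 2 < k := by linarith
          have : ⌊x⌋ - 2 < k := by exact_mod_cast this
          lia
        · have : (k : ℝ) < ⌊x⌋ + 2 := by linarith
          have : k < ⌊x⌋ + 2 := by exact_mod_cast this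
          lia
      refine hlf.continuous ?_ (fun k => isClosed_Icc) fun k => ?_
      · refine eq_univ_of_forall fun x => mem_iUnion.mpr ⟨⌊x⌋, Int.floor_le x, ?_⟩
        exact (Int.lt_floor_add_one x).le
      · refine continuousOn_pi.mpr fun i => ?_
        have h3 := (hloc k i).continuousOn
        have h4 : ContinuousOn (fun x : ℝ => Y (x - k + k) i) (Icc (k : ℝ) (k + 1)) :=
          h3.comp (f := fun x : ℝ => x - k) (by fun_prop)
            fun x hx => ⟨by linarith [hx.1], by linarith [hx.2]⟩
        simpa using h4
    have hint : ∀ i a b, IntervalIntegrable (fun t => qsRhs p r Y t i) volume a b :=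
      fun i a b => intervalIntegrable_qsRhs (hp a b) (hr a b) hc i
    refine ⟨hc, fun i => ?_⟩
    have hloc2 : ∀ k : ℤ, ∀ x ∈ Icc (0 : ℝ) 1,
        Y (x + k) i = Y k i + ∫ t in (k : ℝ)..(x + k), qsRhs p r Y t i := by
      intro k x hx
      have := (hloc k i).2 x hx
      simp only [qsRhs_shift (hppk k) (hrpk k)] at this
      rw [this, intervalIntegral.integral_comp_add_right (fun t => qsRhs p r Y t i)]
      simp
    have hk : ∀ k : ℤ, Y k i = Y 0 i + ∫ t in (0 : ℝ)..k, qsRhs p r Y t i := by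
      intro k
      induction k using Int.induction_on with
      | zero => simp
      | succ k ih =>
        have h3 := hloc2 k 1 (by simp)
        rw [ih, add_assoc, intervalIntegral.integral_add_adjacent_intervals
          (hint i _ _) (hint i _ _), add_comm (1 : ℝ)] at h3
        exact_mod_cast h3
      | pred k ih =>
        have h3 := hloc2 (-k - 1) 1 (by simp)
        have h4 : (1 : ℝ) + ((-k - 1 : ℤ) : ℝ) = ((-k : ℤ) : ℝ) := by push_cast; ring
        rw [h4, ih] at h3
        have h5 := intervalIntegral.integral_add_adjacent_intervals
          (hint i 0 ((-k - 1 : ℤ) : ℝ)) (hint i ((-k - 1 : ℤ) : ℝ) ((-k : ℤ) : ℝ))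
        linear_combination -h3 - h5
    intro x
    have h3 := hloc2 ⌊x⌋ (x - ⌊x⌋) ⟨by linarith [Int.floor_le x],
      by linarith [Int.lt_floor_add_one x]⟩
    rw [hk, add_assoc, intervalIntegral.integral_add_adjacent_intervals
      (hint i _ _) (hint i _ _)] at h3
    simpa using h3

/-! ### The monodromy matrix of the transposed equation -/

/-- The change to the scaled eigenbasis, and back. -/
def Smat (z : ℂ) : Matrix (Fin 3) (Fin 3) ℂ := Matrix.of fun i k => z ^ (i : ℕ) * al k ^ (i : ℕ)

/-- The inverse change of basis. -/
def SinvMat (z : ℂ) : Matrix (Fin 3) (Fin 3) ℂ :=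
  Matrix.of fun k i => be k ^ (i : ℕ) / z ^ (i : ℕ) / 3

lemma Smat_mulVec (z : ℂ) (x : Fin 3 → ℂ) : (Smat z).mulVec x = unscaled z x := by
  funext i
  simp [Matrix.mulVec, dotProduct, Smat, unscaled, Finset.mul_sum, mul_assoc]

lemma SinvMat_mulVec (z : ℂ) (y : Fin 3 → ℂ) : (SinvMat z).mulVec y = scaled z y := by
  funext k
  simp only [Matrix.mulVec, dotProduct, SinvMat, scaled, Fin.sum_univ_three, Matrix.of_apply]
  ring

lemma Smat_mul_SinvMat {z : ℂ} (hz : z ≠ 0) : Smat z * SinvMat z = 1 := by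
  refine Matrix.ext_of_mulVec_single fun i => ?_
  rw [← Matrix.mulVec_mulVec, SinvMat_mulVec, Smat_mulVec, unscaled_scaled hz, Matrix.one_mulVec]

lemma SinvMat_mul_Smat {z : ℂ} (hz : z ≠ 0) : SinvMat z * Smat z = 1 := by
  refine Matrix.ext_of_mulVec_single fun i => ?_
  rw [← Matrix.mulVec_mulVec, Smat_mulVec, SinvMat_mulVec, scaled_unscaled hz, Matrix.one_mulVec]

/-- The matrix of the propagator. -/
def propMat (z : ℂ) (E : Ecal) (x : ℝ) : Matrix (Fin 3) (Fin 3) ℂ :=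
  Complex.exp (z / 2 * x) • (Smat z * Matrix.of (fun k l => col (dz z) E l x k) * SinvMat z)

lemma propMat_mulVec (z : ℂ) (E : Ecal) (x : ℝ) (y : Fin 3 → ℂ) :
    (propMat z E x).mulVec y = prop z E x y := by
  rw [propMat, Matrix.smul_mulVec, ← Matrix.mulVec_mulVec, ← Matrix.mulVec_mulVec, SinvMat_mulVec,
    Smat_mulVec]
  funext i
  simp only [prop, Pi.smul_apply, smul_eq_mul]
  congr 2
  funext k
  rw [sol_sum]
  simp only [Matrix.mulVec, dotProduct, Matrix.of_apply, col, Fin.sum_univ_three, ext, Curves.add_c,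
    Curves.smul_c, ContinuousMap.add_apply, ContinuousMap.smul_apply, smul_eq_mul]
  ring

/-- The scaled monodromy matrix. -/
def TMat (z : ℂ) (E : Ecal) : Matrix (Fin 3) (Fin 3) ℂ := Matrix.of (TT (dz z) E)

/-- The monodromy matrix of the transposed equation. -/
def NMat (z : ℂ) (E : Ecal) : Matrix (Fin 3) (Fin 3) ℂ :=
  Complex.exp (z / 2) • (Smat z * TMat z E * SinvMat z)

lemma propMat_one (z : ℂ) (E : Ecal) : propMat z E 1 = NMat z E := by
  simp only [propMat, NMat, TMat, col_one, Complex.ofReal_one, mul_one]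

lemma det_TMat {z : ℂ} (hd : Tame (dz z)) {E : Ecal} (hE : ‖E‖ < 1 / 36) :
    (TMat z E).det = Complex.exp (-(3 * z / 2)) := by
  have h1 := hd.det3_col_one hE
  simp only [det3, col_one] at h1
  have h2 : dz z 0 + dz z 1 + dz z 2 = -(3 * z / 2) := by
    simp [dz, al]; ring
  rw [h2] at h1
  rw [← h1, TMat, Matrix.det_fin_three]
  simp only [Matrix.of_apply]
  ring

/-- The first order system is traceless before the scaling; the factor exp(z/2)³ restores what the
subtraction of z/2 from each exponent took away. -/
lemma det_NMat {z : ℂ} (hz : z ≠ 0) (hd : Tame (dz z)) {E : Ecal} (hE : ‖E‖ < 1 / 36) :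
    (NMat z E).det = 1 := by
  rw [NMat, Matrix.det_smul, Matrix.det_mul, Matrix.det_mul, det_TMat hd hE]
  have h1 : (Smat z).det * (SinvMat z).det = 1 := by
    rw [← Matrix.det_mul, Smat_mul_SinvMat hz, Matrix.det_one]
  have h2 : Complex.exp (z / 2) ^ 3 * Complex.exp (-(3 * z / 2)) = 1 := by
    rw [← Complex.exp_nat_mul, ← Complex.exp_add]
    push_cast
    rw [show (3 : ℂ) * (z / 2) + -(3 * z / 2) = 0 by ring, Complex.exp_zero]
  rw [Fintype.card_fin]
  linear_combination Complex.exp (z / 2) ^ 3 * Complex.exp (-(3 * z / 2)) * h1 + h2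

/-- Periodic coefficients that are integrable on a period. -/
structure PerCoef (p q : ℝ → ℂ) : Prop where
  per_p : Function.Periodic p 1
  per_q : Function.Periodic q 1
  int_p : ∀ a b, IntervalIntegrable p volume a b
  int_q : ∀ a b, IntervalIntegrable q volume a b

/-- Quasi-solutions are given by the propagator. -/
lemma PerCoef.isQuasiSolution_iff {p q : ℝ → ℂ} (hpq : PerCoef p q) {z : ℂ} (hz : z ≠ 0)
    (hd : Tame (dz z)) {E : Ecal} (hE : ‖E‖ < 1 / 36)
    (hEpq : Represents E (fun t => p t / z) (fun t => q t / z ^ 2)) (Y : ℝ → Fin 3 → ℂ) :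
    IsQuasiSolution p (fun t => q t - z ^ 3) Y ↔ ∀ k : ℤ, ∀ x ∈ Icc (0 : ℝ) 1,
      Y (x + k) = (propMat z E x).mulVec ((NMat z E ^ k).mulVec (Y 0)) := by
  rw [← propMat_one]
  refine isQuasiSolution_iff_of_unit hpq.per_p (fun t => ?_) hpq.int_p
    (fun a b => (hpq.int_q a b).sub intervalIntegrable_const) ?_ (fun Y hY x hx => ?_)
    (fun y => ?_) Y
  · simp only [hpq.per_q t]
  · rw [propMat_one, det_NMat hz hd hE]; exact isUnit_one
  · rw [propMat_mulVec]; exact hY.eq_prop hz hd hE hEpq hx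
  · simp only [propMat_mulVec]; exact onUnit_prop hz hd hE hEpq y

/-! ### Existence of quasi-solutions -/

/-- The class in `L¹(0, 1)` of an integrable function. -/
def L1.ofFun (f : ℝ → ℂ) (hf : IntervalIntegrable f volume 0 1) : L1 :=
  Integrable.toL1 f ((intervalIntegrable_iff_integrableOn_Ioc_of_le zero_le_one).1 hf)

lemma L1.ofFun_ae {f : ℝ → ℂ} (hf : IntervalIntegrable f volume 0 1) :
    L1.ofFun f hf =ᵐ[volume.restrict (Ioc (0 : ℝ) 1)] f :=
  Integrable.coeFn_toL1 _

lemma L1.norm_eq_of_ae {f : ℝ → ℂ} {u : L1} (h : u =ᵐ[volume.restrict (Ioc (0 : ℝ) 1)] f) :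
    ‖u‖ = ∫ t in (0 : ℝ)..1, ‖f t‖ := by
  rw [L1.norm_eq]
  refine intervalIntegral.integral_congr_ae ?_
  filter_upwards [ae_Ioc_of_ae_restrict h (x := 1) (by simp)] with t ht h1
  rw [ht h1]

lemma Represents.norm_eq {E : Ecal} {P Q : ℝ → ℂ} (h : Represents E P Q) :
    ‖E‖ = max (∫ t in (0 : ℝ)..1, ‖P t‖) (∫ t in (0 : ℝ)..1, ‖Q t‖) := by
  rw [Prod.norm_def, L1.norm_eq_of_ae h.1, L1.norm_eq_of_ae h.2]

lemma exists_represents {P Q : ℝ → ℂ} (hP : IntervalIntegrable P volume 0 1)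
    (hQ : IntervalIntegrable Q volume 0 1) : ∃ E, Represents E P Q :=
  ⟨(L1.ofFun P hP, L1.ofFun Q hQ), L1.ofFun_ae hP, L1.ofFun_ae hQ⟩

lemma integral_comp_neg_of_periodic {F : Type*} [NormedAddCommGroup F] [NormedSpace ℝ F]
    {f : ℝ → F} (hf : Function.Periodic f 1) :
    ∫ t in (0 : ℝ)..1, f (-t) = ∫ t in (0 : ℝ)..1, f t := by
  rw [intervalIntegral.integral_comp_neg]
  have := hf.intervalIntegral_add_eq (-1) 0
  simpa using this

lemma PerCoef.reflect {p q : ℝ → ℂ} (h : PerCoef p q) :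
    PerCoef (fun t => p (-t)) (fun t => q (-t)) where
  per_p t := by
    have := h.per_p (-(t + 1)); simp only at this ⊢; rw [← this]; congr 1; ring
  per_q t := by
    have := h.per_q (-(t + 1)); simp only at this ⊢; rw [← this]; congr 1; ring
  int_p a b := by simpa using (IntervalIntegrable.iff_comp_neg (f := p)).1 (h.int_p (-a) (-b))
  int_q a b := by simpa using (IntervalIntegrable.iff_comp_neg (f := q)).1 (h.int_q (-a) (-b))

lemma PerCoef.exists_isQuasiSolution {p q : ℝ → ℂ} (hpq : PerCoef p q) {z : ℂ} (hz : z ≠ 0)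
    (hd : Tame (dz z)) {E : Ecal} (hE : ‖E‖ < 1 / 36)
    (hEpq : Represents E (fun t => p t / z) (fun t => q t / z ^ 2)) (y : Fin 3 → ℂ) :
    ∃ Y, IsQuasiSolution p (fun t => q t - z ^ 3) Y ∧ Y 0 = y := by
  have h0 : ∀ v, (propMat z E 0).mulVec v = v := fun v => by
    rw [propMat_mulVec]; exact prop_zero hz hd hE v
  have hdet : IsUnit (NMat z E).det := by rw [det_NMat hz hd hE]; exact isUnit_one
  set Y : ℝ → Fin 3 → ℂ :=
    fun x => (propMat z E (Int.fract x)).mulVec ((NMat z E ^ ⌊x⌋).mulVec y) with hY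
  have hY0 : Y 0 = y := by simp [hY, h0]
  refine ⟨Y, ?_, hY0⟩
  rw [hpq.isQuasiSolution_iff hz hd hE hEpq, hY0]
  intro k x hx
  -- At x = 1 the integer part jumps, and the value is produced by the next period; there the extra
  -- factor `NMat` replaces the propagator at 1.
  rcases eq_or_lt_of_le hx.2 with h1 | h1
  · have h2 : ⌊x + k⌋ = 1 + k := by rw [h1]; simp
    have h3 : Int.fract (x + k) = 0 := by rw [h1]; simp
    simp only [hY, h2, h3, h0]
    rw [h1, propMat_one, Matrix.mulVec_mulVec, Matrix.zpow_one_add hdet]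
  · have h2 : ⌊x + k⌋ = k := by
      rw [Int.floor_add_intCast, Int.floor_eq_zero_iff.2 ⟨hx.1, h1⟩, zero_add]
    have h3 : Int.fract (x + k) = x := by
      rw [Int.fract_add_intCast, Int.fract_eq_self.2 ⟨hx.1, h1⟩]
    simp only [hY, h2, h3]

/-- Reflection turns solutions of the transposed equation into solutions of the original one. -/
lemma IsQuasiSolution.reflect {p r : ℝ → ℂ} {W : ℝ → Fin 3 → ℂ}
    (h : IsQuasiSolution (fun t => p (-t)) (fun t => -r (-t)) W) :
    IsQuasiSolution p r (fun x => ![W (-x) 0, -W (-x) 1, W (-x) 2]) := by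
  obtain ⟨hc, h0, h1, h2⟩ := h
  have key : ∀ (f : ℝ → ℂ) (x : ℝ), ∫ t in (0 : ℝ)..x, f (-t) = -∫ t in (0 : ℝ)..-x, f t := by
    intro f x
    rw [intervalIntegral.integral_comp_neg, neg_zero, intervalIntegral.integral_symm]
  have hk : ∀ k, Continuous fun x : ℝ => W (-x) k := fun k => by fun_prop
  refine ⟨?_, fun x => ?_, fun x => ?_, fun x => ?_⟩
  · refine continuous_pi fun k => ?_
    fin_cases k
    · exact hk 0
    · exact (hk 1).neg
    · exact hk 2
  · have := h0 (-x)
    simp only [Matrix.cons_val_zero, Matrix.cons_val_one, neg_zero]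
    rw [intervalIntegral.integral_neg, key fun t => W t 1, this]
    ring
  · have := h1 (-x)
    simp only [Matrix.cons_val_zero, Matrix.cons_val_one, Matrix.cons_val, neg_zero]
    have h3 := key (fun t => W t 2 - p (-t) * W t 0) x
    simp only [neg_neg] at h3
    rw [h3, this]
    ring
  · have := h2 (-x)
    simp only [Matrix.cons_val_zero, Matrix.cons_val_one, Matrix.cons_val, neg_zero]
    have h3 := key (fun t => -r (-t) * W t 0 - p (-t) * W t 1) x
    simp only [neg_neg] at h3
    have h4 : ∫ t in (0 : ℝ)..x, (r t * W (-t) 0 - p t * -W (-t) 1) =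
        -∫ t in (0 : ℝ)..x, (-r t * W (-t) 0 - p t * W (-t) 1) := by
      rw [← intervalIntegral.integral_neg]
      congr 1
      funext t
      ring
    rw [h4, h3, this]
    ring

/-- The original equation read backwards is the transposed one with the coefficients p(−x), q(−x) at
the same λ, and the reflection preserves the norm over a period. So solvability is inherited. -/
lemma PerCoef.exists_isSolution {p q : ℝ → ℂ} (hpq : PerCoef p q) {z : ℂ} (hz : z ≠ 0)
    (hd : Tame (dz z)) {E : Ecal} (hE : ‖E‖ < 1 / 36)
    (hEpq : Represents E (fun t => p t / z) (fun t => q t / z ^ 2)) (y : Fin 3 → ℂ) :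
    ∃ Y, IsQuasiSolution p (fun t => z ^ 3 - q t) Y ∧ Y 0 = y := by
  obtain ⟨E', hE'⟩ := exists_represents (P := fun t => p (-t) / z) (Q := fun t => q (-t) / z ^ 2)
    ((hpq.reflect.int_p 0 1).div_const z) ((hpq.reflect.int_q 0 1).div_const (z ^ 2))
  have hn : ‖E'‖ = ‖E‖ := by
    rw [hE'.norm_eq, hEpq.norm_eq]
    congr 1
    · exact integral_comp_neg_of_periodic (f := fun t => ‖p t / z‖) fun t => by
        simp only [hpq.per_p t]
    · exact integral_comp_neg_of_periodic (f := fun t => ‖q t / z ^ 2‖) fun t => by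
        simp only [hpq.per_q t]
  obtain ⟨W, hW, hW0⟩ := hpq.reflect.exists_isQuasiSolution hz hd (hn ▸ hE) hE'
    ![y 0, -y 1, y 2]
  refine ⟨fun x => ![W (-x) 0, -W (-x) 1, W (-x) 2], IsQuasiSolution.reflect ?_, ?_⟩
  · convert hW using 3
    ring
  · funext k
    simp only [neg_zero, hW0]
    fin_cases k <;> simp

/-! ### The monodromy matrices of the equation and of its transpose -/

lemma OnUnit.of_isQuasiSolution {p r : ℝ → ℂ} {Y : ℝ → Fin 3 → ℂ} (h : IsQuasiSolution p r Y)
    (hp : IntervalIntegrable p volume 0 1) (hr : IntervalIntegrable r volume 0 1) :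
    OnUnit p r Y := by
  rw [isQuasiSolution_iff] at h
  exact fun i => ⟨intervalIntegrable_qsRhs hp hr h.1 i, fun x _ => h.2 i x⟩

/-- Lagrange's identity: the two equations are formally adjoint, so this bilinear form has
derivative zero. -/
lemma OnUnit.bracket {p r : ℝ → ℂ} {Y Z : ℝ → Fin 3 → ℂ} (hY : OnUnit p r Y)
    (hZ : OnUnit p (fun t => -r t) Z) :
    Y 1 2 * Z 1 0 - Y 1 1 * Z 1 1 + Y 1 0 * Z 1 2 =
      Y 0 2 * Z 0 0 - Y 0 1 * Z 0 1 + Y 0 0 * Z 0 2 := by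
  have h := (((hY 2).mul (hZ 0)).sub ((hY 1).mul (hZ 1))).add ((hY 0).mul (hZ 2))
  have h2 := h.mono_right (g' := fun _ => 0) fun t _ => by
    simp only [qsRhs, Matrix.cons_val_zero, Matrix.cons_val_one, Matrix.cons_val]
    ring
  have h3 := h2.integral_eq
  simp only [intervalIntegral.integral_zero] at h3
  linear_combination -h3

/-- The matrix of the bracket. -/
def Bc : Matrix (Fin 3) (Fin 3) ℂ := !![0, 0, 1; 0, -1, 0; 1, 0, 0]

lemma Bc_mul_Bc : Bc * Bc = 1 := by
  ext i j
  fin_cases i <;> fin_cases j <;> simp [Bc, Matrix.mul_apply, Fin.sum_univ_three]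

section

variable {p q : ℝ → ℂ} (hpq : PerCoef p q) {z : ℂ} (hz : z ≠ 0) (hd : Tame (dz z)) {E : Ecal}
  (hE : ‖E‖ < 1 / 36) (hEpq : Represents E (fun t => p t / z) (fun t => q t / z ^ 2))

include hpq hz hd hE hEpq

/-- The entry (j, i) of the left side is the bracket at x = 1 of the fundamental solution with index
j and the transposed solution that starts at the i-th unit vector. The bracket is constant, and at x
= 0 it is the entry of `Bc`. -/
lemma PerCoef.monodromy_mul : monodromy p q (z ^ 3) * Bc * NMat z E = Bc := by
  have hqr : IntervalIntegrable (fun t => z ^ 3 - q t) volume 0 1 :=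
    intervalIntegrable_const.sub (hpq.int_q 0 1)
  refine Matrix.ext_of_mulVec_single fun i => ?_
  set v : Fin 3 → ℂ := Pi.single i 1
  obtain ⟨Z, hZ, hZ0⟩ := hpq.exists_isQuasiSolution hz hd hE hEpq v
  have hZ1 : Z 1 = (NMat z E).mulVec v := by
    have := (hpq.isQuasiSolution_iff hz hd hE hEpq Z).1 hZ 0 1 (by simp)
    simpa [propMat_one, hZ0] using this
  have hZu : OnUnit p (fun t => -(z ^ 3 - q t)) Z := by
    refine OnUnit.of_isQuasiSolution ?_ (hpq.int_p 0 1) hqr.neg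
    simpa using hZ
  rw [← Matrix.mulVec_mulVec, ← Matrix.mulVec_mulVec, ← hZ1]
  funext j
  obtain ⟨W, hW, hW0⟩ := hpq.exists_isSolution hz hd hE hEpq (fun k => if j = k then 1 else 0)
  have hF : IsSolution p q (z ^ 3) (fundSol p q (z ^ 3) j) ∧
      ∀ k, fundSol p q (z ^ 3) j 0 k = if j = k then 1 else 0 :=
    Classical.epsilon_spec (p := fun Y => IsSolution p q (z ^ 3) Y ∧
      ∀ k, Y 0 k = if j = k then 1 else 0) ⟨W, hW, fun k => by rw [hW0]⟩
  have hb := (OnUnit.of_isQuasiSolution hF.1 (hpq.int_p 0 1) hqr).bracket hZu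
  simp only [hF.2] at hb
  have h0 := congrFun hZ0
  fin_cases j <;>
    simp [monodromy, Bc, Matrix.mulVec, dotProduct, Fin.sum_univ_three, h0] at hb ⊢ <;>
    linear_combination hb

/-- The two matrices are conjugate by the involution `Bc`. Thus the dominant multiplier of M is the
inverse of the smallest one of the transposed equation. -/
lemma PerCoef.charpoly_monodromy :
    (monodromy p q (z ^ 3)).charpoly = ((NMat z E)⁻¹).charpoly := by
  have hdet : IsUnit (NMat z E).det := by rw [det_NMat hz hd hE]; exact isUnit_one
  have h1 := hpq.monodromy_mul hz hd hE hEpq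
  have h2 : monodromy p q (z ^ 3) = Bc * (NMat z E)⁻¹ * Bc := by
    calc monodromy p q (z ^ 3) =
        monodromy p q (z ^ 3) * Bc * NMat z E * (NMat z E)⁻¹ * Bc := by
          rw [Matrix.mul_nonsing_inv_cancel_right _ _ hdet, mul_assoc, Bc_mul_Bc, mul_one]
      _ = _ := by rw [h1]
  rw [h2, Matrix.charpoly_mul_comm, ← mul_assoc, Bc_mul_Bc, one_mul]

end

open Polynomial in
/-- The characteristic polynomial of a matrix with a right eigenvector `(1, -1 - s, s)` and a left
eigenvector `(1 + s + u, 1 + u, u)` that annihilate each other. -/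
lemma charpoly_eq_of_eigenvectors {G : Matrix (Fin 3) (Fin 3) ℂ} {s u κ κ' : ℂ} (hu : 1 + u ≠ 0)
    (h1 : G.mulVec ![1, -1 - s, s] = κ • ![1, -1 - s, s])
    (h2 : Matrix.vecMul ![1 + s + u, 1 + u, u] G = κ' • ![1 + s + u, 1 + u, u]) :
    G.charpoly = (X - C κ) * (X - C κ') * (X - C (G.trace - κ - κ')) := by
  have a0 := congrFun h1 0
  have a1 := congrFun h1 1
  have a2 := congrFun h1 2
  have b0 := congrFun h2 0
  have b1 := congrFun h2 1
  have b2 := congrFun h2 2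
  simp [Matrix.mulVec, Matrix.vecMul, dotProduct, Fin.sum_univ_three] at a0 a1 a2 b0 b1 b2
  -- The eigenvalues κ and κ' may coincide, as they do at zero coefficients, so diagonalization is
  -- not available. What matters is the flag formed by the right eigenvector and the plane
  -- annihilated by the left one, which triangularizes G. In coordinates, the eigenvector equations
  -- eliminate five entries of G.
  have e00 : G 0 0 = κ + (1 + s) * G 0 1 - s * G 0 2 := by linear_combination a0
  have e20 : G 2 0 = κ * s + (1 + s) * G 2 1 - s * G 2 2 := by linear_combination a2
  have e10 : G 1 0 = -κ * (1 + s) + (1 + s) * G 1 1 - s * G 1 2 := by linear_combination a1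
  have e11 : G 1 1 = κ' - ((1 + s + u) * G 0 1 + u * G 2 1) / (1 + u) := by
    field_simp; linear_combination b1
  have e12 : G 1 2 = (κ' * u - (1 + s + u) * G 0 2 - u * G 2 2) / (1 + u) := by
    field_simp; linear_combination b2
  have hcoef : G.charpoly = X ^ 3 - C (G 0 0 + G 1 1 + G 2 2) * X ^ 2 +
      C (G 0 0 * G 1 1 - G 0 1 * G 1 0 + G 0 0 * G 2 2 - G 0 2 * G 2 0 + G 1 1 * G 2 2
        - G 1 2 * G 2 1) * X - C G.det := by
    rw [Matrix.charpoly, Matrix.det_fin_three, Matrix.det_fin_three]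
    simp
    ring
  rw [hcoef, Matrix.det_fin_three, Matrix.trace_fin_three]
  have i2 : G 0 0 * G 1 1 - G 0 1 * G 1 0 + G 0 0 * G 2 2 - G 0 2 * G 2 0 + G 1 1 * G 2 2
        - G 1 2 * G 2 1 = κ * κ' + (κ + κ') * (G 0 0 + G 1 1 + G 2 2 - κ - κ') := by
    rw [e10, e20, e00, e11, e12]
    field_simp
    ring
  have i3 : G 0 0 * G 1 1 * G 2 2 - G 0 0 * G 1 2 * G 2 1 - G 0 1 * G 1 0 * G 2 2 +
      G 0 1 * G 1 2 * G 2 0 + G 0 2 * G 1 0 * G 2 1 - G 0 2 * G 1 1 * G 2 0 =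
      κ * κ' * (G 0 0 + G 1 1 + G 2 2 - κ - κ') := by
    rw [e10, e20, e00, e11, e12]
    field_simp
    ring
  rw [i2, i3]
  simp only [C_add, C_sub, C_mul]
  ring

/-! ### The perturbation of the scaled monodromy matrix at the base points -/

/-- The base point `2πn/√3`. -/
def zc (n : ℤ) : ℂ := (zo n : ℂ)

/-- The sign `(-1)ⁿ`. -/
def sg (n : ℤ) : ℂ := (-1) ^ n

lemma sg_mul_sg (n : ℤ) : sg n * sg n = 1 := by
  rw [sg, ← mul_zpow]; simp

lemma norm_sg (n : ℤ) : ‖sg n‖ = 1 := by simp [sg]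

lemma le_zo {n : ℤ} (hn : 0 < n) : 3 * (n : ℝ) ≤ zo n := by
  have h1 : (√3 : ℝ) ≤ 2 := by
    rw [Real.sqrt_le_left (by norm_num)]; norm_num
  have h2 : 0 < (√3 : ℝ) := by positivity
  have hn' : (0 : ℝ) < n := by exact_mod_cast hn
  rw [zo, le_div_iff₀ h2]
  nlinarith [Real.pi_gt_three, mul_pos hn' h2, mul_pos hn' (sub_pos.2 Real.pi_gt_three)]

lemma three_le_zo {n : ℤ} (hn : 0 < n) : 3 ≤ zo n := by
  have h := le_zo hn
  have hn' : (1 : ℝ) ≤ n := by exact_mod_cast hn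
  linarith

lemma zc_ne_zero {n : ℤ} (hn : 0 < n) : zc n ≠ 0 := by
  have := three_le_zo hn
  simp only [zc, ne_eq, Complex.ofReal_eq_zero]
  linarith

lemma dz_zero (z : ℂ) : dz z 0 = √3 / 2 * Complex.I * z := by simp [dz, al]; ring

lemma dz_one (z : ℂ) : dz z 1 = -(√3 / 2 * Complex.I * z) := by simp [dz, al]; ring

lemma dz_two (z : ℂ) : dz z 2 = -(3 / 2 * z) := by simp [dz, al]; ring

lemma sqrt_three_mul_zo (n : ℤ) : √3 / 2 * zo n = π * n := by
  rw [zo]; field_simp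

lemma dz_zc_zero (n : ℤ) : dz (zc n) 0 = n * (π * Complex.I) := by
  have : ((√3 / 2 * zo n : ℝ) : ℂ) = ((π * n : ℝ) : ℂ) := by rw [sqrt_three_mul_zo]
  push_cast at this
  rw [dz_zero, zc]
  linear_combination Complex.I * this

lemma dz_zc_one (n : ℤ) : dz (zc n) 1 = -(n * (π * Complex.I)) := by
  rw [dz_one, ← dz_zero, dz_zc_zero]

lemma exp_int_mul_pi_mul_I (n : ℤ) : Complex.exp (n * (π * Complex.I)) = sg n := by
  rw [Complex.exp_int_mul, Complex.exp_pi_mul_I, sg]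

lemma exp_dz_zc_zero (n : ℤ) : Complex.exp (dz (zc n) 0) = sg n := by
  rw [dz_zc_zero, exp_int_mul_pi_mul_I]

lemma exp_dz_zc_one (n : ℤ) : Complex.exp (dz (zc n) 1) = sg n := by
  rw [dz_zc_one, Complex.exp_neg, exp_int_mul_pi_mul_I]
  exact inv_eq_of_mul_eq_one_left (sg_mul_sg n)

lemma tame_dz_zc {n : ℤ} (hn : 0 < n) : Tame (dz (zc n)) := by
  have := three_le_zo hn
  intro k
  fin_cases k
  · simp [dz_zc_zero]
  · simp [dz_zc_one]
  · simp [dz_two, zc]; linarith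

/-- The exponentially small multiplier. -/
def cN (n : ℤ) : ℂ := sg n * Complex.exp (dz (zc n) 2)

lemma norm_cN_le {n : ℤ} (hn : 0 < n) : ‖cN n‖ ≤ 1 / 10 := by
  have h1 := three_le_zo hn
  rw [cN, norm_mul, norm_sg, one_mul, dz_two, Complex.norm_exp]
  have h2 : (-(3 / 2 * zc n)).re ≤ -4 := by simp [zc]; linarith
  refine (Real.exp_le_exp.2 h2).trans ?_
  rw [Real.exp_neg, one_div]
  gcongr
  have h3 : (2 : ℝ) ≤ Real.exp 1 := by linarith [Real.exp_one_gt_d9]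
  calc (10 : ℝ) ≤ 2 ^ 4 := by norm_num
    _ ≤ Real.exp 1 ^ 4 := by gcongr
    _ = Real.exp 4 := by rw [← Real.exp_nat_mul]; norm_num

/-- The unperturbed multipliers. -/
def diag0 (n : ℤ) : Fin 3 → ℂ := ![1, 1, cN n]

/-- The perturbation of the scaled monodromy matrix, normalized by the sign. -/
def BB (n : ℤ) (E : Ecal) (i j : Fin 3) : ℂ :=
  sg n * TT (dz (zc n)) E i j - if i = j then diag0 n i else 0

lemma sg_mul_exp_dz (n : ℤ) (i : Fin 3) : sg n * Complex.exp (dz (zc n) i) = diag0 n i := by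
  fin_cases i
  · simp [exp_dz_zc_zero, diag0, sg_mul_sg]
  · simp [exp_dz_zc_one, diag0, sg_mul_sg]
  · simp [diag0, cN]

lemma BB_zero (n : ℤ) : BB n 0 = 0 := by
  funext i j
  rw [BB, TT_zero, mul_ite, sg_mul_exp_dz, mul_zero, sub_self]
  rfl

lemma BB_eq (n : ℤ) :
    BB n = fun E => sg n • TT (dz (zc n)) E - fun i j => if i = j then diag0 n i else 0 := rfl

section

variable {n : ℤ} (hn : 0 < n)

include hn

lemma analyticOnNhd_BB : AnalyticOnNhd ℂ (BB n) (Metric.ball 0 (1 / 36)) := by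
  rw [BB_eq]
  exact fun E hE => ((analyticAt_const (v := sg n)).fun_smul
    ((tame_dz_zc hn).analyticOnNhd_TT E hE)).fun_sub
    analyticAt_const

lemma norm_diag0_le (i : Fin 3) : ‖diag0 n i‖ ≤ 1 := by
  fin_cases i
  · simp [diag0]
  · simp [diag0]
  · exact (norm_cN_le hn).trans (by norm_num)

lemma norm_BB_le {E : Ecal} (hE : ‖E‖ < 1 / 36) : ‖BB n E‖ ≤ 7 := by
  rw [BB_eq]
  refine (norm_sub_le _ _).trans ?_
  have h1 := (tame_dz_zc hn).norm_TT_le hE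
  have h2 : ‖fun i j : Fin 3 => if i = j then diag0 n i else 0‖ ≤ 1 := by
    refine (pi_norm_le_iff_of_nonneg zero_le_one).2 fun i =>
      (pi_norm_le_iff_of_nonneg zero_le_one).2 fun j => ?_
    split_ifs
    · exact norm_diag0_le hn i
    · simp
  rw [norm_smul, norm_sg]
  linarith

lemma norm_BB_le_mul {E : Ecal} (hE : ‖E‖ < 1 / 36) : ‖BB n E‖ ≤ 252 * ‖E‖ := by
  have := norm_le_of_bounded (analyticOnNhd_BB hn)
    (fun x hx => norm_BB_le hn (by simpa using hx)) (BB_zero n) hE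
  linarith

lemma rep_fderiv_BB {E : Ecal} (hE : ‖E‖ < 1 / 36) : Rep (fderiv ℂ (BB n) E) := by
  have h := (tame_dz_zc hn).rep_fderiv_TT hE
  have hd : DifferentiableAt ℂ (TT (dz (zc n))) E :=
    ((tame_dz_zc hn).analyticOnNhd_TT E (by simpa using hE)).differentiableAt
  rw [BB_eq, fderiv_sub_const, fderiv_fun_const_smul hd]
  exact h.comp (sg n • ContinuousLinearMap.id ℂ _)

end

/-- First order term of the expansion of the monodromy matrix. -/
def T1 (d : Fin 3 → ℂ) (V : Ecal) (j l : Fin 3) : ℂ := ev1 j (KE d V (X0 d (Pi.single l 1)))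

lemma T1_eq (d : Fin 3 → ℂ) (V : Ecal) (j l : Fin 3) :
    T1 d V j l = ∫ t in (0 : ℝ)..1, Complex.exp (d j * (1 - t)) * RR V j l t *
      Complex.exp (d l * t) := by
  rw [T1, ev1_apply, KE_apply]
  refine intervalIntegral.integral_congr fun t ht => ?_
  rw [uIcc_of_le zero_le_one] at ht
  simp only [ext_apply _ ht, X0_apply]
  rw [Finset.sum_eq_single l]
  · simp
    ring
  · intro b _ hb
    simp [hb]
  · simp

lemma T1_add (d : Fin 3 → ℂ) (V W : Ecal) (j l : Fin 3) :
    T1 d (V + W) j l = T1 d V j l + T1 d W j l := by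
  simp [T1]

lemma T1_smul (d : Fin 3 → ℂ) (a : ℂ) (V : Ecal) (j l : Fin 3) :
    T1 d (a • V) j l = a * T1 d V j l := by
  simp [T1]

lemma Tame.hasFDerivAt_TT_zero {d : Fin 3 → ℂ} (h : Tame d) (V : Ecal) (j l : Fin 3) :
    fderiv ℂ (TT d) 0 V j l = T1 d V j l := by
  have h0 : ‖(0 : Ecal)‖ < 1 / 36 := by simp
  obtain ⟨L, hL, hLV⟩ := h.hasFDerivAt_TT_apply h0 j l
  have hd : DifferentiableAt ℂ (TT d) 0 :=
    (h.analyticOnNhd_TT 0 (by simp)).differentiableAt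
  have h1 := (hasFDerivAt_pi'.mp (hasFDerivAt_pi'.mp hd.hasFDerivAt j) l).unique hL
  have h2 := hLV V
  rw [← h1] at h2
  simp only [sol, map_zero, sub_zero, Ring.inverse_one] at h2
  exact h2

lemma fderiv_BB_zero {n : ℤ} (hn : 0 < n) (V : Ecal) (i j : Fin 3) :
    fderiv ℂ (BB n) 0 V i j = sg n * T1 (dz (zc n)) V i j := by
  have hd : DifferentiableAt ℂ (TT (dz (zc n))) 0 :=
    ((tame_dz_zc hn).analyticOnNhd_TT 0 (by simp)).differentiableAt
  rw [BB_eq, fderiv_sub_const, fderiv_fun_const_smul hd, ← (tame_dz_zc hn).hasFDerivAt_TT_zero]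
  rfl

/-- The pair of coefficients `(0, 1)`. -/
def oneQ : Ecal := (0, L1.ofFun (fun _ => 1) intervalIntegrable_const)

lemma norm_oneQ : ‖oneQ‖ = 1 := by
  rw [oneQ, Prod.norm_mk, norm_zero, L1.norm_eq_of_ae (L1.ofFun_ae _)]
  simp

lemma RR_oneQ_ae (k l : Fin 3) :
    ∀ᵐ t ∂(volume : Measure ℝ), t ∈ uIoc (0 : ℝ) 1 → RR oneQ k l t = cc k := by
  have h1 : ((0 : L1) : ℝ → ℂ) =ᵐ[volume.restrict (Ioc (0 : ℝ) 1)] 0 := Lp.coeFn_zero _ _ _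
  have h2 := L1.ofFun_ae (f := fun _ => 1) intervalIntegrable_const
  filter_upwards [ae_Ioc_of_ae_restrict h1 (x := 1) (by simp),
    ae_Ioc_of_ae_restrict h2 (x := 1) (by simp)] with t h3 h4 ht
  simp only [RR, oneQ, h3 ht, h4 ht]
  simp

lemma T1_oneQ (d : Fin 3 → ℂ) (j l : Fin 3) :
    T1 d oneQ j l = cc j * ∫ t in (0 : ℝ)..1, Complex.exp (d j * (1 - t)) *
      Complex.exp (d l * t) := by
  rw [T1_eq, ← intervalIntegral.integral_const_mul]
  refine intervalIntegral.integral_congr_ae ?_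
  filter_upwards [RR_oneQ_ae j l] with t h ht
  rw [h ht]
  ring

lemma T1_oneQ_self (d : Fin 3 → ℂ) (j : Fin 3) : T1 d oneQ j j = cc j * Complex.exp (d j) := by
  rw [T1_oneQ]
  congr 1
  rw [← one_mul (Complex.exp (d j))]
  simp only [← Complex.exp_add]
  have : ∀ t : ℝ, d j * (1 - t) + d j * t = d j := fun t => by ring
  simp [this]

/-- The integral of exp((d l − d j)t) over [0, 1] vanishes because the two exponentials agree at t =
1. Consequently a change of the spectral parameter does not couple the two dominant components to
first order. -/
lemma T1_oneQ_of_ne {d : Fin 3 → ℂ} {j l : Fin 3} (h : Complex.exp (d j) = Complex.exp (d l))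
    (hjl : d j ≠ d l) : T1 d oneQ j l = 0 := by
  rw [T1_oneQ]
  have h1 : ∀ t : ℝ, Complex.exp (d j * (1 - t)) * Complex.exp (d l * t) =
      Complex.exp (d j) * Complex.exp ((d l - d j) * t) := fun t => by
    rw [← Complex.exp_add, ← Complex.exp_add]; ring_nf
  simp only [h1]
  rw [intervalIntegral.integral_const_mul, integral_exp_mul_complex (sub_ne_zero.2 (Ne.symm hjl))]
  simp [Complex.exp_sub, h]

lemma sg_mul_T1_oneQ_zero (n : ℤ) : sg n * T1 (dz (zc n)) oneQ 0 0 = cc 0 := by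
  rw [T1_oneQ_self, exp_dz_zc_zero, mul_left_comm, sg_mul_sg, mul_one]

lemma sg_mul_T1_oneQ_one (n : ℤ) : sg n * T1 (dz (zc n)) oneQ 1 1 = cc 1 := by
  rw [T1_oneQ_self, exp_dz_zc_one, mul_left_comm, sg_mul_sg, mul_one]

lemma dz_zc_ne {n : ℤ} (hn : 0 < n) : dz (zc n) 0 ≠ dz (zc n) 1 := by
  rw [dz_zc_zero, dz_zc_one, ne_eq, eq_neg_iff_add_eq_zero, ← two_mul]
  simp [hn.ne', Real.pi_ne_zero]

lemma T1_oneQ_zero_one {n : ℤ} (hn : 0 < n) : T1 (dz (zc n)) oneQ 0 1 = 0 :=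
  T1_oneQ_of_ne (by rw [exp_dz_zc_zero, exp_dz_zc_one]) (dz_zc_ne hn)

lemma T1_oneQ_one_zero {n : ℤ} (hn : 0 < n) : T1 (dz (zc n)) oneQ 1 0 = 0 :=
  T1_oneQ_of_ne (by rw [exp_dz_zc_zero, exp_dz_zc_one]) (dz_zc_ne hn).symm

/-! ### The equations for the eigenvectors -/

/-- On lines through the origin the fixed point maps below are quadratic without constant term, so
their derivatives at 0 can be read off. -/
lemma fderiv_zero_apply_of_quadratic {E F : Type*} [NormedAddCommGroup E] [NormedSpace ℂ E]
    [NormedAddCommGroup F] [NormedSpace ℂ F] {f : E → F} (hf : DifferentiableAt ℂ f 0) {v : E}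
    {a b : F} (h : ∀ t : ℂ, f (t • v) = t • a + t ^ 2 • b) : fderiv ℂ f 0 v = a := by
  have h1 : HasDerivAt (fun t : ℂ => f (t • v)) (fderiv ℂ f 0 v) 0 := by
    have h2 : HasDerivAt (fun t : ℂ => t • v) v 0 := by
      simpa using (hasDerivAt_id (0 : ℂ)).smul_const v
    have h3 : HasFDerivAt f (fderiv ℂ f 0) ((0 : ℂ) • v) := by
      rw [zero_smul]; exact hf.hasFDerivAt
    exact h3.comp_hasDerivAt 0 h2
  have h4 : HasDerivAt (fun t : ℂ => t • a + t ^ 2 • b) a 0 := by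
    have h5 := ((hasDerivAt_id (0 : ℂ)).smul_const a).fun_add
      (((hasDerivAt_id (0 : ℂ)).pow 2).smul_const b)
    simpa using h5
  simp only [h] at h1
  exact h1.unique h4

/-- Matrices of perturbations. -/
abbrev Mat : Type := Fin 3 → Fin 3 → ℂ

/-- The map whose fixed points `(K m, s, k)` correspond to the values `m` of the spectral parameter
for which `(1, -1 - s, s)` is an eigenvector with eigenvalue `1 + k`. -/
def rightMap (c K : ℂ) (x : Mat × (Fin 3 → ℂ)) : Fin 3 → ℂ :=
  ![x.2 0 - K * (Complex.I * √3) * (x.1 0 0 - x.1 0 1 + x.2 1 * (x.1 0 2 - x.1 0 1) + x.1 1 0 -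
      (1 + x.2 1) * x.1 1 1 + x.2 1 * x.1 1 2 + x.2 1 * x.2 2),
    (x.1 2 0 - (1 + x.2 1) * x.1 2 1 + x.2 1 * x.1 2 2 - x.2 1 * x.2 2) / (1 - c),
    -x.1 1 0 + (1 + x.2 1) * x.1 1 1 - x.2 1 * x.1 1 2 - x.2 1 * x.2 2]

/-- The map whose fixed points `(u, k')` correspond to left eigenvectors `(1 + s + u, 1 + u, u)`
with eigenvalue `1 + k'`. -/
def leftMap (c : ℂ) (x : (Mat × ℂ) × (Fin 2 → ℂ)) : Fin 2 → ℂ :=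
  ![((1 + x.1.2 + x.2 0) * x.1.1 0 2 + (1 + x.2 0) * x.1.1 1 2 + x.2 0 * x.1.1 2 2 -
      x.2 0 * x.2 1) / (1 - c),
    (1 + x.1.2 + x.2 0) * x.1.1 0 1 + (1 + x.2 0) * x.1.1 1 1 + x.2 0 * x.1.1 2 1 -
      x.2 0 * x.2 1]

open scoped ContDiff in
lemma analyticAt_rightMap (c K : ℂ) x : AnalyticAt ℂ (rightMap c K) x := by
  suffices ContDiff ℂ ω (rightMap c K) from this.contDiffAt.analyticAt
  rw [contDiff_pi]
  intro i
  fin_cases i <;> simp [rightMap] <;> fun_prop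

open scoped ContDiff in
lemma analyticAt_leftMap (c : ℂ) x : AnalyticAt ℂ (leftMap c) x := by
  suffices ContDiff ℂ ω (leftMap c) from this.contDiffAt.analyticAt
  rw [contDiff_pi]
  intro i
  fin_cases i <;> simp [leftMap] <;> fun_prop

lemma fderiv_rightMap_zero (c K : ℂ) (β : Mat) (w : Fin 3 → ℂ) :
    fderiv ℂ (rightMap c K) 0 (β, w) =
      ![w 0 - K * (Complex.I * √3) * (β 0 0 - β 0 1 + β 1 0 - β 1 1), (β 2 0 - β 2 1) / (1 - c),
        -β 1 0 + β 1 1] := by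
  refine fderiv_zero_apply_of_quadratic
    (analyticAt_rightMap c K 0).differentiableAt
    (b := ![-K * (Complex.I * √3) * (w 1 * (β 0 2 - β 0 1) - w 1 * β 1 1 + w 1 * β 1 2
      + w 1 * w 2), (-w 1 * β 2 1 + w 1 * β 2 2 - w 1 * w 2) / (1 - c),
      w 1 * β 1 1 - w 1 * β 1 2 - w 1 * w 2]) fun t => ?_
  funext i
  fin_cases i <;> simp [rightMap] <;> ring

lemma fderiv_leftMap_zero (c : ℂ) (w : Fin 2 → ℂ) : fderiv ℂ (leftMap c) 0 (0, w) = 0 := by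
  refine fderiv_zero_apply_of_quadratic
    (analyticAt_leftMap c 0).differentiableAt
    (b := ![-(w 0 * w 1) / (1 - c), -(w 0 * w 1)]) fun t => ?_
  funext i
  fin_cases i <;> simp [leftMap] <;> ring

lemma norm_one_sub_ge {c : ℂ} (hc : ‖c‖ ≤ 1 / 10) : 9 / 10 ≤ ‖1 - c‖ := by
  have := norm_sub_norm_le 1 c
  rw [norm_one] at this
  linarith

lemma norm_div_one_sub_le {a c : ℂ} {A : ℝ} (hc : ‖c‖ ≤ 1 / 10) (ha : ‖a‖ ≤ A) :
    ‖a / (1 - c)‖ ≤ 10 / 9 * A := by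
  have h := norm_one_sub_ge hc
  rw [norm_div, div_le_iff₀ (by linarith)]
  nlinarith [norm_nonneg a]

lemma norm_entry_le {b : Mat} {A : ℝ} (h : ‖b‖ ≤ A) (i j : Fin 3) : ‖b i j‖ ≤ A :=
  ((norm_le_pi_norm (b i) j).trans (norm_le_pi_norm b i)).trans h

/-- The constants are crude; only their independence of n is used, through |c| ≤ 1/10. -/
lemma norm_rightMap_le {c K : ℂ} (hc : ‖c‖ ≤ 1 / 10) (hK : ‖K‖ ≤ 10000)
    {x : Mat × (Fin 3 → ℂ)} (hb : ‖x.1‖ ≤ 7) (hw : ‖x.2‖ ≤ 1 / 100) :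
    ‖rightMap c K x‖ ≤ 1000000 := by
  have b := norm_entry_le hb
  have w := fun i => (norm_le_pi_norm x.2 i).trans hw
  have h1 : ‖1 + x.2 1‖ ≤ 2 := (norm_add_le_of_le norm_one.le (w 1)).trans (by norm_num)
  have hI : ‖Complex.I * (√3 : ℝ)‖ ≤ 2 := by
    rw [norm_mul, Complex.norm_I, one_mul, Complex.norm_real, Real.norm_of_nonneg (by positivity),
      Real.sqrt_le_left (by norm_num)]
    norm_num
  refine (pi_norm_le_iff_of_nonneg (by norm_num)).2 fun i => ?_
  fin_cases i
  · exact (norm_sub_le_of_le (w 0) (norm_mul_le_of_le (norm_mul_le_of_le hK hI)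
      (norm_add_le_of_le (norm_add_le_of_le (norm_sub_le_of_le (norm_add_le_of_le
        (norm_add_le_of_le (norm_sub_le_of_le (b 0 0) (b 0 1)) (norm_mul_le_of_le (w 1)
          (norm_sub_le_of_le (b 0 2) (b 0 1)))) (b 1 0)) (norm_mul_le_of_le h1 (b 1 1)))
            (norm_mul_le_of_le (w 1) (b 1 2))) (norm_mul_le_of_le (w 1) (w 2))))).trans
              (by norm_num)
  · exact (norm_div_one_sub_le hc (norm_sub_le_of_le (norm_add_le_of_le (norm_sub_le_of_le (b 2 0)
      (norm_mul_le_of_le h1 (b 2 1))) (norm_mul_le_of_le (w 1) (b 2 2)))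
        (norm_mul_le_of_le (w 1) (w 2)))).trans (by norm_num)
  · exact (norm_sub_le_of_le (norm_sub_le_of_le (norm_add_le_of_le ((norm_neg _).trans_le (b 1 0))
      (norm_mul_le_of_le h1 (b 1 1))) (norm_mul_le_of_le (w 1) (b 1 2)))
        (norm_mul_le_of_le (w 1) (w 2))).trans (by norm_num)

lemma norm_leftMap_le {c : ℂ} (hc : ‖c‖ ≤ 1 / 10) {x : (Mat × ℂ) × (Fin 2 → ℂ)} (hx : ‖x‖ ≤ 1) :
    ‖leftMap c x‖ ≤ 100 := by
  have b := norm_entry_le ((norm_fst_le x.1).trans ((norm_fst_le x).trans hx))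
  have hs := (norm_snd_le x.1).trans ((norm_fst_le x).trans hx)
  have w := fun i => (norm_le_pi_norm x.2 i).trans ((norm_snd_le x).trans hx)
  have h1 : ‖1 + x.2 0‖ ≤ 2 := (norm_add_le_of_le norm_one.le (w 0)).trans (by norm_num)
  have h2 : ‖1 + x.1.2 + x.2 0‖ ≤ 3 :=
    (norm_add_le_of_le (norm_add_le_of_le norm_one.le hs) (w 0)).trans (by norm_num)
  have h3 : ∀ i, ‖(1 + x.1.2 + x.2 0) * x.1.1 0 i + (1 + x.2 0) * x.1.1 1 i +
      x.2 0 * x.1.1 2 i - x.2 0 * x.2 1‖ ≤ 7 := fun i =>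
    (norm_sub_le_of_le (norm_add_le_of_le (norm_add_le_of_le (norm_mul_le_of_le h2 (b 0 i))
      (norm_mul_le_of_le h1 (b 1 i))) (norm_mul_le_of_le (w 0) (b 2 i)))
        (norm_mul_le_of_le (w 0) (w 1))).trans (by norm_num)
  refine (pi_norm_le_iff_of_nonneg (by norm_num)).2 fun i => ?_
  fin_cases i
  · exact (norm_div_one_sub_le hc (h3 2)).trans (by norm_num)
  · exact (h3 1).trans (by norm_num)

/-! ### Functions whose derivative has a continuous kernel -/

section RepAt

variable {F G : Type*} [NormedAddCommGroup F] [NormedSpace ℂ F] [NormedAddCommGroup G]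
  [NormedSpace ℂ G]

/-- The derivative of `f` at `E` exists and is given by continuous kernels. -/
def RepAt (f : Ecal → F) (E : Ecal) : Prop := ∃ L, HasFDerivAt f L E ∧ Rep L

lemma RepAt.comp [CompleteSpace F] [CompleteSpace G] {f : Ecal → F} {E : Ecal} (h : RepAt f E)
    {φ : F → G} (hφ : DifferentiableAt ℂ φ (f E)) : RepAt (fun E => φ (f E)) E := by
  obtain ⟨L, hL, hR⟩ := h
  exact ⟨_, hφ.hasFDerivAt.comp E hL, hR.comp _⟩

lemma RepAt.prodMk [CompleteSpace F] [CompleteSpace G] {f : Ecal → F} {g : Ecal → G} {E : Ecal}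
    (hf : RepAt f E) (hg : RepAt g E) : RepAt (fun E => (f E, g E)) E := by
  obtain ⟨L, hL, hR⟩ := hf
  obtain ⟨M, hM, hR'⟩ := hg
  refine ⟨L.prod M, hL.prodMk hM, ?_⟩
  have : L.prod M =
      ContinuousLinearMap.inl ℂ F G ∘L L + ContinuousLinearMap.inr ℂ F G ∘L M := by
    ext V <;> simp
  rw [this]
  exact (hR.comp _).add (hR'.comp _)

lemma repAt_BB {n : ℤ} (hn : 0 < n) {E : Ecal} (hE : ‖E‖ < 1 / 36) : RepAt (BB n) E :=
  ⟨_, (analyticOnNhd_BB hn E (by simpa using hE)).differentiableAt.hasFDerivAt,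
    rep_fderiv_BB hn hE⟩

lemma RepAt.comp_add_smul [CompleteSpace F] {f : Ecal → F} {m : Ecal → ℂ} {E V : Ecal}
    (hf : RepAt f (E + m E • V)) (hm : RepAt m E) : RepAt (fun E => f (E + m E • V)) E := by
  obtain ⟨L, hL, hR⟩ := hf
  obtain ⟨M, hM, hR'⟩ := hm
  have h1 : HasFDerivAt (fun E : Ecal => E + m E • V)
      (ContinuousLinearMap.id ℂ Ecal + M.smulRight V) E :=
    (hasFDerivAt_id E).add (hM.smul_const V)
  refine ⟨_, hL.comp E h1, ?_⟩
  have : L ∘L (ContinuousLinearMap.id ℂ Ecal + M.smulRight V) =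
      L + (L ∘L (ContinuousLinearMap.toSpanSingleton ℂ V)) ∘L M := by
    ext V <;> simp
  rw [this]
  exact hR.add (hR'.comp _)

end RepAt

/-! ### Spectral data of the monodromy matrix near the base points -/

/-- The shift of the coefficients by the spectral parameter. -/
def shiftE (x : Ecal × (Fin 3 → ℂ)) : Ecal := x.1 + (x.2 0 / 10000) • oneQ

/-- The fixed point map for the right eigenvectors. -/
def rightFix (n : ℤ) (x : Ecal × (Fin 3 → ℂ)) : Fin 3 → ℂ :=
  rightMap (cN n) 10000 (BB n (shiftE x), x.2)

lemma norm_shiftE_le (x : Ecal × (Fin 3 → ℂ)) : ‖shiftE x‖ ≤ 2 * ‖x‖ := by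
  have h2 : ‖x.2 0 / 10000‖ ≤ ‖x.2‖ := by
    rw [norm_div]
    have := norm_le_pi_norm x.2 0
    have h3 : ‖(10000 : ℂ)‖ = 10000 := by norm_num
    rw [h3]
    have := norm_nonneg (x.2 0)
    linarith
  have h3 : ‖shiftE x‖ ≤ ‖x.1‖ + ‖x.2 0 / 10000‖ * 1 := by
    refine (norm_add_le _ _).trans ?_
    rw [norm_smul, norm_oneQ]
  linarith [norm_fst_le x, norm_snd_le x]

lemma hasFDerivAt_shiftE (x : Ecal × (Fin 3 → ℂ)) :
    ∃ L : Ecal × (Fin 3 → ℂ) →L[ℂ] Ecal, HasFDerivAt shiftE L x ∧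
      ∀ y, L y = shiftE y := by
  have h : ∃ L : Ecal × (Fin 3 → ℂ) →L[ℂ] Ecal, ∀ y, L y = shiftE y := by
    refine ⟨ContinuousLinearMap.fst ℂ _ _ +
      (((1 / 10000 : ℂ) • (ContinuousLinearMap.proj (R := ℂ) (φ := fun _ : Fin 3 => ℂ) 0 ∘L
        ContinuousLinearMap.snd ℂ Ecal (Fin 3 → ℂ))).smulRight oneQ), fun y => ?_⟩
    simp [shiftE]
    ring_nf
  obtain ⟨L, hL⟩ := h
  refine ⟨L, ?_, hL⟩
  have : shiftE = L := funext fun y => (hL y).symm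
  rw [this]
  exact L.hasFDerivAt

lemma analyticAt_shiftE (x : Ecal × (Fin 3 → ℂ)) : AnalyticAt ℂ shiftE x := by
  have h1 : AnalyticAt ℂ (fun x : Ecal × (Fin 3 → ℂ) => x.2 0) x :=
    ((ContinuousLinearMap.proj (R := ℂ) (φ := fun _ : Fin 3 => ℂ) 0) ∘L
      (ContinuousLinearMap.snd ℂ Ecal (Fin 3 → ℂ))).analyticAt x
  exact analyticAt_fst.fun_add ((h1.fun_div analyticAt_const (by norm_num)).fun_smul
    analyticAt_const)

section

variable {n : ℤ} (hn : 0 < n)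

include hn

lemma analyticAt_rightFix {x : Ecal × (Fin 3 → ℂ)} (hx : ‖x‖ < 1 / 100) :
    AnalyticAt ℂ (rightFix n) x := by
  have hs := norm_shiftE_le x
  have h1 : AnalyticAt ℂ (fun x => BB n (shiftE x)) x :=
    (analyticOnNhd_BB hn (shiftE x) (by rw [mem_ball_zero_iff]; linarith)).comp
      (analyticAt_shiftE x)
  exact (analyticAt_rightMap (cN n) 10000 _).comp (h1.prod analyticAt_snd)

lemma norm_rightFix_le {x : Ecal × (Fin 3 → ℂ)} (hx : ‖x‖ < 1 / 100) :
    ‖rightFix n x‖ ≤ 1000000 := by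
  have hs := norm_shiftE_le x
  exact norm_rightMap_le (norm_cN_le hn) (by norm_num) (norm_BB_le hn (by linarith))
    ((norm_snd_le x).trans hx.le)

/-- The factor i√3 is the inverse of cc 0 − cc 1 = −i√3/3, the derivative in m of the solvability
condition. So the first component is a Newton step and its derivative vanishes. The other two
components depend on m with a coefficient of size up to about 2 · 1008 · 10/9; taking 10000 m as the
unknown pushes this below 1/4. -/
lemma fderiv_rightFix_zero_le (w : Fin 3 → ℂ) :
    ‖fderiv ℂ (rightFix n) 0 (0, w)‖ ≤ ‖w‖ / 4 := by
  obtain ⟨S, hS, hSy⟩ := hasFDerivAt_shiftE 0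
  have h0 : shiftE 0 = 0 := by simp [shiftE]
  have hB : HasFDerivAt (BB n) (fderiv ℂ (BB n) 0) (shiftE 0) := by
    rw [h0]
    exact (analyticOnNhd_BB hn 0 (by simp)).differentiableAt.hasFDerivAt
  have h1 : HasFDerivAt (fun x : Ecal × (Fin 3 → ℂ) => (BB n (shiftE x), x.2))
      ((fderiv ℂ (BB n) 0 ∘L S).prod (ContinuousLinearMap.snd ℂ _ _)) 0 :=
    (hB.comp 0 hS).prodMk hasFDerivAt_snd
  have h2 : HasFDerivAt (rightMap (cN n) 10000) (fderiv ℂ (rightMap (cN n) 10000) 0)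
      (BB n (shiftE 0), (0 : Ecal × (Fin 3 → ℂ)).2) := by
    rw [h0, BB_zero]
    exact (analyticAt_rightMap (cN n) 10000 0).differentiableAt.hasFDerivAt
  have h3 : fderiv ℂ (rightFix n) 0 = _ := (HasFDerivAt.comp
    (f := fun x : Ecal × (Fin 3 → ℂ) => (BB n (shiftE x), x.2)) 0 h2 h1).fderiv
  set β := fderiv ℂ (BB n) 0 oneQ with hβ
  have h4 : fderiv ℂ (rightFix n) 0 (0, w) =
      fderiv ℂ (rightMap (cN n) 10000) 0 ((w 0 / 10000) • β, w) := by
    rw [h3]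
    simp [hSy, shiftE, hβ]
  have hβn : ‖β‖ ≤ 1008 := by
    have := norm_fderiv_le_of_bounded (analyticOnNhd_BB hn)
      (fun x hx => norm_BB_le hn (by simpa using hx)) (x := 0) (by simp)
    refine ((fderiv ℂ (BB n) 0).le_opNorm _).trans ?_
    rw [norm_oneQ]
    linarith
  have b := norm_entry_le hβn
  have w0 := norm_le_pi_norm w 0
  have hw : ‖w 0 / 10000‖ ≤ ‖w‖ / 10000 := by
    rw [norm_div]
    have h3 : ‖(10000 : ℂ)‖ = 10000 := by norm_num
    rw [h3]
    gcongr
  have hwn := norm_nonneg w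
  rw [h4, fderiv_rightMap_zero]
  refine (pi_norm_le_iff_of_nonneg (by positivity)).2 fun i => ?_
  fin_cases i
  · have e0 : β 0 0 = cc 0 := by rw [hβ, fderiv_BB_zero hn, sg_mul_T1_oneQ_zero]
    have e1 : β 1 1 = cc 1 := by rw [hβ, fderiv_BB_zero hn, sg_mul_T1_oneQ_one]
    have e2 : β 0 1 = 0 := by rw [hβ, fderiv_BB_zero hn, T1_oneQ_zero_one hn, mul_zero]
    have e3 : β 1 0 = 0 := by rw [hβ, fderiv_BB_zero hn, T1_oneQ_one_zero hn, mul_zero]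
    have e4 : cc 0 - cc 1 = -(Complex.I * √3) / 3 := by
      simp only [cc, be_sq]
      simp [al]
      ring
    have e5 : w 0 - 10000 * (Complex.I * √3) * (w 0 / 10000 * β 0 0 - w 0 / 10000 * β 0 1 +
        w 0 / 10000 * β 1 0 - w 0 / 10000 * β 1 1) = 0 := by
      rw [e0, e1, e2, e3]
      linear_combination -(Complex.I * √3) * w 0 * e4 + w 0 / 3 * (√3 : ℂ) ^ 2 * Complex.I_sq -
        w 0 / 3 * sqrt_three_sq
    simpa [e5] using by positivity
  · refine (norm_div_one_sub_le (norm_cN_le hn) (norm_sub_le_of_le (norm_mul_le_of_le hw (b 2 0))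
      (norm_mul_le_of_le hw (b 2 1)))).trans ?_
    linarith
  · refine (norm_add_le_of_le ((norm_neg _).trans_le (norm_mul_le_of_le hw (b 1 0)))
      (norm_mul_le_of_le hw (b 1 1))).trans ?_
    linarith

end

lemma rightFix_zero (n : ℤ) : rightFix n 0 = 0 := by
  have h0 : shiftE 0 = 0 := by simp [shiftE]
  rw [rightFix, h0, BB_zero]
  funext i
  fin_cases i <;> simp [rightMap]

/-- Solutions of the equations for the right eigenvectors. -/
lemma exists_rightFix : ∃ ρ > 0, ∃ σ > 0, ρ ≤ 1 / 100 ∧ σ ≤ 1 / 100 ∧ ∃ L ≥ 0, ∀ n : ℤ, 0 < n →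
    ∃ g : Ecal → Fin 3 → ℂ, AnalyticOnNhd ℂ g (Metric.ball 0 ρ) ∧ ∀ E ∈ Metric.ball (0 : Ecal) ρ,
      ‖g E‖ ≤ L * ‖E‖ ∧ ‖g E‖ < σ ∧ rightFix n (E, g E) = g E ∧
      (∀ w, ‖w‖ < σ → rightFix n (E, w) = w → w = g E) ∧ RepAt g E := by
  obtain ⟨ρ, hρ, σ, hσ, hρr, hσr, L, hL, H⟩ := analytic_fixedPoint (E := Ecal) (W := Fin 3 → ℂ)
    (K := 1000000) (r := 1 / 100) (by norm_num) (by norm_num)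
  refine ⟨ρ, hρ, σ, hσ, hρr, hσr, L, hL, fun n hn => ?_⟩
  obtain ⟨g, hg, hg2⟩ := H (rightFix n) (fun x hx => analyticAt_rightFix hn (by simpa using hx))
    (fun x hx => norm_rightFix_le hn (by simpa using hx)) (rightFix_zero n)
    (fderiv_rightFix_zero_le hn)
  refine ⟨g, hg, fun E hE => ?_⟩
  obtain ⟨h1, h2, h3, h4, A, hA⟩ := hg2 E hE
  refine ⟨h1, h2, h3, h4, _, (hg E hE).differentiableAt.hasFDerivAt, ?_⟩
  rw [mem_ball_zero_iff] at hE
  have hx : ‖(E, g E)‖ < 1 / 100 := by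
    rw [Prod.norm_mk]; exact max_lt (by linarith) (by linarith)
  have hs := norm_shiftE_le (E, g E)
  -- The derivative of g is A composed with the partial derivative in the coefficients, so it is
  -- enough to find kernels with the value g E frozen.
  have h5 : RepAt (fun E' => rightFix n (E', g E)) E := by
    have h6 : RepAt (fun E' => BB n (E' + (g E 0 / 10000) • oneQ)) E :=
      (repAt_BB hn (E := E + (g E 0 / 10000) • oneQ) (by
        simp only [shiftE] at hs; linarith)).comp_add_smul (m := fun _ => g E 0 / 10000)
        ⟨0, hasFDerivAt_const _ _, Rep.zero⟩
    refine h6.comp (φ := fun b => rightMap (cN n) 10000 (b, g E)) ?_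
    exact ((analyticAt_rightMap (cN n) 10000 _).comp
      (f := fun b : Mat => (b, g E)) (analyticAt_id.prod analyticAt_const)).differentiableAt
  obtain ⟨M, hM, hR⟩ := h5
  have h7 : HasFDerivAt (fun E' => rightFix n (E', g E))
      (fderiv ℂ (rightFix n) (E, g E) ∘L .inl ℂ Ecal (Fin 3 → ℂ)) E :=
    HasFDerivAt.comp (f := fun E' => (E', g E)) E
      (analyticAt_rightFix hn hx).differentiableAt.hasFDerivAt (hasFDerivAt_prodMk_left E (g E))
  rw [hA, h7.unique hM]
  exact hR.comp A

/-- Solutions of the equations for the left eigenvectors. -/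
lemma exists_leftMap : ∃ ρ > 0, ρ ≤ 1 ∧ ∃ L ≥ 0, ∀ c : ℂ, ‖c‖ ≤ 1 / 10 →
    ∃ g : Mat × ℂ → Fin 2 → ℂ, AnalyticOnNhd ℂ g (Metric.ball 0 ρ) ∧
      ∀ x ∈ Metric.ball (0 : Mat × ℂ) ρ, ‖g x‖ ≤ L * ‖x‖ ∧ leftMap c (x, g x) = g x := by
  obtain ⟨ρ, hρ, σ, hσ, hρr, hσr, L, hL, H⟩ := analytic_fixedPoint (E := Mat × ℂ)
    (W := Fin 2 → ℂ) (K := 100) (r := 1) (by norm_num) (by norm_num)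
  refine ⟨ρ, hρ, hρr, L, hL, fun c hc => ?_⟩
  obtain ⟨g, hg, hg2⟩ := H (leftMap c) (fun x _ => analyticAt_leftMap c x)
    (fun x hx => norm_leftMap_le hc (by simpa using (mem_ball_zero_iff.1 hx).le))
    (by funext i; fin_cases i <;> simp [leftMap])
    (fun w => by rw [fderiv_leftMap_zero]; simpa using by positivity)
  exact ⟨g, hg, fun x hx => ⟨(hg2 x hx).1, (hg2 x hx).2.2.1⟩⟩

/-- `g = (10000 m, s, k)` and `l = (u, k')` describe the eigenvectors of the scaled monodromy matrix
at the value of the spectral parameter for which they have the special form. -/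
structure IsSpec (n : ℤ) (ρ σ L : ℝ) (g : Ecal → Fin 3 → ℂ) (l : Ecal → Fin 2 → ℂ) : Prop where
  an_g : AnalyticOnNhd ℂ g (Metric.ball 0 ρ)
  an_l : AnalyticOnNhd ℂ l (Metric.ball 0 ρ)
  g_le : ∀ E, ‖E‖ < ρ → ‖g E‖ ≤ L * ‖E‖
  l_le : ∀ E, ‖E‖ < ρ → ‖l E‖ ≤ L * ‖E‖
  right : ∀ E, ‖E‖ < ρ → rightFix n (E, g E) = g E
  uniq : ∀ E, ‖E‖ < ρ → ∀ w, ‖w‖ < σ → rightFix n (E, w) = w → w = g E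
  left : ∀ E, ‖E‖ < ρ → leftMap (cN n) ((BB n (shiftE (E, g E)), g E 1), l E) = l E
  rep_g : ∀ E, ‖E‖ < ρ → RepAt g E
  rep_l : ∀ E, ‖E‖ < ρ → RepAt l E

/-- The right eigenvector is found first and enters the left equations as a parameter ξ E,
consisting of the perturbation at the shifted coefficients and of s. The radius ρ is chosen so that
ξ E stays in the domain of the second fixed point and all unknowns are bounded by 1/1000. No
constant depends on n. -/
theorem exists_isSpec : ∃ ρ > 0, ∃ σ > 0, ∃ L ≥ 0, ρ ≤ 1 / 1000 ∧ σ ≤ 1 / 100 ∧ L * ρ ≤ 1 / 1000 ∧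
    ∀ n : ℤ, 0 < n → ∃ g l, IsSpec n ρ σ L g l := by
  obtain ⟨ρ₁, hρ₁, σ, hσ, hρ₁', hσ', L₁, hL₁, H₁⟩ := exists_rightFix
  obtain ⟨ρ₂, hρ₂, hρ₂', L₂, hL₂, H₂⟩ := exists_leftMap
  set A := 252 * (2 * (1 + L₁)) with hA
  have hA1 : 1 ≤ A := by rw [hA]; linarith
  set L := L₁ + L₂ * A with hL
  have hL0 : 0 ≤ L := by positivity
  set ρ := min ρ₁ (min (1 / 1000) (min (1 / (1000 * (L + 1))) (ρ₂ / (2 * A)))) with hρ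
  have r1 : ρ ≤ ρ₁ := min_le_left _ _
  have r2 : ρ ≤ 1 / 1000 := (min_le_right _ _).trans (min_le_left _ _)
  have r3 : ρ ≤ 1 / (1000 * (L + 1)) :=
    (min_le_right _ _).trans ((min_le_right _ _).trans (min_le_left _ _))
  have r4 : ρ ≤ ρ₂ / (2 * A) :=
    (min_le_right _ _).trans ((min_le_right _ _).trans (min_le_right _ _))
  have hρ0 : 0 < ρ := by
    refine lt_min hρ₁ (lt_min (by norm_num) (lt_min (by positivity) (by positivity)))
  have hLρ : L * ρ ≤ 1 / 1000 := by
    rw [le_div_iff₀ (by positivity)] at r3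
    nlinarith
  refine ⟨ρ, hρ0, σ, hσ, L, hL0, r2, hσ', hLρ, fun n hn => ?_⟩
  obtain ⟨g, hg, hg2⟩ := H₁ n hn
  obtain ⟨l, hl, hl2⟩ := H₂ (cN n) (norm_cN_le hn)
  have hball : ∀ E : Ecal, ‖E‖ < ρ → E ∈ Metric.ball (0 : Ecal) ρ₁ := fun E hE => by
    rw [mem_ball_zero_iff]; exact hE.trans_le r1
  set ξ : Ecal → Mat × ℂ := fun E => (BB n (shiftE (E, g E)), g E 1) with hξ
  have hs : ∀ E, ‖E‖ < ρ → ‖shiftE (E, g E)‖ ≤ 2 * (1 + L₁) * ‖E‖ ∧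
      ‖shiftE (E, g E)‖ < 1 / 36 := by
    intro E hE
    have h1 := norm_shiftE_le (E, g E)
    have h2 : ‖(E, g E)‖ ≤ (1 + L₁) * ‖E‖ := by
      rw [Prod.norm_mk]
      have := (hg2 E (hball E hE)).1
      have h3 := norm_nonneg E
      have h4 : 0 ≤ L₁ * ‖E‖ := by positivity
      exact max_le (by linarith) (by linarith)
    have h5 : ‖(E, g E)‖ ≤ 1 / 100 := by
      rw [Prod.norm_mk]
      exact max_le (by linarith) ((hg2 E (hball E hE)).2.1.le.trans hσ')
    exact ⟨by linarith, by linarith⟩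
  have hξn : ∀ E, ‖E‖ < ρ → ‖ξ E‖ ≤ A * ‖E‖ := by
    intro E hE
    have h1 := norm_BB_le_mul hn (hs E hE).2
    have h2 := (norm_le_pi_norm (g E) 1).trans (hg2 E (hball E hE)).1
    have h3 := norm_nonneg E
    rw [hξ, Prod.norm_mk]
    refine max_le (h1.trans ?_) (h2.trans ?_)
    · have := (hs E hE).1
      rw [hA]; linarith
    · rw [hA]; nlinarith [mul_nonneg hL₁ h3]
  have hξb : ∀ E, ‖E‖ < ρ → ξ E ∈ Metric.ball (0 : Mat × ℂ) ρ₂ := by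
    intro E hE
    rw [mem_ball_zero_iff]
    refine (hξn E hE).trans_lt ?_
    have h5 : A * ‖E‖ ≤ A * (ρ₂ / (2 * A)) := by
      refine mul_le_mul_of_nonneg_left (hE.le.trans r4) (by linarith)
    have h6 : A * (ρ₂ / (2 * A)) = ρ₂ / 2 := by field_simp
    linarith
  have hrep_g : ∀ E, ‖E‖ < ρ → RepAt g E := fun E hE => (hg2 E (hball E hE)).2.2.2.2
  have han_g : AnalyticOnNhd ℂ g (Metric.ball 0 ρ) :=
    hg.mono (Metric.ball_subset_ball r1)
  refine ⟨g, fun E => l (ξ E), han_g, fun E hE => ?_, fun E hE => ?_, fun E hE => ?_,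
    fun E hE => (hg2 E (hball E hE)).2.2.1, fun E hE => (hg2 E (hball E hE)).2.2.2.1,
    fun E hE => (hl2 _ (hξb E hE)).2, hrep_g, fun E hE => ?_⟩
  · have hE' := mem_ball_zero_iff.1 hE
    have h1 : AnalyticAt ℂ (fun E => (E, g E)) E := analyticAt_id.prod (han_g E hE)
    have h2 : AnalyticAt ℂ (fun E => BB n (shiftE (E, g E))) E :=
      AnalyticAt.comp (f := fun E => shiftE (E, g E))
        (analyticOnNhd_BB hn _ (by simpa using (hs E hE').2))
        (AnalyticAt.comp (f := fun E => (E, g E)) (analyticAt_shiftE _) h1)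
    have h3 : AnalyticAt ℂ (fun E => g E 1) E := (analyticAt_pi_iff.1 (han_g E hE)) 1
    exact AnalyticAt.comp (f := ξ) (hl _ (hξb E hE')) (h2.prod h3)
  · refine (hg2 E (hball E hE)).1.trans ?_
    refine mul_le_mul_of_nonneg_right ?_ (norm_nonneg _)
    rw [hL]
    have : 0 ≤ L₂ * A := by positivity
    linarith
  · refine (hl2 _ (hξb E hE)).1.trans ?_
    have h1 := mul_le_mul_of_nonneg_left (hξn E hE) hL₂
    have h2 : 0 ≤ L₁ * ‖E‖ := by positivity
    rw [hL]
    linarith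
  · have h0 : RepAt (fun E => g E 0 / 10000) E :=
      (hrep_g E hE).comp (φ := fun w : Fin 3 → ℂ => w 0 / 10000)
        (by fun_prop)
    have h1 : RepAt (fun E => g E 1) E :=
      (hrep_g E hE).comp (φ := fun w : Fin 3 → ℂ => w 1) (differentiableAt_apply 1 (g E))
    have h2 : RepAt (fun E => BB n (E + (g E 0 / 10000) • oneQ)) E :=
      RepAt.comp_add_smul (f := BB n) (m := fun E => g E 0 / 10000) (V := oneQ)
        (repAt_BB hn (E := E + (g E 0 / 10000) • oneQ) (hs E hE).2) h0
    have h3 : RepAt ξ E := by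
      simp only [hξ, shiftE]
      exact h2.prodMk h1
    exact h3.comp (φ := l) (hl _ (hξb E hE)).differentiableAt

/-! ### Linear algebra of the three-point conditions -/

/-- The sum of the components. -/
def csum (X : Fin 3 → ℂ) : ℂ := X 0 + X 1 + X 2

lemma norm_mulVec_le {B : Matrix (Fin 3) (Fin 3) ℂ} {η x : ℝ} (hB : ∀ i j, ‖B i j‖ ≤ η)
    {X : Fin 3 → ℂ} (hX : ∀ i, ‖X i‖ ≤ x) (i : Fin 3) : ‖B.mulVec X i‖ ≤ 3 * η * x := by
  simp only [Matrix.mulVec, dotProduct, Fin.sum_univ_three]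
  refine (norm_add_le_of_le (norm_add_le_of_le (norm_mul_le_of_le (hB i 0) (hX 0))
    (norm_mul_le_of_le (hB i 1) (hX 1))) (norm_mul_le_of_le (hB i 2) (hX 2))).trans_eq ?_
  ring

lemma norm_csum_le {X : Fin 3 → ℂ} {x : ℝ} (hX : ∀ i, ‖X i‖ ≤ x) : ‖csum X‖ ≤ 3 * x :=
  (norm_add_le_of_le (norm_add_le_of_le (hX 0) (hX 1)) (hX 2)).trans_eq (by ring)

/-- If the three-point conditions have a nontrivial solution, then the two dominant unperturbed
multipliers are close to each other. -/
lemma norm_sub_le_of_csum_eq_zero {g : Fin 3 → ℂ} {B : Matrix (Fin 3) (Fin 3) ℂ} {η : ℝ}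
    (hη : η ≤ 1) (hg : ∀ i, ‖g i‖ ≤ 3) (h02 : 1 / 5 ≤ ‖g 0 - g 2‖) (h12 : 1 / 5 ≤ ‖g 1 - g 2‖)
    (hB : ∀ i j, ‖B i j‖ ≤ η) {X : Fin 3 → ℂ} (hX : X ≠ 0) (h0 : csum X = 0)
    (h1 : csum ((Matrix.diagonal g + B).mulVec X) = 0)
    (h2 : csum ((Matrix.diagonal g + B).mulVec ((Matrix.diagonal g + B).mulVec X)) = 0) :
    ‖g 0 - g 1‖ ≤ 2000 * η := by
  set x := ‖X‖ with hx
  have hx0 : 0 < x := norm_pos_iff.2 hX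
  have hη0 : 0 ≤ η := (norm_nonneg _).trans (hB 0 0)
  have hXi : ∀ i, ‖X i‖ ≤ x := norm_le_pi_norm X
  have hBX := norm_mulVec_le hB hXi
  set Z := B.mulVec X with hZ
  have hD : ∀ V, (Matrix.diagonal g + B).mulVec V = fun i => g i * V i + B.mulVec V i := by
    intro V
    funext i
    rw [Matrix.add_mulVec, Pi.add_apply, Matrix.mulVec_diagonal]
  rw [hD X] at h1 h2
  rw [hD] at h2
  set W := B.mulVec (fun i => g i * X i + Z i) with hW
  have hgX : ∀ i, ‖g i * X i + Z i‖ ≤ 6 * x := fun i =>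
    (norm_add_le_of_le (norm_mul_le_of_le (hg i) (hXi i)) (hBX i)).trans (by nlinarith)
  have hWi : ∀ i, ‖W i‖ ≤ 18 * (η * x) := fun i =>
    (norm_mulVec_le hB hgX i).trans_eq (by ring)
  have e1 : ‖csum Z‖ ≤ 9 * (η * x) := (norm_csum_le hBX).trans_eq (by ring)
  have e2 : ‖csum fun i => g i * Z i + W i‖ ≤ 81 * (η * x) := by
    refine (norm_csum_le (x := 27 * (η * x)) fun i => ?_).trans_eq (by ring)
    exact (norm_add_le_of_le (norm_mul_le_of_le (hg i) (hBX i)) (hWi i)).trans_eq (by ring)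
  have h1' : (g 0 - g 2) * X 0 + (g 1 - g 2) * X 1 = -csum Z := by
    simp only [csum] at h0 h1 ⊢
    linear_combination h1 - g 2 * h0
  have h2' : (g 0 ^ 2 - g 2 ^ 2) * X 0 + (g 1 ^ 2 - g 2 ^ 2) * X 1 =
      -csum fun i => g i * Z i + W i := by
    simp only [csum] at h0 h2 ⊢
    linear_combination h2 - g 2 ^ 2 * h0
  -- Elimination as in a Vandermonde system. The differences g 0 − g 2 and g 1 − g 2 are bounded
  -- below and can be divided out, so g 0 − g 1 times each component of X is O(η).
  have f0 : (g 0 - g 2) * ((g 0 - g 1) * X 0) =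
      (g 1 + g 2) * csum Z - csum fun i => g i * Z i + W i := by
    linear_combination h2' - (g 1 + g 2) * h1'
  have f1 : (g 1 - g 2) * ((g 0 - g 1) * X 1) =
      (csum fun i => g i * Z i + W i) - (g 0 + g 2) * csum Z := by
    linear_combination (g 0 + g 2) * h1' - h2'
  have hprod : 0 ≤ η * x := by positivity
  have k0 : ‖(g 0 - g 1) * X 0‖ ≤ 675 * (η * x) := by
    have := norm_sub_le_of_le (norm_mul_le_of_le (norm_add_le_of_le (hg 1) (hg 2)) e1) e2
    rw [← f0, norm_mul] at this
    nlinarith [norm_nonneg ((g 0 - g 1) * X 0)]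
  have k1 : ‖(g 0 - g 1) * X 1‖ ≤ 675 * (η * x) := by
    have := norm_sub_le_of_le e2 (norm_mul_le_of_le (norm_add_le_of_le (hg 0) (hg 2)) e1)
    rw [← f1, norm_mul] at this
    nlinarith [norm_nonneg ((g 0 - g 1) * X 1)]
  have k2 : ‖(g 0 - g 1) * X 2‖ ≤ 1350 * (η * x) := by
    have h : (g 0 - g 1) * X 2 = -((g 0 - g 1) * X 0) - (g 0 - g 1) * X 1 := by
      simp only [csum] at h0
      linear_combination (g 0 - g 1) * h0
    rw [h]
    exact (norm_sub_le_of_le ((norm_neg _).trans_le k0) k1).trans_eq (by ring)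
  have k : ‖(g 0 - g 1) • X‖ ≤ 1350 * (η * x) := by
    refine (pi_norm_le_iff_of_nonneg (by positivity)).2 fun i => ?_
    fin_cases i
    · exact k0.trans (by linarith)
    · exact k1.trans (by linarith)
    · exact k2
  rw [norm_smul, ← hx, ← mul_assoc] at k
  have := le_of_mul_le_mul_right k hx0
  linarith

/-- The vector `(1, -1 - s, s)`. -/
def Xs (s : ℂ) : Fin 3 → ℂ := ![1, -1 - s, s]

/-- The matrix `diag(1, 1, c) + b`. -/
def pertMat (c : ℂ) (b : Mat) : Matrix (Fin 3) (Fin 3) ℂ :=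
  Matrix.of fun i j => b i j + if i = j then ![1, 1, c] i else 0

lemma csum_pertMat (c : ℂ) (b : Mat) (X : Fin 3 → ℂ) : csum ((pertMat c b).mulVec X) =
    X 0 + X 1 + c * X 2 + csum ((Matrix.of b).mulVec X) := by
  simp [csum, pertMat, Matrix.mulVec, dotProduct, Fin.sum_univ_three]
  ring

section

variable {c : ℂ} (hc : ‖c‖ ≤ 1 / 10) {b : Mat} {β : ℝ} (hβ : β ≤ 1 / 50) (hb : ‖b‖ ≤ β)

include hc hβ hb

/-- The first two hypotheses leave only multiples of (0, −1, 1), for which the third reads (1 − c) X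
2 = O(β) X 2. -/
lemma eq_zero_of_csum_eq_zero {X : Fin 3 → ℂ} (hX : X 0 = 0) (h0 : csum X = 0)
    (h1 : csum ((pertMat c b).mulVec X) = 0) : X = 0 := by
  have h2 : X 1 = -X 2 := by
    simp only [csum, hX] at h0
    linear_combination h0
  have hXi : ∀ i, ‖X i‖ ≤ ‖X 2‖ := by
    intro i
    fin_cases i
    · simp [hX]
    · simp [h2]
    · simp
  have h3 := norm_csum_le (norm_mulVec_le (B := Matrix.of b) (norm_entry_le hb) hXi)
  rw [csum_pertMat, hX, h2] at h1
  have h4 : csum ((Matrix.of b).mulVec X) = (1 - c) * X 2 := by linear_combination h1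
  rw [h4, norm_mul] at h3
  have h5 := norm_one_sub_ge hc
  have h6 : X 2 = 0 := by
    rw [← norm_eq_zero]
    nlinarith [norm_nonneg (X 2)]
  funext i
  fin_cases i
  · simp [hX]
  · simp [h2, h6]
  · simp [h6]

/-- A nontrivial solution of the three-point conditions is an eigenvector of special form. -/
lemma exists_eq_Xs_of_csum_eq_zero {X : Fin 3 → ℂ} (hX : X ≠ 0) (h0 : csum X = 0)
    (h1 : csum ((pertMat c b).mulVec X) = 0)
    (h2 : csum ((pertMat c b).mulVec ((pertMat c b).mulVec X)) = 0) :
    ∃ s k : ℂ, ‖s‖ ≤ 20 * β ∧ ‖k‖ ≤ 20 * β ∧ X = X 0 • Xs s ∧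
      (pertMat c b).mulVec (Xs s) = (1 + k) • Xs s := by
  have hX0 : X 0 ≠ 0 := fun h => hX (eq_zero_of_csum_eq_zero hc hβ hb h h0 h1)
  set s := X 2 / X 0 with hs
  have hXs : X = X 0 • Xs s := by
    funext i
    have h3 : X 1 = -X 0 - X 2 := by simp only [csum] at h0; linear_combination h0
    fin_cases i
    · simp [Xs]
    · simp [Xs, hs, h3]; field_simp
    · simp [Xs, hs]; field_simp
  have hsm : ∀ a : ℂ, ∀ V : Fin 3 → ℂ, csum (a • V) = a * csum V := fun a V => by
    simp [csum]; ring
  have hsub : ∀ U V : Fin 3 → ℂ, csum (U - V) = csum U - csum V := fun U V => by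
    simp [csum]; ring
  have g0 : csum (Xs s) = 0 := by
    rw [hXs, hsm] at h0; exact (mul_eq_zero.1 h0).resolve_left hX0
  have g1 : csum ((pertMat c b).mulVec (Xs s)) = 0 := by
    rw [hXs, Matrix.mulVec_smul, hsm] at h1; exact (mul_eq_zero.1 h1).resolve_left hX0
  have g2 : csum ((pertMat c b).mulVec ((pertMat c b).mulVec (Xs s))) = 0 := by
    rw [hXs, Matrix.mulVec_smul, Matrix.mulVec_smul, hsm] at h2
    exact (mul_eq_zero.1 h2).resolve_left hX0
  set κ := (pertMat c b).mulVec (Xs s) 0 with hκ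
  -- The defect of the eigenvector equation has first component zero by the choice of κ, and it
  -- satisfies the first two three-point conditions because `Xs s` satisfies all three. So it
  -- vanishes.
  have hD : (pertMat c b).mulVec (Xs s) - κ • Xs s = 0 := by
    refine eq_zero_of_csum_eq_zero hc hβ hb ?_ ?_ ?_
    · simp [hκ, Xs]
    · rw [hsub, hsm, g0, g1]; ring
    · rw [Matrix.mulVec_sub, Matrix.mulVec_smul, hsub, hsm, g1, g2]; ring
  have hβ0 : 0 ≤ β := (norm_nonneg _).trans hb
  have hXi : ∀ i, ‖Xs s i‖ ≤ 1 + ‖s‖ := by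
    intro i
    fin_cases i
    · simp [Xs]
    · simpa [Xs] using norm_sub_le (-1) s
    · simp [Xs]
  have hbX := norm_mulVec_le (B := Matrix.of b) (norm_entry_le hb) hXi
  have hsn : ‖s‖ ≤ 20 * β := by
    have h3 := norm_csum_le hbX
    rw [csum_pertMat] at g1
    have h4 : csum ((Matrix.of b).mulVec (Xs s)) = (1 - c) * s := by
      have : Xs s 0 + Xs s 1 + c * Xs s 2 = -((1 - c) * s) := by simp [Xs]; ring
      linear_combination g1 - this
    rw [h4, norm_mul] at h3
    nlinarith [norm_one_sub_ge hc, norm_nonneg s]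
  refine ⟨s, κ - 1, hsn, ?_, hXs, ?_⟩
  · have h5 : κ - 1 = (Matrix.of b).mulVec (Xs s) 0 := by
      simp [hκ, pertMat, Matrix.mulVec, dotProduct, Fin.sum_univ_three, Xs]
      ring
    rw [h5]
    refine (hbX 0).trans ?_
    nlinarith [norm_nonneg s]
  · rw [add_sub_cancel]; exact sub_eq_zero.1 hD

end

/-- The fixed point equation in terms of eigenvectors. -/
lemma rightMap_eq_iff {c K : ℂ} (hc : ‖c‖ ≤ 1 / 10) (hK : K ≠ 0) {b : Mat} {w : Fin 3 → ℂ} :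
    rightMap c K (b, w) = w ↔ (pertMat c b).mulVec (Xs (w 1)) = (1 + w 2) • Xs (w 1) := by
  have h1c : 1 - c ≠ 0 := fun h => by
    have := norm_one_sub_ge hc
    rw [h, norm_zero] at this
    linarith
  have hI : Complex.I * √3 ≠ 0 := by simp
  simp only [funext_iff, Fin.forall_fin_succ, IsEmpty.forall_iff, and_true]
  simp [rightMap, pertMat, Matrix.mulVec, dotProduct, Fin.sum_univ_three, Xs]
  rw [div_eq_iff h1c]
  constructor
  · rintro ⟨h0, h1, h2⟩
    have h0' := h0.resolve_left hK
    refine ⟨?_, ?_, ?_⟩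
    · linear_combination h0' + h2
    · linear_combination -h2
    · linear_combination h1
  · rintro ⟨h0, h1, h2⟩
    refine ⟨Or.inr ?_, ?_, ?_⟩
    · linear_combination h0 + h1
    · linear_combination h2
    · linear_combination -h1

/-- Fixed points of `leftMap` are left eigenvectors. -/
lemma vecMul_eq_of_leftMap_eq {c : ℂ} (hc : ‖c‖ ≤ 1 / 10) {b : Mat} {s k : ℂ} {w : Fin 2 → ℂ}
    (hr : (pertMat c b).mulVec (Xs s) = (1 + k) • Xs s) (h : leftMap c ((b, s), w) = w) :
    Matrix.vecMul ![1 + s + w 0, 1 + w 0, w 0] (pertMat c b) =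
      (1 + w 1) • ![1 + s + w 0, 1 + w 0, w 0] := by
  have h1c : 1 - c ≠ 0 := fun h => by
    have := norm_one_sub_ge hc
    rw [h, norm_zero] at this
    linarith
  have r0 := congrFun hr 0
  have r1 := congrFun hr 1
  have r2 := congrFun hr 2
  have l0 := congrFun h 0
  have l1 := congrFun h 1
  simp [pertMat, Matrix.mulVec, dotProduct, Fin.sum_univ_three, Xs] at r0 r1 r2
  simp [leftMap] at l0 l1
  rw [div_eq_iff h1c] at l0
  have m1 : (1 + s + w 0) * b 0 1 + (1 + w 0) * (b 1 1 + 1) + w 0 * b 2 1 =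
      (1 + w 1) * (1 + w 0) := by linear_combination l1
  have m2 : (1 + s + w 0) * b 0 2 + (1 + w 0) * b 1 2 + w 0 * (b 2 2 + c) =
      (1 + w 1) * w 0 := by linear_combination l0
  -- Components 1 and 2 are the fixed point equations. Component 0 is free of charge: the left
  -- vector annihilates the right eigenvector, whose first entry is 1.
  funext i
  fin_cases i
  · simp [pertMat, Matrix.vecMul, dotProduct, Fin.sum_univ_three]
    linear_combination (1 + s + w 0) * r0 + (1 + w 0) * r1 + w 0 * r2 + (1 + s) * m1 - s * m2
  · simp [pertMat, Matrix.vecMul, dotProduct, Fin.sum_univ_three]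
    linear_combination m1
  · simp [pertMat, Matrix.vecMul, dotProduct, Fin.sum_univ_three]
    linear_combination m2

/-! ### The cube root -/

lemma cbrt_pow (l : ℂ) : (l ^ (1 / 3 : ℂ)) ^ 3 = l := by
  simpa using Complex.cpow_nat_inv_pow l (n := 3) (by norm_num)

lemma cbrt_re_nonneg (l : ℂ) : 0 ≤ (l ^ (1 / 3 : ℂ)).re := by
  by_cases hl : l = 0
  · simp [hl]
  · rw [Complex.cpow_def_of_ne_zero hl, Complex.exp_re]
    refine mul_nonneg (Real.exp_pos _).le (Real.cos_nonneg_of_mem_Icc ?_)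
    have h1 := Complex.neg_pi_lt_arg l
    have h2 := Complex.arg_le_pi l
    have h3 : (Complex.log l * (1 / 3)).im = l.arg / 3 := by
      rw [Complex.mul_im, Complex.log_im]
      norm_num
      ring
    have h4 := Real.pi_pos
    rw [h3]
    constructor <;> linarith

/-- Factor w³ − z³ = (w − z)(w + z · al 0)(w + z · al 1). The principal root has nonnegative real
part and al 0, al 1 have real part 1/2, so both cofactors have modulus at least z/2. -/
lemma norm_cbrt_sub_le {l : ℂ} {n : ℤ} (hn : 0 < n) {m : ℂ} (h : l = zc n ^ 3 - m * zc n ^ 2) :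
    ‖l ^ (1 / 3 : ℂ) - zc n‖ ≤ 4 * ‖m‖ := by
  set w := l ^ (1 / 3 : ℂ) with hw
  have h1 : w ^ 3 = l := cbrt_pow l
  have h2 : 0 ≤ w.re := cbrt_re_nonneg l
  have hz := three_le_zo hn
  have h3 : (w - zc n) * ((w + zc n * al 0) * (w + zc n * al 1)) = -(m * zc n ^ 2) := by
    have e1 : al 0 + al 1 = 1 := by simp [al]; ring
    have e2 : al 0 * al 1 = 1 := by
      have := be_mul_al 1
      simpa [be, al] using this
    linear_combination h1 + h + (w - zc n) * w * zc n * e1 + (w - zc n) * zc n ^ 2 * e2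
  have h4 : ∀ a : ℂ, a.re = 1 / 2 → zo n / 2 ≤ ‖w + zc n * a‖ := by
    intro a ha
    refine le_trans ?_ (Complex.re_le_norm _)
    simp [zc, ha]
    linarith
  have h5 := h4 (al 0) (by simp [al])
  have h6 := h4 (al 1) (by simp [al])
  have h7 := congrArg norm h3
  rw [norm_mul, norm_mul, norm_neg, norm_mul, norm_pow] at h7
  have h8 : ‖zc n‖ = zo n := by
    rw [zc, Complex.norm_real, Real.norm_of_nonneg (by linarith)]
  rw [h8] at h7
  have h9 : zo n / 2 * (zo n / 2) ≤ ‖w + zc n * al 0‖ * ‖w + zc n * al 1‖ :=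
    mul_le_mul h5 h6 (by linarith) (norm_nonneg _)
  have h10 : ‖w - zc n‖ * (zo n / 2 * (zo n / 2)) ≤ ‖m‖ * zo n ^ 2 := by
    rw [← h7]
    exact mul_le_mul_of_nonneg_left h9 (norm_nonneg _)
  have h11 : 0 < zo n ^ 2 := by positivity
  have h12 : ‖w - zc n‖ * zo n ^ 2 ≤ 4 * ‖m‖ * zo n ^ 2 := by linarith
  exact le_of_mul_le_mul_right h12 h11

/-! ### The three-point conditions in terms of the monodromy matrix -/

lemma csum_eq_unscaled (z : ℂ) (X : Fin 3 → ℂ) : unscaled z X 0 = csum X := by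
  simp [unscaled, csum, Fin.sum_univ_three]

lemma NMat_mulVec_unscaled {z : ℂ} (hz : z ≠ 0) (E : Ecal) (X : Fin 3 → ℂ) :
    (NMat z E).mulVec (unscaled z X) =
      Complex.exp (z / 2) • unscaled z ((TMat z E).mulVec X) := by
  rw [NMat, Matrix.smul_mulVec, ← Matrix.mulVec_mulVec, ← Matrix.mulVec_mulVec, SinvMat_mulVec,
    scaled_unscaled hz, Smat_mulVec]

section

variable {p q : ℝ → ℂ} (hpq : PerCoef p q) {z : ℂ} (hz : z ≠ 0) (hd : Tame (dz z)) {E : Ecal}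
  (hE : ‖E‖ < 1 / 36) (hEpq : Represents E (fun t => p t / z) (fun t => q t / z ^ 2))

include hpq hz hd hE hEpq

lemma PerCoef.eq_of_zero_eq {Y Z : ℝ → Fin 3 → ℂ}
    (hY : IsQuasiSolution p (fun t => q t - z ^ 3) Y)
    (hZ : IsQuasiSolution p (fun t => q t - z ^ 3) Z) (h : Y 0 = Z 0) : Y = Z := by
  rw [hpq.isQuasiSolution_iff hz hd hE hEpq] at hY hZ
  funext x
  have hx : Int.fract x ∈ Icc (0 : ℝ) 1 := ⟨Int.fract_nonneg x, (Int.fract_lt_one x).le⟩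
  have h1 := hY ⌊x⌋ _ hx
  have h2 := hZ ⌊x⌋ _ hx
  rw [Int.fract_add_floor] at h1 h2
  rw [h1, h2, h]

lemma PerCoef.apply_one {Y : ℝ → Fin 3 → ℂ} (hY : IsQuasiSolution p (fun t => q t - z ^ 3) Y) :
    Y 1 = (NMat z E).mulVec (Y 0) := by
  have := (hpq.isQuasiSolution_iff hz hd hE hEpq Y).1 hY 0 1 (by simp)
  simpa [propMat_one] using this

lemma PerCoef.apply_two {Y : ℝ → Fin 3 → ℂ} (hY : IsQuasiSolution p (fun t => q t - z ^ 3) Y) :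
    Y 2 = (NMat z E).mulVec ((NMat z E).mulVec (Y 0)) := by
  have := (hpq.isQuasiSolution_iff hz hd hE hEpq Y).1 hY 1 1 (by simp)
  simpa [propMat_one, one_add_one_eq_two] using this

/-- The value of a solution is the sum of its scaled components, and a step by one period is the
monodromy matrix; the nonzero factors exp(z/2) drop out of the conditions. -/
lemma PerCoef.isTransposeBVP_iff {Y : ℝ → Fin 3 → ℂ}
    (hY : IsQuasiSolution p (fun t => q t - z ^ 3) Y) {X : Fin 3 → ℂ} (hX : Y 0 = unscaled z X) :
    IsTransposeBVP p q (z ^ 3) Y ↔ csum X = 0 ∧ csum ((TMat z E).mulVec X) = 0 ∧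
      csum ((TMat z E).mulVec ((TMat z E).mulVec X)) = 0 := by
  have h1 := hpq.apply_one hz hd hE hEpq hY
  have h2 := hpq.apply_two hz hd hE hEpq hY
  rw [hX, NMat_mulVec_unscaled hz] at h1 h2
  rw [Matrix.mulVec_smul, NMat_mulVec_unscaled hz] at h2
  have hY' : IsTransposeSolution p q (z ^ 3) Y := hY
  rw [IsTransposeBVP, h1, h2, hX]
  simp [csum_eq_unscaled, hY']

end

/-! ### The determinantal relation for the unperturbed problem -/

lemma norm_sub_le_of_sin {u : ℂ} (hu : ‖u‖ ≤ 1) : ‖u‖ ≤ 2 * ‖Complex.sin u‖ := by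
  have h1 := Complex.sin_bound hu
  have h2 : ‖u‖ ≤ ‖Complex.sin u‖ + ‖Complex.sin u - (u - u ^ 3 / 6)‖ + ‖u ^ 3 / 6‖ := by
    have : u = Complex.sin u - (Complex.sin u - (u - u ^ 3 / 6)) + u ^ 3 / 6 := by ring
    calc ‖u‖ = ‖Complex.sin u - (Complex.sin u - (u - u ^ 3 / 6)) + u ^ 3 / 6‖ := by rw [← this]
      _ ≤ _ := norm_add_le_of_le (norm_sub_le _ _) le_rfl
  have h3 : ‖u ^ 3 / 6‖ ≤ ‖u‖ / 6 := by
    rw [norm_div, norm_pow]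
    have h6 : ‖(6 : ℂ)‖ = 6 := by norm_num
    rw [h6]
    gcongr
    calc ‖u‖ ^ 3 ≤ ‖u‖ ^ 1 := pow_le_pow_of_le_one (norm_nonneg _) hu (by norm_num)
      _ = ‖u‖ := pow_one _
  have h4 : ‖u‖ ^ 5 ≤ ‖u‖ := by
    calc ‖u‖ ^ 5 ≤ ‖u‖ ^ 1 := pow_le_pow_of_le_one (norm_nonneg _) hu (by norm_num)
      _ = ‖u‖ := pow_one _
  linarith [norm_nonneg u]

section

variable {n : ℤ} (hn : 0 < n) {z : ℂ} (hz : ‖z - zc n‖ < 1)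

include hn hz

lemma re_zo_sub_le : zo n - 1 ≤ z.re ∧ |z.im| ≤ 1 := by
  have h1 := (Complex.abs_re_le_norm (z - zc n)).trans hz.le
  have h2 := (Complex.abs_im_le_norm (z - zc n)).trans hz.le
  simp [zc] at h1 h2
  exact ⟨by linarith [(abs_le.1 h1).1], h2⟩

lemma norm_le_of_near : ‖z‖ ≤ 4 / 3 * zo n ∧ 2 / 3 * zo n ≤ ‖z‖ := by
  have h0 := three_le_zo hn
  have h8 : ‖zc n‖ = zo n := by
    rw [zc, Complex.norm_real, Real.norm_of_nonneg (by linarith)]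
  have h1 := norm_sub_norm_le z (zc n)
  have h2 := norm_sub_norm_le (zc n) z
  rw [norm_sub_rev] at h2
  rw [h8] at h1 h2
  constructor <;> linarith

lemma tame_of_near : Tame (dz z) := by
  obtain ⟨h1, h2⟩ := re_zo_sub_le hn hz
  have h0 := three_le_zo hn
  have h3 : (√3 : ℝ) ≤ 2 := by
    rw [Real.sqrt_le_left (by norm_num)]; norm_num
  have h4 : 0 ≤ (√3 : ℝ) := Real.sqrt_nonneg _
  have h5 : √3 / 2 * |z.im| ≤ 1 := by nlinarith [abs_nonneg z.im]
  have h6 : |√3 / 2 * z.im| ≤ 1 := by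
    rwa [abs_mul, abs_of_nonneg (by positivity : (0 : ℝ) ≤ √3 / 2)]
  rw [abs_le] at h6
  intro k
  fin_cases k
  · simp [dz_zero]
    linarith
  · simp [dz_one]
    linarith
  · simp [dz_two]
    linarith

/-- This separates the third multiplier from the two dominant ones on all of the domain: 1/3 − 1/8 ≥
1/5 is the gap required by `norm_sub_le_of_csum_eq_zero`. -/
lemma norm_exp_dz_bounds : 1 / 3 ≤ ‖Complex.exp (dz z 0)‖ ∧ 1 / 3 ≤ ‖Complex.exp (dz z 1)‖ ∧
    ‖Complex.exp (dz z 2)‖ ≤ 1 / 8 := by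
  obtain ⟨h1, h2⟩ := re_zo_sub_le hn hz
  have h0 := three_le_zo hn
  have h3 : (√3 : ℝ) ≤ 2 := by
    rw [Real.sqrt_le_left (by norm_num)]; norm_num
  have h4 : 0 ≤ (√3 : ℝ) := Real.sqrt_nonneg _
  have h5 : √3 / 2 * |z.im| ≤ 1 := by nlinarith [abs_nonneg z.im]
  have h6 : |√3 / 2 * z.im| ≤ 1 := by
    rwa [abs_mul, abs_of_nonneg (by positivity : (0 : ℝ) ≤ √3 / 2)]
  rw [abs_le] at h6
  have h7 : ∀ x : ℝ, -1 ≤ x → 1 / 3 ≤ Real.exp x := by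
    intro x hx
    refine le_trans ?_ (Real.exp_le_exp.2 hx)
    rw [Real.exp_neg, one_div]
    gcongr
    linarith [Real.exp_one_lt_d9]
  refine ⟨?_, ?_, ?_⟩
  · rw [Complex.norm_exp]
    refine h7 _ ?_
    simp [dz_zero]
    linarith
  · rw [Complex.norm_exp]
    refine h7 _ ?_
    simp [dz_one]
    linarith
  · rw [Complex.norm_exp]
    have h8 : (dz z 2).re ≤ -3 := by simp [dz_two]; linarith
    refine (Real.exp_le_exp.2 h8).trans ?_
    rw [Real.exp_neg, one_div]
    gcongr
    have h9 : (2 : ℝ) ≤ Real.exp 1 := by linarith [Real.exp_one_gt_d9]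
    calc (8 : ℝ) = 2 ^ 3 := by norm_num
      _ ≤ Real.exp 1 ^ 3 := by gcongr
      _ = Real.exp 3 := by rw [← Real.exp_nat_mul]; norm_num

/-- The distance of `z` to the base point is controlled by the difference of the dominant
unperturbed multipliers. -/
lemma norm_sub_zc_le :
    ‖z - zc n‖ ≤ 2 * ‖Complex.exp (dz z 0) - Complex.exp (dz z 1)‖ := by
  set u : ℂ := √3 / 2 * (z - zc n) with hu
  have h3 : (√3 : ℝ) ≤ 2 := by
    rw [Real.sqrt_le_left (by norm_num)]; norm_num
  have h4 : 1 ≤ (√3 : ℝ) := by rw [Real.one_le_sqrt]; norm_num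
  have hun : ‖u‖ = √3 / 2 * ‖z - zc n‖ := by
    rw [hu, norm_mul, norm_div, Complex.norm_real, Real.norm_of_nonneg (by positivity)]
    norm_num
  have hu1 : ‖u‖ ≤ 1 := by
    rw [hun]
    nlinarith [norm_nonneg (z - zc n)]
  have h5 : dz z 0 = dz (zc n) 0 + u * Complex.I := by
    rw [dz_zero, dz_zero, hu]; ring
  have h6 : dz z 1 = dz (zc n) 1 + -u * Complex.I := by
    rw [dz_one, dz_one, hu]; ring
  have h7 : Complex.exp (dz z 0) - Complex.exp (dz z 1) =
      sg n * (2 * Complex.I * Complex.sin u) := by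
    rw [h5, h6, Complex.exp_add, Complex.exp_add, exp_dz_zc_zero, exp_dz_zc_one, Complex.sin]
    linear_combination sg n * (Complex.exp (u * Complex.I) - Complex.exp (-u * Complex.I)) *
      Complex.I_sq
  have h8 := norm_sub_le_of_sin hu1
  rw [h7, norm_mul, norm_sg, norm_mul, norm_mul, Complex.norm_I, Complex.norm_two]
  nlinarith [norm_nonneg (z - zc n)]

end

/-! ### Change of the base point and of the spectral parameter -/

/-- The coefficients relative to another base point. -/
def rebase (a : ℂ) (E : Ecal) : Ecal := (a • E.1, a ^ 2 • E.2)

lemma Represents.rebase {E : Ecal} {p q : ℝ → ℂ} {z w : ℂ} (hz : z ≠ 0)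
    (h : Represents E (fun t => p t / z) (fun t => q t / z ^ 2)) :
    Represents (rebase (z / w) E) (fun t => p t / w) (fun t => q t / w ^ 2) := by
  constructor
  · filter_upwards [h.1, Lp.coeFn_smul (z / w) E.1] with t h1 h2
    simp only [ThreePoint.rebase]
    rw [h2, Pi.smul_apply, h1, smul_eq_mul]
    field_simp
  · filter_upwards [h.2, Lp.coeFn_smul ((z / w) ^ 2) E.2] with t h1 h2
    simp only [ThreePoint.rebase]
    rw [h2, Pi.smul_apply, h1, smul_eq_mul]
    field_simp

lemma norm_rebase_le {a : ℂ} (ha : ‖a‖ ≤ 3 / 2) (E : Ecal) : ‖rebase a E‖ ≤ 9 / 4 * ‖E‖ := by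
  have h1 := norm_fst_le E
  have h2 := norm_snd_le E
  have h3 : ‖a‖ ^ 2 ≤ 9 / 4 := by nlinarith [norm_nonneg a]
  rw [rebase, Prod.norm_mk, norm_smul, norm_smul, norm_pow]
  refine max_le ?_ ?_
  · nlinarith [norm_nonneg E, norm_nonneg E.1, norm_nonneg a]
  · exact mul_le_mul h3 h2 (norm_nonneg _) (by norm_num)

/-- Only q − λ enters the equation, so λ = z³ − m z² with coefficient q is the same as λ = z³ with q
+ m z². The base point stays fixed while the spectral parameter moves. -/
lemma Represents.add_smul_oneQ {E : Ecal} {p q : ℝ → ℂ} {z m : ℂ} (hz : z ≠ 0)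
    (h : Represents E (fun t => p t / z) (fun t => q t / z ^ 2)) :
    Represents (E + m • oneQ) (fun t => p t / z) (fun t => (q t + m * z ^ 2) / z ^ 2) := by
  constructor
  · have h0 : (E + m • oneQ).1 = E.1 := by simp [oneQ]
    rw [h0]
    exact h.1
  · have h0 : (E + m • oneQ).2 = E.2 + m • oneQ.2 := rfl
    rw [h0]
    filter_upwards [h.2, Lp.coeFn_add E.2 (m • oneQ.2), Lp.coeFn_smul m oneQ.2,
      L1.ofFun_ae (f := fun _ => 1) intervalIntegrable_const] with t h1 h2 h3 h4
    rw [h2, Pi.add_apply, h3, h1, Pi.smul_apply]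
    have h5 : oneQ.2 t = 1 := h4
    rw [h5]
    field_simp
    simp

lemma PerCoef.add_const {p q : ℝ → ℂ} (h : PerCoef p q) (a : ℂ) : PerCoef p fun t => q t + a where
  per_p := h.per_p
  per_q t := by simp only [h.per_q t]
  int_p := h.int_p
  int_q s t := (h.int_q s t).add intervalIntegrable_const

lemma isTransposeBVP_add_iff {p q : ℝ → ℂ} {l a : ℂ} {Y : ℝ → Fin 3 → ℂ} :
    IsTransposeBVP p (fun t => q t + a) (l + a) Y ↔ IsTransposeBVP p q l Y := by
  simp [IsTransposeBVP, IsTransposeSolution]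

lemma monodromy_add (p q : ℝ → ℂ) (l a : ℂ) :
    monodromy p (fun t => q t + a) (l + a) = monodromy p q l := by
  simp [monodromy, fundSol, IsSolution]

lemma epsilon_eq {α : Type*} [Nonempty α] {P : α → Prop} {a : α} (h : P a)
    (hu : ∀ b, P b → b = a) : Classical.epsilon P = a :=
  hu _ (Classical.epsilon_spec ⟨a, h⟩)

lemma norm_TT_sub_zero_le {d : Fin 3 → ℂ} (h : Tame d) {E : Ecal} (hE : ‖E‖ < 1 / 36) :
    ‖TT d E - TT d 0‖ ≤ 432 * ‖E‖ := by
  have := norm_le_of_bounded (f := fun E => TT d E - TT d 0) (r := 1 / 36) (K := 12)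
    (fun E hE => (h.analyticOnNhd_TT E hE).fun_sub analyticAt_const)
    (fun E hE => (norm_sub_le_of_le (h.norm_TT_le (by simpa using hE))
      (h.norm_TT_le (by simp))).trans (by norm_num)) (sub_self _) hE
  linarith

lemma TMat_zc (n : ℤ) (E : Ecal) :
    TMat (zc n) E = sg n • pertMat (cN n) (BB n E) := by
  ext i j
  have h : BB n E i j = sg n * TT (dz (zc n)) E i j - if i = j then diag0 n i else 0 := rfl
  simp only [TMat, Matrix.of_apply, Matrix.smul_apply, pertMat, h, diag0, smul_eq_mul]
  rw [sub_add_cancel, ← mul_assoc, sg_mul_sg, one_mul]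

lemma csum_smul (a : ℂ) (X : Fin 3 → ℂ) : csum (a • X) = a * csum X := by
  simp [csum]; ring

lemma sg_ne_zero (n : ℤ) : sg n ≠ 0 := fun h => by
  have := sg_mul_sg n
  rw [h] at this
  simp at this

lemma csum_TMat_zc_iff (n : ℤ) (E : Ecal) (X : Fin 3 → ℂ) :
    (csum ((TMat (zc n) E).mulVec X) = 0 ∧
      csum ((TMat (zc n) E).mulVec ((TMat (zc n) E).mulVec X)) = 0) ↔
    csum ((pertMat (cN n) (BB n E)).mulVec X) = 0 ∧
      csum ((pertMat (cN n) (BB n E)).mulVec ((pertMat (cN n) (BB n E)).mulVec X)) = 0 := by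
  simp only [TMat_zc, Matrix.smul_mulVec, Matrix.mulVec_smul, csum_smul, mul_eq_zero, sg_ne_zero,
    false_or]

/-- Periodic coefficients that are small in comparison with the domain on which the spectral data
are defined. -/
structure Setting (n : ℤ) (ρ σ L : ℝ) (g : Ecal → Fin 3 → ℂ) (l : Ecal → Fin 2 → ℂ)
    (p q : ℝ → ℂ) (E : Ecal) : Prop where
  hn : 0 < n
  spec : IsSpec n ρ σ L g l
  hρ : ρ ≤ 1 / 1000
  hσ : σ ≤ 1 / 100
  hL : 0 ≤ L
  hLρ : L * ρ ≤ 1 / 1000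
  hpq : PerCoef p q
  rep : Represents E (fun t => p t / zc n) (fun t => q t / zc n ^ 2)
  small : ‖E‖ < ρ
  tiny : ‖E‖ < σ / 10 ^ 12

/-- The eigenvalue of the three-point problem. -/
def lam (n : ℤ) (g : Ecal → Fin 3 → ℂ) (E : Ecal) : ℂ := zc n ^ 3 - g E 0 / 10000 * zc n ^ 2

/-- The functional that gives the derivative of an eigenfunction at `0`. -/
def slope (s : ℂ) : ℂ := al 0 * Xs s 0 + al 1 * Xs s 1 + al 2 * Xs s 2

/-- At s = 0 the slope is al 0 − al 1 = i√3. Hence y'(0) does not vanish for eigenfunctions and the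
normalization is possible. -/
lemma slope_ne_zero {s : ℂ} (hs : ‖s‖ ≤ 1 / 1000) : slope s ≠ 0 := by
  intro h
  have h1 : s * (al 1 + 1) = Complex.I * √3 := by
    simp only [slope, Xs, al] at h ⊢
    simp at h ⊢
    linear_combination -h
  have h2 := congrArg norm h1
  have h3 : ‖al 1 + 1‖ ≤ 2 :=
    (norm_add_le_of_le (norm_al 1).le norm_one.le).trans (by norm_num)
  have h4 : 1 ≤ (√3 : ℝ) := by rw [Real.one_le_sqrt]; norm_num
  rw [norm_mul, norm_mul, Complex.norm_I, Complex.norm_real,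
    Real.norm_of_nonneg (by positivity)] at h2
  nlinarith [norm_nonneg s, norm_nonneg (al 1 + 1)]

lemma unscaled_one (z : ℂ) (a s : ℂ) : unscaled z (a • Xs s) 1 = z * a * slope s := by
  simp [unscaled, Fin.sum_univ_three, slope]
  ring

/-! ### Existence and uniqueness of the eigenvalue and of the normalized eigenfunction -/

namespace Setting

variable {n : ℤ} {ρ σ L : ℝ} {g : Ecal → Fin 3 → ℂ} {l : Ecal → Fin 2 → ℂ} {p q : ℝ → ℂ}
  {E : Ecal} (h : Setting n ρ σ L g l p q E)

include h

lemma norm_g_le (i : Fin 3) : ‖g E i‖ ≤ 1 / 1000 := by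
  refine (norm_le_pi_norm (g E) i).trans ((h.spec.g_le E h.small).trans ?_)
  exact (mul_le_mul_of_nonneg_left h.small.le h.hL).trans h.hLρ

lemma norm_l_le (i : Fin 2) : ‖l E i‖ ≤ 1 / 1000 := by
  refine (norm_le_pi_norm (l E) i).trans ((h.spec.l_le E h.small).trans ?_)
  exact (mul_le_mul_of_nonneg_left h.small.le h.hL).trans h.hLρ

lemma norm_shift_lt : ‖shiftE (E, g E)‖ < 1 / 36 := by
  have h1 := norm_shiftE_le (E, g E)
  have h2 : ‖(E, g E)‖ ≤ 1 / 1000 := by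
    rw [Prod.norm_mk]
    exact max_le (h.small.le.trans h.hρ)
      ((pi_norm_le_iff_of_nonneg (by norm_num)).2 h.norm_g_le)
  linarith

lemma rep_shift : Represents (shiftE (E, g E)) (fun t => p t / zc n)
    (fun t => (q t + g E 0 / 10000 * zc n ^ 2) / zc n ^ 2) :=
  h.rep.add_smul_oneQ (zc_ne_zero h.hn)

lemma perCoef_shift : PerCoef p fun t => q t + g E 0 / 10000 * zc n ^ 2 := h.hpq.add_const _

lemma right_eig : (pertMat (cN n) (BB n (shiftE (E, g E)))).mulVec (Xs (g E 1)) =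
    (1 + g E 2) • Xs (g E 1) :=
  (rightMap_eq_iff (norm_cN_le h.hn) (by norm_num)).1 (h.spec.right E h.small)

lemma left_eig : Matrix.vecMul ![1 + g E 1 + l E 0, 1 + l E 0, l E 0]
    (pertMat (cN n) (BB n (shiftE (E, g E)))) =
    (1 + l E 1) • ![1 + g E 1 + l E 0, 1 + l E 0, l E 0] :=
  vecMul_eq_of_leftMap_eq (norm_cN_le h.hn) h.right_eig (h.spec.left E h.small)

lemma isTransposeSolution_iff {Y : ℝ → Fin 3 → ℂ} : IsTransposeSolution p q (lam n g E) Y ↔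
    IsQuasiSolution p (fun t => q t + g E 0 / 10000 * zc n ^ 2 - zc n ^ 3) Y := by
  rw [IsTransposeSolution]
  have : (fun t => q t - lam n g E) =
      fun t => q t + g E 0 / 10000 * zc n ^ 2 - zc n ^ 3 := by
    funext t
    rw [lam]
    ring
  rw [this]

lemma isTransposeBVP_of {Y : ℝ → Fin 3 → ℂ} (hY : IsTransposeSolution p q (lam n g E) Y) {a : ℂ}
    (ha : Y 0 = unscaled (zc n) (a • Xs (g E 1))) : IsTransposeBVP p q (lam n g E) Y := by
  rw [← isTransposeBVP_add_iff (a := g E 0 / 10000 * zc n ^ 2)]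
  have h1 : lam n g E + g E 0 / 10000 * zc n ^ 2 = zc n ^ 3 := by rw [lam]; ring
  rw [h1, h.perCoef_shift.isTransposeBVP_iff (zc_ne_zero h.hn) (tame_dz_zc h.hn) h.norm_shift_lt
    h.rep_shift (h.isTransposeSolution_iff.1 hY) ha, csum_TMat_zc_iff]
  have h2 : csum (Xs (g E 1)) = 0 := by simp [csum, Xs]; ring
  simp only [Matrix.mulVec_smul, h.right_eig, csum_smul, h2, mul_zero, and_self]

lemma lam_mem_dom : lam n g E ∈ dom n := by
  have h1 := norm_cbrt_sub_le h.hn (l := lam n g E) (m := g E 0 / 10000) rfl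
  have h2 := h.norm_g_le 0
  have h3 : ‖g E 0 / 10000‖ ≤ 1 / 1000 := by
    rw [norm_div]
    have : ‖(10000 : ℂ)‖ = 10000 := by norm_num
    rw [this]
    linarith [norm_nonneg (g E 0)]
  change ‖lam n g E ^ (1 / 3 : ℂ) - zc n‖ < 1
  linarith

/-- All eigenfunctions of the three-point problem with eigenvalues near the base point. -/
lemma eq_lam_of_isTransposeBVP {μ : ℂ} (hμ : μ ∈ dom n) {Y : ℝ → Fin 3 → ℂ}
    (hY : IsTransposeBVP p q μ Y) (hY0 : Y ≠ 0) :
    μ = lam n g E ∧ ∃ a : ℂ, Y 0 = unscaled (zc n) (a • Xs (g E 1)) := by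
  set z := μ ^ (1 / 3 : ℂ) with hz
  have hzμ : z ^ 3 = μ := cbrt_pow μ
  have hnear : ‖z - zc n‖ < 1 := hμ
  have hn := h.hn
  have h3 := three_le_zo hn
  have hzc0 := zc_ne_zero hn
  obtain ⟨hz1, hz2⟩ := norm_le_of_near hn hnear
  have hz0 : z ≠ 0 := by
    rw [← norm_pos_iff]; linarith
  have hd := tame_of_near hn hnear
  have hzcn : ‖zc n‖ = zo n := by
    rw [zc, Complex.norm_real, Real.norm_of_nonneg (by linarith)]
  have hE0 := norm_nonneg E
  have hσ0 : 0 < σ := by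
    have := h.tiny
    by_contra hcon
    have : σ / 10 ^ 12 ≤ 0 := div_nonpos_of_nonpos_of_nonneg (not_lt.1 hcon) (by positivity)
    linarith
  -- first localization
  have hEz : ‖rebase (zc n / z) E‖ ≤ 9 / 4 * ‖E‖ := by
    refine norm_rebase_le ?_ E
    rw [norm_div, hzcn, div_le_iff₀ (by linarith)]
    linarith
  have hsmall := h.small
  have hρ := h.hρ
  have hEz' : ‖rebase (zc n / z) E‖ < 1 / 36 := by linarith
  have hrepz := h.rep.rebase hzc0 (w := z)
  have hYz : IsQuasiSolution p (fun t => q t - z ^ 3) Y := by rw [hzμ]; exact hY.1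
  have hX : Y 0 = unscaled z (scaled z (Y 0)) := (unscaled_scaled hz0 _).symm
  have hYne : Y 0 ≠ 0 := by
    intro h0
    refine hY0 (h.hpq.eq_of_zero_eq hz0 hd hEz' hrepz hYz ?_ h0)
    rw [isQuasiSolution_iff]
    refine ⟨continuous_const, fun i x => ?_⟩
    fin_cases i <;> simp [qsRhs]
  have hXne : scaled z (Y 0) ≠ 0 := by
    intro h0
    rw [h0, ← Smat_mulVec, Matrix.mulVec_zero] at hX
    exact hYne hX
  have hcs := (h.hpq.isTransposeBVP_iff hz0 hd hEz' hrepz hYz hX).1 (hzμ ▸ hY)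
  set gz : Fin 3 → ℂ := fun k => Complex.exp (dz z k) with hgz
  set B : Matrix (Fin 3) (Fin 3) ℂ := TMat z (rebase (zc n / z) E) - Matrix.diagonal gz with hB
  have hTB : TMat z (rebase (zc n / z) E) = Matrix.diagonal gz + B := by rw [hB]; abel
  have hBn : ∀ i j, ‖B i j‖ ≤ 972 * ‖E‖ := by
    intro i j
    have h5 : B i j = (TT (dz z) (rebase (zc n / z) E) - TT (dz z) 0) i j := by
      rw [hB]
      simp only [Matrix.sub_apply, TMat, Matrix.of_apply, Pi.sub_apply, TT_zero,
        Matrix.diagonal_apply, hgz]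
    rw [h5]
    refine norm_entry_le ((norm_TT_sub_zero_le hd hEz').trans ?_) i j
    linarith
  obtain ⟨b0, b1, b2⟩ := norm_exp_dz_bounds hn hnear
  have hgn : ∀ i, ‖gz i‖ ≤ 3 := fun i => by
    simpa using hd.norm_exp_le i (s := 1) (by simp)
  rw [hTB] at hcs
  -- At the base point z = μ^(1/3) itself a nontrivial solution forces exp(dz z 0) and exp(dz z 1)
  -- to be within O(‖E‖) of each other; in the domain this happens only for z within O(‖E‖) of `zc
  -- n`.
  have hclose : ‖gz 0 - gz 1‖ ≤ 2000 * (972 * ‖E‖) := by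
    refine norm_sub_le_of_csum_eq_zero (by linarith) hgn ?_ ?_ hBn hXne hcs.1 hcs.2.1 hcs.2.2
    · have := norm_sub_norm_le (gz 0) (gz 2)
      simp only [hgz] at this ⊢
      linarith
    · have := norm_sub_norm_le (gz 1) (gz 2)
      simp only [hgz] at this ⊢
      linarith
  have hloc : ‖z - zc n‖ ≤ 4 * 10 ^ 6 * ‖E‖ := by
    refine (norm_sub_zc_le hn hnear).trans ?_
    simp only [hgz] at hclose
    linarith
  -- the spectral parameter relative to the base point
  set m : ℂ := (zc n ^ 3 - μ) / zc n ^ 2 with hm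
  have hμm : μ + m * zc n ^ 2 = zc n ^ 3 := by rw [hm]; field_simp; ring
  have hmn : ‖m‖ ≤ 2 * 10 ^ 7 * ‖E‖ := by
    have h5 : m = (zc n - z) * ((z / zc n) ^ 2 + z / zc n + 1) := by
      rw [hm, ← hzμ]; field_simp; ring
    have h6 : ‖z / zc n‖ ≤ 4 / 3 := by
      rw [norm_div, hzcn, div_le_iff₀ (by linarith)]; exact hz1
    have h7 : ‖(z / zc n) ^ 2 + z / zc n + 1‖ ≤ 5 := by
      refine (norm_add_le_of_le (norm_add_le_of_le ((norm_pow _ _).trans_le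
        (pow_le_pow_left₀ (norm_nonneg _) h6 2)) h6) norm_one.le).trans (by norm_num)
    rw [h5]
    refine (norm_mul_le_of_le ((norm_sub_rev _ _).trans_le hloc) h7).trans_eq (by ring)
  -- Source of the factor 10¹²: here |10000 m| ≤ 2 · 10¹¹‖E‖, and the perturbation is at most 252 ·
  -- 21 · 10⁶‖E‖. Both must be small against σ in order that (10000 m, s, k) falls under the
  -- uniqueness of the fixed point.
  have htiny := h.tiny
  have hE'n : ‖E + m • oneQ‖ ≤ 21 * 10 ^ 6 * ‖E‖ := by
    have := norm_add_le_of_le (le_refl ‖E‖) (norm_smul m oneQ).le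
    rw [norm_oneQ] at this
    linarith
  have hσ := h.hσ
  have hE'lt : ‖E + m • oneQ‖ < 1 / 36 := by linarith
  have hβ : ‖BB n (E + m • oneQ)‖ ≤ σ / 100 := by
    have := norm_BB_le_mul hn hE'lt
    linarith
  have hY2 : IsTransposeBVP p (fun t => q t + m * zc n ^ 2) (zc n ^ 3) Y := by
    rw [← hμm, isTransposeBVP_add_iff]; exact hY
  set X := scaled (zc n) (Y 0) with hXdef
  have hX2 : Y 0 = unscaled (zc n) X := (unscaled_scaled hzc0 _).symm
  have hX2ne : X ≠ 0 := by
    intro h0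
    rw [h0, ← Smat_mulVec, Matrix.mulVec_zero] at hX2
    exact hYne hX2
  have hcs2 := ((h.hpq.add_const _).isTransposeBVP_iff hzc0 (tame_dz_zc hn) hE'lt
    (h.rep.add_smul_oneQ hzc0) hY2.1 hX2).1 hY2
  rw [csum_TMat_zc_iff] at hcs2
  obtain ⟨s, k, hs, hk, hXs, heig⟩ := exists_eq_Xs_of_csum_eq_zero (norm_cN_le hn)
    (β := σ / 100) (by linarith) hβ hX2ne hcs2.1 hcs2.2.1 hcs2.2.2
  set w : Fin 3 → ℂ := ![10000 * m, s, k] with hw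
  have hwE : shiftE (E, w) = E + m • oneQ := by
    have : w 0 / 10000 = m := by simp [hw]
    simp only [shiftE, this]
  have hfix : rightFix n (E, w) = w := by
    rw [rightFix, hwE]
    exact (rightMap_eq_iff (norm_cN_le hn) (by norm_num)).2 heig
  have hwn : ‖w‖ < σ := by
    rw [pi_norm_lt_iff hσ0]
    intro i
    fin_cases i
    · simp only [hw, Fin.zero_eta, Matrix.cons_val_zero, norm_mul]
      have : ‖(10000 : ℂ)‖ = 10000 := by norm_num
      rw [this]
      linarith
    · simp only [hw, Fin.mk_one, Matrix.cons_val_one, Matrix.cons_val_zero]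
      linarith
    · simp only [hw, Fin.reduceFinMk, Matrix.cons_val]
      linarith
  have hwg := h.spec.uniq E h.small w hwn hfix
  have hm0 : m = g E 0 / 10000 := by rw [← hwg]; simp [hw]
  have hs1 : s = g E 1 := by rw [← hwg]; simp [hw]
  refine ⟨?_, X 0, ?_⟩
  · rw [lam, ← hm0]
    linear_combination hμm
  · rw [← hs1, ← hXs]; exact hX2

lemma exists_normalized : ∃ Y, IsTransposeBVP p q (lam n g E) Y ∧ Y 0 1 = 1 := by
  have hzc0 := zc_ne_zero h.hn
  have hsl := slope_ne_zero (h.norm_g_le 1)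
  obtain ⟨Y, hY, hY0⟩ := h.perCoef_shift.exists_isQuasiSolution hzc0 (tame_dz_zc h.hn)
    h.norm_shift_lt h.rep_shift (unscaled (zc n) ((1 / (zc n * slope (g E 1))) • Xs (g E 1)))
  refine ⟨Y, h.isTransposeBVP_of (h.isTransposeSolution_iff.2 hY) hY0, ?_⟩
  rw [hY0, unscaled_one]
  field_simp

lemma normalized_unique {Y Z : ℝ → Fin 3 → ℂ} (hY : IsTransposeBVP p q (lam n g E) Y)
    (hY1 : Y 0 1 = 1) (hZ : IsTransposeBVP p q (lam n g E) Z) (hZ1 : Z 0 1 = 1) : Y = Z := by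
  have key : ∀ W, IsTransposeBVP p q (lam n g E) W → W 0 1 = 1 →
      W 0 = unscaled (zc n) ((1 / (zc n * slope (g E 1))) • Xs (g E 1)) := by
    intro W hW hW1
    have hW0 : W ≠ 0 := by
      rintro rfl
      simp at hW1
    obtain ⟨-, a, ha⟩ := h.eq_lam_of_isTransposeBVP h.lam_mem_dom hW hW0
    rw [ha, unscaled_one] at hW1
    have hzc0 := zc_ne_zero h.hn
    have hsl := slope_ne_zero (h.norm_g_le 1)
    have : a = 1 / (zc n * slope (g E 1)) := by
      field_simp
      linear_combination hW1
    rw [ha, this]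
  exact h.perCoef_shift.eq_of_zero_eq (zc_ne_zero h.hn) (tame_dz_zc h.hn) h.norm_shift_lt
    h.rep_shift (h.isTransposeSolution_iff.1 hY.1) (h.isTransposeSolution_iff.1 hZ.1)
    ((key Y hY hY1).trans (key Z hZ hZ1).symm)

/-- The initial vector is an eigenvector of the monodromy matrix, so y'(1)/y'(0) is the
corresponding eigenvalue. -/
lemma normalized_apply_one {Y : ℝ → Fin 3 → ℂ} (hY : IsTransposeBVP p q (lam n g E) Y)
    (hY1 : Y 0 1 = 1) : Y 1 1 = Complex.exp (zc n / 2) * sg n * (1 + g E 2) := by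
  have hW0 : Y ≠ 0 := by
    rintro rfl
    simp at hY1
  obtain ⟨-, a, ha⟩ := h.eq_lam_of_isTransposeBVP h.lam_mem_dom hY hW0
  rw [h.perCoef_shift.apply_one (zc_ne_zero h.hn) (tame_dz_zc h.hn) h.norm_shift_lt
    h.rep_shift (h.isTransposeSolution_iff.1 hY.1), ha, NMat_mulVec_unscaled (zc_ne_zero h.hn),
    Matrix.mulVec_smul, TMat_zc, Matrix.smul_mulVec, h.right_eig, smul_smul, smul_smul,
    Pi.smul_apply, unscaled_one]
  rw [ha, unscaled_one] at hY1
  rw [smul_eq_mul]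
  linear_combination Complex.exp (zc n / 2) * sg n * (1 + g E 2) * hY1

lemma isEigenvalue_lam : lam n g E ∈ dom n ∧ IsTransposeEigenvalue p q (lam n g E) := by
  obtain ⟨Y, hY, hY1⟩ := h.exists_normalized
  refine ⟨h.lam_mem_dom, Y, hY, ?_⟩
  rintro rfl
  simp at hY1

lemma eq_lam {μ : ℂ} (hμ : μ ∈ dom n ∧ IsTransposeEigenvalue p q μ) : μ = lam n g E := by
  obtain ⟨h1, Y, hY, hY0⟩ := hμ
  exact (h.eq_lam_of_isTransposeBVP h1 hY hY0).1

lemma muT_eq : muT p q n = lam n g E := epsilon_eq h.isEigenvalue_lam fun _ => h.eq_lam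

end Setting

/-! ### The dominant multiplier and the reality of the spectral data -/

open Polynomial in
/-- The multipliers of a matrix of determinant one with eigenvectors of the special form. -/
lemma charpoly_eq_of_eigenvectors_of_det {G : Matrix (Fin 3) (Fin 3) ℂ} {s u a b : ℂ}
    (hu : 1 + u ≠ 0) (ha : a ≠ 0) (hb : b ≠ 0) (hdet : G.det = 1)
    (h1 : G.mulVec ![1, -1 - s, s] = a • ![1, -1 - s, s])
    (h2 : Matrix.vecMul ![1 + s + u, 1 + u, u] G = b • ![1 + s + u, 1 + u, u]) :
    G.charpoly = (X - C a) * (X - C b) * (X - C (a * b)⁻¹) := by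
  have h := charpoly_eq_of_eigenvectors hu h1 h2
  have h3 := Matrix.det_eq_sign_charpoly_coeff G
  rw [hdet, h, coeff_zero_eq_eval_zero] at h3
  simp at h3
  have h4 : G.trace - a - b = (a * b)⁻¹ := by
    refine eq_inv_of_mul_eq_one_left ?_
    linear_combination -h3
  rw [h, h4]

open Polynomial in
lemma charpoly_inv_eq_of_eigenvectors_of_det {G : Matrix (Fin 3) (Fin 3) ℂ} {s u a b : ℂ}
    (hu : 1 + u ≠ 0) (ha : a ≠ 0) (hb : b ≠ 0) (hdet : G.det = 1)
    (h1 : G.mulVec ![1, -1 - s, s] = a • ![1, -1 - s, s])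
    (h2 : Matrix.vecMul ![1 + s + u, 1 + u, u] G = b • ![1 + s + u, 1 + u, u]) :
    (G⁻¹).charpoly = (X - C a⁻¹) * (X - C b⁻¹) * (X - C (a * b)) := by
  have hG : IsUnit G.det := by rw [hdet]; exact isUnit_one
  have h := charpoly_eq_of_eigenvectors_of_det (G := G⁻¹) (s := s) hu (inv_ne_zero ha)
    (inv_ne_zero hb) (by rw [Matrix.det_nonsing_inv, hdet, Ring.inverse_one]) ?_ ?_
  · rw [h, mul_inv, inv_inv, inv_inv]
  · have := congrArg (fun v => a⁻¹ • (G⁻¹).mulVec v) h1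
    simp only [Matrix.mulVec_mulVec, Matrix.nonsing_inv_mul _ hG, Matrix.one_mulVec,
      Matrix.mulVec_smul, smul_smul, inv_mul_cancel₀ ha, one_smul] at this
    exact this.symm
  · have := congrArg (fun v => b⁻¹ • Matrix.vecMul v G⁻¹) h2
    simp only [Matrix.vecMul_vecMul, Matrix.mul_nonsing_inv _ hG, Matrix.vecMul_one,
      Matrix.smul_vecMul, smul_smul, inv_mul_cancel₀ hb, one_smul] at this
    exact this.symm

open Polynomial in
-- The roots a⁻¹ and b⁻¹ lie inside the unit circle and ab outside. Hence ab is simple and dominant,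
-- even when a = b.
lemma isTau3_iff_of_charpoly {p q : ℝ → ℂ} {μ a b : ℂ} (ha : 1 < ‖a‖) (hb : 1 < ‖b‖)
    (h : (monodromy p q μ).charpoly = (X - C a⁻¹) * (X - C b⁻¹) * (X - C (a * b))) (τ : ℂ) :
    IsTau3 p q μ τ ↔ τ = a * b := by
  have ha0 : a ≠ 0 := by rintro rfl; simp at ha; linarith
  have hb0 : b ≠ 0 := by rintro rfl; simp at hb; linarith
  have hab : 1 < ‖a * b‖ := by rw [norm_mul]; nlinarith
  have hinv : ∀ c : ℂ, 1 < ‖c‖ → ‖c⁻¹‖ < 1 := fun c hc => by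
    rw [norm_inv]; exact inv_lt_one_of_one_lt₀ hc
  have hroot : ∀ σ : ℂ, (monodromy p q μ).charpoly.IsRoot σ ↔ σ = a⁻¹ ∨ σ = b⁻¹ ∨ σ = a * b := by
    intro σ
    simp [h, IsRoot, sub_eq_zero, or_assoc]
  have hne : (monodromy p q μ).charpoly ≠ 0 := (Matrix.charpoly_monic _).ne_zero
  constructor
  · rintro ⟨h1, h2⟩
    by_contra hτ
    have h3 : (monodromy p q μ).charpoly.IsRoot τ :=
      (rootMultiplicity_pos hne).1 (by rw [h1]; exact one_pos)
    have h4 := h2 (a * b) ((hroot _).2 (Or.inr (Or.inr rfl))) (Ne.symm hτ)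
    rcases (hroot τ).1 h3 with h5 | h5 | h5
    · have := hinv a ha; rw [← h5] at this; linarith
    · have := hinv b hb; rw [← h5] at this; linarith
    · exact hτ h5
  · rintro rfl
    have e1 : a * b ≠ a⁻¹ := fun h0 => by
      have := hinv a ha; rw [← h0] at this; linarith
    have e2 : a * b ≠ b⁻¹ := fun h0 => by
      have := hinv b hb; rw [← h0] at this; linarith
    constructor
    · rw [h] at hne ⊢
      rw [rootMultiplicity_mul hne, rootMultiplicity_mul (left_ne_zero_of_mul hne),
        rootMultiplicity_X_sub_C, rootMultiplicity_X_sub_C, rootMultiplicity_X_sub_C]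
      simp [e1, e2]
    · intro σ hσ hne'
      rcases (hroot σ).1 hσ with h5 | h5 | h5
      · have := hinv a ha; rw [h5]; linarith
      · have := hinv b hb; rw [h5]; linarith
      · exact absurd h5 hne'

lemma intervalIntegral_conj_eq (f : ℝ → ℂ) (a b : ℝ) :
    ∫ x in a..b, (starRingEnd ℂ) (f x) = (starRingEnd ℂ) (∫ x in a..b, f x) :=
  intervalIntegral.intervalIntegral_conj

lemma IsQuasiSolution.conj {p r : ℝ → ℂ} {Y : ℝ → Fin 3 → ℂ} (h : IsQuasiSolution p r Y) :
    IsQuasiSolution (fun t => starRingEnd ℂ (p t)) (fun t => starRingEnd ℂ (r t))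
      (fun t i => starRingEnd ℂ (Y t i)) := by
  rw [isQuasiSolution_iff] at h ⊢
  refine ⟨continuous_pi fun i => Complex.continuous_conj.comp ((continuous_apply i).comp h.1),
    fun i x => ?_⟩
  rw [h.2 i x, map_add, ← intervalIntegral_conj_eq]
  congr 2
  funext t
  fin_cases i <;> simp [qsRhs]

namespace Setting

variable {n : ℤ} {ρ σ L : ℝ} {g : Ecal → Fin 3 → ℂ} {l : Ecal → Fin 2 → ℂ} {p q : ℝ → ℂ}
  {E : Ecal} (h : Setting n ρ σ L g l p q E)

/-- The derivative at `1` of the normalized eigenfunction. -/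
def mulA (n : ℤ) (g : Ecal → Fin 3 → ℂ) (E : Ecal) : ℂ :=
  Complex.exp (zc n / 2) * sg n * (1 + g E 2)

/-- The multiplier that belongs to the left eigenvector. -/
def mulB (n : ℤ) (l : Ecal → Fin 2 → ℂ) (E : Ecal) : ℂ :=
  Complex.exp (zc n / 2) * sg n * (1 + l E 1)

lemma one_lt_norm_mul {k : ℂ} (hn : 0 < n) (hk : ‖k‖ ≤ 1 / 1000) :
    1 < ‖Complex.exp (zc n / 2) * sg n * (1 + k)‖ := by
  have h1 : 1 - 1 / 1000 ≤ ‖1 + k‖ := by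
    have := norm_sub_norm_le 1 (-k)
    rw [norm_one, norm_neg, sub_neg_eq_add] at this
    linarith
  have h2 : (2 : ℝ) ≤ ‖Complex.exp (zc n / 2)‖ := by
    rw [Complex.norm_exp]
    have h3 := three_le_zo hn
    have h4 : 1 ≤ (zc n / 2).re := by
      simp [zc]
      linarith
    linarith [Real.exp_le_exp.2 h4, Real.exp_one_gt_d9]
  rw [norm_mul, norm_mul, norm_sg, mul_one]
  nlinarith

include h

lemma one_lt_norm_mulA : 1 < ‖mulA n g E‖ := one_lt_norm_mul h.hn (h.norm_g_le 2)

lemma one_lt_norm_mulB : 1 < ‖mulB n l E‖ := one_lt_norm_mul h.hn (h.norm_l_le 1)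

/-- The monodromy matrix of the transposed equation in the scaled eigenbasis. -/
lemma exists_eigenbasis : ∃ G : Matrix (Fin 3) (Fin 3) ℂ,
    NMat (zc n) (shiftE (E, g E)) = Smat (zc n) * G * SinvMat (zc n) ∧ G.det = 1 ∧
    G.mulVec ![1, -1 - g E 1, g E 1] = mulA n g E • ![1, -1 - g E 1, g E 1] ∧
    Matrix.vecMul ![1 + g E 1 + l E 0, 1 + l E 0, l E 0] G =
      mulB n l E • ![1 + g E 1 + l E 0, 1 + l E 0, l E 0] := by
  have hzc0 := zc_ne_zero h.hn
  refine ⟨(Complex.exp (zc n / 2) * sg n) • pertMat (cN n) (BB n (shiftE (E, g E))), ?_, ?_, ?_, ?_⟩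
  · rw [NMat, TMat_zc, mul_smul, Matrix.mul_smul, Matrix.mul_smul, Matrix.smul_mul,
      Matrix.mul_smul, Matrix.smul_mul, Matrix.smul_mul]
  · have h1 := det_NMat hzc0 (tame_dz_zc h.hn) h.norm_shift_lt
    have h2 : (Smat (zc n)).det * (SinvMat (zc n)).det = 1 := by
      rw [← Matrix.det_mul, Smat_mul_SinvMat hzc0, Matrix.det_one]
    rw [NMat, TMat_zc, ← Matrix.smul_mul, ← Matrix.mul_smul, smul_smul, Matrix.det_mul,
      Matrix.det_mul] at h1
    linear_combination h1 - Matrix.det ((Complex.exp (zc n / 2) * sg n) •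
      pertMat (cN n) (BB n (shiftE (E, g E)))) * h2
  · have := h.right_eig
    rw [Xs] at this
    rw [Matrix.smul_mulVec, this, smul_smul, mulA]
  · rw [Matrix.vecMul_smul, h.left_eig, smul_smul, mulB]

lemma one_add_ne_zero : 1 + l E 0 ≠ 0 := by
  intro h0
  have h1 := h.norm_l_le 0
  have h2 : l E 0 = -1 := by linear_combination h0
  rw [h2] at h1
  norm_num at h1

lemma mulA_ne_zero : mulA n g E ≠ 0 := norm_pos_iff.1 (by linarith [h.one_lt_norm_mulA])

lemma mulB_ne_zero : mulB n l E ≠ 0 := norm_pos_iff.1 (by linarith [h.one_lt_norm_mulB])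

lemma charpoly_NMat : (NMat (zc n) (shiftE (E, g E))).charpoly =
    (Polynomial.X - Polynomial.C (mulA n g E)) * (Polynomial.X - Polynomial.C (mulB n l E)) *
      (Polynomial.X - Polynomial.C (mulA n g E * mulB n l E)⁻¹) := by
  obtain ⟨G, hN, hdet, h1, h2⟩ := h.exists_eigenbasis
  rw [hN, Matrix.charpoly_mul_comm, ← mul_assoc, SinvMat_mul_Smat (zc_ne_zero h.hn), one_mul]
  exact charpoly_eq_of_eigenvectors_of_det h.one_add_ne_zero h.mulA_ne_zero h.mulB_ne_zero
    hdet h1 h2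

lemma charpoly_monodromy : (monodromy p q (lam n g E)).charpoly =
    (Polynomial.X - Polynomial.C (mulA n g E)⁻¹) * (Polynomial.X - Polynomial.C (mulB n l E)⁻¹) *
      (Polynomial.X - Polynomial.C (mulA n g E * mulB n l E)) := by
  obtain ⟨G, hN, hdet, h1, h2⟩ := h.exists_eigenbasis
  have hzc0 := zc_ne_zero h.hn
  have hG : IsUnit G.det := by rw [hdet]; exact isUnit_one
  have h3 : lam n g E + g E 0 / 10000 * zc n ^ 2 = zc n ^ 3 := by rw [lam]; ring
  rw [← monodromy_add p q (lam n g E) (g E 0 / 10000 * zc n ^ 2), h3,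
    h.perCoef_shift.charpoly_monodromy hzc0 (tame_dz_zc h.hn) h.norm_shift_lt h.rep_shift]
  have h4 : (NMat (zc n) (shiftE (E, g E)))⁻¹ = Smat (zc n) * G⁻¹ * SinvMat (zc n) := by
    refine Matrix.inv_eq_right_inv ?_
    rw [hN]
    calc Smat (zc n) * G * SinvMat (zc n) * (Smat (zc n) * G⁻¹ * SinvMat (zc n)) =
        Smat (zc n) * (G * (SinvMat (zc n) * Smat (zc n)) * G⁻¹) * SinvMat (zc n) := by
          simp only [mul_assoc]
      _ = 1 := by
          rw [SinvMat_mul_Smat hzc0, mul_one, Matrix.mul_nonsing_inv _ hG, mul_one,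
            Smat_mul_SinvMat hzc0]
  rw [h4, Matrix.charpoly_mul_comm, ← mul_assoc, SinvMat_mul_Smat hzc0, one_mul]
  exact charpoly_inv_eq_of_eigenvectors_of_det h.one_add_ne_zero h.mulA_ne_zero h.mulB_ne_zero
    hdet h1 h2

lemma isTau3_iff (τ : ℂ) : IsTau3 p q (lam n g E) τ ↔ τ = mulA n g E * mulB n l E :=
  isTau3_iff_of_charpoly h.one_lt_norm_mulA h.one_lt_norm_mulB h.charpoly_monodromy τ

lemma tau3_eq : tau3 p q (lam n g E) = mulA n g E * mulB n l E :=
  epsilon_eq ((h.isTau3_iff _).2 rfl) fun _ => (h.isTau3_iff _).1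

lemma isNormalizedEigenfunction_iff (Y : ℝ → Fin 3 → ℂ) : IsNormalizedEigenfunction p q n Y ↔
    IsTransposeBVP p q (lam n g E) Y ∧ Y 0 1 = 1 := by
  rw [IsNormalizedEigenfunction, h.muT_eq]

lemma existsUnique_normalized : ∃! Y, IsNormalizedEigenfunction p q n Y := by
  obtain ⟨Y, hY⟩ := h.exists_normalized
  refine ⟨Y, (h.isNormalizedEigenfunction_iff Y).2 hY, fun Z hZ => ?_⟩
  have hZ' := (h.isNormalizedEigenfunction_iff Z).1 hZ
  exact h.normalized_unique hZ'.1 hZ'.2 hY.1 hY.2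

lemma yT_spec : IsTransposeBVP p q (lam n g E) (yT p q n) ∧ yT p q n 0 1 = 1 := by
  obtain ⟨Y, hY, -⟩ := h.existsUnique_normalized
  exact (h.isNormalizedEigenfunction_iff _).1 (Classical.epsilon_spec ⟨Y, hY⟩)

lemma yT_apply_one : yT p q n 1 1 = mulA n g E :=
  h.normalized_apply_one h.yT_spec.1 h.yT_spec.2

/-! ### Real coefficients -/

section Real

variable (hp : ∀ t, starRingEnd ℂ (p t) = p t) (hq : ∀ t, starRingEnd ℂ (q t) = q t)

include hp hq

lemma conj_isTransposeBVP {μ : ℂ} {Y : ℝ → Fin 3 → ℂ} (hY : IsTransposeBVP p q μ Y) :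
    IsTransposeBVP p q (starRingEnd ℂ μ) (fun t i => starRingEnd ℂ (Y t i)) := by
  obtain ⟨h1, h2, h3, h4⟩ := hY
  refine ⟨?_, by simp [h2], by simp [h3], by simp [h4]⟩
  have := h1.conj
  simp only [map_sub, hp, hq] at this
  exact this

/-- The conjugate is an eigenvalue of the same real problem and lies in the same domain, where the
eigenvalue is unique. Conjugation commutes with the principal cube root except on the negative axis,
and there λ is real already. -/
lemma conj_lam : starRingEnd ℂ (lam n g E) = lam n g E := by
  by_cases harg : (lam n g E).arg = π
  · rw [Complex.arg_eq_pi_iff] at harg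
    exact Complex.conj_eq_iff_im.2 harg.2
  · obtain ⟨hdom, Y, hY, hY0⟩ := h.isEigenvalue_lam
    refine h.eq_lam ⟨?_, _, h.conj_isTransposeBVP hp hq hY, fun h0 => hY0 ?_⟩
    · have h1 := Complex.cpow_conj (lam n g E) (1 / 3) harg
      have h2 : starRingEnd ℂ (1 / 3 : ℂ) = 1 / 3 := by
        rw [map_div₀, map_one, map_ofNat]
      rw [h2] at h1
      have h3 : (starRingEnd ℂ (lam n g E)) ^ (1 / 3 : ℂ) =
          starRingEnd ℂ (lam n g E ^ (1 / 3 : ℂ)) := by rw [h1, Complex.conj_conj]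
      change ‖(starRingEnd ℂ (lam n g E)) ^ (1 / 3 : ℂ) - (zo n : ℂ)‖ < 1
      have h4 : (zo n : ℂ) = starRingEnd ℂ (zo n : ℂ) := (Complex.conj_ofReal _).symm
      rw [h3, h4, ← map_sub, Complex.norm_conj]
      exact hdom
    · funext t i
      have := congrFun (congrFun h0 t) i
      simpa using this

lemma conj_mulA : starRingEnd ℂ (mulA n g E) = mulA n g E := by
  have h1 := h.conj_isTransposeBVP hp hq h.yT_spec.1
  rw [h.conj_lam hp hq] at h1
  have h2 := h.normalized_apply_one h1 (by simp [h.yT_spec.2])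
  rw [h.yT_apply_one] at h2
  exact h2

lemma conj_NMat : (NMat (zc n) (shiftE (E, g E))).map (starRingEnd ℂ) =
    NMat (zc n) (shiftE (E, g E)) := by
  have hzc0 := zc_ne_zero h.hn
  have hd := tame_dz_zc h.hn
  have happ := fun Y hY => h.perCoef_shift.apply_one hzc0 hd h.norm_shift_lt h.rep_shift (Y := Y)
    (h.isTransposeSolution_iff.1 hY)
  refine Matrix.ext_of_mulVec_single fun i => ?_
  obtain ⟨Y, hY, hY0⟩ := h.perCoef_shift.exists_isQuasiSolution hzc0 hd h.norm_shift_lt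
    h.rep_shift (Pi.single i 1)
  have hY' := h.isTransposeSolution_iff.2 hY
  have h1 := happ Y hY'
  have hYc : IsTransposeSolution p q (lam n g E) fun t i => starRingEnd ℂ (Y t i) := by
    have := IsQuasiSolution.conj hY'
    simp only [map_sub, hp, hq, h.conj_lam hp hq] at this
    exact this
  have h2 := happ _ hYc
  have h3 : (fun i => starRingEnd ℂ (Y 0 i)) = Pi.single i 1 := by
    rw [hY0]
    funext j
    simp [Pi.single_apply, apply_ite (starRingEnd ℂ)]
  rw [h3] at h2
  rw [hY0] at h1
  rw [← h2, h1]
  funext j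
  simp

/-- The matrix N is real, so the conjugate of b is one of a, b, 1/(ab). If it is a, then b is real
because a is; the last value is impossible since |b| > 1 > 1/|ab|. -/
lemma conj_mulB : starRingEnd ℂ (mulB n l E) = mulB n l E := by
  have h1 : (NMat (zc n) (shiftE (E, g E))).charpoly.IsRoot (mulB n l E) := by
    rw [h.charpoly_NMat]; simp [Polynomial.IsRoot]
  have h2 := h1.map (f := starRingEnd ℂ)
  rw [← Matrix.charpoly_map] at h2
  have h3 := h.conj_NMat hp hq
  have h4 : (NMat (zc n) (shiftE (E, g E))).charpoly.IsRoot (starRingEnd ℂ (mulB n l E)) := by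
    rw [← h3]; exact h2
  rw [h.charpoly_NMat] at h4
  simp only [Polynomial.IsRoot, Polynomial.eval_mul, Polynomial.eval_sub, Polynomial.eval_X,
    Polynomial.eval_C, mul_eq_zero, sub_eq_zero] at h4
  rcases h4 with (h4 | h4) | h4
  · have h5 := congrArg (starRingEnd ℂ) h4
    rw [Complex.conj_conj, h.conj_mulA hp hq] at h5
    rw [h4, h5]
  · exact h4
  · exfalso
    have h5 := congrArg norm h4
    have h6 : 1 < ‖mulA n g E * mulB n l E‖ := by
      rw [norm_mul]; nlinarith [h.one_lt_norm_mulA, h.one_lt_norm_mulB]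
    rw [Complex.norm_conj, norm_inv] at h5
    have := inv_lt_one_of_one_lt₀ h6
    linarith [h.one_lt_norm_mulB]

lemma exists_ofReal_eq {k : ℂ} (hk : ‖k‖ ≤ 1 / 1000)
    (hc : starRingEnd ℂ (Complex.exp (zc n / 2) * sg n * (1 + k)) =
      Complex.exp (zc n / 2) * sg n * (1 + k)) : ∃ x : ℝ, 0 < x ∧ (x : ℂ) = 1 + k := by
  have h1 : starRingEnd ℂ (Complex.exp (zc n / 2)) = Complex.exp (zc n / 2) := by
    rw [← Complex.exp_conj, map_div₀, map_ofNat, zc, Complex.conj_ofReal]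
  have h2 : starRingEnd ℂ (sg n) = sg n := by simp [sg]
  have h3 : starRingEnd ℂ (1 + k) = 1 + k := by
    rw [map_mul, map_mul, h1, h2] at hc
    exact mul_left_cancel₀ (mul_ne_zero (Complex.exp_ne_zero _) (sg_ne_zero n)) hc
  rw [Complex.conj_eq_iff_real] at h3
  obtain ⟨x, hx⟩ := h3
  refine ⟨x, ?_, hx.symm⟩
  have h4 : x = 1 + k.re := by
    have := congrArg Complex.re hx
    simpa using this.symm
  have h5 := (Complex.abs_re_le_norm k).trans hk
  rw [abs_le] at h5
  linarith

lemma exists_real : ∃ x y : ℝ, 0 < x ∧ 0 < y ∧ (x : ℂ) = 1 + g E 2 ∧ (y : ℂ) = 1 + l E 1 := by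
  obtain ⟨x, hx, hx'⟩ := h.exists_ofReal_eq hp hq (h.norm_g_le 2) (h.conj_mulA hp hq)
  obtain ⟨y, hy, hy'⟩ := h.exists_ofReal_eq hp hq (h.norm_l_le 1) (h.conj_mulB hp hq)
  exact ⟨x, y, hx, hy, hx', hy'⟩

lemma exists_tau3_eq : ∃ x y : ℝ, 0 < x ∧ 0 < y ∧ (x : ℂ) = 1 + g E 2 ∧ (y : ℂ) = 1 + l E 1 ∧
    tau3 p q (muT p q n) = ((Real.exp (zo n) * (x * y) : ℝ) : ℂ) := by
  obtain ⟨x, y, hx, hy, hx', hy'⟩ := h.exists_real hp hq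
  refine ⟨x, y, hx, hy, hx', hy', ?_⟩
  have h1 : Complex.exp (zc n / 2) * Complex.exp (zc n / 2) = Complex.exp (zo n) := by
    rw [← Complex.exp_add, add_halves, zc]
  rw [h.muT_eq, h.tau3_eq, mulA, mulB, ← hx', ← hy']
  push_cast
  linear_combination (sg n * sg n * x * y) * h1 + Complex.exp (zo n) * x * y * sg_mul_sg n

lemma normingWellDefined : (∃! μ, μ ∈ dom n ∧ IsTransposeEigenvalue p q μ) ∧
    (muT p q n).im = 0 ∧ (∃! Y, IsNormalizedEigenfunction p q n Y) ∧ yT p q n 1 1 ≠ 0 ∧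
    (∃! τ, IsTau3 p q (muT p q n) τ) ∧ (tau3 p q (muT p q n)).im = 0 ∧
    0 < (tau3 p q (muT p q n)).re := by
  obtain ⟨x, y, hx, hy, -, -, hτ⟩ := h.exists_tau3_eq hp hq
  refine ⟨⟨_, h.isEigenvalue_lam, fun _ => h.eq_lam⟩, ?_, h.existsUnique_normalized, ?_, ?_, ?_, ?_⟩
  · rw [h.muT_eq]
    exact Complex.conj_eq_iff_im.1 (h.conj_lam hp hq)
  · rw [h.yT_apply_one]; exact h.mulA_ne_zero
  · rw [h.muT_eq]
    exact ⟨_, (h.isTau3_iff _).2 rfl, fun _ => (h.isTau3_iff _).1⟩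
  · rw [hτ, Complex.ofReal_im]
  · rw [hτ, Complex.ofReal_re]; positivity

/-- The norming constants in terms of the eigenvectors of the scaled monodromy matrix. -/
lemma normingPos_eq : (normingPos p q n : ℂ) =
    4 * (π * n) ^ 2 * (Complex.log (1 + g E 2) - Complex.log (1 + l E 1)) := by
  obtain ⟨x, y, hx, hy, hx', hy', hτ⟩ := h.exists_tau3_eq hp hq
  have h1 : ‖mulA n g E‖ = Real.exp (zo n / 2) * x := by
    rw [mulA, ← hx', norm_mul, norm_mul, norm_sg, mul_one, Complex.norm_exp, Complex.norm_real,
      Real.norm_of_nonneg hx.le]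
    simp [zc]
  have hpos : 0 < Real.exp (zo n) * (x * y) := by positivity
  -- The exponentials cancel: |y'(1)| = exp(z/2) x and τ₃ = exp(z) x y leave (x/y)^(1/2). The
  -- resulting factor 1/2 turns 8(πn)² into 4(πn)².
  have h2 : Real.log ‖yT p q n 1 1 * tau3 p q (muT p q n) ^ (-(1 / 2) : ℂ)‖ =
      (Real.log x - Real.log y) / 2 := by
    rw [h.yT_apply_one, hτ, norm_mul, h1, Complex.norm_cpow_eq_rpow_re_of_pos hpos,
      Real.log_mul (by positivity) (by positivity), Real.log_mul (Real.exp_ne_zero _) hx.ne',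
      Real.log_rpow hpos, Real.log_mul (Real.exp_ne_zero _) (by positivity),
      Real.log_mul hx.ne' hy.ne', Real.log_exp, Real.log_exp]
    have : (-(1 / 2) : ℂ).re = -(1 / 2) := by norm_num
    rw [this]
    ring
  rw [normingPos, h2, ← hx', ← hy', ← Complex.ofReal_log hx.le, ← Complex.ofReal_log hy.le]
  push_cast
  ring

end Real

end Setting

/-! ### Expansion of the logarithm of the ratio of the multipliers -/

/-- Second order term of the expansion of the monodromy matrix. -/
def T2 (d : Fin 3 → ℂ) (V W : Ecal) (j l : Fin 3) : ℂ :=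
  ev1 j (KE d V (KE d W (X0 d (Pi.single l 1))))

lemma Tame.norm_X0_single_le {d : Fin 3 → ℂ} (h : Tame d) (l : Fin 3) :
    ‖X0 d (Pi.single l 1)‖ ≤ 3 := by
  refine (h.norm_X0_le _).trans ?_
  rw [Pi.norm_single, norm_one, mul_one]

lemma Tame.norm_KE_apply_le {d : Fin 3 → ℂ} (h : Tame d) (V : Ecal) (X : Curves) :
    ‖KE d V X‖ ≤ 18 * ‖V‖ * ‖X‖ :=
  ((KE d V).le_opNorm X).trans (by gcongr; exact h.norm_KE_le V)

lemma Tame.norm_T1_le {d : Fin 3 → ℂ} (h : Tame d) (V : Ecal) (j l : Fin 3) :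
    ‖T1 d V j l‖ ≤ 54 * ‖V‖ := by
  refine (norm_ev1_apply_le j _).trans ((h.norm_KE_apply_le V _).trans ?_)
  nlinarith [h.norm_X0_single_le l, norm_nonneg V]

lemma Tame.norm_T2_le {d : Fin 3 → ℂ} (h : Tame d) (V W : Ecal) (j l : Fin 3) :
    ‖T2 d V W j l‖ ≤ 972 * (‖V‖ * ‖W‖) := by
  refine (norm_ev1_apply_le j _).trans ((h.norm_KE_apply_le V _).trans ?_)
  calc _ ≤ 18 * ‖V‖ * (18 * ‖W‖ * 3) := by
        gcongr
        refine (h.norm_KE_apply_le W _).trans ?_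
        gcongr
        exact h.norm_X0_single_le l
    _ = _ := by ring

lemma T2_add_smul (d : Fin 3 → ℂ) (V W : Ecal) (a : ℂ) (j l : Fin 3) :
    T2 d (V + a • W) (V + a • W) j l = T2 d V V j l +
      a * (T2 d V W j l + T2 d W V j l) + a ^ 2 * T2 d W W j l := by
  simp [T2]
  ring

section

variable {n : ℤ} (hn : 0 < n) {E : Ecal} (hE : ‖E‖ < 1 / 36)

include hn hE

lemma norm_BB_sub_T1_sub_T2_le (i j : Fin 3) :
    ‖BB n E i j - sg n * T1 (dz (zc n)) E i j - sg n * T2 (dz (zc n)) E E i j‖ ≤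
      34992 * ‖E‖ ^ 3 := by
  have h := (tame_dz_zc hn).norm_TT_sub_le hE i j
  have h1 : (if i = j then diag0 n i else 0) =
      sg n * (if i = j then Complex.exp (dz (zc n) i) else 0) := by
    rw [mul_ite, sg_mul_exp_dz, mul_zero]
  have h2 : BB n E i j - sg n * T1 (dz (zc n)) E i j - sg n * T2 (dz (zc n)) E E i j =
      sg n * (TT (dz (zc n)) E i j - (if i = j then Complex.exp (dz (zc n) i) else 0)
      - ev1 i (KE (dz (zc n)) E (X0 (dz (zc n)) (Pi.single j 1)))
      - ev1 i (KE (dz (zc n)) E (KE (dz (zc n)) E (X0 (dz (zc n)) (Pi.single j 1))))) := by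
    have h3 : BB n E i j = sg n * TT (dz (zc n)) E i j - if i = j then diag0 n i else 0 := rfl
    rw [h3, h1, T1, T2]
    ring
  rw [h2, norm_mul, norm_sg, one_mul]
  exact h.trans_eq (by ring)

lemma norm_BB_sub_T1_le (i j : Fin 3) :
    ‖BB n E i j - sg n * T1 (dz (zc n)) E i j‖ ≤ 2000 * ‖E‖ ^ 2 := by
  have h1 := norm_BB_sub_T1_sub_T2_le hn hE i j
  have h2 := (tame_dz_zc hn).norm_T2_le E E i j
  have h3 : ‖sg n * T2 (dz (zc n)) E E i j‖ ≤ 972 * (‖E‖ * ‖E‖) := by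
    rw [norm_mul, norm_sg, one_mul]; exact h2
  have h4 := norm_add_le_of_le h1 h3
  rw [sub_add_cancel] at h4
  refine h4.trans ?_
  nlinarith [mul_nonneg (sq_nonneg ‖E‖) (sub_pos.2 hE).le]

end

lemma norm_log_sub_le {k : ℂ} (hk : ‖k‖ ≤ 1 / 1000) :
    ‖Complex.log (1 + k) - k‖ ≤ ‖k‖ ^ 2 := by
  refine (Complex.norm_log_one_add_sub_self_le (by linarith)).trans ?_
  have : (1 - ‖k‖)⁻¹ ≤ 2 := by
    rw [inv_le_comm₀ (by linarith) (by norm_num)]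
    linarith
  nlinarith [sq_nonneg ‖k‖]

/-- The logarithm of the ratio of the multipliers. -/
def logRatio (g : Ecal → Fin 3 → ℂ) (l : Ecal → Fin 2 → ℂ) (E : Ecal) : ℂ :=
  Complex.log (1 + g E 2) - Complex.log (1 + l E 1)

/-- The estimate of the fixed points in terms of the perturbation. -/
lemma norm_fixed_points_le {c s k u k' : ℂ} {b : Mat} {β : ℝ} (hc : ‖c‖ ≤ 1 / 10) (hb : ‖b‖ ≤ β)
    (hs0 : ‖s‖ ≤ 1 / 1000) (hk0 : ‖k‖ ≤ 1 / 1000) (hu0 : ‖u‖ ≤ 1 / 1000) (hk0' : ‖k'‖ ≤ 1 / 1000)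
    (hs : s = (b 2 0 - (1 + s) * b 2 1 + s * b 2 2 - s * k) / (1 - c))
    (hk : k = -b 1 0 + (1 + s) * b 1 1 - s * b 1 2 - s * k)
    (hu : u = ((1 + s + u) * b 0 2 + (1 + u) * b 1 2 + u * b 2 2 - u * k') / (1 - c))
    (hk' : k' = (1 + s + u) * b 0 1 + (1 + u) * b 1 1 + u * b 2 1 - u * k') :
    ‖s‖ ≤ 5 * β ∧ ‖k‖ ≤ 5 * β ∧
      ‖Complex.log (1 + k) - Complex.log (1 + k') + (b 0 1 + b 1 0)‖ ≤ 300 * β ^ 2 := by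
  have hbe := norm_entry_le hb
  have hβ0 : 0 ≤ β := (norm_nonneg _).trans hb
  have h1s : ‖1 + s‖ ≤ 1001 / 1000 := (norm_add_le_of_le norm_one.le hs0).trans (by norm_num)
  have h1u : ‖1 + u‖ ≤ 1001 / 1000 := (norm_add_le_of_le norm_one.le hu0).trans (by norm_num)
  have h1su : ‖1 + s + u‖ ≤ 1002 / 1000 := (norm_add_le_of_le h1s hu0).trans (by norm_num)
  have es : ‖s‖ ≤ 5 * β := by
    have := norm_div_one_sub_le hc (norm_sub_le_of_le (norm_add_le_of_le (norm_sub_le_of_le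
      (hbe 2 0) (norm_mul_le_of_le h1s (hbe 2 1))) (norm_mul_le_of_le hs0 (hbe 2 2)))
        (norm_mul_le_of_le (le_refl ‖s‖) hk0))
    rw [← hs] at this
    linarith [norm_nonneg s]
  have ek : ‖k‖ ≤ 5 * β := by
    have := norm_sub_le_of_le (norm_sub_le_of_le (norm_add_le_of_le ((norm_neg _).trans_le
      (hbe 1 0)) (norm_mul_le_of_le h1s (hbe 1 1))) (norm_mul_le_of_le hs0 (hbe 1 2)))
        (norm_mul_le_of_le hs0 (le_refl ‖k‖))
    rw [← hk] at this
    linarith [norm_nonneg k]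
  have eu : ‖u‖ ≤ 5 * β := by
    have := norm_div_one_sub_le hc (norm_sub_le_of_le (norm_add_le_of_le (norm_add_le_of_le
      (norm_mul_le_of_le h1su (hbe 0 2)) (norm_mul_le_of_le h1u (hbe 1 2)))
        (norm_mul_le_of_le hu0 (hbe 2 2))) (norm_mul_le_of_le (le_refl ‖u‖) hk0'))
    rw [← hu] at this
    linarith [norm_nonneg u]
  have ek' : ‖k'‖ ≤ 5 * β := by
    have := norm_sub_le_of_le (norm_add_le_of_le (norm_add_le_of_le
      (norm_mul_le_of_le h1su (hbe 0 1)) (norm_mul_le_of_le h1u (hbe 1 1)))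
        (norm_mul_le_of_le hu0 (hbe 2 1))) (norm_mul_le_of_le hu0 (le_refl ‖k'‖))
    rw [← hk'] at this
    linarith [norm_nonneg k']
  refine ⟨es, ek, ?_⟩
  -- The entry b 1 1 occurs in both k and k' and cancels in k − k'. What remains is −(b 0 1 + b 1
  -- 0), up to products of two small quantities.
  have e1 : Complex.log (1 + k) - Complex.log (1 + k') + (b 0 1 + b 1 0) =
      (Complex.log (1 + k) - k) - (Complex.log (1 + k') - k') + (s * (b 1 1 - b 1 2 - k)) -
        ((s + u) * b 0 1 + u * (b 1 1 + b 2 1 - k')) := by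
    linear_combination hk - hk'
  have l1 := (norm_log_sub_le hk0).trans (pow_le_pow_left₀ (norm_nonneg _) ek 2)
  have l2 := (norm_log_sub_le hk0').trans (pow_le_pow_left₀ (norm_nonneg _) ek' 2)
  rw [e1]
  refine (norm_sub_le_of_le (norm_add_le_of_le (norm_sub_le_of_le l1 l2) (norm_mul_le_of_le es
    (norm_sub_le_of_le (norm_sub_le_of_le (hbe 1 1) (hbe 1 2)) ek))) (norm_add_le_of_le
      (norm_mul_le_of_le (norm_add_le_of_le es eu) (hbe 0 1)) (norm_mul_le_of_le eu
        (norm_sub_le_of_le (norm_add_le_of_le (hbe 1 1) (hbe 2 1)) ek')))).trans ?_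
  nlinarith [sq_nonneg β]

section

variable {n : ℤ} {ρ σ L : ℝ} {g : Ecal → Fin 3 → ℂ} {l : Ecal → Fin 2 → ℂ}

lemma IsSpec.fixed_eqs (h : IsSpec n ρ σ L g l) {E : Ecal} (hE : ‖E‖ < ρ) :
    (let b := BB n (shiftE (E, g E))
    let s := g E 1
    let k := g E 2
    let u := l E 0
    let k' := l E 1
    b 0 0 - b 0 1 + s * (b 0 2 - b 0 1) + b 1 0 - (1 + s) * b 1 1 + s * b 1 2 + s * k = 0 ∧
    s = (b 2 0 - (1 + s) * b 2 1 + s * b 2 2 - s * k) / (1 - cN n) ∧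
    k = -b 1 0 + (1 + s) * b 1 1 - s * b 1 2 - s * k ∧
    u = ((1 + s + u) * b 0 2 + (1 + u) * b 1 2 + u * b 2 2 - u * k') / (1 - cN n) ∧
    k' = (1 + s + u) * b 0 1 + (1 + u) * b 1 1 + u * b 2 1 - u * k') := by
  have r := h.right E hE
  have l' := h.left E hE
  have r0 := congrFun r 0
  have r1 := congrFun r 1
  have r2 := congrFun r 2
  have l0 := congrFun l' 0
  have l1 := congrFun l' 1
  simp only [rightFix, rightMap, leftMap, Matrix.cons_val_zero, Matrix.cons_val_one,
    Matrix.cons_val] at r0 r1 r2 l0 l1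
  refine ⟨?_, r1.symm, r2.symm, l0.symm, l1.symm⟩
  rw [sub_eq_self] at r0
  exact (mul_eq_zero.1 r0).resolve_left (by simp)

end

namespace Setting

variable {n : ℤ} {ρ σ L : ℝ} {g : Ecal → Fin 3 → ℂ} {l : Ecal → Fin 2 → ℂ} {p q : ℝ → ℂ}
  {E : Ecal} (h : Setting n ρ σ L g l p q E)

include h

set_option maxHeartbeats 1600000 in
/-- The logarithm of the ratio of the multipliers up to terms of second order. -/
lemma norm_logRatio_add_le {τ θ : ℝ} (hτ : ∀ i j, ‖T1 (dz (zc n)) E i j‖ ≤ τ)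
    (hθ : ∀ i j, i ≠ j → ‖T2 (dz (zc n)) E E i j‖ ≤ θ) :
    ‖logRatio g l E + sg n * (T1 (dz (zc n)) E 0 1 + T1 (dz (zc n)) E 1 0)‖ ≤
      10 ^ 40 * (1 + L) ^ 6 * ((τ + ‖E‖ ^ 2) ^ 2 + ‖E‖ * (τ + ‖E‖ ^ 2) + ‖E‖ ^ 3) + 2 * θ := by
  have hn := h.hn
  have hd := tame_dz_zc hn
  have hL := h.hL
  set x := ‖E‖ with hx
  have hx0 : 0 ≤ x := norm_nonneg E
  have hτ0 : 0 ≤ τ := (norm_nonneg _).trans (hτ 0 0)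
  set m := g E 0 / 10000 with hm
  have hE' : shiftE (E, g E) = E + m • oneQ := rfl
  have hlt := h.norm_shift_lt
  obtain ⟨e0, e1, e2, e3, e4⟩ := h.spec.fixed_eqs h.small
  rw [hE'] at e0 e1 e2 e3 e4 hlt
  set b := BB n (E + m • oneQ) with hb
  set E' := E + m • oneQ with hE'def
  have hgi : ∀ i, ‖g E i‖ ≤ (1 + L) * x := fun i =>
    ((norm_le_pi_norm (g E) i).trans (h.spec.g_le E h.small)).trans (by nlinarith)
  have hmx : ‖m‖ ≤ (1 + L) * x := by
    rw [hm, norm_div]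
    have : ‖(10000 : ℂ)‖ = 10000 := by norm_num
    rw [this]
    have := hgi 0
    have h2 := norm_nonneg (g E 0)
    linarith
  have hE'x : ‖E'‖ ≤ 2 * (1 + L) * x := by
    have := norm_add_le_of_le (le_refl ‖E‖) (norm_smul m oneQ).le
    rw [norm_oneQ, mul_one, ← hx] at this
    nlinarith
  have hbn : ‖b‖ ≤ 504 * (1 + L) * x := (norm_BB_le_mul hn hlt).trans (by linarith)
  have hbe := norm_entry_le hbn
  set D : Mat := fun i j => b i j - sg n * T1 (dz (zc n)) E' i j with hD
  have hDn : ∀ i j, ‖D i j‖ ≤ 8000 * (1 + L) ^ 2 * x ^ 2 := fun i j => by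
    refine (norm_BB_sub_T1_le hn hlt i j).trans ?_
    have := pow_le_pow_left₀ (norm_nonneg _) hE'x 2
    nlinarith
  have hT1 : ∀ i j, T1 (dz (zc n)) E' i j = T1 (dz (zc n)) E i j + m * T1 (dz (zc n)) oneQ i j :=
    fun i j => by rw [hE'def, T1_add, T1_smul]
  have hsT : ∀ i j, ‖sg n * T1 (dz (zc n)) E i j‖ ≤ τ := fun i j => by
    rw [norm_mul, norm_sg, one_mul]; exact hτ i j
  have b00 : b 0 0 = D 0 0 + sg n * T1 (dz (zc n)) E 0 0 + m * cc 0 := by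
    rw [← sg_mul_T1_oneQ_zero n]
    simp only [hD, hT1]
    ring
  have b11 : b 1 1 = D 1 1 + sg n * T1 (dz (zc n)) E 1 1 + m * cc 1 := by
    rw [← sg_mul_T1_oneQ_one n]
    simp only [hD, hT1]
    ring
  -- In contrast to the diagonal entries, these contain no term linear in m, by `T1_oneQ_zero_one`
  -- and `T1_oneQ_one_zero`.
  have b01 : b 0 1 = D 0 1 + sg n * T1 (dz (zc n)) E 0 1 := by
    simp only [hD, hT1, T1_oneQ_zero_one hn]
    ring
  have b10 : b 1 0 = D 1 0 + sg n * T1 (dz (zc n)) E 1 0 := by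
    simp only [hD, hT1, T1_oneQ_one_zero hn]
    ring
  clear_value D
  -- the spectral parameter
  have hmb : ‖m‖ ≤ 10 ^ 6 * (1 + L) ^ 2 * (τ + x ^ 2) := by
    have hcc : cc 0 - cc 1 = -(Complex.I * √3) / 3 := by
      simp only [cc, be_sq]
      simp [al]
      ring
    -- The first fixed point equation solved for m, whose coefficient is cc 0 − cc 1. The other
    -- terms are of size τ + ‖E‖², which is smaller than the general bound L‖E‖ on the unknowns.
    have hme : m = -(Complex.I * √3) * (D 0 0 + sg n * T1 (dz (zc n)) E 0 0 - b 0 1 + b 1 0 -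
        (D 1 1 + sg n * T1 (dz (zc n)) E 1 1) +
        g E 1 * (b 0 2 - b 0 1 - b 1 1 + b 1 2 + g E 2)) := by
      rw [b00, b11] at e0
      rw [b11]
      linear_combination (Complex.I * √3) * e0 - (Complex.I * √3 * m) * hcc +
        (m / 3 * (√3 : ℂ) ^ 2) * Complex.I_sq - m / 3 * sqrt_three_sq
    have hI : ‖-(Complex.I * (√3 : ℝ))‖ ≤ 2 := by
      rw [norm_neg, norm_mul, Complex.norm_I, one_mul, Complex.norm_real,
        Real.norm_of_nonneg (by positivity), Real.sqrt_le_left (by norm_num)]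
      norm_num
    have hb01 : ‖b 0 1‖ ≤ 8000 * (1 + L) ^ 2 * x ^ 2 + τ := by
      rw [b01]; exact norm_add_le_of_le (hDn _ _) (hsT _ _)
    have hb10 : ‖b 1 0‖ ≤ 8000 * (1 + L) ^ 2 * x ^ 2 + τ := by
      rw [b10]; exact norm_add_le_of_le (hDn _ _) (hsT _ _)
    rw [hme]
    refine (norm_mul_le_of_le hI (norm_add_le_of_le (norm_sub_le_of_le (norm_add_le_of_le
      (norm_sub_le_of_le (norm_add_le_of_le (hDn 0 0) (hsT 0 0)) hb01) hb10)
        (norm_add_le_of_le (hDn 1 1) (hsT 1 1))) (norm_mul_le_of_le (hgi 1) (norm_add_le_of_le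
          (norm_add_le_of_le (norm_sub_le_of_le (norm_sub_le_of_le (hbe 0 2) (hbe 0 1)) (hbe 1 1))
            (hbe 1 2)) (hgi 2))))).trans ?_
    have hL2 : 1 ≤ (1 + L) ^ 2 := one_le_pow₀ (by linarith)
    have hx2 : 0 ≤ (1 + L) ^ 2 * x ^ 2 := by positivity
    nlinarith [mul_nonneg hτ0 (sub_nonneg.2 hL2)]
  -- the perturbation
  set y := τ + x ^ 2 with hy
  have hy0 : 0 ≤ y := by positivity
  have hL2 : 1 ≤ (1 + L) ^ 2 := one_le_pow₀ (by linarith)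
  have hbβ : ‖b‖ ≤ 10 ^ 8 * (1 + L) ^ 2 * y := by
    refine (pi_norm_le_iff_of_nonneg (by positivity)).2 fun i =>
      (pi_norm_le_iff_of_nonneg (by positivity)).2 fun j => ?_
    have h1 : b i j = D i j + sg n * T1 (dz (zc n)) E i j +
        m * (sg n * T1 (dz (zc n)) oneQ i j) := by
      simp only [hD, hT1]
      ring
    have h2 : ‖sg n * T1 (dz (zc n)) oneQ i j‖ ≤ 54 := by
      have := hd.norm_T1_le oneQ i j
      rw [norm_oneQ] at this
      rw [norm_mul, norm_sg, one_mul]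
      linarith
    rw [h1]
    refine (norm_add_le_of_le (norm_add_le_of_le (hDn i j) (hsT i j))
      (norm_mul_le_of_le hmb h2)).trans ?_
    have h3 : 0 ≤ (1 + L) ^ 2 * x ^ 2 := by positivity
    have h4 : 0 ≤ ((1 + L) ^ 2 - 1) * τ := mul_nonneg (by linarith) hτ0
    have h5 : 0 ≤ (1 + L) ^ 2 * τ := by positivity
    rw [hy]
    nlinarith
  obtain ⟨-, -, hlog⟩ := norm_fixed_points_le (norm_cN_le hn) hbβ (h.norm_g_le 1) (h.norm_g_le 2)
    (h.norm_l_le 0) (h.norm_l_le 1) e1 e2 e3 e4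
  -- the off-diagonal entries
  have hoff : ∀ i j, i ≠ j → T1 (dz (zc n)) oneQ i j = 0 →
      ‖b i j - sg n * T1 (dz (zc n)) E i j‖ ≤
        θ + 10 ^ 16 * (1 + L) ^ 4 * (x * y + y ^ 2 + x ^ 3) := by
    intro i j hij h1
    have h2 := norm_BB_sub_T1_sub_T2_le hn hlt i j
    rw [hT1, h1, mul_zero, add_zero, T2_add_smul] at h2
    have h3 : b i j - sg n * T1 (dz (zc n)) E i j =
        (b i j - sg n * T1 (dz (zc n)) E i j - sg n * (T2 (dz (zc n)) E E i j +
          m * (T2 (dz (zc n)) E oneQ i j + T2 (dz (zc n)) oneQ E i j) +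
          m ^ 2 * T2 (dz (zc n)) oneQ oneQ i j)) + sg n * (T2 (dz (zc n)) E E i j +
          m * (T2 (dz (zc n)) E oneQ i j + T2 (dz (zc n)) oneQ E i j) +
          m * (m * T2 (dz (zc n)) oneQ oneQ i j)) := by ring
    have h4 := hd.norm_T2_le E oneQ i j
    have h5 := hd.norm_T2_le oneQ E i j
    have h6 := hd.norm_T2_le oneQ oneQ i j
    rw [norm_oneQ] at h4 h5 h6
    rw [h3]
    refine (norm_add_le_of_le h2 (norm_mul_le_of_le (norm_sg n).le (norm_add_le_of_le
      (norm_add_le_of_le (hθ i j hij) (norm_mul_le_of_le hmb (norm_add_le_of_le h4 h5)))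
        (norm_mul_le_of_le hmb (norm_mul_le_of_le hmb h6))))).trans ?_
    have h7 := pow_le_pow_left₀ (norm_nonneg _) hE'x 3
    have hL3 : (1 + L) ^ 3 ≤ (1 + L) ^ 4 := pow_le_pow_right₀ (by linarith) (by norm_num)
    have hL4 : (1 + L) ^ 2 ≤ (1 + L) ^ 4 := pow_le_pow_right₀ (by linarith) (by norm_num)
    have i1 : (1 + L) ^ 3 * x ^ 3 ≤ (1 + L) ^ 4 * x ^ 3 :=
      mul_le_mul_of_nonneg_right hL3 (by positivity)
    have i2 : (1 + L) ^ 2 * (x * y) ≤ (1 + L) ^ 4 * (x * y) :=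
      mul_le_mul_of_nonneg_right hL4 (by positivity)
    have i3 : 0 ≤ (1 + L) ^ 4 * x ^ 3 := by positivity
    have i4 : 0 ≤ (1 + L) ^ 4 * (x * y) := by positivity
    have i5 : 0 ≤ (1 + L) ^ 4 * y ^ 2 := by positivity
    have i6 : 34992 * ‖E'‖ ^ 3 ≤ 34992 * 8 * ((1 + L) ^ 3 * x ^ 3) := by
      refine (mul_le_mul_of_nonneg_left h7 (by norm_num)).trans_eq (by ring)
    rw [← hx]
    calc _ ≤ 34992 * 8 * ((1 + L) ^ 3 * x ^ 3) + (θ + 10 ^ 6 * 1944 * ((1 + L) ^ 2 * (x * y)) +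
          10 ^ 12 * 972 * ((1 + L) ^ 4 * y ^ 2)) := by
            refine (add_le_add_left i6 _).trans_eq ?_
            ring
      _ ≤ _ := by nlinarith
  have o1 := hoff 0 1 (by decide) (T1_oneQ_zero_one hn)
  have o2 := hoff 1 0 (by decide) (T1_oneQ_one_zero hn)
  have hfin : logRatio g l E + sg n * (T1 (dz (zc n)) E 0 1 + T1 (dz (zc n)) E 1 0) =
      (Complex.log (1 + g E 2) - Complex.log (1 + l E 1) + (b 0 1 + b 1 0)) -
        (b 0 1 - sg n * T1 (dz (zc n)) E 0 1) - (b 1 0 - sg n * T1 (dz (zc n)) E 1 0) := by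
    rw [logRatio]
    ring
  rw [hfin]
  refine (norm_sub_le_of_le (norm_sub_le_of_le hlog o1) o2).trans ?_
  have hL6 : (1 + L) ^ 4 ≤ (1 + L) ^ 6 := pow_le_pow_right₀ (by linarith) (by norm_num)
  have j1 := mul_le_mul_of_nonneg_right hL6 (show 0 ≤ x * y + y ^ 2 + x ^ 3 by positivity)
  have j2 : 0 ≤ (1 + L) ^ 6 * (x * y) := by positivity
  have j3 : 0 ≤ (1 + L) ^ 6 * y ^ 2 := by positivity
  have j4 : 0 ≤ (1 + L) ^ 6 * x ^ 3 := by positivity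
  have j5 := mul_le_mul_of_nonneg_right hL6 (show 0 ≤ y ^ 2 by positivity)
  nlinarith

end Setting

/-! ### Oscillatory integrals -/

/-- Integration by parts against exp((d l − d j)t) gains the reciprocal of the difference of the
exponents. The factor 9 bounds the product of two exponentials, each at most 3. -/
lemma Tame.norm_oscillatory_le {d : Fin 3 → ℂ} (hd : Tame d) {j l : Fin 3} (hjl : d l ≠ d j)
    {f f' : ℝ → ℂ} (hf : HasPrim f f') {S A : ℝ} (hS : ∀ t ∈ Icc (0 : ℝ) 1, ‖f t‖ ≤ S)
    (hA : ∫ t in (0 : ℝ)..1, ‖f' t‖ ≤ A) {x : ℝ} (hx : x ∈ Icc (0 : ℝ) 1) :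
    ‖∫ t in (0 : ℝ)..x, Complex.exp (d j * (x - t)) * (f t * Complex.exp (d l * t))‖ ≤
      9 * (S + A) / ‖d l - d j‖ := by
  have hδ : 0 < ‖d l - d j‖ := norm_pos_iff.2 (sub_ne_zero.2 hjl)
  have h0 : (0 : ℝ) ∈ Icc (0 : ℝ) 1 := by simp
  have hS0 : 0 ≤ S := (norm_nonneg _).trans (hS 0 h0)
  have hx' : x ∈ uIcc (0 : ℝ) 1 := by rwa [uIcc_of_le zero_le_one]
  have hi := hf.intervalIntegrable
  have i1 : IntervalIntegrable (fun t : ℝ => Complex.exp (d j * (x - t)) *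
      (f t * Complex.exp (d l * t))) volume 0 x :=
    (IntervalIntegrable.mono_Icc (hi.mul_continuousOn (by fun_prop)) hx).continuousOn_mul
      (by fun_prop)
  have i2 : IntervalIntegrable (fun t : ℝ => Complex.exp (d j * (x - t)) *
      (f' t * Complex.exp (d l * t))) volume 0 x :=
    (IntervalIntegrable.mono_Icc (hf.1.mul_continuousOn (by fun_prop)) hx).continuousOn_mul
      (by fun_prop)
  have h1 := ((HasPrim.cexp (d l - d j)).mul hf).2 x hx
  beta_reduce at h1
  have h2 : (d l - d j) * ∫ t in (0 : ℝ)..x, Complex.exp (d j * (x - t)) *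
      (f t * Complex.exp (d l * t)) = Complex.exp (d l * x) * f x - Complex.exp (d j * x) * f 0 -
        ∫ t in (0 : ℝ)..x, Complex.exp (d j * (x - t)) * (f' t * Complex.exp (d l * t)) := by
    have h3 : Complex.exp (d l * x) = Complex.exp (d j * x) * Complex.exp ((d l - d j) * x) := by
      rw [← Complex.exp_add]; ring_nf
    have h4 : ∀ t : ℝ, Complex.exp (d j * x) * Complex.exp ((d l - d j) * t) =
        Complex.exp (d j * (x - t)) * Complex.exp (d l * t) := fun t => by
      rw [← Complex.exp_add, ← Complex.exp_add]; ring_nf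
    rw [h3, mul_assoc, h1, mul_add, ← intervalIntegral.integral_const_mul,
      ← intervalIntegral.integral_const_mul, eq_sub_iff_add_eq,
      ← intervalIntegral.integral_add (i1.const_mul _) i2]
    simp only [Complex.ofReal_zero, mul_zero, Complex.exp_zero, one_mul, add_sub_cancel_left]
    congr 1
    funext t
    linear_combination (-(d l - d j) * f t - f' t) * h4 t
  have h5 : ‖∫ t in (0 : ℝ)..x, Complex.exp (d j * (x - t)) *
      (f' t * Complex.exp (d l * t))‖ ≤ 9 * A := by
    calc _ ≤ ∫ t in (0 : ℝ)..x, 9 * ‖f' t‖ := by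
          refine intervalIntegral.norm_integral_le_of_norm_le hx.1 (.of_forall fun t ht => ?_)
            ((IntervalIntegrable.mono_Icc hf.1 hx).norm.const_mul _)
          have e1 := hd.norm_exp_le j (s := x - t) ⟨by linarith [ht.2], by linarith [ht.1, hx.2]⟩
          have e2 := hd.norm_exp_le l (s := t) ⟨ht.1.le, ht.2.trans hx.2⟩
          push_cast at e1
          refine (norm_mul_le_of_le e1 (norm_mul_le_of_le le_rfl e2)).trans_eq ?_
          ring
      _ ≤ ∫ t in (0 : ℝ)..1, 9 * ‖f' t‖ :=
          intervalIntegral.integral_mono_interval le_rfl hx.1 hx.2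
            (.of_forall fun t => by positivity) (hf.1.norm.const_mul _)
      _ ≤ 9 * A := by rw [intervalIntegral.integral_const_mul]; linarith
  rw [le_div_iff₀ hδ, mul_comm, ← norm_mul, h2]
  refine (norm_sub_le_of_le (norm_sub_le_of_le (norm_mul_le_of_le (hd.norm_exp_le l hx) (hS x hx))
    (norm_mul_le_of_le (hd.norm_exp_le j hx) (hS 0 h0))) h5).trans ?_
  linarith

lemma one_le_norm_al_sub {j l : Fin 3} (h : j ≠ l) : 1 ≤ ‖al l - al j‖ := by
  have h3 : √3 * √3 = (3 : ℝ) := Real.mul_self_sqrt (by norm_num)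
  have : 1 ≤ ‖al l - al j‖ ^ 2 := by
    rw [Complex.sq_norm, Complex.normSq_apply]
    fin_cases j <;> fin_cases l <;> simp [al] at h ⊢ <;> nlinarith
  exact (one_le_sq_iff₀ (norm_nonneg _)).1 this

lemma le_norm_dz_sub {z : ℂ} {j l : Fin 3} (h : j ≠ l) : ‖z‖ ≤ ‖dz z l - dz z j‖ := by
  have : dz z l - dz z j = z * (al l - al j) := by rw [dz, dz]; ring
  rw [this, norm_mul]
  exact le_mul_of_one_le_right (norm_nonneg _) (one_le_norm_al_sub h)

lemma aa_zero_one : aa 0 1 = al 0 / 3 := by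
  rw [aa, be_sq]; simp [al, be]; ring_nf; simp [sqrt_three_sq]; ring

lemma aa_one_zero : aa 1 0 = al 1 / 3 := by
  rw [aa, be_sq]; simp [al, be]; ring_nf; simp [sqrt_three_sq]; ring

lemma cc_eq (k : Fin 3) : cc k = -al k / 3 := by rw [cc, be_sq]

lemma bn_eq (n : ℤ) (t : ℝ) : (bn n t : ℂ) =
    al 0 * Complex.exp (-(n * (2 * π * Complex.I)) * t) +
      al 1 * Complex.exp (n * (2 * π * Complex.I) * t) := by
  have e1 : (n * (2 * π * Complex.I) * t : ℂ) = ((2 * π * n * t : ℝ) : ℂ) * Complex.I := by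
    push_cast; ring
  have e2 : (-(n * (2 * π * Complex.I)) * t : ℂ) = ((-(2 * π * n * t) : ℝ) : ℂ) * Complex.I := by
    push_cast; ring
  rw [e1, e2, Complex.exp_mul_I, Complex.exp_mul_I, ← Complex.ofReal_cos, ← Complex.ofReal_sin,
    ← Complex.ofReal_cos, ← Complex.ofReal_sin, Real.cos_neg, Real.sin_neg, bn]
  simp only [al, Matrix.cons_val_zero, Matrix.cons_val_one]
  push_cast
  linear_combination ((√3 : ℂ) * Complex.sin (2 * π * n * t)) * Complex.I_sq

lemma continuous_bn (n : ℤ) : Continuous (bn n) := by unfold bn; fun_prop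

/-- The first order term of the logarithm of the ratio of the multipliers. -/
lemma neg_sg_mul_T1 (n : ℤ) (E : Ecal) :
    -(sg n * (T1 (dz (zc n)) E 0 1 + T1 (dz (zc n)) E 1 0)) =
      ∫ t in (0 : ℝ)..1, (bn n t / 3 : ℂ) * (E.2 t - E.1 t) := by
  have hi : ∀ a b : Fin 3, IntervalIntegrable (fun t : ℝ => Complex.exp (dz (zc n) a * (1 - t)) *
      RR E a b t * Complex.exp (dz (zc n) b * t)) volume 0 1 := fun a b =>
    ((RR_intervalIntegrable E a b).continuousOn_mul (by fun_prop)).mul_continuousOn (by fun_prop)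
  rw [T1_eq, T1_eq, ← intervalIntegral.integral_add (hi 0 1) (hi 1 0), ← neg_mul,
    ← intervalIntegral.integral_const_mul]
  congr 1
  funext t
  have e1 : Complex.exp (dz (zc n) 0 * (1 - t)) * Complex.exp (dz (zc n) 1 * t) =
      sg n * Complex.exp (-(n * (2 * π * Complex.I)) * t) := by
    rw [← exp_dz_zc_zero, ← Complex.exp_add, ← Complex.exp_add, dz_zc_zero, dz_zc_one]
    ring_nf
  have e2 : Complex.exp (dz (zc n) 1 * (1 - t)) * Complex.exp (dz (zc n) 0 * t) =
      sg n * Complex.exp (n * (2 * π * Complex.I) * t) := by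
    rw [← exp_dz_zc_one, ← Complex.exp_add, ← Complex.exp_add, dz_zc_zero, dz_zc_one]
    ring_nf
  rw [bn_eq, RR, RR, aa_zero_one, aa_one_zero, cc_eq, cc_eq]
  linear_combination (-sg n * (al 0 / 3 * E.1 t + -al 0 / 3 * E.2 t)) * e1 +
    (-sg n * (al 1 / 3 * E.1 t + -al 1 / 3 * E.2 t)) * e2 +
    (-(al 0 * Complex.exp (-(n * (2 * π * Complex.I)) * t) +
      al 1 * Complex.exp (n * (2 * π * Complex.I) * t)) / 3 * (E.1 t - E.2 t)) * sg_mul_sg n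

/-! ### Smooth first coefficients -/

/-- A pair of coefficients with an absolutely continuous first component of mean value zero,
scaled at the point `z`. -/
structure SmoothPair (z M : ℝ) (p p' q : ℝ → ℂ) (E : Ecal) : Prop where
  one_le : 1 ≤ z
  prim : HasPrim p p'
  norm_le : ∀ t ∈ Icc (0 : ℝ) 1, ‖p t‖ ≤ M
  int_le : ∫ t in (0 : ℝ)..1, ‖p' t‖ ≤ M
  mean : ∫ t in (0 : ℝ)..1, p t = 0
  int_q : IntervalIntegrable q volume 0 1
  int_q_le : ∫ t in (0 : ℝ)..1, ‖q t‖ ≤ M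
  rep : Represents E (fun t => p t / z) (fun t => q t / z ^ 2)

lemma KE_fst_apply {d : Fin 3 → ℂ} {E : Ecal} {P Q : ℝ → ℂ} (h : Represents E P Q) (X : Curves)
    (k : Fin 3) {x : ℝ} (hx : x ∈ Icc (0 : ℝ) 1) :
    (KE d (E.1, 0) X).c k ⟨x, hx⟩ = ∫ t in (0 : ℝ)..x, Complex.exp (d k * (x - t)) *
      ∑ l, aa k l * P t * ext (X.c l) t := by
  have h0 : ((0 : L1) : ℝ → ℂ) =ᵐ[volume.restrict (Ioc (0 : ℝ) 1)] 0 := Lp.coeFn_zero _ _ _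
  rw [KE_apply]
  refine intervalIntegral.integral_congr_ae ?_
  filter_upwards [ae_Ioc_of_ae_restrict h.1 hx, ae_Ioc_of_ae_restrict h0 hx] with t h1 h2 ht
  simp only [RR, h1 ht, h2 ht]
  simp

lemma KE_fst_X0_apply {d : Fin 3 → ℂ} {E : Ecal} {P Q : ℝ → ℂ} (h : Represents E P Q)
    (k l : Fin 3) {x : ℝ} (hx : x ∈ Icc (0 : ℝ) 1) :
    (KE d (E.1, 0) (X0 d (Pi.single l 1))).c k ⟨x, hx⟩ = aa k l *
      ∫ t in (0 : ℝ)..x, Complex.exp (d k * (x - t)) * (P t * Complex.exp (d l * t)) := by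
  rw [KE_fst_apply h, ← intervalIntegral.integral_const_mul]
  refine intervalIntegral.integral_congr fun t ht => ?_
  rw [uIcc_of_le hx.1] at ht
  have ht' : t ∈ Icc (0 : ℝ) 1 := ⟨ht.1, ht.2.trans hx.2⟩
  simp only [ext_apply _ ht', X0_apply]
  rw [Finset.sum_eq_single l]
  · simp
    ring
  · intro b _ hb
    simp [hb]
  · simp

namespace SmoothPair

variable {z M : ℝ} {p p' q : ℝ → ℂ} {E : Ecal} (h : SmoothPair z M p p' q E)

include h

lemma nonneg : 0 ≤ M := (norm_nonneg _).trans (h.norm_le 0 (by simp))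

lemma norm_fst_le : ‖E.1‖ ≤ M / z := by
  have hz : 0 < z := by linarith [h.one_le]
  rw [L1.norm_eq_of_ae h.rep.1]
  simp only [norm_div, Complex.norm_real, Real.norm_of_nonneg hz.le]
  rw [intervalIntegral.integral_div]
  gcongr
  have := intervalIntegral.integral_mono_on zero_le_one h.prim.intervalIntegrable.norm
    intervalIntegrable_const h.norm_le
  simpa using this

lemma norm_snd_le : ‖E.2‖ ≤ M / z ^ 2 := by
  have hz : 0 < z := by linarith [h.one_le]
  rw [L1.norm_eq_of_ae h.rep.2]
  simp only [norm_div, norm_pow, Complex.norm_real, Real.norm_of_nonneg hz.le]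
  rw [intervalIntegral.integral_div]
  gcongr
  exact h.int_q_le

lemma norm_le_div : ‖E‖ ≤ M / z := by
  have hz : 0 < z := by linarith [h.one_le]
  refine max_le h.norm_fst_le (h.norm_snd_le.trans ?_)
  have := h.nonneg
  gcongr
  nlinarith [h.one_le]

lemma norm_mk_fst_le : ‖((E.1, 0) : Ecal)‖ ≤ M / z := by
  rw [Prod.norm_mk, norm_zero, max_eq_left (norm_nonneg _)]; exact h.norm_fst_le

lemma norm_mk_snd_le : ‖((0, E.2) : Ecal)‖ ≤ M / z ^ 2 := by
  rw [Prod.norm_mk, norm_zero, max_eq_right (norm_nonneg _)]; exact h.norm_snd_le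

/-- Off the diagonal the exponents differ by at least z in modulus, so the oscillation improves the
weight 1/z of p to 1/z². -/
lemma norm_KE_fst_X0_le (hd : Tame (dz z)) {k l : Fin 3} (hkl : k ≠ l) {x : ℝ}
    (hx : x ∈ Icc (0 : ℝ) 1) :
    ‖(KE (dz z) (E.1, 0) (X0 (dz z) (Pi.single l 1))).c k ⟨x, hx⟩‖ ≤ 18 * (M / z ^ 2) := by
  have hz : 0 < z := by linarith [h.one_le]
  have hdz : z ≤ ‖dz z l - dz z k‖ := by
    have := le_norm_dz_sub (z := (z : ℂ)) hkl
    rwa [Complex.norm_real, Real.norm_of_nonneg hz.le] at this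
  have hne : dz z l ≠ dz z k := sub_ne_zero.1 (norm_pos_iff.1 (hz.trans_le hdz))
  have h1 := hd.norm_oscillatory_le hne h.prim h.norm_le h.int_le hx
  have h2 : ∀ t : ℝ, Complex.exp (dz z k * (x - t)) * (p t / z * Complex.exp (dz z l * t)) =
      (1 / z) * (Complex.exp (dz z k * (x - t)) * (p t * Complex.exp (dz z l * t))) := fun t => by
    ring
  rw [KE_fst_X0_apply h.rep]
  simp only [h2]
  rw [intervalIntegral.integral_const_mul]
  refine (norm_mul_le_of_le (norm_aa_le k l) (norm_mul_le_of_le (le_refl _) h1)).trans ?_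
  rw [norm_div, norm_one, Complex.norm_real, Real.norm_of_nonneg hz.le]
  have hM := h.nonneg
  calc 1 * (1 / z * (9 * (M + M) / ‖dz z l - dz z k‖)) ≤ 1 * (1 / z * (9 * (M + M) / z)) := by
        gcongr
    _ = _ := by field_simp; ring

/-- On the diagonal nothing oscillates and a primitive of p remains. It vanishes at x = 1 because p
has mean value zero; for other x it only has the weight 1/z. -/
lemma KE_fst_X0_self (k : Fin 3) {x : ℝ} (hx : x ∈ Icc (0 : ℝ) 1) :
    (KE (dz z) (E.1, 0) (X0 (dz z) (Pi.single k 1))).c k ⟨x, hx⟩ =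
      aa k k / z * (Complex.exp (dz z k * x) * ∫ t in (0 : ℝ)..x, p t) := by
  rw [KE_fst_X0_apply h.rep, ← intervalIntegral.integral_const_mul,
    ← intervalIntegral.integral_const_mul, ← intervalIntegral.integral_const_mul]
  congr 1
  funext t
  have : Complex.exp (dz z k * x) = Complex.exp (dz z k * (x - t)) * Complex.exp (dz z k * t) := by
    rw [← Complex.exp_add]; ring_nf
  rw [this]
  ring

/-- The contribution of p gains 1/z from oscillation off the diagonal and vanishes on it by the mean
value zero; q carries the weight 1/z² from the start. -/
lemma norm_T1_le (hd : Tame (dz z)) (j l : Fin 3) : ‖T1 (dz z) E j l‖ ≤ 72 * (M / z ^ 2) := by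
  have hE : E = (E.1, 0) + (0, E.2) := by simp
  have h1 : ‖T1 (dz z) (E.1, 0) j l‖ ≤ 18 * (M / z ^ 2) := by
    by_cases hjl : j = l
    · subst hjl
      rw [T1, ev1_apply, h.KE_fst_X0_self, h.mean, mul_zero, mul_zero, norm_zero]
      have := h.nonneg
      positivity
    · exact h.norm_KE_fst_X0_le hd hjl _
  have h2 := hd.norm_T1_le (0, E.2) j l
  rw [hE, T1_add]
  refine (norm_add_le_of_le h1 h2).trans ?_
  linarith [h.norm_mk_snd_le]

/-- Sum over the intermediate index k. For k ≠ l the inner integral is already O(M/z²), and the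
outer factor p/z supplies the third power. For k = l the inner integral is a primitive of p with
weight 1/z; p times this primitive is again absolutely continuous, and since j ≠ l the outer
integral oscillates. -/
lemma norm_T2_fst_le (hd : Tame (dz z)) {j l : Fin 3} (hjl : j ≠ l) :
    ‖T2 (dz z) (E.1, 0) (E.1, 0) j l‖ ≤ 200 * (M ^ 2 / z ^ 3) := by
  have hz : 0 < z := by linarith [h.one_le]
  have hM := h.nonneg
  have h1' : (1 : ℝ) ∈ Icc (0 : ℝ) 1 := by simp
  set Y := KE (dz z) (E.1, 0) (X0 (dz z) (Pi.single l 1)) with hY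
  have hYn : ∀ k, k ≠ l → ∀ t ∈ Icc (0 : ℝ) 1, ‖ext (Y.c k) t‖ ≤ 18 * (M / z ^ 2) :=
    fun k hk t ht => by rw [ext_apply _ ht]; exact h.norm_KE_fst_X0_le hd hk ht
  have hi : ∀ k, IntervalIntegrable (fun t : ℝ => Complex.exp (dz z j * (1 - t)) *
      (aa j k * (p t / z) * ext (Y.c k) t)) volume 0 1 := fun k =>
    (((h.prim.intervalIntegrable.div_const _).const_mul _).mul_continuousOn
      (continuous_ext _).continuousOn).continuousOn_mul (by fun_prop)
  have hsum : T2 (dz z) (E.1, 0) (E.1, 0) j l = ∑ k, ∫ t in (0 : ℝ)..1,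
      Complex.exp (dz z j * (1 - t)) * (aa j k * (p t / z) * ext (Y.c k) t) := by
    rw [T2, ev1_apply, ← hY, KE_fst_apply h.rep, ← intervalIntegral.integral_finsetSum
      fun k _ => hi k]
    simp only [Finset.mul_sum, Complex.ofReal_one]
  have hk : ∀ k, ‖∫ t in (0 : ℝ)..1,
      Complex.exp (dz z j * (1 - t)) * (aa j k * (p t / z) * ext (Y.c k) t)‖ ≤
        54 * (M ^ 2 / z ^ 3) := by
    intro k
    by_cases hkl : k = l
    · subst hkl
      have hI : HasPrim (fun x => ∫ t in (0 : ℝ)..x, p t) p :=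
        ⟨h.prim.intervalIntegrable, fun x _ => by simp⟩
      have hIn : ∀ t ∈ Icc (0 : ℝ) 1, ‖∫ s in (0 : ℝ)..t, p s‖ ≤ M := fun t ht => by
        have := intervalIntegral.norm_integral_le_of_norm_le_const (a := (0 : ℝ)) (b := t)
          (f := p) (C := M) fun s hs => by
            rw [uIoc_of_le ht.1] at hs
            exact h.norm_le s ⟨hs.1.le, hs.2.trans ht.2⟩
        rw [sub_zero, abs_of_nonneg ht.1] at this
        nlinarith [ht.2]
      have hdz : z ≤ ‖dz z k - dz z j‖ := by
        have := le_norm_dz_sub (z := (z : ℂ)) hjl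
        rwa [Complex.norm_real, Real.norm_of_nonneg hz.le] at this
      have hne : dz z k ≠ dz z j := sub_ne_zero.1 (norm_pos_iff.1 (hz.trans_le hdz))
      have hA : ∫ t in (0 : ℝ)..1, ‖p' t * (∫ s in (0 : ℝ)..t, p s) + p t * p t‖ ≤
          M * M + M * M := by
        have j1 := (h.prim.mul hI).1.norm
        have j2 : IntervalIntegrable (fun t => ‖p' t‖ * M + M * M) volume 0 1 :=
          (h.prim.1.norm.mul_const _).add intervalIntegrable_const
        refine (intervalIntegral.integral_mono_on zero_le_one j1 j2 fun t ht =>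
          norm_add_le_of_le (norm_mul_le_of_le le_rfl (hIn t ht))
            (norm_mul_le_of_le (h.norm_le t ht) (h.norm_le t ht))).trans ?_
        rw [intervalIntegral.integral_add (h.prim.1.norm.mul_const _) intervalIntegrable_const,
          intervalIntegral.integral_mul_const]
        have := mul_le_mul_of_nonneg_right h.int_le hM
        simpa using this
      have h1 := hd.norm_oscillatory_le hne (h.prim.mul hI) (S := M * M)
        (fun t ht => norm_mul_le_of_le (h.norm_le t ht) (hIn t ht)) hA h1'
      have h2 : (∫ t in (0 : ℝ)..1, Complex.exp (dz z j * (1 - t)) *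
          (aa j k * (p t / z) * ext (Y.c k) t)) = aa j k * (aa k k * ((1 / z ^ 2 : ℝ) *
            ∫ t in (0 : ℝ)..1, Complex.exp (dz z j * ((1 : ℝ) - t)) *
              ((p t * ∫ s in (0 : ℝ)..t, p s) * Complex.exp (dz z k * t)))) := by
        rw [← intervalIntegral.integral_const_mul, ← intervalIntegral.integral_const_mul,
          ← intervalIntegral.integral_const_mul]
        refine intervalIntegral.integral_congr fun t ht => ?_
        rw [uIcc_of_le zero_le_one] at ht
        simp only [ext_apply _ ht]
        rw [hY, h.KE_fst_X0_self]
        push_cast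
        ring
      rw [h2]
      refine (norm_mul_le_of_le (norm_aa_le j k) (norm_mul_le_of_le (norm_aa_le k k)
        (norm_mul_le_of_le (le_refl _) h1))).trans ?_
      rw [Complex.norm_real, Real.norm_of_nonneg (by positivity)]
      calc 1 * (1 * (1 / z ^ 2 * (9 * (M * M + (M * M + M * M)) / ‖dz z k - dz z j‖))) ≤
          1 * (1 * (1 / z ^ 2 * (9 * (M * M + (M * M + M * M)) / z))) := by gcongr
        _ = 27 * (M ^ 2 / z ^ 3) := by field_simp; ring
        _ ≤ _ := by gcongr; norm_num
    · have := intervalIntegral.norm_integral_le_of_norm_le_const (a := (0 : ℝ)) (b := 1)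
        (f := fun t : ℝ => Complex.exp (dz z j * (1 - t)) * (aa j k * (p t / z) * ext (Y.c k) t))
        (C := 3 * (1 * (M / z) * (18 * (M / z ^ 2)))) fun t ht => by
          rw [uIoc_of_le zero_le_one] at ht
          have ht' : t ∈ Icc (0 : ℝ) 1 := ⟨ht.1.le, ht.2⟩
          have e1 := hd.norm_exp_le j (s := 1 - t) ⟨by linarith [ht.2], by linarith [ht.1]⟩
          push_cast at e1
          refine norm_mul_le_of_le e1 (norm_mul_le_of_le (norm_mul_le_of_le (norm_aa_le j k) ?_)
            (hYn k hkl t ht'))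
          rw [norm_div, Complex.norm_real, Real.norm_of_nonneg hz.le]
          gcongr
          exact h.norm_le t ht'
      refine this.trans_eq ?_
      simp
      field_simp
      ring
  rw [hsum]
  refine (norm_sum_le_of_le _ fun k _ => hk k).trans ?_
  simp only [Finset.sum_const, Finset.card_univ, Fintype.card_fin, nsmul_eq_mul]
  have : 0 ≤ M ^ 2 / z ^ 3 := by positivity
  push_cast
  linarith

lemma norm_T2_le (hd : Tame (dz z)) {j l : Fin 3} (hjl : j ≠ l) :
    ‖T2 (dz z) E E j l‖ ≤ 3200 * (M ^ 2 / z ^ 3) := by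
  have hz : 0 < z := by linarith [h.one_le]
  have hM := h.nonneg
  have hE : E = (E.1, 0) + (1 : ℂ) • (0, E.2) := by simp
  have e1 := h.norm_T2_fst_le hd hjl
  have e2 := hd.norm_T2_le (E.1, 0) (0, E.2) j l
  have e3 := hd.norm_T2_le (0, E.2) (E.1, 0) j l
  have e4 := hd.norm_T2_le (0, E.2) (0, E.2) j l
  have k1 := h.norm_mk_fst_le
  have k2 := h.norm_mk_snd_le
  have k3 : M / z ^ 2 ≤ M / z := by
    gcongr
    nlinarith [h.one_le]
  have k4 : ‖((0, E.2) : Ecal)‖ ≤ M / z := k2.trans k3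
  have m1 : ‖((E.1, 0) : Ecal)‖ * ‖((0, E.2) : Ecal)‖ ≤ M / z * (M / z ^ 2) := by gcongr
  have m2 : ‖((0, E.2) : Ecal)‖ * ‖((0, E.2) : Ecal)‖ ≤ M / z * (M / z ^ 2) := by gcongr
  have m3 : M / z * (M / z ^ 2) = M ^ 2 / z ^ 3 := by field_simp
  rw [hE, T2_add_smul, one_pow, one_mul, one_mul]
  refine (norm_add_le_of_le (norm_add_le_of_le e1 (norm_add_le_of_le e2 e3)) e4).trans ?_
  rw [mul_comm ‖((0, E.2) : Ecal)‖ ‖((E.1, 0) : Ecal)‖, ]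
  rw [m3] at m1 m2
  have m4 : 0 ≤ M ^ 2 / z ^ 3 := by positivity
  linarith

end SmoothPair

lemma three_mul_zo_sq (n : ℤ) : 3 * zo n ^ 2 = 4 * (π * n) ^ 2 := by
  rw [zo, div_pow, Real.sq_sqrt (by norm_num)]; ring

/-- The asymptotics of the logarithm of the ratio of the multipliers. -/
lemma Setting.norm_logRatio_sub_le {n : ℤ} {ρ σ L : ℝ} {g : Ecal → Fin 3 → ℂ}
    {l : Ecal → Fin 2 → ℂ} {p₀ q₀ p p' q : ℝ → ℂ} {E : Ecal}
    (h : Setting n ρ σ L g l p₀ q₀ E) {M : ℝ}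
    (hs : SmoothPair (zo n) M p p' q E) (hM : M ≤ 1) :
    ‖4 * (π * n) ^ 2 * logRatio g l E -
      ∫ t in (0 : ℝ)..1, (bn n t : ℂ) * (q t - zo n * p t)‖ ≤
        10 ^ 45 * (1 + L) ^ 6 * M ^ 2 / n := by
  have hn := h.hn
  have hz := le_zo hn
  have hn1 : (1 : ℝ) ≤ n := by exact_mod_cast hn
  have hz0 : 0 < zo n := by linarith
  have hd := tame_dz_zc hn
  have hM0 := hs.nonneg
  have hL := h.hL
  have h1 := h.norm_logRatio_add_le (fun i j => hs.norm_T1_le hd i j)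
    (fun i j hij => hs.norm_T2_le hd hij)
  rw [← sub_neg_eq_add, neg_sg_mul_T1] at h1
  have hint : (∫ t in (0 : ℝ)..1, (bn n t : ℂ) * (q t - zo n * p t)) =
      4 * (π * n) ^ 2 * ∫ t in (0 : ℝ)..1, (bn n t / 3 : ℂ) * (E.2 t - E.1 t) := by
    rw [← intervalIntegral.integral_const_mul]
    refine intervalIntegral.integral_congr_ae ?_
    have hzc : (zo n : ℂ) ≠ 0 := zc_ne_zero hn
    filter_upwards [ae_Ioc_of_ae_restrict hs.rep.1 (x := 1) (by simp),
      ae_Ioc_of_ae_restrict hs.rep.2 (x := 1) (by simp)] with t h2 h3 ht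
    have h4 := congrArg (fun x : ℝ => (x : ℂ)) (three_mul_zo_sq n)
    simp only [Complex.ofReal_mul, Complex.ofReal_pow, Complex.ofReal_ofNat,
      Complex.ofReal_intCast] at h4
    rw [h2 ht, h3 ht, ← h4]
    field_simp
  rw [hint, ← mul_sub, norm_mul]
  have hnorm : ‖(4 * (π * n) ^ 2 : ℂ)‖ = 3 * zo n ^ 2 := by
    rw [three_mul_zo_sq]
    have : (4 * (π * n) ^ 2 : ℂ) = ((4 * (π * n) ^ 2 : ℝ) : ℂ) := by push_cast; rfl
    rw [this, Complex.norm_real, Real.norm_of_nonneg (by positivity)]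
  rw [hnorm]
  set z := zo n with hzdef
  set w := M / z ^ 2 with hw
  have hx : ‖E‖ ≤ M / z := hs.norm_le_div
  have hx2 : ‖E‖ ^ 2 ≤ w := by
    refine (pow_le_pow_left₀ (norm_nonneg _) hx 2).trans ?_
    rw [div_pow, hw]
    gcongr
    nlinarith
  have hw0 : 0 ≤ w := by positivity
  have hz1 : 1 ≤ z := hs.one_le
  have hV : 0 ≤ M ^ 2 / z ^ 3 := by positivity
  -- Each of the three remainders is O(M²/z³), the cubic one because M ≤ 1. The prefactor 3z² then
  -- leaves M²/z, and z ≥ n.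
  have i1 : (72 * w + ‖E‖ ^ 2) ^ 2 ≤ 5329 * (M ^ 2 / z ^ 3) := by
    calc (72 * w + ‖E‖ ^ 2) ^ 2 ≤ (72 * w + w) ^ 2 := by gcongr
      _ = 5329 * (M ^ 2 / z ^ 4) := by rw [hw]; field_simp; norm_num
      _ ≤ 5329 * (M ^ 2 / z ^ 3) := by (gcongr; norm_num)
  have i2 : ‖E‖ * (72 * w + ‖E‖ ^ 2) ≤ 73 * (M ^ 2 / z ^ 3) := by
    calc ‖E‖ * (72 * w + ‖E‖ ^ 2) ≤ M / z * (72 * w + w) := by gcongr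
      _ = _ := by rw [hw]; field_simp; norm_num
  have i3 : ‖E‖ ^ 3 ≤ M ^ 2 / z ^ 3 := by
    refine (pow_le_pow_left₀ (norm_nonneg _) hx 3).trans ?_
    rw [div_pow]
    exact div_le_div_of_nonneg_right (pow_le_pow_of_le_one hM0 hM (by norm_num)) (by positivity)
  have hL6 : 1 ≤ (1 + L) ^ 6 := one_le_pow₀ (by linarith)
  have j1 : 10 ^ 40 * (1 + L) ^ 6 * ((72 * w + ‖E‖ ^ 2) ^ 2 + ‖E‖ * (72 * w + ‖E‖ ^ 2) +
      ‖E‖ ^ 3) + 2 * (3200 * (M ^ 2 / z ^ 3)) ≤ 10 ^ 44 * (1 + L) ^ 6 * (M ^ 2 / z ^ 3) := by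
    have k1 := mul_le_mul_of_nonneg_left (add_le_add (add_le_add i1 i2) i3)
      (show 0 ≤ 10 ^ 40 * (1 + L) ^ 6 by positivity)
    have k2 := mul_le_mul_of_nonneg_right hL6 hV
    linarith
  calc _ ≤ 3 * z ^ 2 * (10 ^ 44 * (1 + L) ^ 6 * (M ^ 2 / z ^ 3)) := by
        gcongr
        exact h1.trans j1
    _ = 3 * 10 ^ 44 * (1 + L) ^ 6 * M ^ 2 / z := by field_simp
    _ ≤ 10 ^ 45 * (1 + L) ^ 6 * M ^ 2 / n := by
        gcongr
        · norm_num
        · linarith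

/-! ### The gradient of the logarithm of the ratio of the multipliers -/

/-- Test the functional with the indicator function of (a, b], whose L¹ norm is b − a. -/
lemma norm_integral_le_of_functional_le {G : ℝ → ℂ} {C : ℝ}
    (h : ∀ V : L1, ‖∫ t in (0 : ℝ)..1, V t * G t‖ ≤ C * ‖V‖) {a b : ℝ} (ha : 0 ≤ a) (hab : a ≤ b)
    (hb : b ≤ 1) : ‖∫ t in a..b, G t‖ ≤ C * (b - a) := by
  have hsub : Ioc a b ⊆ Ioc (0 : ℝ) 1 := Ioc_subset_Ioc ha hb
  set f : ℝ → ℂ := (Ioc a b).indicator fun _ => 1 with hf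
  have hfi : IntervalIntegrable f volume 0 1 := by
    rw [intervalIntegrable_iff_integrableOn_Ioc_of_le zero_le_one]
    exact (integrable_const (1 : ℂ)).indicator measurableSet_Ioc
  have h1 := h (L1.ofFun f hfi)
  have h2 : ∫ t in (0 : ℝ)..1, ‖f t‖ = b - a := by
    have : ∀ t, ‖f t‖ = (Ioc a b).indicator (fun _ => (1 : ℝ)) t := fun t => by
      rw [hf, norm_indicator_eq_indicator_norm]; simp
    simp only [this]
    rw [intervalIntegral.integral_of_le zero_le_one, setIntegral_indicator measurableSet_Ioc,
      inter_eq_self_of_subset_right hsub]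
    simp [hab]
  have h3 : ∫ t in (0 : ℝ)..1, L1.ofFun f hfi t * G t = ∫ t in a..b, G t := by
    have : ∫ t in (0 : ℝ)..1, L1.ofFun f hfi t * G t =
        ∫ t in (0 : ℝ)..1, (Ioc a b).indicator G t := by
      refine intervalIntegral.integral_congr_ae ?_
      filter_upwards [ae_Ioc_of_ae_restrict (L1.ofFun_ae hfi) (x := 1) (by simp)] with t ht h1
      rw [ht h1, hf]
      by_cases hm : t ∈ Ioc a b <;> simp [hm]
    rw [this, intervalIntegral.integral_of_le zero_le_one, setIntegral_indicator measurableSet_Ioc,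
      inter_eq_self_of_subset_right hsub, intervalIntegral.integral_of_le hab]
  rwa [h3, L1.norm_eq_of_ae (L1.ofFun_ae hfi), h2] at h1

/-- A continuous kernel is bounded by the norm of the functional. -/
lemma norm_kernel_le {G : ℝ → ℂ} (hG : ContinuousOn G (Icc 0 1)) {C : ℝ} (hC : 0 ≤ C)
    (h : ∀ V : L1, ‖∫ t in (0 : ℝ)..1, V t * G t‖ ≤ C * ‖V‖) {t : ℝ} (ht : t ∈ Icc (0 : ℝ) 1) :
    ‖G t‖ ≤ C := by
  set G' : ℝ → ℂ := fun t => G (projIcc 0 1 zero_le_one t) with hG'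
  have hc : Continuous G' :=
    (continuousOn_iff_continuous_domRestrict.1 hG).comp continuous_projIcc
  have hGG' : ∀ t ∈ Icc (0 : ℝ) 1, G' t = G t := fun t ht => by
    simp only [hG', projIcc_of_mem _ ht]
  have hint : ∀ a b : ℝ, a ∈ Icc (0 : ℝ) 1 → b ∈ Icc (0 : ℝ) 1 →
      ∫ s in a..b, G' s = ∫ s in a..b, G s := fun a b ha hb =>
    intervalIntegral.integral_congr fun s hs => hGG' s (uIcc_subset_Icc ha hb hs)
  have hbd : ∀ a b : ℝ, a ∈ Icc (0 : ℝ) 1 → b ∈ Icc (0 : ℝ) 1 →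
      ‖∫ s in a..b, G' s‖ ≤ C * |b - a| := by
    intro a b ha hb
    rw [hint a b ha hb]
    rcases le_total a b with hab | hab
    · rw [abs_of_nonneg (sub_nonneg.2 hab)]
      exact norm_integral_le_of_functional_le h ha.1 hab hb.2
    · rw [intervalIntegral.integral_symm, norm_neg, abs_sub_comm, abs_of_nonneg (sub_nonneg.2 hab)]
      exact norm_integral_le_of_functional_le h hb.1 hab ha.2
  have key : ∀ s ∈ Ioo (0 : ℝ) 1, ‖G s‖ ≤ C := by
    intro s hs
    have hs' : s ∈ Icc (0 : ℝ) 1 := Ioo_subset_Icc_self hs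
    -- By continuity G is the derivative of its primitive, and the primitive is Lipschitz with
    -- constant C. The end points follow by closure.
    have hd : HasDerivAt (fun x => ∫ r in s..x, G' r) (G' s) s :=
      (hc.integral_hasStrictDerivAt s s).hasDerivAt
    rw [← hGG' s hs']
    refine hd.le_of_lip' hC ?_
    filter_upwards [isOpen_Ioo.mem_nhds hs] with x hx
    rw [intervalIntegral.integral_same, sub_zero, Real.norm_eq_abs]
    exact hbd s x hs' (Ioo_subset_Icc_self hx)
  have hcl : closure (Ioo (0 : ℝ) 1) = Icc 0 1 := closure_Ioo zero_ne_one
  exact le_on_closure key (by rw [hcl]; exact hG.norm) continuousOn_const (by rwa [hcl])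

/-- The first order term of the logarithm of the ratio of the multipliers. -/
def logRatioLin (n : ℤ) : Ecal →L[ℂ] ℂ :=
  -(sg n • (ev1 0 ∘L (KE (dz (zc n))).flip (X0 (dz (zc n)) (Pi.single 1 1)) +
    ev1 1 ∘L (KE (dz (zc n))).flip (X0 (dz (zc n)) (Pi.single 0 1))))

lemma logRatioLin_eq (n : ℤ) (V : Ecal) :
    logRatioLin n V = -(sg n * (T1 (dz (zc n)) V 0 1 + T1 (dz (zc n)) V 1 0)) := rfl

lemma logRatioLin_apply (n : ℤ) (V : Ecal) : logRatioLin n V =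
    ∫ t in (0 : ℝ)..1, (bn n t / 3 : ℂ) * (V.2 t - V.1 t) := by
  rw [logRatioLin_eq, neg_sg_mul_T1]

namespace IsSpec

variable {n : ℤ} {ρ σ L : ℝ} {g : Ecal → Fin 3 → ℂ} {l : Ecal → Fin 2 → ℂ}
  (h : IsSpec n ρ σ L g l) (hL : 0 ≤ L) (hLρ : L * ρ ≤ 1 / 1000)

section

variable {E : Ecal} (hE : ‖E‖ < ρ)

include h hL hLρ hE

lemma norm_g_le (i : Fin 3) : ‖g E i‖ ≤ 1 / 1000 :=
  (norm_le_pi_norm (g E) i).trans ((h.g_le E hE).trans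
    ((mul_le_mul_of_nonneg_left hE.le hL).trans hLρ))

lemma norm_l_le (i : Fin 2) : ‖l E i‖ ≤ 1 / 1000 :=
  (norm_le_pi_norm (l E) i).trans ((h.l_le E hE).trans
    ((mul_le_mul_of_nonneg_left hE.le hL).trans hLρ))

lemma norm_logRatio_le : ‖logRatio g l E‖ ≤ 1 := by
  have h1 := norm_log_sub_le (h.norm_g_le hL hLρ hE 2)
  have h2 := norm_log_sub_le (h.norm_l_le hL hLρ hE 1)
  have h3 := h.norm_g_le hL hLρ hE 2
  have h4 := h.norm_l_le hL hLρ hE 1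
  have h5 : logRatio g l E = (Complex.log (1 + g E 2) - g E 2 + g E 2) -
      (Complex.log (1 + l E 1) - l E 1 + l E 1) := by rw [logRatio]; ring
  rw [h5]
  refine (norm_sub_le_of_le (norm_add_le_of_le h1 h3) (norm_add_le_of_le h2 h4)).trans ?_
  nlinarith [norm_nonneg (g E 2), norm_nonneg (l E 1)]

lemma analyticAt_log_sub : AnalyticAt ℂ (fun x : (Fin 3 → ℂ) × (Fin 2 → ℂ) =>
    Complex.log (1 + x.1 2) - Complex.log (1 + x.2 1)) (g E, l E) := by
  have slit : ∀ k : ℂ, ‖k‖ ≤ 1 / 1000 → 1 + k ∈ Complex.slitPlane := fun k hk => by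
    refine Complex.mem_slitPlane_of_norm_lt_one (by linarith)
  have a1 : AnalyticAt ℂ (fun x : (Fin 3 → ℂ) × (Fin 2 → ℂ) => x.1 2) (g E, l E) :=
    ((ContinuousLinearMap.proj (R := ℂ) (φ := fun _ : Fin 3 => ℂ) 2) ∘L
      (ContinuousLinearMap.fst ℂ (Fin 3 → ℂ) (Fin 2 → ℂ))).analyticAt _
  have a2 : AnalyticAt ℂ (fun x : (Fin 3 → ℂ) × (Fin 2 → ℂ) => x.2 1) (g E, l E) :=
    ((ContinuousLinearMap.proj (R := ℂ) (φ := fun _ : Fin 2 => ℂ) 1) ∘L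
      (ContinuousLinearMap.snd ℂ (Fin 3 → ℂ) (Fin 2 → ℂ))).analyticAt _
  exact ((analyticAt_const.fun_add a1).clog (slit _ (h.norm_g_le hL hLρ hE 2))).fun_sub
    ((analyticAt_const.fun_add a2).clog (slit _ (h.norm_l_le hL hLρ hE 1)))

lemma analyticAt_logRatio : AnalyticAt ℂ (logRatio g l) E :=
  AnalyticAt.comp (f := fun E => (g E, l E)) (h.analyticAt_log_sub hL hLρ hE)
    ((h.an_g E (by simpa using hE)).prod (h.an_l E (by simpa using hE)))

lemma repAt_logRatio : RepAt (logRatio g l) E :=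
  ((h.rep_g E hE).prodMk (h.rep_l E hE)).comp (h.analyticAt_log_sub hL hLρ hE).differentiableAt

/-- A coarse second order estimate for arbitrary small L¹ coefficients, without smoothness; it
serves to identify the derivative at 0. -/
lemma norm_logRatio_sub_lin_le (hn : 0 < n) (hρ : ρ ≤ 1 / 1000) :
    ‖logRatio g l E - logRatioLin n E‖ ≤ 10 ^ 8 * (1 + L) ^ 2 * ‖E‖ ^ 2 := by
  obtain ⟨-, e1, e2, e3, e4⟩ := h.fixed_eqs hE
  set m := g E 0 / 10000 with hm
  have hE' : shiftE (E, g E) = E + m • oneQ := rfl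
  have hmx : ‖m‖ ≤ L * ‖E‖ := by
    have h1 := (norm_le_pi_norm (g E) 0).trans (h.g_le E hE)
    rw [hm, norm_div]
    have : ‖(10000 : ℂ)‖ = 10000 := by norm_num
    rw [this]
    linarith [norm_nonneg (g E 0)]
  have hx : ‖E + m • oneQ‖ ≤ (1 + L) * ‖E‖ := by
    have := norm_add_le_of_le (le_refl ‖E‖) (norm_smul m oneQ).le
    rw [norm_oneQ, mul_one] at this
    linarith
  have hlt : ‖E + m • oneQ‖ < 1 / 36 := by
    have := mul_le_mul_of_nonneg_left hE.le hL
    linarith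
  rw [hE'] at e1 e2 e3 e4
  have hb : ‖BB n (E + m • oneQ)‖ ≤ 252 * ((1 + L) * ‖E‖) :=
    (norm_BB_le_mul hn hlt).trans (by linarith)
  obtain ⟨-, -, h1⟩ := norm_fixed_points_le (norm_cN_le hn) hb (h.norm_g_le hL hLρ hE 1)
    (h.norm_g_le hL hLρ hE 2) (h.norm_l_le hL hLρ hE 0) (h.norm_l_le hL hLρ hE 1) e1 e2 e3 e4
  have h2 := norm_BB_sub_T1_le hn hlt 0 1
  have h3 := norm_BB_sub_T1_le hn hlt 1 0
  rw [T1_add, T1_smul, T1_oneQ_zero_one hn, mul_zero, add_zero] at h2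
  rw [T1_add, T1_smul, T1_oneQ_one_zero hn, mul_zero, add_zero] at h3
  have h4 := pow_le_pow_left₀ (norm_nonneg _) hx 2
  have h5 : logRatio g l E - logRatioLin n E =
      (Complex.log (1 + g E 2) - Complex.log (1 + l E 1) + (BB n (E + m • oneQ) 0 1 +
        BB n (E + m • oneQ) 1 0)) - (BB n (E + m • oneQ) 0 1 - sg n * T1 (dz (zc n)) E 0 1) -
        (BB n (E + m • oneQ) 1 0 - sg n * T1 (dz (zc n)) E 1 0) := by
    rw [logRatio, logRatioLin_eq]; ring
  rw [h5]
  refine (norm_sub_le_of_le (norm_sub_le_of_le h1 h2) h3).trans ?_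
  have h6 : 0 ≤ ((1 + L) * ‖E‖) ^ 2 := sq_nonneg _
  nlinarith

end

include h hL hLρ in
lemma hasFDerivAt_logRatio_zero (hn : 0 < n) (hρ0 : 0 < ρ) (hρ : ρ ≤ 1 / 1000) :
    HasFDerivAt (logRatio g l) (logRatioLin n) 0 := by
  have h1 : (fun E => logRatio g l E - logRatioLin n E) =O[nhds 0] fun E : Ecal => ‖E - 0‖ ^ 2 := by
    refine Asymptotics.IsBigO.of_bound (10 ^ 8 * (1 + L) ^ 2) ?_
    filter_upwards [Metric.ball_mem_nhds (0 : Ecal) hρ0] with E hE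
    rw [mem_ball_zero_iff] at hE
    rw [sub_zero, norm_pow, norm_norm]
    exact h.norm_logRatio_sub_lin_le hL hLρ hE hn hρ
  have h2 := (h1.hasFDerivAt one_lt_two).add (logRatioLin n).hasFDerivAt
  rw [zero_add] at h2
  refine h2.congr_of_eventuallyEq (.of_forall fun E => ?_)
  simp

include h hL hLρ in
/-- The gradient of the logarithm of the ratio of the multipliers. -/
lemma exists_gradient (hn : 0 < n) (hρ : ρ ≤ 1 / 1000) {E : Ecal} (hE : ‖E‖ < ρ / 2) :
    ∃ (D : Ecal →L[ℂ] ℂ) (gP gQ : ℝ → ℂ), ContinuousOn gP (Icc 0 1) ∧ ContinuousOn gQ (Icc 0 1) ∧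
      HasFDerivAt (logRatio g l) D E ∧
      (∀ V : Ecal, D V = ∫ t in (0 : ℝ)..1, (V.1 t * gP t + V.2 t * gQ t)) ∧
      (∀ t ∈ Icc (0 : ℝ) 1, ‖gP t + bn n t / 3‖ ≤ 16 / ρ ^ 2 * ‖E‖) ∧
      ∀ t ∈ Icc (0 : ℝ) 1, ‖gQ t - bn n t / 3‖ ≤ 16 / ρ ^ 2 * ‖E‖ := by
  have hρ0 : 0 < ρ := by linarith [norm_nonneg E]
  have hE' : ‖E‖ < ρ := by linarith
  obtain ⟨D, hD, gP, gQ, hP, hQ, hr⟩ := h.repAt_logRatio hL hLρ hE'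
  simp only [smul_eq_mul] at hr
  -- The function `logRatio g l` is bounded by 1 on the ball of radius ρ, so Cauchy's estimates
  -- control `D - logRatioLin n` as a functional on L¹ × L¹. By `norm_kernel_le` this is a sup norm
  -- bound on its continuous kernels.
  have h1 := norm_fderiv_sub_le_of_bounded (f := logRatio g l) (r := ρ) (K := 1)
    (fun E hE => h.analyticAt_logRatio hL hLρ (by simpa using hE))
    (fun E hE => h.norm_logRatio_le hL hLρ (by simpa using hE)) hE
  rw [hD.fderiv, (h.hasFDerivAt_logRatio_zero hL hLρ hn hρ0 hρ).fderiv, mul_one] at h1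
  have hC : 0 ≤ 16 / ρ ^ 2 * ‖E‖ := by positivity
  have hb : Continuous fun t => (bn n t / 3 : ℂ) :=
    (Complex.continuous_ofReal.comp (continuous_bn n)).div_const 3
  have hdiff : ∀ V : Ecal, (D - logRatioLin n) V =
      ∫ t in (0 : ℝ)..1, (V.1 t * (gP t + bn n t / 3) + V.2 t * (gQ t - bn n t / 3)) := fun V => by
    have i1 := intervalIntegrable_smul V.1 hP
    have i2 := intervalIntegrable_smul V.2 hQ
    simp only [smul_eq_mul] at i1 i2
    have i3 : IntervalIntegrable (fun t => (bn n t / 3 : ℂ) * (V.2 t - V.1 t)) volume 0 1 :=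
      ((L1.intervalIntegrable V.2).sub (L1.intervalIntegrable V.1)).continuousOn_mul hb.continuousOn
    rw [sub_apply, hr, logRatioLin_apply, ← intervalIntegral.integral_sub
      (i1.add i2) i3]
    congr 1
    funext t
    ring
  have hz : ∀ᵐ t, t ∈ uIoc (0 : ℝ) 1 → ((0 : L1) : ℝ → ℂ) t = 0 :=
    ae_Ioc_of_ae_restrict (Lp.coeFn_zero ℂ 1 (volume.restrict (Ioc (0 : ℝ) 1))) (by simp)
  refine ⟨D, gP, gQ, hP, hQ, hD, hr, fun t ht => ?_, fun t ht => ?_⟩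
  · refine norm_kernel_le (hP.add hb.continuousOn) hC (fun V => ?_) ht
    have h2 := (D - logRatioLin n).le_of_opNorm_le h1 (V, 0)
    have h4 : ‖((V, 0) : Ecal)‖ = ‖V‖ := by
      rw [Prod.norm_mk, norm_zero, max_eq_left (norm_nonneg _)]
    rw [hdiff, h4] at h2
    refine (le_of_eq ?_).trans h2
    congr 1
    refine intervalIntegral.integral_congr_ae ?_
    filter_upwards [hz] with t h3 ht
    rw [h3 ht]
    simp only [Pi.add_apply, Pi.sub_apply]
    ring
  · refine norm_kernel_le (hQ.sub hb.continuousOn) hC (fun V => ?_) ht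
    have h2 := (D - logRatioLin n).le_of_opNorm_le h1 (0, V)
    have h4 : ‖((0, V) : Ecal)‖ = ‖V‖ := by
      rw [Prod.norm_mk, norm_zero, max_eq_right (norm_nonneg _)]
    rw [hdiff, h4] at h2
    refine (le_of_eq ?_).trans h2
    congr 1
    refine intervalIntegral.integral_congr_ae ?_
    filter_upwards [hz] with t h3 ht
    rw [h3 ht]
    simp only [Pi.add_apply, Pi.sub_apply]
    ring

end IsSpec

/-! ### Mean-zero functions on the circle as periodic functions -/

/-- The line is a countable union of unit intervals, and on each of them the projection to the
circle preserves the measure. -/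
lemma ae_of_ae_circle {P : UnitAddCircle → Prop} (h : ∀ᵐ x, P x) : ∀ᵐ x : ℝ, P x := by
  have h1 : ∀ n : ℤ, ∀ᵐ x : ℝ ∂volume.restrict (Ioc (n : ℝ) (n + 1)), P x := fun n =>
    (UnitAddCircle.measurePreserving_mk n).quasiMeasurePreserving.ae h
  have h2 := ae_all_iff.2 fun n => (ae_restrict_iff' measurableSet_Ioc).1 (h1 n)
  filter_upwards [h2] with x hx
  have : x ∈ ⋃ n : ℤ, Ioc (n : ℝ) (n + 1) := by rw [iUnion_Ioc_intCast]; trivial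
  obtain ⟨n, hn⟩ := mem_iUnion.1 this
  exact hx n hn

lemma ae_comp_sign {P : ℝ → Prop} (h : ∀ᵐ x, P x) {e : ℤ} (he : e = 1 ∨ e = -1) :
    ∀ᵐ x : ℝ, P (e * x) := by
  rcases he with rfl | rfl
  · simpa using h
  · simpa using (Measure.measurePreserving_neg (volume : Measure ℝ)).quasiMeasurePreserving.ae h

lemma norm_sign {𝕜 : Type*} [RCLike 𝕜] {e : ℤ} (he : e = 1 ∨ e = -1) : ‖(e : 𝕜)‖ = 1 := by
  rcases he with rfl | rfl <;> simp

section

lemma periodic_comp_sign {F : Type*} {f : ℝ → F} (hf : Function.Periodic f 1) {e : ℤ}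
    (he : e = 1 ∨ e = -1) : Function.Periodic (fun x : ℝ => f (e * x)) 1 := by
  intro x
  rcases he with rfl | rfl
  · simpa using hf x
  · have := hf (-x - 1)
    simp only [sub_add_cancel] at this
    simp only [Int.cast_neg, Int.cast_one, neg_mul, one_mul, this]
    congr 1
    ring

variable {F : Type*} [NormedAddCommGroup F]

lemma intervalIntegrable_comp_sign {f : ℝ → F} (hf : ∀ a b, IntervalIntegrable f volume a b)
    {e : ℤ} (he : e = 1 ∨ e = -1) (a b : ℝ) :
    IntervalIntegrable (fun x : ℝ => f (e * x)) volume a b := by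
  rcases he with rfl | rfl
  · simpa using hf a b
  · simpa using (IntervalIntegrable.iff_comp_neg (f := f)).1 (hf (-a) (-b))

lemma integral_comp_sign [NormedSpace ℝ F] {f : ℝ → F} (hf : Function.Periodic f 1) {e : ℤ}
    (he : e = 1 ∨ e = -1) : ∫ t in (0 : ℝ)..1, f (e * t) = ∫ t in (0 : ℝ)..1, f t := by
  rcases he with rfl | rfl
  · simp
  · simpa using integral_comp_neg_of_periodic hf

end

namespace MeanZero

variable {𝕜 : Type} [RCLike 𝕜] (f : MeanZero 𝕜)

/-- A mean-zero function on the circle as a periodic function. -/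
def fn (x : ℝ) : 𝕜 := (f : Lp 𝕜 2 (volume : Measure UnitAddCircle)) (x : UnitAddCircle)

lemma periodic_fn : Function.Periodic (fn f) 1 := by
  intro x
  have : ((x + 1 : ℝ) : UnitAddCircle) = (x : UnitAddCircle) := AddCircle.coe_add_period 1 x
  rw [fn, fn, this]

lemma integrable_circle : Integrable (f : Lp 𝕜 2 (volume : Measure UnitAddCircle)) :=
  (Lp.memLp _).integrable one_le_two

lemma intervalIntegrable_fn (a b : ℝ) : IntervalIntegrable (fn f) volume a b := by
  refine (periodic_fn f).intervalIntegrable one_ne_zero (t := 0) ?_ a b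
  rw [intervalIntegrable_iff_integrableOn_Ioc_of_le (by norm_num)]
  exact (UnitAddCircle.measurePreserving_mk 0).integrable_comp_of_integrable (integrable_circle f)

lemma integral_fn : ∫ x in (0 : ℝ)..1, fn f x = 0 := by
  have := UnitAddCircle.intervalIntegral_preimage 0
    (f : Lp 𝕜 2 (volume : Measure UnitAddCircle))
  rw [zero_add] at this
  exact this.trans f.2

lemma integral_norm_fn_le : ∫ x in (0 : ℝ)..1, ‖(fn f) x‖ ≤ ‖f‖ := by
  have h1 := UnitAddCircle.intervalIntegral_preimage 0
    fun x => ‖(f : Lp 𝕜 2 (volume : Measure UnitAddCircle)) x‖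
  rw [zero_add] at h1
  refine h1.le.trans ?_
  have : IsProbabilityMeasure (volume : Measure UnitAddCircle) := ⟨UnitAddCircle.measure_univ⟩
  have h2 : eLpNorm (f : Lp 𝕜 2 (volume : Measure UnitAddCircle)) 1 volume ≤
      eLpNorm (f : Lp 𝕜 2 (volume : Measure UnitAddCircle)) 2 volume :=
    eLpNorm_le_eLpNorm_of_exponent_le one_le_two (Lp.aestronglyMeasurable _)
  rw [integral_norm_eq_lintegral_enorm (Lp.aestronglyMeasurable _),
    ← eLpNorm_one_eq_lintegral_enorm]
  exact ENNReal.toReal_mono (Lp.eLpNorm_ne_top _) h2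

lemma fn_add (g : MeanZero 𝕜) : ∀ᵐ x : ℝ, fn (f + g) x = (fn f) x + (fn g) x :=
  ae_of_ae_circle (Lp.coeFn_add (f : Lp 𝕜 2 (volume : Measure UnitAddCircle)) g)

lemma fn_smul (c : 𝕜) : ∀ᵐ x : ℝ, fn (c • f) x = c * (fn f) x :=
  ae_of_ae_circle (Lp.coeFn_smul c (f : Lp 𝕜 2 (volume : Measure UnitAddCircle)))

lemma fn_toComplex (f : MeanZero ℝ) : ∀ᵐ x : ℝ, fn (toComplex f) x = ((fn f x : ℝ) : ℂ) :=
  ae_of_ae_circle (Complex.ofRealCLM.coeFn_compLp f.1)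

/-- The mean-zero primitive of a mean-zero function. -/
def prim (x : ℝ) : 𝕜 :=
  (∫ s in (0 : ℝ)..x, fn f s) - ∫ r in (0 : ℝ)..1, ∫ s in (0 : ℝ)..r, fn f s

lemma prim_sub (x y : ℝ) : (prim f) y - (prim f) x = ∫ s in x..y, fn f s := by
  rw [prim, prim, sub_sub_sub_cancel_right, intervalIntegral.integral_interval_sub_left
    (intervalIntegrable_fn f _ _) (intervalIntegrable_fn f _ _)]

lemma periodic_prim : Function.Periodic (prim f) 1 := by
  intro x
  have h := prim_sub f x (x + 1)
  rw [(periodic_fn f).intervalIntegral_add_eq x 0, zero_add, integral_fn f] at h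
  exact sub_eq_zero.1 h

lemma continuous_prim : Continuous (prim f) :=
  (intervalIntegral.continuous_primitive (intervalIntegrable_fn f) 0).sub continuous_const

lemma integral_prim : ∫ x in (0 : ℝ)..1, prim f x = 0 := by
  have h : Continuous fun x => ∫ s in (0 : ℝ)..x, fn f s :=
    intervalIntegral.continuous_primitive (intervalIntegrable_fn f) 0
  simp only [prim]
  rw [intervalIntegral.integral_sub (h.intervalIntegrable _ _) intervalIntegrable_const]
  simp

lemma norm_primitive_le {x : ℝ} (hx : x ∈ Icc (0 : ℝ) 1) :
    ‖∫ s in (0 : ℝ)..x, fn f s‖ ≤ ‖f‖ :=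
  (intervalIntegral.norm_integral_le_integral_norm hx.1).trans
    ((intervalIntegral.integral_mono_interval le_rfl hx.1 hx.2
      (.of_forall fun _ => norm_nonneg _) (intervalIntegrable_fn f 0 1).norm).trans
        (integral_norm_fn_le f))

lemma norm_prim_le (x : ℝ) : ‖(prim f) x‖ ≤ 2 * ‖f‖ := by
  obtain ⟨y, hy, hxy⟩ := (periodic_prim f).exists_mem_Ico₀ one_pos x
  rw [hxy, prim]
  have h1 := norm_primitive_le f (x := y) ⟨hy.1, hy.2.le⟩
  have h2 := intervalIntegral.norm_integral_le_of_norm_le_const (a := (0 : ℝ)) (b := 1)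
    (f := fun r => ∫ s in (0 : ℝ)..r, fn f s) (C := ‖f‖) fun r hr => by
      rw [uIoc_of_le zero_le_one] at hr
      exact norm_primitive_le f ⟨hr.1.le, hr.2⟩
  rw [sub_zero, abs_one, mul_one] at h2
  exact (norm_sub_le_of_le h1 h2).trans_eq (by ring)

lemma primitive_add (g : MeanZero 𝕜) (x : ℝ) : ∫ s in (0 : ℝ)..x, fn (f + g) s =
    (∫ s in (0 : ℝ)..x, fn f s) + ∫ s in (0 : ℝ)..x, fn g s := by
  rw [← intervalIntegral.integral_add (intervalIntegrable_fn f _ _) (intervalIntegrable_fn g _ _)]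
  refine intervalIntegral.integral_congr_ae ?_
  filter_upwards [fn_add f g] with t ht _ using ht

lemma prim_add (g : MeanZero 𝕜) (x : ℝ) : (prim (f + g)) x = (prim f) x + (prim g) x := by
  have hf : Continuous fun x => ∫ s in (0 : ℝ)..x, fn f s :=
    intervalIntegral.continuous_primitive (intervalIntegrable_fn f) 0
  have hg : Continuous fun x => ∫ s in (0 : ℝ)..x, fn g s :=
    intervalIntegral.continuous_primitive (intervalIntegrable_fn g) 0
  simp only [prim, primitive_add f g]
  rw [intervalIntegral.integral_add (hf.intervalIntegrable _ _) (hg.intervalIntegrable _ _)]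
  ring

lemma primitive_smul (c : 𝕜) (x : ℝ) : ∫ s in (0 : ℝ)..x, fn (c • f) s =
    c * ∫ s in (0 : ℝ)..x, fn f s := by
  rw [← intervalIntegral.integral_const_mul]
  refine intervalIntegral.integral_congr_ae ?_
  filter_upwards [fn_smul f c] with t ht _ using ht

lemma prim_smul (c : 𝕜) (x : ℝ) : (prim (c • f)) x = c * (prim f) x := by
  simp only [prim, primitive_smul f c]
  rw [intervalIntegral.integral_const_mul]
  ring

lemma primitive_toComplex (f : MeanZero ℝ) (x : ℝ) : ∫ s in (0 : ℝ)..x, fn (toComplex f) s =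
    ((∫ s in (0 : ℝ)..x, fn f s : ℝ) : ℂ) := by
  rw [← intervalIntegral.integral_ofReal]
  refine intervalIntegral.integral_congr_ae ?_
  filter_upwards [fn_toComplex f] with t ht _ using ht

lemma prim_toComplex (f : MeanZero ℝ) (x : ℝ) : (prim (toComplex f)) x = ((prim f x : ℝ) : ℂ) := by
  simp only [prim, primitive_toComplex f]
  rw [intervalIntegral.integral_ofReal, Complex.ofReal_sub]

lemma hasPrim_comp_sign (f : MeanZero ℂ) {e : ℤ} (he : e = 1 ∨ e = -1) :
    HasPrim (fun x : ℝ => prim f (e * x)) (fun x : ℝ => e * fn f (e * x)) := by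
  refine ⟨(intervalIntegrable_comp_sign (intervalIntegrable_fn f) he 0 1).const_mul _,
    fun x _ => ?_⟩
  have h := intervalIntegral.smul_integral_comp_mul_left (fn f) (e : ℝ) (a := 0) (b := x)
  rw [mul_zero, ← prim_sub f, Complex.real_smul] at h
  beta_reduce
  rw [intervalIntegral.integral_const_mul, mul_zero]
  push_cast at h
  rw [h]
  ring

lemma norm_toComplex_le (f : MeanZero ℝ) : ‖(toComplex f)‖ ≤ ‖f‖ := by
  have := Complex.ofRealCLM.norm_compLp_le (f : Lp ℝ 2 (volume : Measure UnitAddCircle))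
  rwa [Complex.ofRealCLM_norm, one_mul] at this

end MeanZero

/-! ### The scaled coefficients as functions of the potential -/

/-- A linear family of integrable functions as a bounded operator with values in `L¹(0, 1)`. -/
def L1.clm {V : Type*} [NormedAddCommGroup V] [NormedSpace ℂ V] (Φ : V → ℝ → ℂ)
    (hi : ∀ v, IntervalIntegrable (Φ v) volume 0 1)
    (hadd : ∀ v w, ∀ᵐ x, Φ (v + w) x = Φ v x + Φ w x)
    (hsmul : ∀ (c : ℂ) (v), ∀ᵐ x, Φ (c • v) x = c * Φ v x) (C : ℝ)
    (hC : ∀ v, ∫ x in (0 : ℝ)..1, ‖Φ v x‖ ≤ C * ‖v‖) : V →L[ℂ] L1 :=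
  LinearMap.mkContinuous
    { toFun := fun v => L1.ofFun (Φ v) (hi v)
      map_add' := fun v w => by
        refine Lp.ext ?_
        filter_upwards [L1.ofFun_ae (hi (v + w)), L1.ofFun_ae (hi v), L1.ofFun_ae (hi w),
          ae_restrict_of_ae (hadd v w),
          Lp.coeFn_add (L1.ofFun (Φ v) (hi v)) (L1.ofFun (Φ w) (hi w))] with x h1 h2 h3 h4 h5
        rw [h1, h5, Pi.add_apply, h2, h3, h4]
      map_smul' := fun c v => by
        refine Lp.ext ?_
        filter_upwards [L1.ofFun_ae (hi (c • v)), L1.ofFun_ae (hi v),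
          ae_restrict_of_ae (hsmul c v),
          Lp.coeFn_smul c (L1.ofFun (Φ v) (hi v))] with x h1 h2 h3 h4
        rw [h1, RingHom.id_apply, h4, Pi.smul_apply, h2, h3, smul_eq_mul] }
    C (fun v => (L1.norm_eq_of_ae (L1.ofFun_ae (hi v))).trans_le (hC v))

lemma L1.clm_ae {V : Type*} [NormedAddCommGroup V] [NormedSpace ℂ V] {Φ : V → ℝ → ℂ}
    {hi : ∀ v, IntervalIntegrable (Φ v) volume 0 1}
    {hadd : ∀ v w, ∀ᵐ x, Φ (v + w) x = Φ v x + Φ w x}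
    {hsmul : ∀ (c : ℂ) (v), ∀ᵐ x, Φ (c • v) x = c * Φ v x} {C : ℝ}
    {hC : ∀ v, ∫ x in (0 : ℝ)..1, ‖Φ v x‖ ≤ C * ‖v‖} (v : V) :
    L1.clm Φ hi hadd hsmul C hC v =ᵐ[volume.restrict (Ioc (0 : ℝ) 1)] Φ v :=
  L1.ofFun_ae (hi v)

lemma coefP_eq {𝕜 : Type} [RCLike 𝕜] (ψ : Coef 𝕜) : coefP ψ = (MeanZero.prim ψ.fst) := rfl

lemma coefDP_eq {𝕜 : Type} [RCLike 𝕜] (ψ : Coef 𝕜) : coefDP ψ = (MeanZero.fn ψ.fst) := rfl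

lemma coefQ_eq {𝕜 : Type} [RCLike 𝕜] (ψ : Coef 𝕜) : coefQ ψ = (MeanZero.fn ψ.snd) := rfl

section Scaled

variable {e : ℤ} (he : e = 1 ∨ e = -1) (z : ℂ)

include he in
lemma integral_norm_comp_sign_fn_le (f : MeanZero ℂ) :
    ∫ x in (0 : ℝ)..1, ‖MeanZero.fn f (e * x)‖ ≤ ‖f‖ := by
  rw [integral_comp_sign (f := fun x => ‖MeanZero.fn f x‖)
    (fun x => congrArg norm (MeanZero.periodic_fn f x)) he]
  exact MeanZero.integral_norm_fn_le f

/-- The scaled first coefficient. -/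
def scaledP : Coef ℂ →L[ℂ] L1 :=
  L1.clm (fun ψ x => coefP ψ (e * x) / z)
    (fun ψ => (((MeanZero.continuous_prim ψ.fst).comp
      (by fun_prop : Continuous fun x : ℝ => (e * x : ℝ)))
      |>.div_const z).intervalIntegrable _ _)
    (fun v w => .of_forall fun x => by
      rw [coefP_eq, coefP_eq, coefP_eq, WithLp.add_fst, MeanZero.prim_add]; ring)
    (fun c v => .of_forall fun x => by
      rw [coefP_eq, coefP_eq, WithLp.smul_fst, MeanZero.prim_smul]; ring)
    (2 * ‖z‖⁻¹)
    (fun v => by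
      have h := intervalIntegral.integral_mono_on zero_le_one (μ := volume) (a := 0) (b := 1)
        (f := fun x : ℝ => ‖coefP v (e * x) / z‖) (g := fun _ => 2 * ‖z‖⁻¹ * ‖v‖)
        ((((MeanZero.continuous_prim v.fst).comp
          (by fun_prop : Continuous fun x : ℝ => (e * x : ℝ)))
          |>.div_const z).norm.intervalIntegrable _ _) intervalIntegrable_const (fun x _ => by
            rw [norm_div, div_eq_mul_inv, coefP_eq, mul_right_comm]
            gcongr
            exact (MeanZero.norm_prim_le v.fst _).trans (by gcongr; exact WithLp.norm_fst_le _ v))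
      simpa using h)

/-- The scaled second coefficient. -/
def scaledQ : Coef ℂ →L[ℂ] L1 :=
  L1.clm (fun ψ x => e * coefQ ψ (e * x) / z ^ 2)
    (fun ψ => ((intervalIntegrable_comp_sign (MeanZero.intervalIntegrable_fn ψ.snd) he
      0 1).const_mul (e : ℂ)).div_const _)
    (fun v w => by
      filter_upwards [ae_comp_sign (MeanZero.fn_add v.snd w.snd) he] with x hx
      rw [coefQ_eq, coefQ_eq, coefQ_eq, WithLp.add_snd, hx]; ring)
    (fun c v => by
      filter_upwards [ae_comp_sign (MeanZero.fn_smul v.snd c) he] with x hx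
      rw [coefQ_eq, coefQ_eq, WithLp.smul_snd, hx]; ring)
    (‖z‖⁻¹ ^ 2)
    (fun v => by
      simp only [norm_div, norm_mul, norm_sign he, one_mul, norm_pow]
      rw [intervalIntegral.integral_div, div_eq_inv_mul, inv_pow]
      gcongr
      exact (integral_norm_comp_sign_fn_le he _).trans (WithLp.norm_snd_le _ v))

/-- The pair of scaled coefficients. -/
def scaledCoef : Coef ℂ →L[ℂ] Ecal := (scaledP (e := e) z).prod (scaledQ he z)

lemma represents_scaledCoef (ψ : Coef ℂ) : Represents (scaledCoef he z ψ)
    (fun x => coefP ψ (e * x) / z) (fun x => e * coefQ ψ (e * x) / z ^ 2) :=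
  ⟨L1.clm_ae ψ, L1.clm_ae ψ⟩

/-- The value M = 2‖ψ‖ comes from the sup norm of the mean-zero primitive p, which is at most twice
the L² norm of p'. -/
lemma smoothPair_scaledCoef {z : ℝ} (hz : 1 ≤ z) (ψ : Coef ℂ) :
    SmoothPair z (2 * ‖ψ‖) (fun x => coefP ψ (e * x)) (fun x => e * coefDP ψ (e * x))
      (fun x => e * coefQ ψ (e * x)) (scaledCoef he z ψ) where
  one_le := hz
  prim := MeanZero.hasPrim_comp_sign ψ.fst he
  norm_le t _ := (MeanZero.norm_prim_le ψ.fst _).trans (by gcongr; exact WithLp.norm_fst_le _ ψ)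
  int_le := by
    simp only [norm_mul, norm_sign he, one_mul]
    refine (integral_norm_comp_sign_fn_le he ψ.fst).trans ?_
    linarith [WithLp.norm_fst_le _ ψ, norm_nonneg ψ]
  mean := (integral_comp_sign (MeanZero.periodic_prim ψ.fst) he).trans
    (MeanZero.integral_prim ψ.fst)
  int_q := (intervalIntegrable_comp_sign (MeanZero.intervalIntegrable_fn ψ.snd) he 0 1).const_mul _
  int_q_le := by
    simp only [norm_mul, norm_sign he, one_mul]
    refine (integral_norm_comp_sign_fn_le he ψ.snd).trans ?_
    linarith [WithLp.norm_snd_le _ ψ, norm_nonneg ψ]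
  rep := represents_scaledCoef he z ψ

end Scaled

/-- The embedding of the real coefficients into the complex ones as a bounded operator. -/
def toComplexCLM : Coef ℝ →L[ℝ] Coef ℂ :=
  LinearMap.mkContinuous
    { toFun := Coef.toComplex
      map_add' := fun ψ φ => by
        have h : ∀ f g : MeanZero ℝ,
            MeanZero.toComplex (f + g) = MeanZero.toComplex f + MeanZero.toComplex g := fun f g =>
          Subtype.ext (map_add (Complex.ofRealCLM.compLpL 2 volume) f.1 g.1)
        simp only [Coef.toComplex, WithLp.add_fst, WithLp.add_snd, h]
        rfl
      map_smul' := fun c ψ => by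
        have h : ∀ f : MeanZero ℝ,
            MeanZero.toComplex (c • f) = c • MeanZero.toComplex f := fun f =>
          Subtype.ext (map_smul (Complex.ofRealCLM.compLpL 2 volume) c f.1)
        simp only [Coef.toComplex, WithLp.smul_fst, WithLp.smul_snd, h]
        rfl } 1
    (fun ψ => by
      rw [one_mul]
      refine (sq_le_sq₀ (norm_nonneg _) (norm_nonneg _)).1 ?_
      rw [WithLp.prod_norm_sq_eq_of_L2, WithLp.prod_norm_sq_eq_of_L2]
      gcongr
      · exact MeanZero.norm_toComplex_le ψ.fst
      · exact MeanZero.norm_toComplex_le ψ.snd)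

lemma norm_toComplex_le (ψ : Coef ℝ) : ‖ψ.toComplex‖ ≤ ‖ψ‖ :=
  (toComplexCLM.le_of_opNorm_le (LinearMap.mkContinuous_norm_le _ zero_le_one _) ψ).trans_eq
    (one_mul _)

lemma coefP_toComplex (ψ : Coef ℝ) (x : ℝ) : coefP ψ.toComplex x = cP ψ x :=
  (MeanZero.prim_toComplex ψ.fst) x

lemma coefQ_toComplex (ψ : Coef ℝ) : ∀ᵐ x : ℝ, coefQ ψ.toComplex x = cQ ψ x :=
  (MeanZero.fn_toComplex ψ.snd)

lemma represents_scaledCoef_toComplex {e : ℤ} (he : e = 1 ∨ e = -1) (z : ℂ) (ψ : Coef ℝ) :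
    Represents (scaledCoef he z ψ.toComplex)
      (fun x => cP ψ (e * x) / z) (fun x => e * cQ ψ (e * x) / z ^ 2) := by
  have h := represents_scaledCoef he z ψ.toComplex
  refine ⟨h.1.trans (.of_forall fun x => by simp only [coefP_toComplex]), h.2.trans ?_⟩
  filter_upwards [ae_restrict_of_ae (ae_comp_sign (coefQ_toComplex ψ) he)] with x hx
  rw [hx]

lemma perCoef_comp_sign {e : ℤ} (he : e = 1 ∨ e = -1) (ψ : Coef ℝ) :
    PerCoef (fun x => cP ψ (e * x)) (fun x => e * cQ ψ (e * x)) := by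
  have hp : Function.Periodic (cP ψ) 1 := fun x =>
    congrArg Complex.ofReal (MeanZero.periodic_prim ψ.fst x)
  have hq : Function.Periodic (cQ ψ) 1 := fun x =>
    congrArg Complex.ofReal (MeanZero.periodic_fn ψ.snd x)
  have ip : ∀ a b, IntervalIntegrable (cP ψ) volume a b := fun a b =>
    (Complex.continuous_ofReal.comp (MeanZero.continuous_prim ψ.fst)).intervalIntegrable a b
  have iq : ∀ a b, IntervalIntegrable (cQ ψ) volume a b := fun a b =>
    ⟨(MeanZero.intervalIntegrable_fn ψ.snd a b).1.ofReal,
      (MeanZero.intervalIntegrable_fn ψ.snd a b).2.ofReal⟩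
  exact ⟨periodic_comp_sign hp he, fun x => congrArg ((e : ℂ) * ·) (periodic_comp_sign hq he x),
    intervalIntegrable_comp_sign ip he,
    fun a b => (intervalIntegrable_comp_sign iq he a b).const_mul _⟩

/-- By periodicity p(1 − x) = p(−x), and likewise for q. So both signs of the index are covered by
one formula with e = ±1 and the coefficients p(ex), e q(ex). -/
lemma normingFun_eq {e : ℤ} (he : e = 1 ∨ e = -1) (ψ : Coef ℝ) {n : ℤ} (hn : 0 < n) :
    hs (e * n) ψ = e * normingPos (fun x => cP ψ (e * x)) (fun x => e * cQ ψ (e * x)) n := by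
  rcases he with rfl | rfl
  · simp [hs, normingFun, hn]
  · have h1 : (fun x => cP ψ (1 - x)) = fun x => cP ψ (((-1 : ℤ) : ℝ) * x) := funext fun x => by
      have : cP ψ (-x + 1) = cP ψ (-x) :=
        congrArg Complex.ofReal (MeanZero.periodic_prim ψ.fst (-x))
      simp only [Int.cast_neg, Int.cast_one, neg_mul, one_mul, ← this]
      congr 1
      ring
    have h2 : (fun x => -cQ ψ (1 - x)) = fun x => ((-1 : ℤ) : ℂ) * cQ ψ (((-1 : ℤ) : ℝ) * x) :=
      funext fun x => by
        have : cQ ψ (-x + 1) = cQ ψ (-x) :=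
          congrArg Complex.ofReal (MeanZero.periodic_fn ψ.snd (-x))
        simp only [Int.cast_neg, Int.cast_one, neg_mul, one_mul, ← this]
        congr 2
        ring
    have h3 : ¬ 0 < -1 * n := by omega
    rw [hs, normingFun, if_neg h3, h1, h2]
    simp

/-! ### Norming constants as functions of the coefficients -/

lemma exists_sign_mul {m : ℤ} (hm : m ≠ 0) :
    ∃ e n : ℤ, (e = 1 ∨ e = -1) ∧ 0 < n ∧ m = e * n := by
  rcases hm.lt_or_gt with h | h
  · exact ⟨-1, -m, .inr rfl, by omega, by ring⟩
  · exact ⟨1, m, .inl rfl, h, by ring⟩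

lemma zo_sign_mul (e n : ℤ) : zo (e * n) = e * zo n := by
  rw [zo, zo]; push_cast; ring

lemma integral_bn {m : ℤ} (hm : m ≠ 0) : ∫ t in (0 : ℝ)..1, bn m t = 0 := by
  have hm' : 2 * π * (m : ℝ) ≠ 0 := by
    have : (m : ℝ) ≠ 0 := by exact_mod_cast hm
    positivity
  have hd : ∀ t : ℝ, HasDerivAt (fun t => (Real.sin (2 * π * m * t) -
      √3 * Real.cos (2 * π * m * t)) / (2 * π * m)) (bn m t) t := fun t => by
    have h0 : HasDerivAt (fun t : ℝ => 2 * π * m * t) (2 * π * m) t := by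
      simpa using (hasDerivAt_id t).const_mul (2 * π * m)
    refine ((h0.sin.sub (h0.cos.const_mul √3)).div_const _).congr_deriv ?_
    rw [bn]
    field_simp
    ring
  rw [intervalIntegral.integral_eq_sub_of_hasDerivAt (fun t _ => hd t)
    ((continuous_bn m).intervalIntegrable _ _)]
  have h1 : 2 * π * (m : ℝ) * 1 = m * (2 * π) := by ring
  rw [h1, Real.cos_int_mul_two_pi, mul_zero, Real.sin_zero, Real.cos_zero]
  have h2 : (m : ℝ) * (2 * π) = ((2 * m : ℤ) : ℝ) * π := by push_cast; ring
  rw [h2, Real.sin_int_mul_pi]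
  ring

lemma bn_sign_mul {e : ℤ} (he : e = 1 ∨ e = -1) (n : ℤ) (t : ℝ) : bn (e * n) (e * t) = bn n t := by
  rcases he with rfl | rfl
  · simp
  · simp [bn]

lemma periodic_bn (n : ℤ) : Function.Periodic (bn n) 1 := by
  intro t
  have h : 2 * π * (n : ℝ) * (t + 1) = 2 * π * n * t + n * (2 * π) := by ring
  rw [bn, h, Real.cos_add_int_mul_two_pi, Real.sin_add_int_mul_two_pi, bn]

/-- The point `t` or `1 - t`, depending on the sign. -/
def flip (e : ℤ) (t : ℝ) : ℝ := (1 - e) / 2 + e * t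

lemma flip_mem {e : ℤ} (he : e = 1 ∨ e = -1) {t : ℝ} (ht : t ∈ Icc (0 : ℝ) 1) :
    flip e t ∈ Icc (0 : ℝ) 1 := by
  rcases he with rfl | rfl
  · simpa [flip] using ht
  · constructor <;> simp [flip] <;> linarith [ht.1, ht.2]

lemma continuous_flip (e : ℤ) : Continuous (flip e) := by unfold flip; fun_prop

lemma integral_flip {e : ℤ} (he : e = 1 ∨ e = -1) (f : ℝ → ℝ) :
    ∫ t in (0 : ℝ)..1, f (flip e t) = ∫ t in (0 : ℝ)..1, f t := by
  rcases he with rfl | rfl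
  · simp [flip]
  · have : ∀ t : ℝ, flip (-1) t = 1 - t := fun t => by simp [flip]; ring
    simp [this]

lemma periodic_apply_flip {F : Type*} {f : ℝ → F} (hf : Function.Periodic f 1) {e : ℤ}
    (he : e = 1 ∨ e = -1) (t : ℝ) : f (e * flip e t) = f t := by
  rcases he with rfl | rfl
  · simp [flip]
  · have : ((-1 : ℤ) : ℝ) * flip (-1) t = t - 1 := by simp [flip]; ring
    rw [this, hf.sub_eq]

lemma periodic_flip {F : Type*} {f : ℝ → F} (hf : Function.Periodic f 1) {e : ℤ}
    (he : e = 1 ∨ e = -1) (t : ℝ) : f (flip e t) = f (e * t) := by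
  rcases he with rfl | rfl
  · simp [flip]
  · have : flip (-1) t = ((-1 : ℤ) : ℝ) * t + 1 := by simp [flip]; ring
    rw [this, hf]

lemma flip_flip {e : ℤ} (he : e = 1 ∨ e = -1) (t : ℝ) : flip e (flip e t) = t := by
  rcases he with rfl | rfl
  · simp [flip]
  · simp [flip]

lemma bn_flip {e : ℤ} (he : e = 1 ∨ e = -1) (n : ℤ) (t : ℝ) : bn n (flip e t) = bn (e * n) t := by
  rw [← bn_sign_mul he, periodic_apply_flip (periodic_bn _) he]

/-- The first order term of the norming constants. -/
lemma integral_bn_mul_coef (m : ℤ) (ψ : Coef ℝ) :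
    ∫ t in (0 : ℝ)..1, bn m t * (coefQ ψ t - zo m * coefP ψ t) =
      fs m (coefDP ψ) / √3 + fc m (coefQ ψ) - fc m (coefDP ψ) + √3 * fs m (coefQ ψ) := by
  have hcos : Continuous fun t : ℝ => Real.cos (2 * π * m * t) := by fun_prop
  have hsin : Continuous fun t : ℝ => Real.sin (2 * π * m * t) := by fun_prop
  have iD := MeanZero.intervalIntegrable_fn ψ.fst 0 1
  have iQ := MeanZero.intervalIntegrable_fn ψ.snd 0 1
  have iP := (MeanZero.continuous_prim ψ.fst).intervalIntegrable 0 1 (μ := volume)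
  rw [← coefDP_eq] at iD
  rw [← coefQ_eq] at iQ
  rw [← coefP_eq] at iP
  -- u is a primitive of zo m · bn m. Integrating by parts moves the large factor zo m from p to p',
  -- and the boundary terms cancel by periodicity.
  set u : ℝ → ℝ := fun t => Real.sin (2 * π * m * t) / √3 - Real.cos (2 * π * m * t) with hu
  have huc : Continuous u := (hsin.div_const _).sub hcos
  have hu' : ∀ t : ℝ, HasDerivAt u (zo m * bn m t) t := fun t => by
    have h0 : HasDerivAt (fun t : ℝ => 2 * π * m * t) (2 * π * m) t := by
      simpa using (hasDerivAt_id t).const_mul (2 * π * m)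
    refine ((h0.sin.div_const _).sub h0.cos).congr_deriv ?_
    rw [bn, zo]
    field_simp
    ring
  have hprim : HasPrim (fun t => (u t : ℂ)) fun t => ((zo m * bn m t : ℝ) : ℂ) :=
    HasPrim.of_hasDerivAt (fun t => (hu' t).ofReal_comp)
      (Complex.continuous_ofReal.comp (continuous_const.mul (continuous_bn m)))
  have hp := MeanZero.hasPrim_comp_sign (MeanZero.toComplex ψ.fst) (e := 1) (.inl rfl)
  have h1 := (hprim.mul hp).integral_eq
  have hper : (u 1 : ℂ) * coefP ψ 1 - u 0 * coefP ψ 0 = 0 := by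
    have e1 : coefP ψ 1 = coefP ψ 0 := by
      have := MeanZero.periodic_prim ψ.fst 0
      rwa [zero_add] at this
    have e2 : u 1 = u 0 := by
      have h1 : 2 * π * (m : ℝ) * 1 = m * (2 * π) := by ring
      have h2 : (m : ℝ) * (2 * π) = ((2 * m : ℤ) : ℝ) * π := by push_cast; ring
      simp only [hu]
      rw [h1, Real.cos_int_mul_two_pi, h2, Real.sin_int_mul_pi]
      simp
    rw [e1, e2, sub_self]
  have h2 : ∫ t in (0 : ℝ)..1, (zo m * bn m t * coefP ψ t + u t * coefDP ψ t) = 0 := by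
    have h3 : ((∫ t in (0 : ℝ)..1, (zo m * bn m t * coefP ψ t + u t * coefDP ψ t) : ℝ) : ℂ) =
        0 := by
      rw [← intervalIntegral.integral_ofReal]
      refine Eq.trans ?_ (h1.trans ?_)
      · refine intervalIntegral.integral_congr_ae ?_
        filter_upwards [MeanZero.fn_toComplex ψ.fst] with t ht _
        simp only [Int.cast_one, one_mul, ht, MeanZero.prim_toComplex]
        rw [coefP_eq, coefDP_eq]
        push_cast
        ring
      · simp only [Int.cast_one, one_mul, MeanZero.prim_toComplex]
        exact hper
    exact_mod_cast h3
  have hs3 : √3 ≠ 0 := by positivity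
  have a1 := iD.mul_continuousOn hsin.continuousOn
  have a2 := iQ.mul_continuousOn hcos.continuousOn
  have a3 := iD.mul_continuousOn hcos.continuousOn
  have a4 := iQ.mul_continuousOn hsin.continuousOn
  have i1 : IntervalIntegrable (fun t => bn m t * (coefQ ψ t - zo m * coefP ψ t)) volume 0 1 :=
    (iQ.sub (iP.const_mul _)).continuousOn_mul (continuous_bn m).continuousOn
  have i2 : IntervalIntegrable (fun t => zo m * bn m t * coefP ψ t + u t * coefDP ψ t)
      volume 0 1 :=
    (iP.continuousOn_mul (continuous_const.mul (continuous_bn m)).continuousOn).add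
      (iD.continuousOn_mul huc.continuousOn)
  have h5 := intervalIntegral.integral_add i1 i2
  rw [h2, add_zero] at h5
  rw [← h5, fs, fc, fc, fs, ← intervalIntegral.integral_div, ← intervalIntegral.integral_const_mul,
    ← intervalIntegral.integral_add (a1.div_const _) a2, ← intervalIntegral.integral_sub
    ((a1.div_const _).add a2) a3, ← intervalIntegral.integral_add
    (((a1.div_const _).add a2).sub a3) (a4.const_mul _)]
  congr 1
  funext t
  simp only [hu, bn]
  ring

/-- Removal of the mean value from a kernel. -/
lemma abs_sub_integral_sub_le {G B : ℝ → ℝ} (hG : ContinuousOn G (Icc 0 1)) (hB : Continuous B)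
    (hB0 : ∫ t in (0 : ℝ)..1, B t = 0) {K : ℝ} (h : ∀ t ∈ Icc (0 : ℝ) 1, |G t - B t| ≤ K) {t : ℝ}
    (ht : t ∈ Icc (0 : ℝ) 1) : |G t - (∫ s in (0 : ℝ)..1, G s) - B t| ≤ 2 * K := by
  have hGi : IntervalIntegrable G volume 0 1 :=
    ContinuousOn.intervalIntegrable (by rwa [uIcc_of_le zero_le_one])
  have h1 := intervalIntegral.norm_integral_le_of_norm_le_const (a := (0 : ℝ)) (b := 1)
    (f := fun t => G t - B t) (C := K) fun s hs => by
      rw [uIoc_of_le zero_le_one] at hs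
      exact h s ⟨hs.1.le, hs.2⟩
  rw [intervalIntegral.integral_sub hGi (hB.intervalIntegrable _ _), hB0, sub_zero, sub_zero,
    abs_one, mul_one, Real.norm_eq_abs] at h1
  have h2 : G t - (∫ s in (0 : ℝ)..1, G s) - B t = (G t - B t) - ∫ s in (0 : ℝ)..1, G s := by ring
  rw [h2]
  exact (abs_sub _ _).trans (by linarith [h t ht])

/-- Constants in the kernels are invisible to mean-zero p and q; subtracting the mean values makes
the kernels themselves mean-zero. -/
lemma isGradient_of_kernel {F : Coef ℝ → ℝ} {ψ : Coef ℝ} {D : Coef ℝ →L[ℝ] ℝ}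
    (hD : HasFDerivAt F D ψ) {gp gq : ℝ → ℝ} (hp : ContinuousOn gp (Icc 0 1))
    (hq : ContinuousOn gq (Icc 0 1))
    (h : ∀ v, D v = ∫ t in (0 : ℝ)..1, (gp t * coefP v t + gq t * coefQ v t)) :
    IsGradient F ψ (fun t => gp t - ∫ s in (0 : ℝ)..1, gp s)
      (fun t => gq t - ∫ s in (0 : ℝ)..1, gq s) := by
  have ip : IntervalIntegrable gp volume 0 1 :=
    ContinuousOn.intervalIntegrable (by rwa [uIcc_of_le zero_le_one])
  have iq : IntervalIntegrable gq volume 0 1 :=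
    ContinuousOn.intervalIntegrable (by rwa [uIcc_of_le zero_le_one])
  refine ⟨hp.sub continuousOn_const, hq.sub continuousOn_const, ?_, ?_, D, hD, fun v => ?_⟩
  · rw [intervalIntegral.integral_sub ip intervalIntegrable_const]; simp
  · rw [intervalIntegral.integral_sub iq intervalIntegrable_const]; simp
  · have iP : IntervalIntegrable (coefP v) volume 0 1 :=
      (MeanZero.continuous_prim v.fst).intervalIntegrable 0 1
    have iQ : IntervalIntegrable (coefQ v) volume 0 1 := MeanZero.intervalIntegrable_fn v.snd 0 1
    have mP : ∫ t in (0 : ℝ)..1, coefP v t = 0 := MeanZero.integral_prim v.fst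
    have mQ : ∫ t in (0 : ℝ)..1, coefQ v t = 0 := MeanZero.integral_fn v.snd
    have jP : IntervalIntegrable (fun t => gp t * coefP v t) volume 0 1 :=
      iP.continuousOn_mul (by rwa [uIcc_of_le zero_le_one])
    have jQ : IntervalIntegrable (fun t => gq t * coefQ v t) volume 0 1 :=
      iQ.continuousOn_mul (by rwa [uIcc_of_le zero_le_one])
    rw [h v]
    simp only [sub_mul]
    rw [intervalIntegral.integral_add (jP.sub (iP.const_mul _)) (jQ.sub (iQ.const_mul _)),
      intervalIntegral.integral_sub jP (iP.const_mul _),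
      intervalIntegral.integral_sub jQ (iQ.const_mul _), intervalIntegral.integral_const_mul,
      intervalIntegral.integral_const_mul, mP, mQ, intervalIntegral.integral_add jP jQ]
    ring

/-- The analytic extension of the norming constants. -/
def normingExt {e : ℤ} (he : e = 1 ∨ e = -1) (n : ℤ) (g : Ecal → Fin 3 → ℂ) (l : Ecal → Fin 2 → ℂ)
    (ψ : Coef ℂ) : ℂ :=
  e * (4 * (π * n) ^ 2) * logRatio g l (scaledCoef he (zc n) ψ)

lemma norm_scaledCoef_le {e : ℤ} (he : e = 1 ∨ e = -1) {n : ℤ} (hn : 0 < n) (ψ : Coef ℂ) :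
    ‖scaledCoef he (zc n) ψ‖ ≤ 2 * ‖ψ‖ / zo n :=
  (smoothPair_scaledCoef he (by linarith [three_le_zo hn]) ψ).norm_le_div

lemma norm_scaledCoef_le_norm {e : ℤ} (he : e = 1 ∨ e = -1) {n : ℤ} (hn : 0 < n) (ψ : Coef ℂ) :
    ‖scaledCoef he (zc n) ψ‖ ≤ ‖ψ‖ := by
  refine (norm_scaledCoef_le he hn ψ).trans ?_
  have := three_le_zo hn
  rw [div_le_iff₀ (by linarith)]
  nlinarith [norm_nonneg ψ]

section

variable {e n : ℤ} (he : e = 1 ∨ e = -1) {ρ σ L : ℝ} {g : Ecal → Fin 3 → ℂ} {l : Ecal → Fin 2 → ℂ}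
  (hn : 0 < n) (h : IsSpec n ρ σ L g l) (hρ : ρ ≤ 1 / 1000) (hL : 0 ≤ L)
  (hLρ : L * ρ ≤ 1 / 1000)

include hn h hL hLρ in
lemma analyticAt_normingExt {ψ : Coef ℂ} (hψ : ‖ψ‖ < ρ) : AnalyticAt ℂ (normingExt he n g l) ψ := by
  have h1 := (norm_scaledCoef_le_norm he hn ψ).trans_lt hψ
  exact analyticAt_const.fun_mul (AnalyticAt.comp (f := scaledCoef he (zc n))
    (h.analyticAt_logRatio hL hLρ h1) ((scaledCoef he (zc n)).analyticAt ψ))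

variable (hσ : σ ≤ 1 / 100) {ψ : Coef ℝ} (hψ : ‖ψ‖ < ρ / 2) (hψ' : ‖ψ‖ < σ / 10 ^ 12)

include hn h hρ hL hLρ hσ hψ hψ'

lemma setting_scaledCoef : Setting n ρ σ L g l (fun x => cP ψ (e * x)) (fun x => e * cQ ψ (e * x))
    (scaledCoef he (zc n) ψ.toComplex) := by
  have h1 := (norm_scaledCoef_le_norm he hn ψ.toComplex).trans (norm_toComplex_le ψ)
  exact ⟨hn, h, hρ, hσ, hL, hLρ, perCoef_comp_sign he ψ, represents_scaledCoef_toComplex he _ ψ,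
    h1.trans_lt (by linarith [norm_nonneg ψ]), h1.trans_lt hψ'⟩

lemma normingExt_toComplex : normingExt he n g l ψ.toComplex = (hs (e * n) ψ : ℂ) := by
  have h1 := (setting_scaledCoef he hn h hρ hL hLρ hσ hψ hψ').normingPos_eq
    (fun t => by simp [cP]) (fun t => by simp [cQ])
  rw [normingFun_eq he ψ hn, Complex.ofReal_mul, h1, normingExt, logRatio]
  push_cast
  ring

lemma normingWellDefined_of_small : NormingWellDefined ψ n := by
  have h1 := (setting_scaledCoef (.inl rfl : (1 : ℤ) = 1 ∨ (1 : ℤ) = -1) hn h hρ hL hLρ hσ hψ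
    hψ').normingWellDefined (fun t => by simp [cP]) (fun t => by simp [cQ])
  have e1 : (fun x => cP ψ (((1 : ℤ) : ℝ) * x)) = cP ψ := funext fun x => by simp
  have e2 : (fun x => ((1 : ℤ) : ℂ) * cQ ψ (((1 : ℤ) : ℝ) * x)) = cQ ψ := funext fun x => by simp
  rwa [e1, e2] at h1

include he in
lemma abs_hs_sub_le (hψ2 : 2 * ‖ψ‖ ≤ 1) : |hs (e * n) ψ -
    (fs (e * n) (coefDP ψ) / √3 + fc (e * n) (coefQ ψ) - fc (e * n) (coefDP ψ) +
      √3 * fs (e * n) (coefQ ψ))| ≤ 10 ^ 46 * (1 + L) ^ 6 * ‖ψ‖ ^ 2 / n := by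
  have hψC := norm_toComplex_le ψ
  have hn' : (0 : ℝ) < n := by exact_mod_cast hn
  have h3 := (setting_scaledCoef he hn h hρ hL hLρ hσ hψ hψ').norm_logRatio_sub_le
    (smoothPair_scaledCoef he (by linarith [three_le_zo hn]) ψ.toComplex) (by linarith)
  have he2 : (e : ℝ) * e = 1 := by rcases he with rfl | rfl <;> simp
  have he2' : (e : ℂ) * e = 1 := by exact_mod_cast he2
  -- Since bn (e n)(e t) = bn n t and zo (e n) = e · zo n, the substitution of e t for t identifies
  -- the main term with index e n for ψ as e times the main term with index n for the coefficients
  -- p(ex), e q(ex).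
  have h4 : ((∫ t in (0 : ℝ)..1, bn (e * n) t * (coefQ ψ t - zo (e * n) * coefP ψ t) : ℝ) : ℂ) =
      e * ∫ t in (0 : ℝ)..1, (bn n t : ℂ) *
        (e * coefQ ψ.toComplex (e * t) - zo n * coefP ψ.toComplex (e * t)) := by
    rw [← integral_comp_sign (f := fun t => bn (e * n) t * (coefQ ψ t - zo (e * n) * coefP ψ t))
      (fun t => by
        simp only [coefQ_eq, coefP_eq]
        rw [periodic_bn, MeanZero.periodic_fn, MeanZero.periodic_prim]) he,
      ← intervalIntegral.integral_ofReal, ← intervalIntegral.integral_const_mul]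
    refine intervalIntegral.integral_congr_ae ?_
    filter_upwards [ae_comp_sign (coefQ_toComplex ψ) he] with t ht _
    rw [ht, coefP_toComplex, bn_sign_mul he, zo_sign_mul, cQ, cP]
    push_cast
    linear_combination (-(bn n t : ℂ) * ((coefQ ψ (e * t) : ℝ) : ℂ)) * he2'
  rw [← integral_bn_mul_coef, ← Real.norm_eq_abs, ← Complex.norm_real, Complex.ofReal_sub, h4,
    ← normingExt_toComplex he hn h hρ hL hLρ hσ hψ hψ', normingExt, mul_assoc, ← mul_sub, norm_mul,
    norm_sign he, one_mul]
  refine h3.trans ?_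
  have h5 : (2 * ‖ψ.toComplex‖) ^ 2 ≤ 10 * ‖ψ‖ ^ 2 := by
    have := pow_le_pow_left₀ (norm_nonneg _) hψC 2
    nlinarith [sq_nonneg ‖ψ‖]
  calc _ ≤ 10 ^ 45 * (1 + L) ^ 6 * (10 * ‖ψ‖ ^ 2) / n := by gcongr
    _ = _ := by ring

include he in
lemma exists_gradient_hs : ∃ gp gq : ℝ → ℝ, IsGradient (hs (e * n)) ψ gp gq ∧
    ∀ t ∈ Icc (0 : ℝ) 1, |gp t + zo (e * n) * bn (e * n) t| ≤ 192 / ρ ^ 2 * ‖ψ‖ ∧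
      |gq t - bn (e * n) t| ≤ 192 / ρ ^ 2 * ‖ψ‖ / n := by
  have hψC := norm_toComplex_le ψ
  have hn' : (0 : ℝ) < n := by exact_mod_cast hn
  have hm : e * n ≠ 0 := by rcases he with rfl | rfl <;> omega
  have hz := le_zo hn
  have hz0 : 0 < zo n := by linarith
  have hρ0 : 0 < ρ := by linarith [norm_nonneg ψ]
  have he2 : (e : ℝ) * e = 1 := by rcases he with rfl | rfl <;> simp
  have he2' : (e : ℂ) * e = 1 := by exact_mod_cast he2
  set Θ := scaledCoef he (zc n) with hΘ
  set E := Θ ψ.toComplex with hE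
  have hEle : ‖E‖ ≤ 2 * ‖ψ‖ / zo n :=
    (norm_scaledCoef_le he hn ψ.toComplex).trans (by gcongr)
  have hEρ : ‖E‖ < ρ / 2 := ((norm_scaledCoef_le_norm he hn ψ.toComplex).trans hψC).trans_lt hψ
  obtain ⟨D, gP, gQ, cP', cQ', hD, hDV, hP, hQ⟩ := h.exists_gradient hL hLρ hn hρ hEρ
  set c : ℂ := e * (4 * (π * n) ^ 2) with hc
  have hc' : c = e * (3 * zc n ^ 2) := by
    have h4 := congrArg (fun x : ℝ => (x : ℂ)) (three_mul_zo_sq n)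
    simp only [Complex.ofReal_mul, Complex.ofReal_pow, Complex.ofReal_ofNat,
      Complex.ofReal_intCast] at h4
    rw [hc, zc, h4]
  have hd1 : HasFDerivAt (fun φ : Coef ℝ => normingExt he n g l φ.toComplex)
      (((c • D).restrictScalars ℝ) ∘L ((Θ.restrictScalars ℝ) ∘L toComplexCLM)) ψ := by
    have k1 : HasFDerivAt (fun V => c * logRatio g l V) ((c • D).restrictScalars ℝ) E :=
      (hD.const_mul c).restrictScalars ℝ
    exact HasFDerivAt.comp (g := fun V => c * logRatio g l V)
      (f := (Θ.restrictScalars ℝ) ∘L toComplexCLM) ψ k1 (ContinuousLinearMap.hasFDerivAt _)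
  have hd2 : HasFDerivAt (hs (e * n)) (Complex.reCLM ∘L
      (((c • D).restrictScalars ℝ) ∘L ((Θ.restrictScalars ℝ) ∘L toComplexCLM))) ψ := by
    refine (Complex.reCLM.hasFDerivAt.comp ψ hd1).congr_of_eventuallyEq ?_
    have o : IsOpen {φ : Coef ℝ | ‖φ‖ < ρ / 2 ∧ ‖φ‖ < σ / 10 ^ 12} :=
      (isOpen_lt continuous_norm continuous_const).inter
        (isOpen_lt continuous_norm continuous_const)
    filter_upwards [o.mem_nhds ⟨hψ, hψ'⟩] with φ hφ
    simp only [Function.comp_apply, Complex.reCLM_apply]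
    rw [normingExt_toComplex he hn h hρ hL hLρ hσ hφ.1 hφ.2, Complex.ofReal_re]
  -- The factors 3ez and 3 are c = 3ez² times the weights 1/z and e/z² of the scaled coefficients.
  -- The argument is `flip e t`, congruent to e t modulo 1, because the kernels are controlled on
  -- [0, 1] only.
  set gp : ℝ → ℝ := fun t => (3 * e * zc n * gP (flip e t)).re with hgp
  set gq : ℝ → ℝ := fun t => (3 * gQ (flip e t)).re with hgq
  have cp : ContinuousOn gp (Icc 0 1) := Complex.continuous_re.comp_continuousOn
    (continuousOn_const.mul (cP'.comp (continuous_flip e).continuousOn fun t ht => flip_mem he ht))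
  have cq : ContinuousOn gq (Icc 0 1) := Complex.continuous_re.comp_continuousOn
    (continuousOn_const.mul (cQ'.comp (continuous_flip e).continuousOn fun t ht => flip_mem he ht))
  have hker : ∀ v, (Complex.reCLM ∘L (((c • D).restrictScalars ℝ) ∘L
      ((Θ.restrictScalars ℝ) ∘L toComplexCLM))) v =
      ∫ t in (0 : ℝ)..1, (gp t * coefP v t + gq t * coefQ v t) := by
    intro v
    have e1 : (Complex.reCLM ∘L (((c • D).restrictScalars ℝ) ∘L
      ((Θ.restrictScalars ℝ) ∘L toComplexCLM))) v = (c * D (Θ v.toComplex)).re := rfl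
    have i1 := intervalIntegrable_smul (Θ v.toComplex).1 cP'
    have i2 := intervalIntegrable_smul (Θ v.toComplex).2 cQ'
    simp only [smul_eq_mul] at i1 i2
    have e2 := Complex.reCLM.intervalIntegral_comp_comm ((i1.add i2).const_mul c)
    rw [e1, hDV, ← intervalIntegral.integral_const_mul]
    have hrep := represents_scaledCoef_toComplex he (zc n) v
    rw [← hΘ] at hrep
    refine e2.symm.trans ?_
    rw [← integral_flip he fun t => gp t * coefP v t + gq t * coefQ v t]
    refine intervalIntegral.integral_congr_ae ?_
    filter_upwards [ae_Ioc_of_ae_restrict hrep.1 (x := 1) (by simp),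
      ae_Ioc_of_ae_restrict hrep.2 (x := 1) (by simp)] with t h1 h2 ht
    have hzc := zc_ne_zero hn
    have e3 : c * ((Θ v.toComplex).1 t * gP t + (Θ v.toComplex).2 t * gQ t) =
        3 * e * zc n * gP t * (coefP v (e * t) : ℝ) + 3 * gQ t * (coefQ v (e * t) : ℝ) := by
      rw [h1 ht, h2 ht, hc', cP, cQ]
      field_simp
      linear_combination (coefQ v (e * t) * gQ t : ℂ) * he2'
    simp only [Complex.reCLM_apply, hgp, hgq, flip_flip he]
    rw [e3, Complex.add_re, Complex.re_mul_ofReal, Complex.re_mul_ofReal, coefP_eq, coefQ_eq,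
      periodic_flip (MeanZero.periodic_prim _) he, periodic_flip (MeanZero.periodic_fn _) he]
  -- The gain ‖E‖ ≤ 2‖ψ‖/z balances the factor z in the derivative with respect to p and yields the
  -- decay 1/n in the derivative with respect to q.
  have hKE : 16 / ρ ^ 2 * ‖E‖ ≤ 32 / ρ ^ 2 * ‖ψ‖ / zo n := by
    calc _ ≤ 16 / ρ ^ 2 * (2 * ‖ψ‖ / zo n) := by gcongr
      _ = _ := by ring
  have b0 : ∫ t in (0 : ℝ)..1, -zo (e * n) * bn (e * n) t = 0 := by
    rw [intervalIntegral.integral_const_mul, integral_bn hm, mul_zero]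
  have k1 : ∀ t ∈ Icc (0 : ℝ) 1, |gp t - -zo (e * n) * bn (e * n) t| ≤ 96 / ρ ^ 2 * ‖ψ‖ := by
    intro t ht
    have e1 : gp t - -zo (e * n) * bn (e * n) t =
        ((3 * e * zo n : ℝ) * (gP (flip e t) + bn n (flip e t) / 3) : ℂ).re := by
      have e2 : ((3 * e * zo n : ℝ) * (gP (flip e t) + bn n (flip e t) / 3) : ℂ) =
          3 * e * zc n * gP (flip e t) + ((e * zo n * bn (e * n) t : ℝ) : ℂ) := by
        rw [bn_flip he, zc]
        push_cast
        ring
      rw [e2, Complex.add_re, Complex.ofReal_re, zo_sign_mul]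
      ring
    rw [e1]
    refine (Complex.abs_re_le_norm _).trans ?_
    rw [norm_mul, Complex.norm_real, norm_mul, norm_mul, norm_sign he, mul_one,
      Real.norm_of_nonneg hz0.le, Real.norm_of_nonneg (by norm_num)]
    calc _ ≤ 3 * zo n * (32 / ρ ^ 2 * ‖ψ‖ / zo n) := by
          gcongr
          exact (hP _ (flip_mem he ht)).trans hKE
      _ = _ := by field_simp; ring
  have k2 : ∀ t ∈ Icc (0 : ℝ) 1, |gq t - bn (e * n) t| ≤ 96 / ρ ^ 2 * ‖ψ‖ / n := by
    intro t ht
    have e1 : gq t - bn (e * n) t = ((3 : ℝ) * (gQ (flip e t) - bn n (flip e t) / 3) : ℂ).re := by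
      have e2 : ((3 : ℝ) * (gQ (flip e t) - bn n (flip e t) / 3) : ℂ) =
          3 * gQ (flip e t) - ((bn (e * n) t : ℝ) : ℂ) := by
        rw [bn_flip he]
        push_cast
        ring
      rw [e2, Complex.sub_re, Complex.ofReal_re]
    rw [e1]
    refine (Complex.abs_re_le_norm _).trans ?_
    rw [norm_mul, Complex.norm_real, Real.norm_of_nonneg (by norm_num)]
    calc _ ≤ 3 * (32 / ρ ^ 2 * ‖ψ‖ / zo n) := by
          gcongr
          exact (hQ _ (flip_mem he ht)).trans hKE
      _ ≤ 3 * (32 / ρ ^ 2 * ‖ψ‖ / n) := by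
          gcongr
          linarith
      _ = _ := by ring
  -- The comparison functions have mean value zero, so removing the mean values of the kernels at
  -- most doubles the error, from 96 to 192.
  refine ⟨_, _, isGradient_of_kernel hd2 cp cq hker, fun t ht => ⟨?_, ?_⟩⟩
  · have := abs_sub_integral_sub_le cp (B := fun t => -zo (e * n) * bn (e * n) t)
      (continuous_const.mul (continuous_bn _)) b0 k1 ht
    rw [neg_mul, sub_neg_eq_add] at this
    exact this.trans_eq (by ring)
  · exact (abs_sub_integral_sub_le cq (continuous_bn _) (integral_bn hm) k2 ht).trans_eq (by ring)

end

end ThreePoint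

end

/-! ### The main theorem -/

theorem theorem2 :
    ∃ ε₀ : ℝ, 0 < ε₀ ∧ ∀ ε : ℝ, 0 < ε → ε ≤ ε₀ →
      -- the norming constants are well defined on the real ball
      (∀ ψ ∈ Metric.ball (0 : ThreePoint.Coef ℝ) ε, ∀ n : ℤ, 0 < n →
        ThreePoint.NormingWellDefined ψ n) ∧
      -- analyticity on the complex ball
      (∀ n : ℤ, n ≠ 0 → ∃ H : ThreePoint.Coef ℂ → ℂ,
        AnalyticOnNhd ℂ H (Metric.ball (0 : ThreePoint.Coef ℂ) ε) ∧
        ∀ ψ ∈ Metric.ball (0 : ThreePoint.Coef ℝ) ε,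
          H (ThreePoint.Coef.toComplex ψ) = (ThreePoint.hs n ψ : ℂ)) ∧
      -- asymptotics of the norming constants and of their gradients
      ∃ C : ℝ, 0 < C ∧ ∀ ψ ∈ Metric.ball (0 : ThreePoint.Coef ℝ) ε, ∀ n : ℤ, n ≠ 0 →
        |ThreePoint.hs n ψ -
            (ThreePoint.fs n (ThreePoint.coefDP ψ) / √3 + ThreePoint.fc n (ThreePoint.coefQ ψ) -
              ThreePoint.fc n (ThreePoint.coefDP ψ) +
              √3 * ThreePoint.fs n (ThreePoint.coefQ ψ))| ≤ C * ‖ψ‖ ^ 2 / |(n : ℝ)| ∧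
        ∃ gp gq : ℝ → ℝ, ThreePoint.IsGradient (ThreePoint.hs n) ψ gp gq ∧
          ∀ t ∈ Set.Icc (0 : ℝ) 1,
            |gp t + ThreePoint.zo n * ThreePoint.bn n t| ≤ C * ‖ψ‖ ∧
            |gq t - ThreePoint.bn n t| ≤ C * ‖ψ‖ / |(n : ℝ)| := by
  obtain ⟨ρ, hρ0, σ, hσ0, L, hL, hρ, hσ, hLρ, hspec⟩ := ThreePoint.exists_isSpec
  -- ρ/2 leaves room for Cauchy's estimates on the ball of radius ρ, σ/10¹² secures uniqueness of
  -- the eigenvalue in the whole domain, and 1/2 ensures that M = 2‖ψ‖ is at most 1.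
  refine ⟨min (ρ / 2) (min (σ / 10 ^ 12) (1 / 2)), by positivity, fun ε _ hεle => ?_⟩
  have hε1 : ε ≤ ρ / 2 := hεle.trans (min_le_left _ _)
  have hε2 : ε ≤ σ / 10 ^ 12 := hεle.trans ((min_le_right _ _).trans (min_le_left _ _))
  have hε3 : ε ≤ 1 / 2 := hεle.trans ((min_le_right _ _).trans (min_le_right _ _))
  refine ⟨fun ψ hψ n hn => ?_, fun m hm => ?_, 192 / ρ ^ 2 + 10 ^ 46 * (1 + L) ^ 6, by positivity,
    fun ψ hψ m hm => ?_⟩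
  · obtain ⟨g, l, h⟩ := hspec n hn
    rw [mem_ball_zero_iff] at hψ
    exact ThreePoint.normingWellDefined_of_small hn h hρ hL hLρ hσ (hψ.trans_le hε1)
      (hψ.trans_le hε2)
  · obtain ⟨e, n, he, hn, rfl⟩ := ThreePoint.exists_sign_mul hm
    obtain ⟨g, l, h⟩ := hspec n hn
    refine ⟨ThreePoint.normingExt he n g l, fun ψ hψ => ?_, fun ψ hψ => ?_⟩
    · rw [mem_ball_zero_iff] at hψ
      exact ThreePoint.analyticAt_normingExt he hn h hL hLρ (by linarith)
    · rw [mem_ball_zero_iff] at hψ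
      exact ThreePoint.normingExt_toComplex he hn h hρ hL hLρ hσ (hψ.trans_le hε1)
        (hψ.trans_le hε2)
  · obtain ⟨e, n, he, hn, rfl⟩ := ThreePoint.exists_sign_mul hm
    obtain ⟨g, l, h⟩ := hspec n hn
    rw [mem_ball_zero_iff] at hψ
    have hn' : (0 : ℝ) < n := by exact_mod_cast hn
    have habs : |((e * n : ℤ) : ℝ)| = n := by
      rcases he with rfl | rfl <;> simp [abs_of_pos hn']
    have c1 : 192 / ρ ^ 2 ≤ 192 / ρ ^ 2 + 10 ^ 46 * (1 + L) ^ 6 :=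
      le_add_of_nonneg_right (by positivity)
    have c2 : 10 ^ 46 * (1 + L) ^ 6 ≤ 192 / ρ ^ 2 + 10 ^ 46 * (1 + L) ^ 6 :=
      le_add_of_nonneg_left (by positivity)
    rw [habs]
    refine ⟨(ThreePoint.abs_hs_sub_le he hn h hρ hL hLρ hσ (hψ.trans_le hε1) (hψ.trans_le hε2)
      (by linarith)).trans (by gcongr), ?_⟩
    obtain ⟨gp, gq, hgrad, hb⟩ := ThreePoint.exists_gradient_hs he hn h hρ hL hLρ hσ
      (hψ.trans_le hε1) (hψ.trans_le hε2)
    exact ⟨gp, gq, hgrad, fun t ht => ⟨(hb t ht).1.trans (by gcongr),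
      (hb t ht).2.trans (by gcongr)⟩⟩
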